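/- **Energy estimate.** Write $r=|x|$ for $x\in\mathbb R^2$, $\Box=-\partial_t^2+\Delta$, $\nabla_{t,x}=(\partial_t,\partial_1,\partial_2)$, $\partial_r=\frac{x}{|x|}\cdot\nabla_x$. Fix $0<a<b$ and $0<\varepsilon<\tfrac12$. Fix smooth non-negative functions $\chi_{\{r\sim 2^\ell\}}$, $\ell\in\mathbb Z$, supported in $c\,2^\ell\le r\le c'\,2^\ell$ with $\sum_{\ell}\chi_{\{r\sim 2^\ell\}}(r)=1$ for $r>0$, and smooth functions $0\le\chi_{\{r>2^m\}}\le 1$, $m\in\mathbb Z$, which vanish for $r\le \tilde c\,2^m$ and are equal to $1$ for $r\ge \tilde c'\,2^m$ (with $c,\tilde c>0$ and $c',\tilde c'$ independent of $\ell,m$). For an interval $I\subset\mathbb R$ let $\|\cdot\|_{L^q_tL^p_x[I]}$ be the mixed norm on $I\times\mathbb R^2$, and for radial $\psi$ let $\|\psi\|_{L^2_{t\pm r}L^\infty_{t\mp r}[I]}$ be the mixed norm of $\psi$ in the null coordinates $t+r$, $t-r$ over the region $t\in I$, $r>0$. For $k\in\mathbb Z$ define $$\|\psi\|_{Y_k[I]}=\sup_{\varepsilon\le\lambda<1}2^{-(\frac12+\lambda)k}\|\chi_{\{r>2^{-k}\}}r^{-\lambda}\psi\|_{L^2_tL^\infty_x[I]}+\sup_{\ell\in\mathbb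 Z}\|\chi_{\{r\sim2^\ell\}}r^{-\frac12}\psi\|_{L^2_tL^2_x[I]},$$ $$\|\psi\|_{N_k^{\pm}[I]}=\sup_{0<\lambda\le\frac12}2^{-(\frac12-\lambda)k}\|r^\lambda\psi\|_{L^2_{t\pm r}L^\infty_{t\mp r}[I]},$$ $$\|\psi\|_{W_k[I]}=\sup_{\substack{2\le q,p\le\infty\\ \frac1q+\frac1p<\frac12}}\ \sup_{0<\lambda<1}2^{(\frac1q+\frac2p-1)k}\,2^{\lambda k}\sum_{\ell\in\mathbb Z}\|\chi_{\{r\sim2^\ell\}}r^\lambda\psi\|_{L^q_tL^p_x[I]},$$ $$\|\psi\|_{Z_k^{\pm}[I]}=\inf_{\psi=\psi_1+\psi_2}\Bigl\{\|\psi_1\|_{N_k^\pm[I]}+\|\psi_1\|_{Y_k[I]}+\|\psi_2\|_{W_k[I]}+\|\psi_2\|_{Y_k[I]}\Bigr\},$$ the infimum being over decompositions on $I\times\mathbb R^2$ into measurable radial functions ($\psi_1=\psi^{(+)}$, $\psi_2=\psi^{(-)}$ for $Z_k^+$, and $\psi_1=\psi^{(-)}$, $\psi_2=\psi^{(+)}$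 for $Z_k^-$), and $$\begin{aligned}\|\phi\|_{S_k[I]}={}&\|\nabla_{t,x}\phi\|_{L^\infty_tL^2_x[I]}+\sup_{\substack{2\le q,p\le\infty\\ \frac1q+\frac1p\le\frac12-\varepsilon}}2^{(\frac1q+\frac2p-1)k}\|\nabla_{t,x}\phi\|_{L^q_tL^p_x[I]}+\sup_{\varepsilon\le\lambda<1}2^{(\frac12-\lambda)k}\|\chi_{\{r>2^{-k}\}}r^{-\lambda}\phi\|_{L^2_tL^\infty_x[I]}\\&+\sup_{\ell\in\mathbb Z}\|\chi_{\{r\sim2^\ell\}}r^{-\frac12}\nabla_{t,x}\phi\|_{L^2_tL^2_x[I]}+\|(\partial_t+\partial_r)\phi\|_{Z_k^+[I]}+\|(\partial_t-\partial_r)\phi\|_{Z_k^-[I]}.\end{aligned}$$ Then there is a constant $C$, depending only on $a,b,\varepsilon$ and the chosen cut-off functions, such that for all $k\in\mathbb Z$, all intervals $I\ni0$ and all radially symmetric (complex-valued) functions $\phi\in C^1(I;L^2(\mathbb R^2))$, with pointwise $C^1$ representative on $I\times\mathbb R^2$, such that each $\phi(t)$, $t\in I$, has Fourier support in $\{a2^k\le|\xi|\le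 b2^k\}$ and the distribution $\Box\phi$ on the interior of $I\times\mathbb R^2$ is a locally integrable function, $$\|\phi\|_{S_k[I]}\le C\bigl(\|\nabla_{t,x}\phi(0)\|_{L^2_x}+\|\Box\phi\|_{L^1_tL^2_x[I]}\bigr).$$ -/

import Mathlib

open MeasureTheory Set Filter Topology
open scoped ENNReal ContDiff FourierTransform

noncomputable section

namespace RadialWave

/-- The spatial domain `ℝ²` with its Euclidean norm; `r = ‖x‖`. -/
abbrev Plane : Type := EuclideanSpace ℝ (Fin 2)

/-! ### Cut-offs in the radial variable -/

/-- `χ ℓ` is the bump function `χ_{r ∼ 2^ℓ}`: the `χ ℓ` are smooth, non-negative, supported in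
`c 2^ℓ ≤ r ≤ c' 2^ℓ`, and sum up to `1` for `r > 0`. -/
structure IsDyadicPartition (χ : ℤ → ℝ → ℝ) : Prop where
  smooth : ∀ l, ContDiff ℝ ∞ (χ l)
  nonneg : ∀ l r, 0 ≤ χ l r
  support : ∃ c c' : ℝ, 0 < c ∧ ∀ l r, χ l r ≠ 0 → c * (2 : ℝ) ^ l ≤ r ∧ r ≤ c' * (2 : ℝ) ^ l
  hasSum : ∀ r, 0 < r → HasSum (fun l => χ l r) 1

/-- `η m` is the smooth cut-off `χ_{r > 2^m}` to the region `r ≳ 2^m`. -/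
structure IsOuterCutoff (η : ℤ → ℝ → ℝ) : Prop where
  smooth : ∀ m, ContDiff ℝ ∞ (η m)
  mem_Icc : ∀ m r, η m r ∈ Icc (0 : ℝ) 1
  transition : ∃ c c' : ℝ, 0 < c ∧
    (∀ m r, r ≤ c * (2 : ℝ) ^ m → η m r = 0) ∧ (∀ m r, c' * (2 : ℝ) ^ m ≤ r → η m r = 1)

/-! ### Derivatives -/

/-- `∂_t φ` on the time interval `I` (one-sided at the end points of `I`). -/
def timeDeriv (I : Set ℝ) (φ : ℝ → Plane → ℂ) (t : ℝ) (x : Plane) : ℂ :=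
  derivWithin (fun s => φ s x) I t

/-- `∂_i φ` for a spatial direction `i`. -/
def spaceDeriv (i : Fin 2) (φ : ℝ → Plane → ℂ) (t : ℝ) (x : Plane) : ℂ :=
  fderiv ℝ (φ t) x (EuclideanSpace.single i 1)

/-- `∂_r φ = (x / |x|) · ∇_x φ`. -/
def radialDeriv (φ : ℝ → Plane → ℂ) (t : ℝ) (x : Plane) : ℂ :=
  fderiv ℝ (φ t) x (‖x‖⁻¹ • x)

/-- The space-time gradient `∇_{t,x} φ = (∂_t φ, ∂_1 φ, ∂_2 φ)`. -/
def grad (I : Set ℝ) (φ : ℝ → Plane → ℂ) (t : ℝ) (x : Plane) : EuclideanSpace ℂ (Fin 3) :=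
  !₂[timeDeriv I φ t x, spaceDeriv 0 φ t x, spaceDeriv 1 φ t x]

/-- `(∂_t + σ ∂_r) φ`, for `σ = 1` or `σ = -1`. -/
def nullDeriv (I : Set ℝ) (σ : ℝ) (φ : ℝ → Plane → ℂ) (t : ℝ) (x : Plane) : ℂ :=
  timeDeriv I φ t x + (σ : ℂ) * radialDeriv φ t x

/-- The d'Alembertian `□ = -∂_t² + Δ` of a smooth function on `ℝ × ℝ²`. -/
def box (g : ℝ × Plane → ℝ) (z : ℝ × Plane) : ℝ :=
  -iteratedDeriv 2 (fun s => g (s, z.2)) z.1 + Laplacian.laplacian (fun y => g (z.1, y)) z.2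

/-- `□ φ = F` in the sense of distributions in the interior of `I × ℝ²`, where `F` is a locally
integrable function. -/
def HasWeakBox (I : Set ℝ) (φ F : ℝ → Plane → ℂ) : Prop :=
  LocallyIntegrableOn (fun z : ℝ × Plane => F z.1 z.2) (interior I ×ˢ univ) ∧
  ∀ g : ℝ × Plane → ℝ, ContDiff ℝ ∞ g → HasCompactSupport g → tsupport g ⊆ interior I ×ˢ univ →
    ∫ z : ℝ × Plane, box g z • φ z.1 z.2 = ∫ z : ℝ × Plane, g z • F z.1 z.2

/-! ### Radial, frequency localized functions -/

/-- Radial symmetry of a function on `ℝ²`. -/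
def IsRadial (f : Plane → ℂ) : Prop := ∀ x y, ‖x‖ = ‖y‖ → f x = f y

/-- `f` is in `L²(ℝ²)` and its Fourier transform vanishes almost everywhere outside `A`. -/
def HasFourierSupport (f : Plane → ℂ) (A : Set Plane) : Prop :=
  ∃ h : MemLp f 2 volume, ∀ᵐ ξ : Plane, ξ ∉ A → (𝓕 (h.toLp f) : Lp ℂ 2 (volume : Measure Plane)) ξ = 0

/-- The frequency annulus `|ξ| ∼ 2^k` with implicit constants `a < b`. -/
def annulus (a b : ℝ) (k : ℤ) : Set Plane :=
  {ξ | a * (2 : ℝ) ^ k ≤ ‖ξ‖ ∧ ‖ξ‖ ≤ b * (2 : ℝ) ^ k}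

/-- `φ` is a radially symmetric function on `I × ℝ²` of class `C¹(I; L²)` all of whose time slices
have Fourier support in `a 2^k ≤ |ξ| ≤ b 2^k`. (Such a function has a pointwise `C¹`
representative, which is the one considered here.) -/
structure IsLocalized (a b : ℝ) (k : ℤ) (I : Set ℝ) (φ : ℝ → Plane → ℂ) : Prop where
  contDiffOn : ContDiffOn ℝ 1 (fun z : ℝ × Plane => φ z.1 z.2) (I ×ˢ univ)
  radial : ∀ t ∈ I, IsRadial (φ t)
  fourier : ∀ t ∈ I, HasFourierSupport (φ t) (annulus a b k)
  memLp_timeDeriv : ∀ t ∈ I, MemLp (timeDeriv I φ t) 2 volume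
  continuous : ∀ t ∈ I, Tendsto (fun s => eLpNorm (φ s - φ t) 2 volume) (𝓝[I] t) (𝓝 0)
  continuous_timeDeriv : ∀ t ∈ I,
    Tendsto (fun s => eLpNorm (timeDeriv I φ s - timeDeriv I φ t) 2 volume) (𝓝[I] t) (𝓝 0)

/-! ### Norms on `I × ℝ²`, with values in `[0, ∞]` -/

/-- The norm of `L^q_t L^p_x[I]`. -/
def mixedNorm {V : Type*} [NormedAddCommGroup V] (I : Set ℝ) (q p : ℝ≥0∞)
    (g : ℝ → Plane → V) : ℝ≥0∞ :=
  eLpNorm (fun t => eLpNorm (g t) p volume) q (volume.restrict I)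

/-- Multiplication by the radial weight `w(r)`. -/
def weighted {V : Type*} [NormedAddCommGroup V] [NormedSpace ℝ V] (w : ℝ → ℝ)
    (g : ℝ → Plane → V) (t : ℝ) (x : Plane) : V :=
  w ‖x‖ • g t x

/-- For a radial function `g` on `I × ℝ²`, the norm of `L²_{t+r} L^∞_{t-r}[I]` if `σ = 1` and of
`L²_{t-r} L^∞_{t+r}[I]` if `σ = -1`. In the null coordinates `v = t + σ r`, `u = t - σ r` one has
`t = (v + u) / 2` and `r = σ (v - u) / 2`, and `(v, u)` ranges over the points with `t ∈ I`,
`r > 0`. -/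
def nullNorm (I : Set ℝ) (σ : ℝ) (g : ℝ → Plane → ℂ) : ℝ≥0∞ :=
  eLpNorm (fun v : ℝ => eLpNorm
    ({u : ℝ | (v + u) / 2 ∈ I ∧ 0 < σ * (v - u) / 2}.indicator
      fun u : ℝ => g ((v + u) / 2) (EuclideanSpace.single 0 (σ * (v - u) / 2)))
    ∞ volume) 2 volume

/-- The admissible exponents `2 ≤ q, p ≤ ∞`, `1/q + 1/p < 1/2`. -/
def admissible : Set (ℝ≥0∞ × ℝ≥0∞) :=
  {e | 2 ≤ e.1 ∧ 2 ≤ e.2 ∧ e.1⁻¹.toReal + e.2⁻¹.toReal < 1 / 2}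

/-- The admissible exponents with `1/q + 1/p ≤ 1/2 - ε`. -/
def admissibleGap (ε : ℝ) : Set (ℝ≥0∞ × ℝ≥0∞) :=
  {e | 2 ≤ e.1 ∧ 2 ≤ e.2 ∧ e.1⁻¹.toReal + e.2⁻¹.toReal ≤ 1 / 2 - ε}

/-- The scaling factor `2^{(1/q + 2/p - 1) k}`. -/
def strichartzFactor (k : ℤ) (e : ℝ≥0∞ × ℝ≥0∞) : ℝ≥0∞ :=
  (2 : ℝ≥0∞) ^ ((e.1⁻¹.toReal + 2 * e.2⁻¹.toReal - 1) * k)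

/-- `sup_ℓ ‖χ_{r ∼ 2^ℓ} r^{-1/2} g‖_{L²_t L²_x[I]}`. -/
def localEnergyNorm {V : Type*} [NormedAddCommGroup V] [NormedSpace ℝ V] (χ : ℤ → ℝ → ℝ)
    (I : Set ℝ) (g : ℝ → Plane → V) : ℝ≥0∞ :=
  ⨆ l : ℤ, mixedNorm I 2 2 (weighted (fun r => χ l r * r ^ (-(1 / 2) : ℝ)) g)

/-- The norm of `Y_k[I]`, with `λ` ranging over `ε ≤ λ < 1`. -/
def yNorm (ε : ℝ) (χ η : ℤ → ℝ → ℝ) (k : ℤ) (I : Set ℝ) (ψ : ℝ → Plane → ℂ) : ℝ≥0∞ :=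
  (⨆ lam ∈ Ico ε 1, (2 : ℝ≥0∞) ^ (-(1 / 2 + lam) * k) *
    mixedNorm I 2 ∞ (weighted (fun r => η (-k) r * r ^ (-lam)) ψ)) +
  localEnergyNorm χ I ψ

/-- `sup_{0 < λ ≤ 1/2} 2^{-(1/2 - λ) k} ‖r^λ ψ‖`, in the null norm for the sign `σ`. -/
def nullWeightedNorm (k : ℤ) (I : Set ℝ) (σ : ℝ) (ψ : ℝ → Plane → ℂ) : ℝ≥0∞ :=
  ⨆ lam ∈ Ioc (0 : ℝ) (1 / 2), (2 : ℝ≥0∞) ^ (-(1 / 2 - lam) * k) *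
    nullNorm I σ (weighted (fun r => r ^ lam) ψ)

/-- `sup_{(q,p) admissible} sup_{0 < λ < 1} 2^{(1/q + 2/p - 1) k} 2^{λ k}
∑_ℓ ‖χ_{r ∼ 2^ℓ} r^λ ψ‖_{L^q_t L^p_x[I]}`. -/
def strichartzWeightedNorm (χ : ℤ → ℝ → ℝ) (k : ℤ) (I : Set ℝ) (ψ : ℝ → Plane → ℂ) : ℝ≥0∞ :=
  ⨆ e ∈ admissible, ⨆ lam ∈ Ioo (0 : ℝ) 1,
    strichartzFactor k e * (2 : ℝ≥0∞) ^ (lam * k) *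
      ∑' l : ℤ, mixedNorm I e.1 e.2 (weighted (fun r => χ l r * r ^ lam) ψ)

/-- `ψ = ψ₁ + ψ₂` on `I × ℝ²` with `ψ₁`, `ψ₂` measurable and radially symmetric. -/
structure IsDecomposition (I : Set ℝ) (ψ ψ₁ ψ₂ : ℝ → Plane → ℂ) : Prop where
  measurable_left : Measurable (fun z : ℝ × Plane => ψ₁ z.1 z.2)
  measurable_right : Measurable (fun z : ℝ × Plane => ψ₂ z.1 z.2)
  radial_left : ∀ t, IsRadial (ψ₁ t)
  radial_right : ∀ t, IsRadial (ψ₂ t)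
  eq_add : ∀ t ∈ I, ∀ x, ψ t x = ψ₁ t x + ψ₂ t x

/-- The atomic norm of `Z_k^+[I]` (`σ = 1`) or `Z_k^-[I]` (`σ = -1`). The component `ψ₁` measured
in the null norm is `ψ^{(+)}` for `Z_k^+` and `ψ^{(-)}` for `Z_k^-`. -/
def zNorm (ε : ℝ) (χ η : ℤ → ℝ → ℝ) (k : ℤ) (I : Set ℝ) (σ : ℝ) (ψ : ℝ → Plane → ℂ) : ℝ≥0∞ :=
  ⨅ (ψ₁ : ℝ → Plane → ℂ) (ψ₂ : ℝ → Plane → ℂ) (_ : IsDecomposition I ψ ψ₁ ψ₂),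
    (nullWeightedNorm k I σ ψ₁ + yNorm ε χ η k I ψ₁) +
    (strichartzWeightedNorm χ k I ψ₂ + yNorm ε χ η k I ψ₂)

/-- The norm of `S_k[I]`, with the exponents of the Strichartz component ranging over
`1/q + 1/p ≤ 1/2 - ε` and those of the weighted endpoint components over `ε ≤ λ < 1`. -/
def sNorm (ε : ℝ) (χ η : ℤ → ℝ → ℝ) (k : ℤ) (I : Set ℝ) (φ : ℝ → Plane → ℂ) : ℝ≥0∞ :=
  mixedNorm I ∞ 2 (grad I φ) +
  (⨆ e ∈ admissibleGap ε, strichartzFactor k e * mixedNorm I e.1 e.2 (grad I φ)) +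
  (⨆ lam ∈ Ico ε 1, (2 : ℝ≥0∞) ^ ((1 / 2 - lam) * k) *
    mixedNorm I 2 ∞ (weighted (fun r => η (-k) r * r ^ (-lam)) φ)) +
  localEnergyNorm χ I (grad I φ) +
  zNorm ε χ η k I 1 (nullDeriv I 1 φ) +
  zNorm ε χ η k I (-1) (nullDeriv I (-1) φ)

end RadialWave

end

/-! ### Bessel functions as oscillating exponentials with controlled amplitudes -/

noncomputable section

namespace RadialWave

/-! ### Integrals depending on a parameter -/

section Parametric

variable {E F : Type} [NormedAddCommGroup E] [NormedSpace ℝ E] [FiniteDimensional ℝ E]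
  [NormedAddCommGroup F] [NormedSpace ℝ F]

/-! Put N = 2^k, r = |x|, ρ = |y|. Every component of the S_k norm is read off from one pointwise
bound. There is a function H ≥ 0 of one real variable, roughly constant at scale 1/N and with
N^{-1/2}‖H‖_{L²} ≲ ‖∇φ(0)‖_{L²} + ‖□φ‖_{L¹L²}, such that |∇φ| and N|φ| are ≲ (1+Nr)^{-1/2}(H(t+r) +
H(t-r)), while |(∂_t+σ∂_r)φ| ≲ (1+Nr)^{-1/2}H(t+σr) + (1+Nr)^{-3/2}H(t-σr) for σ = ±1.

The bound is Duhamel's formula with explicit radial kernels. Radial symmetry and frequency support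
give a reproducing formula φ(t,x) = ∫K(x,y)φ(t,y)dy, where K superposes ωJ₀(rω)J₀(ρω) over ω ~ N
(`HasFourierSupport.eq_integral_packet`). Inserting a phase e^{i(t-s)ω} turns such a kernel into a
packet k(s,y) solving the wave equation. Green's identity d/ds∫(k∂_sφ - φ∂_sk)dy = -∫k□φ dy,
extracted from the distributional equation in `HasWeakBox.pairing_sub_pairing`, moves the pairing
from s = t to s = 0. The amplitudes in `IsLocalized.eq_pairing` and
`IsLocalized.nullDeriv_eq_pairing` are chosen so that the pairing at s = t equals φ(t,x) or
N^{-1}(∂_t+σ∂_r)φ(t,x).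

The size of the packets comes from J₀(s) = s^{-1/2}(e^{is}a₁(s) + e^{-is}a₋₁(s)), with amplitudes
whose derivatives are O(s^{-2}). A packet is then an oscillatory integral in ω with the phases
τ±r±ρ, and two integrations by parts give decay (1+N²(τ±r±ρ)²)^{-1} (`norm_integral_hasAmp_le`). The
operator ∂_t+σ∂_r produces J₀-iσJ₀', in which one of the two phases cancels to leading order
(`exists_hasAmp_null`); this is the gain (1+Nr)^{-1} in the null bound. H(v) integrates the data and
the translated forcing against a weight concentrated on ρ ≈ |v|, and its L² size follows from a
Schur-type estimate and Minkowski's inequality (`size_waveProfile_le`).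

The rest concerns the majorant only. For the energy, the area element r dr absorbs (1+Nr)^{-1}; for
the local energy, one integrates in t first. A supremum in x is dominated by the square function, a
mean of H² with weight (1+N|v-t|)^{-κ}, κ > 1, whose integral in t is comparable to ‖H‖².
Interpolation of the energy bound, the uniform bound and the L^{2κ}_tL^∞_x bound gives Strichartz.
In null coordinates the leading term H(t+σr) depends on one variable only and the other term is
again bounded by the square function. Hence the Z_k norms need only the trivial decomposition ψ₂ = 0
(`exists_sNorm_le`). -/

theorem hasFDerivAt_intervalIntegral_of_contDiff {f : E × ℝ → F} (hf : ContDiff ℝ 1 f)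
    (a b : ℝ) (x : E) :
    HasFDerivAt (fun x => ∫ w in a..b, f (x, w))
      (∫ w in a..b, (fderiv ℝ f (x, w)).comp (ContinuousLinearMap.inl ℝ E ℝ)) x := by
  have hc : Continuous fun p : E × ℝ =>
      (fderiv ℝ f p).comp (ContinuousLinearMap.inl ℝ E ℝ) :=
    (hf.continuous_fderiv one_ne_zero).clm_comp continuous_const
  obtain ⟨B, hB⟩ := ((isCompact_closedBall x 1).prod (isCompact_uIcc (a := a) (b := b)))
    |>.exists_bound_of_continuousOn hc.continuousOn
  refine intervalIntegral.hasFDerivAt_integral_of_dominated_of_fderiv_le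
    (F := fun x w => f (x, w))
    (F' := fun x w => (fderiv ℝ f (x, w)).comp (ContinuousLinearMap.inl ℝ E ℝ))
    (bound := fun _ => B) (Metric.closedBall_mem_nhds x one_pos) ?_ ?_ ?_ ?_ ?_ ?_
  · exact Eventually.of_forall fun x =>
      (hf.continuous.comp (by fun_prop : Continuous fun w => (x, w))).aestronglyMeasurable
  · exact (hf.continuous.comp (by fun_prop : Continuous fun w => (x, w))).intervalIntegrable _ _
  · exact (hc.comp (by fun_prop : Continuous fun w => (x, w))).aestronglyMeasurable
  · exact Eventually.of_forall fun w hw y hy => hB (y, w) ⟨hy, uIoc_subset_uIcc hw⟩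
  · exact intervalIntegrable_const
  · refine Eventually.of_forall fun w _ y _ => ?_
    have h := (hf.differentiable one_ne_zero (y, w)).hasFDerivAt
    exact h.comp y (hasFDerivAt_prodMk_left y w)

/-- The target space is quantified inside the statement because the induction changes it: the
derivative of the integral is an integral of the same kind with values in continuous linear maps. -/
theorem contDiff_intervalIntegral_nat (a b : ℝ) (n : ℕ) :
    ∀ {F : Type} [NormedAddCommGroup F] [NormedSpace ℝ F] [CompleteSpace F] {f : E × ℝ → F},
      ContDiff ℝ ∞ f → ContDiff ℝ n (fun x => ∫ w in a..b, f (x, w)) := by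
  induction n with
  | zero =>
    intro F _ _ _ f hf
    refine contDiff_zero.2 (continuous_iff_continuousAt.2 fun x => ?_)
    exact (hasFDerivAt_intervalIntegral_of_contDiff
      (hf.of_le (by exact_mod_cast le_top)) a b x).continuousAt
  | succ n ih =>
    intro F _ _ _ f hf
    refine contDiff_succ_iff_hasFDerivAt.2 ⟨_, ?_, fun x =>
      hasFDerivAt_intervalIntegral_of_contDiff (hf.of_le (by exact_mod_cast le_top)) a b x⟩
    refine ih (f := fun p => (fderiv ℝ f p).comp (ContinuousLinearMap.inl ℝ E ℝ)) ?_
    exact (hf.fderiv_right (m := ∞) (by simp)).clm_comp contDiff_const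

theorem contDiff_intervalIntegral [CompleteSpace F] {f : E × ℝ → F}
    (hf : ContDiff ℝ ∞ f) (a b : ℝ) :
    ContDiff ℝ ∞ (fun x => ∫ w in a..b, f (x, w)) :=
  contDiff_infty.2 fun n => contDiff_intervalIntegral_nat a b n hf

theorem hasDerivAt_intervalIntegral_of_contDiff [CompleteSpace F] {f : ℝ × ℝ → F}
    (hf : ContDiff ℝ 1 f)
    {f' : ℝ → ℝ → F} (hf' : ∀ x w, HasDerivAt (fun x => f (x, w)) (f' x w) x) (a b x : ℝ) :
    HasDerivAt (fun x => ∫ w in a..b, f (x, w)) (∫ w in a..b, f' x w) x := by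
  have h := (hasFDerivAt_intervalIntegral_of_contDiff hf a b x).hasDerivAt
  convert h using 1
  have hc : Continuous fun w : ℝ =>
      (fderiv ℝ f (x, w)).comp (ContinuousLinearMap.inl ℝ ℝ ℝ) :=
    ((hf.continuous_fderiv one_ne_zero).comp
      (by fun_prop : Continuous fun w => (x, w))).clm_comp continuous_const
  rw [ContinuousLinearMap.intervalIntegral_apply (hc.intervalIntegrable _ _)]
  refine intervalIntegral.integral_congr fun w _ => ?_
  have h := ((hf.differentiable one_ne_zero (x, w)).hasFDerivAt.comp x
    (hasFDerivAt_prodMk_left x w)).hasDerivAt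
  exact (hf' x w).unique h

end Parametric

/-! ### The Bessel function `J₀` -/

/-- The Bessel function of order zero, `J₀(s) = (2π)⁻¹ ∫ cos (s cos θ) dθ`. -/
def besselJ (s : ℝ) : ℝ := (2 * Real.pi)⁻¹ * ∫ θ in (-Real.pi)..Real.pi, Real.cos (s * Real.cos θ)

/-- The derivative of `J₀`. -/
def besselJ' (s : ℝ) : ℝ :=
  (2 * Real.pi)⁻¹ * ∫ θ in (-Real.pi)..Real.pi, -(Real.cos θ * Real.sin (s * Real.cos θ))

/-- The second derivative of `J₀`. -/
def besselJ'' (s : ℝ) : ℝ :=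
  (2 * Real.pi)⁻¹ * ∫ θ in (-Real.pi)..Real.pi, -(Real.cos θ ^ 2 * Real.cos (s * Real.cos θ))

theorem contDiff_besselJ : ContDiff ℝ ∞ besselJ :=
  contDiff_const.mul (contDiff_intervalIntegral
    (f := fun p : ℝ × ℝ => Real.cos (p.1 * Real.cos p.2)) (by fun_prop) _ _)

theorem hasDerivAt_besselJ (s : ℝ) : HasDerivAt besselJ (besselJ' s) s := by
  refine (hasDerivAt_intervalIntegral_of_contDiff
    (f := fun p : ℝ × ℝ => Real.cos (p.1 * Real.cos p.2)) (by fun_prop)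
    (f' := fun x w => -(Real.cos w * Real.sin (x * Real.cos w))) ?_ _ _ s).const_mul _
  intro x w
  exact ((hasDerivAt_id x).mul_const (Real.cos w)).cos.congr_deriv (by simp; ring)

theorem hasDerivAt_besselJ' (s : ℝ) : HasDerivAt besselJ' (besselJ'' s) s := by
  refine (hasDerivAt_intervalIntegral_of_contDiff
    (f := fun p : ℝ × ℝ => -(Real.cos p.2 * Real.sin (p.1 * Real.cos p.2))) (by fun_prop)
    (f' := fun x w => -(Real.cos w ^ 2 * Real.cos (x * Real.cos w))) ?_ _ _ s).const_mul _
  intro x w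
  exact ((((hasDerivAt_id x).mul_const (Real.cos w)).sin).const_mul (Real.cos w)).neg.congr_deriv
    (by simp; ring)

theorem contDiff_besselJ' : ContDiff ℝ ∞ besselJ' := by
  have : besselJ' = deriv besselJ := funext fun s => (hasDerivAt_besselJ s).deriv.symm
  rw [this]
  exact ((contDiff_infty_iff_deriv).1 contDiff_besselJ).2

/-- The function sin θ · sin(s cos θ) vanishes at both ends, so its derivative integrates to zero;
with sin² + cos² = 1 this is the negative of the left side, up to the factor (2π)⁻¹. -/
theorem besselJ_ode (s : ℝ) : s * besselJ'' s + besselJ' s + s * besselJ s = 0 := by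
  have h0 : ∫ θ in (-Real.pi)..Real.pi, (Real.cos θ * Real.sin (s * Real.cos θ) -
      s * (Real.sin θ ^ 2 * Real.cos (s * Real.cos θ))) = 0 := by
    rw [intervalIntegral.integral_eq_sub_of_hasDerivAt
      (f := fun θ => Real.sin θ * Real.sin (s * Real.cos θ))]
    · simp
    · intro θ _
      exact ((Real.hasDerivAt_sin θ).mul (((Real.hasDerivAt_cos θ).const_mul s).sin)).congr_deriv
        (by ring)
    · exact (by fun_prop : Continuous _).intervalIntegrable _ _
  have i1 : ∀ f : ℝ → ℝ, Continuous f → IntervalIntegrable f volume (-Real.pi) Real.pi :=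
    fun f hf => hf.intervalIntegrable _ _
  unfold besselJ besselJ' besselJ''
  rw [mul_left_comm, mul_left_comm s, ← mul_add, ← mul_add, ← intervalIntegral.integral_const_mul,
    ← intervalIntegral.integral_const_mul, ← intervalIntegral.integral_add (i1 _ (by fun_prop))
    (i1 _ (by fun_prop)), ← intervalIntegral.integral_add (i1 _ (by fun_prop))
    (i1 _ (by fun_prop))]
  rw [← neg_eq_zero, ← intervalIntegral.integral_neg] at h0
  rw [mul_eq_zero]; right
  rw [← h0]
  refine intervalIntegral.integral_congr fun θ _ => ?_
  linear_combination -(s * Real.cos (s * Real.cos θ)) * Real.sin_sq θ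

/-! ### Amplitudes of `J₀` -/

/-- `√s J₀(s)`. -/
def besselY (s : ℝ) : ℝ := s ^ (1 / 2 : ℝ) * besselJ s

/-- The derivative of `√s J₀(s)`. -/
def besselY' (s : ℝ) : ℝ :=
  1 / 2 * s ^ (-1 / 2 : ℝ) * besselJ s + s ^ (1 / 2 : ℝ) * besselJ' s

theorem hasDerivAt_besselY {s : ℝ} (hs : 0 < s) : HasDerivAt besselY (besselY' s) s := by
  refine ((Real.hasDerivAt_rpow_const (p := 1 / 2) (Or.inl hs.ne')).mul
    (hasDerivAt_besselJ s)).congr_deriv ?_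
  rw [besselY']; norm_num

/-- The factor √s removes the first-order term of Bessel's equation. What remains is Y'' = -(1 +
1/(4s²))Y, an integrable perturbation of the harmonic oscillator. -/
theorem hasDerivAt_besselY' {s : ℝ} (hs : 0 < s) :
    HasDerivAt besselY' (-(1 + 1 / (4 * s ^ 2)) * besselY s) s := by
  refine ((((Real.hasDerivAt_rpow_const (p := -1 / 2) (Or.inl hs.ne')).const_mul (1 / 2)).mul
    (hasDerivAt_besselJ s)).add ((Real.hasDerivAt_rpow_const (p := 1 / 2) (Or.inl hs.ne')).mul
    (hasDerivAt_besselJ' s))).congr_deriv ?_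
  have h1 : s ^ (-1 / 2 - 1 : ℝ) = s ^ (1 / 2 : ℝ) / s ^ 2 := by
    rw [eq_div_iff (by positivity), ← Real.rpow_natCast, ← Real.rpow_add hs]; norm_num
  have h2 : s ^ (-1 / 2 : ℝ) = s ^ (1 / 2 : ℝ) / s := by
    rw [eq_div_iff (by positivity), ← Real.rpow_add_one hs.ne']; norm_num
  have h3 : s ^ (1 / 2 - 1 : ℝ) = s ^ (1 / 2 : ℝ) / s := by
    rw [← h2]; norm_num
  rw [h1, h2, h3, besselY]
  have h := besselJ_ode s
  have h4 : besselJ'' s = -besselJ' s / s - besselJ s := by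
    field_simp; linarith
  rw [h4]
  field_simp
  ring

/-- The oscillator energy e = Y² + Y'² satisfies e' = -YY'/(2s²) ≤ e/(4s²), so e·exp(1/(4s)) is
nonincreasing: its derivative is -(Y+Y')²/(4s²) times the exponential. -/
theorem exists_bound_besselY {s₀ : ℝ} (h₀ : 0 < s₀) :
    ∃ C, 0 ≤ C ∧ ∀ s, s₀ ≤ s → |besselY s| ≤ C ∧ |besselY' s| ≤ C := by
  set e : ℝ → ℝ := fun s => besselY s ^ 2 + besselY' s ^ 2 with he
  set g : ℝ → ℝ := fun s => e s * Real.exp (1 / 4 * s⁻¹) with hg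
  have hd : ∀ s, 0 < s → HasDerivAt g ((2 * besselY s * besselY' s +
      2 * besselY' s * (-(1 + 1 / (4 * s ^ 2)) * besselY s)) * Real.exp (1 / 4 * s⁻¹) +
      e s * (Real.exp (1 / 4 * s⁻¹) * (1 / 4 * (-(s ^ 2)⁻¹)))) s := by
    intro s hs
    refine ((((hasDerivAt_besselY hs).pow 2).add ((hasDerivAt_besselY' hs).pow 2)).mul
      (((hasDerivAt_inv hs.ne').const_mul (1 / 4)).exp)).congr_deriv ?_
    simp [he]
  have hanti : AntitoneOn g (Ici s₀) := by
    refine antitoneOn_of_deriv_nonpos (convex_Ici s₀)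
      (fun s hs => (hd s (h₀.trans_le hs)).continuousAt.continuousWithinAt) ?_ ?_
    · intro s hs
      rw [interior_Ici] at hs
      exact (hd s (h₀.trans hs)).differentiableAt.differentiableWithinAt
    · intro s hs
      rw [interior_Ici] at hs
      have hs : 0 < s := h₀.trans hs
      rw [(hd s hs).deriv]
      have : (2 * besselY s * besselY' s +
        2 * besselY' s * (-(1 + 1 / (4 * s ^ 2)) * besselY s)) * Real.exp (1 / 4 * s⁻¹) +
        e s * (Real.exp (1 / 4 * s⁻¹) * (1 / 4 * (-(s ^ 2)⁻¹))) =
        -((besselY s + besselY' s) ^ 2 / (4 * s ^ 2) * Real.exp (1 / 4 * s⁻¹)) := by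
        simp only [he]; field_simp; ring
      rw [this]
      exact neg_nonpos.2 (by positivity)
  refine ⟨√(g s₀), Real.sqrt_nonneg _, fun s hs => ?_⟩
  have h1 : e s ≤ g s₀ := by
    refine le_trans ?_ (hanti self_mem_Ici hs hs)
    have : 0 < s := h₀.trans_le hs
    exact le_mul_of_one_le_right (by positivity) (Real.one_le_exp (by positivity))
  constructor <;> refine Real.abs_le_sqrt (le_trans ?_ h1) <;> simp only [he] <;> nlinarith

/-- The amplitude `a_σ` in `√s J₀(s) = e^{is} a₁(s) + e^{-is} a₋₁(s)`. -/
def besselAmp (σ s : ℝ) : ℂ :=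
  Complex.exp (-(Complex.I * σ * s)) * ((besselY s : ℂ) - Complex.I * σ * besselY' s) / 2

/-- The derivative of `a_σ`. -/
def besselAmp' (σ s : ℝ) : ℂ :=
  Complex.I * σ * Complex.exp (-(Complex.I * σ * s)) * besselY s / (8 * (s : ℂ) ^ 2)

/-- The second derivative of `a_σ`. -/
def besselAmp'' (σ s : ℝ) : ℂ :=
  Complex.I * σ * Complex.exp (-(Complex.I * σ * s)) *
    (-(Complex.I * σ) * besselY s / (8 * (s : ℂ) ^ 2) + besselY' s / (8 * (s : ℂ) ^ 2)
      - besselY s / (4 * (s : ℂ) ^ 3))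

theorem hasDerivAt_cexp_linear (c : ℂ) (s : ℝ) :
    HasDerivAt (fun s : ℝ => Complex.exp (-(c * s))) (-c * Complex.exp (-(c * s))) s := by
  refine (((Complex.ofRealCLM.hasDerivAt (x := s)).const_mul c).neg.cexp).congr_deriv ?_
  simp; ring

/-- Variation of constants: the oscillator part of Y'' cancels against the derivative of the
exponential, and only the potential 1/(4s²) survives. This is why the derivative is O(s^{-2}). -/
theorem hasDerivAt_besselAmp {σ : ℝ} (hσ : σ ^ 2 = 1) {s : ℝ} (hs : 0 < s) :
    HasDerivAt (besselAmp σ) (besselAmp' σ s) s := by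
  refine (((hasDerivAt_cexp_linear (Complex.I * σ) s).mul
    ((hasDerivAt_besselY hs).ofReal_comp.sub
      ((hasDerivAt_besselY' hs).ofReal_comp.const_mul (Complex.I * σ)))).div_const 2).congr_deriv ?_
  have h0 : (s : ℂ) ≠ 0 := by exact_mod_cast hs.ne'
  have hσ' : (σ : ℂ) ^ 2 = 1 := by exact_mod_cast hσ
  rw [besselAmp']
  simp only [Pi.sub_apply]
  push_cast
  field_simp
  linear_combination (32 * (s : ℂ) ^ 2 * (Complex.I ^ 2 * besselY' s)) * hσ' +
    (32 * (s : ℂ) ^ 2 * besselY' s) * Complex.I_sq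

theorem hasDerivAt_besselAmp' (σ : ℝ) {s : ℝ} (hs : 0 < s) :
    HasDerivAt (besselAmp' σ) (besselAmp'' σ s) s := by
  have h0 : (s : ℂ) ≠ 0 := by exact_mod_cast hs.ne'
  refine (((((hasDerivAt_cexp_linear (Complex.I * σ) s).const_mul (Complex.I * (σ : ℂ))).mul
    (hasDerivAt_besselY hs).ofReal_comp).div
    (((Complex.ofRealCLM.hasDerivAt (x := s)).pow 2).const_mul 8))
    (by simpa using h0)).congr_deriv ?_
  rw [besselAmp'']
  simp
  field_simp
  ring

end RadialWave

end

noncomputable section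

namespace RadialWave

/-! ### Quantitative `C²` amplitudes -/

/-- `f` is twice continuously differentiable on `[α, β]`, and `f`, `f'`, `f''` are bounded
by `C` there. -/
def C2On (α β : ℝ) (f : ℝ → ℂ) (C : ℝ) : Prop :=
  ∃ f₁ f₂ : ℝ → ℂ, (∀ x ∈ Icc α β, HasDerivAt f (f₁ x) x) ∧
    (∀ x ∈ Icc α β, HasDerivAt f₁ (f₂ x) x) ∧ ContinuousOn f₂ (Icc α β) ∧
    ∀ x ∈ Icc α β, ‖f x‖ ≤ C ∧ ‖f₁ x‖ ≤ C ∧ ‖f₂ x‖ ≤ C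

/-- `f` is `C2On` and `f`, `f'` vanish at both end points. -/
def C2Zero (α β : ℝ) (f : ℝ → ℂ) (C : ℝ) : Prop :=
  C2On α β f C ∧ f α = 0 ∧ f β = 0 ∧ deriv f α = 0 ∧ deriv f β = 0

variable {α β : ℝ}

theorem C2On.mono {f : ℝ → ℂ} {C D : ℝ} (h : C2On α β f C) (hCD : C ≤ D) : C2On α β f D := by
  obtain ⟨f₁, f₂, h1, h2, h3, h4⟩ := h
  exact ⟨f₁, f₂, h1, h2, h3, fun x hx => ⟨(h4 x hx).1.trans hCD, (h4 x hx).2.1.trans hCD,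
    (h4 x hx).2.2.trans hCD⟩⟩

theorem C2On.continuousOn {f : ℝ → ℂ} {C : ℝ} (h : C2On α β f C) : ContinuousOn f (Icc α β) := by
  obtain ⟨f₁, f₂, h1, -⟩ := h
  exact fun x hx => (h1 x hx).continuousAt.continuousWithinAt

/-- The constant 4 counts the terms of (fg)'' = f''g + 2f'g' + fg''. -/
theorem C2On.mul {f g : ℝ → ℂ} {C D : ℝ} (hf : C2On α β f C) (hg : C2On α β g D) :
    C2On α β (fun x => f x * g x) (4 * (C * D)) := by
  have hfc := hf.continuousOn
  have hgc := hg.continuousOn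
  obtain ⟨f₁, f₂, h1, h2, h3, h4⟩ := hf
  obtain ⟨g₁, g₂, k1, k2, k3, k4⟩ := hg
  refine ⟨fun x => f₁ x * g x + f x * g₁ x,
    fun x => (f₂ x * g x + f₁ x * g₁ x) + (f₁ x * g₁ x + f x * g₂ x),
    fun x hx => (h1 x hx).mul (k1 x hx), fun x hx => ((h2 x hx).mul (k1 x hx)).add
      ((h1 x hx).mul (k2 x hx)), ?_, fun x hx => ?_⟩
  · have e1 : ContinuousOn f₁ (Icc α β) :=
      fun x hx => (h2 x hx).continuousAt.continuousWithinAt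
    have e2 : ContinuousOn g₁ (Icc α β) :=
      fun x hx => (k2 x hx).continuousAt.continuousWithinAt
    exact ((h3.mul hgc).add (e1.mul e2)).add ((e1.mul e2).add (hfc.mul k3))
  · obtain ⟨a0, a1, a2⟩ := h4 x hx
    obtain ⟨b0, b1, b2⟩ := k4 x hx
    have hC : 0 ≤ C := (norm_nonneg _).trans a0
    have hD : 0 ≤ D := (norm_nonneg _).trans b0
    have hm : ∀ u v : ℂ, ‖u‖ ≤ C → ‖v‖ ≤ D → ‖u * v‖ ≤ C * D := fun u v hu hv => by
      rw [norm_mul]; exact mul_le_mul hu hv (norm_nonneg _) hC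
    have hCD : 0 ≤ C * D := mul_nonneg hC hD
    refine ⟨(hm _ _ a0 b0).trans (by linarith), (norm_add_le _ _).trans ?_, ?_⟩
    · have := hm _ _ a1 b0
      have := hm _ _ a0 b1
      linarith
    · refine (norm_add_le _ _).trans ?_
      have e1 := norm_add_le (f₂ x * g x) (f₁ x * g₁ x)
      have e2 := norm_add_le (f₁ x * g₁ x) (f x * g₂ x)
      have := hm _ _ a2 b0
      have := hm _ _ a1 b1
      have := hm _ _ a0 b2
      linarith

theorem C2On.add {f g : ℝ → ℂ} {C D : ℝ} (hf : C2On α β f C) (hg : C2On α β g D) :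
    C2On α β (fun x => f x + g x) (C + D) := by
  obtain ⟨f₁, f₂, h1, h2, h3, h4⟩ := hf
  obtain ⟨g₁, g₂, k1, k2, k3, k4⟩ := hg
  exact ⟨_, _, fun x hx => (h1 x hx).add (k1 x hx), fun x hx => (h2 x hx).add (k2 x hx),
    h3.add k3, fun x hx => ⟨norm_add_le_of_le (h4 x hx).1 (k4 x hx).1,
      norm_add_le_of_le (h4 x hx).2.1 (k4 x hx).2.1,
      norm_add_le_of_le (h4 x hx).2.2 (k4 x hx).2.2⟩⟩

theorem C2On.const_mul {f : ℝ → ℂ} {C : ℝ} (hf : C2On α β f C) (c : ℂ) :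
    C2On α β (fun x => c * f x) (‖c‖ * C) := by
  obtain ⟨f₁, f₂, h1, h2, h3, h4⟩ := hf
  refine ⟨_, _, fun x hx => (h1 x hx).const_mul c, fun x hx => (h2 x hx).const_mul c,
    continuousOn_const.mul h3, fun x hx => ?_⟩
  simp only [norm_mul]
  exact ⟨mul_le_mul_of_nonneg_left (h4 x hx).1 (norm_nonneg _),
    mul_le_mul_of_nonneg_left (h4 x hx).2.1 (norm_nonneg _),
    mul_le_mul_of_nonneg_left (h4 x hx).2.2 (norm_nonneg _)⟩

theorem C2On.zero : C2On α β (fun _ => 0) 0 :=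
  ⟨fun _ => 0, fun _ => 0, fun x _ => hasDerivAt_const x 0, fun x _ => hasDerivAt_const x 0,
    continuousOn_const, fun x _ => by simp⟩

theorem C2Zero.mul {f g : ℝ → ℂ} {C D : ℝ} (hαβ : α ≤ β) (hf : C2Zero α β f C)
    (hg : C2On α β g D) : C2Zero α β (fun x => f x * g x) (4 * (C * D)) := by
  refine ⟨hf.1.mul hg, by simp [hf.2.1], by simp [hf.2.2.1], ?_, ?_⟩
  all_goals
    obtain ⟨⟨f₁, f₂, h1, -⟩, z1, z2, z3, z4⟩ := hf
    obtain ⟨g₁, g₂, k1, -⟩ := hg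
  · have hα : α ∈ Icc α β := left_mem_Icc.2 hαβ
    rw [((h1 α hα).fun_mul (k1 α hα)).deriv, ← (h1 α hα).deriv, z1, z3]; simp
  · have hα : β ∈ Icc α β := right_mem_Icc.2 hαβ
    rw [((h1 β hα).fun_mul (k1 β hα)).deriv, ← (h1 β hα).deriv, z2, z4]; simp

/-- A smooth function on `(0, ∞)` is `C2On` for some constant. -/
theorem exists_c2On_of_contDiffOn (hα : 0 < α) {f : ℝ → ℂ} (hf : ContDiffOn ℝ ∞ f (Ioi 0)) :
    ∃ C, 0 ≤ C ∧ C2On α β f C := by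
  have hsub : Icc α β ⊆ Ioi 0 := fun x hx => hα.trans_le hx.1
  have h1 := ((contDiffOn_infty_iff_deriv_of_isOpen isOpen_Ioi).1 hf).2
  have h2 := ((contDiffOn_infty_iff_deriv_of_isOpen isOpen_Ioi).1 h1).2
  obtain ⟨C0, hC0⟩ := isCompact_Icc.exists_bound_of_continuousOn (hf.continuousOn.mono hsub)
  obtain ⟨C1, hC1⟩ := isCompact_Icc.exists_bound_of_continuousOn (h1.continuousOn.mono hsub)
  obtain ⟨C2, hC2⟩ := isCompact_Icc.exists_bound_of_continuousOn (h2.continuousOn.mono hsub)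
  have hd : ∀ g : ℝ → ℂ, ContDiffOn ℝ ∞ g (Ioi 0) → ∀ x ∈ Icc α β,
      HasDerivAt g (deriv g x) x := fun g hg x hx =>
    ((hg.differentiableOn (by simp)).differentiableAt (isOpen_Ioi.mem_nhds (hsub hx))).hasDerivAt
  refine ⟨max 0 (max C0 (max C1 C2)), le_max_left _ _, deriv f, deriv (deriv f), hd f hf,
    hd _ h1, h2.continuousOn.mono hsub, fun x hx =>
    ⟨(hC0 x hx).trans ?_, (hC1 x hx).trans ?_, (hC2 x hx).trans ?_⟩⟩ <;> simp

/-- Dilates `f(r ·)`, `0 ≤ r ≤ 1`, of a smooth function are uniformly `C2On`. -/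
theorem exists_c2On_comp_mul (hα : 0 < α) {f : ℝ → ℂ} (hf : ContDiff ℝ ∞ f) :
    ∃ C, 0 ≤ C ∧ ∀ r ∈ Icc (0 : ℝ) 1, C2On α β (fun x => f (r * x)) C := by
  have h1 := (contDiff_infty_iff_deriv.1 hf).2
  have h2 := (contDiff_infty_iff_deriv.1 h1).2
  obtain ⟨C0, hC0⟩ := (isCompact_Icc (a := 0) (b := β)).exists_bound_of_continuousOn
    hf.continuous.continuousOn
  obtain ⟨C1, hC1⟩ := (isCompact_Icc (a := 0) (b := β)).exists_bound_of_continuousOn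
    h1.continuous.continuousOn
  obtain ⟨C2, hC2⟩ := (isCompact_Icc (a := 0) (b := β)).exists_bound_of_continuousOn
    h2.continuous.continuousOn
  have hd : ∀ g : ℝ → ℂ, ContDiff ℝ ∞ g → ∀ r x : ℝ,
      HasDerivAt (fun x => g (r * x)) ((r : ℂ) * deriv g (r * x)) x := fun g hg r x => by
    have := ((hg.differentiable (by simp) (r * x)).hasDerivAt).scomp x
      ((hasDerivAt_id x).const_mul r)
    refine this.congr_deriv ?_
    simp
  refine ⟨max 0 (max C0 (max C1 C2)), le_max_left _ _, fun r hr => ⟨fun x => r * deriv f (r * x),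
    fun x => r * (r * deriv (deriv f) (r * x)), fun x _ => hd f hf r x,
    fun x _ => (hd _ h1 r x).const_mul _, ?_, fun x hx => ?_⟩⟩
  · exact (continuous_const.mul (continuous_const.mul
      (h2.continuous.comp (continuous_const.mul continuous_id)))).continuousOn
  · have hrx : r * x ∈ Icc 0 β := by
      have hx0 : 0 ≤ x := hα.le.trans hx.1
      exact ⟨mul_nonneg hr.1 hx0, (mul_le_of_le_one_left hx0 hr.2).trans hx.2⟩
    have hr' : ‖(r : ℂ)‖ ≤ 1 := by
      rw [Complex.norm_real, Real.norm_eq_abs, abs_of_nonneg hr.1]; exact hr.2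
    have hm : ∀ u : ℂ, ‖(r : ℂ) * u‖ ≤ ‖u‖ := fun u => by
      rw [norm_mul]; exact mul_le_of_le_one_left (norm_nonneg _) hr'
    refine ⟨(hC0 _ hrx).trans (by simp), ((hm _).trans (hC1 _ hrx)).trans (by simp),
      ((hm _).trans ((hm _).trans (hC2 _ hrx))).trans (by simp)⟩

/-! ### Amplitudes of dilated Bessel functions -/

theorem norm_cexp_I_mul (x y : ℝ) : ‖Complex.exp (-(Complex.I * x * y))‖ = 1 := by
  rw [show -(Complex.I * x * y) = ((-(x * y) : ℝ) : ℂ) * Complex.I by push_cast; ring]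
  exact Complex.norm_exp_ofReal_mul_I _

/-- Differentiating in x costs a factor r each time. Since the first two derivatives of the
amplitude are O(s^{-2}) at s = rx ≥ α, even the factor r² of the second derivative is absorbed, so
the bound is uniform in r ≥ 1. -/
theorem exists_c2On_besselAmp (hα : 0 < α) :
    ∃ C, 0 ≤ C ∧ ∀ σ : ℝ, σ ^ 2 = 1 → ∀ r : ℝ, 1 ≤ r →
      C2On α β (fun x => besselAmp σ (r * x)) C := by
  obtain ⟨C, hC, hb⟩ := exists_bound_besselY hα
  have hd : ∀ (g : ℝ → ℂ) (g' : ℂ) (r x : ℝ), HasDerivAt g g' (r * x) →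
      HasDerivAt (fun x => g (r * x)) ((r : ℂ) * g') x := fun g g' r x hg => by
    have := hg.scomp x ((hasDerivAt_id x).const_mul r)
    refine this.congr_deriv ?_
    simp
  refine ⟨2 * C + C / α + (2 * C / α ^ 2 + C / α ^ 3), by positivity, fun σ hσ r hr =>
    ⟨fun x => r * besselAmp' σ (r * x), fun x => r * (r * besselAmp'' σ (r * x)),
    fun x hx => hd _ _ r x (hasDerivAt_besselAmp hσ (by have := hα.trans_le hx.1; positivity)),
    fun x hx => (hd _ _ r x (hasDerivAt_besselAmp' σ
      (by have := hα.trans_le hx.1; positivity))).const_mul _, ?_, fun x hx => ?_⟩⟩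
  · have hpos : ∀ x ∈ Icc α β, 0 < r * x := fun x hx => by
      have := hα.trans_le hx.1; positivity
    have hm : ContinuousOn (fun x : ℝ => r * x) (Icc α β) := by fun_prop
    have hY : ContinuousOn (fun x => (besselY (r * x) : ℂ)) (Icc α β) := fun x hx =>
      (Complex.continuous_ofReal.continuousAt.comp ((hasDerivAt_besselY
        (hpos x hx)).continuousAt.comp (by fun_prop))).continuousWithinAt
    have hY' : ContinuousOn (fun x => (besselY' (r * x) : ℂ)) (Icc α β) := fun x hx =>
      (Complex.continuous_ofReal.continuousAt.comp ((hasDerivAt_besselY'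
        (hpos x hx)).continuousAt.comp (by fun_prop))).continuousWithinAt
    have hne : ∀ x ∈ Icc α β, ((r * x : ℝ) : ℂ) ≠ 0 := fun x hx => by
      exact_mod_cast (hpos x hx).ne'
    unfold besselAmp''
    refine continuousOn_const.mul (continuousOn_const.mul ((by fun_prop : ContinuousOn _ _).mul
      (((ContinuousOn.div (by fun_prop) (by fun_prop) ?_).add
      (hY'.div (by fun_prop) ?_)).sub (hY.div (by fun_prop) ?_))))
    all_goals
      intro x hx
      exact mul_ne_zero (by norm_num) (pow_ne_zero _ (hne x hx))
  · have hx0 : 0 < x := hα.trans_le hx.1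
    have hs : α ≤ r * x := hx.1.trans (le_mul_of_one_le_left hx0.le hr)
    have hs0 : 0 < r * x := hα.trans_le hs
    obtain ⟨h1, h2⟩ := hb _ hs
    have hσ1 : ‖(σ : ℂ)‖ = 1 := by
      rw [Complex.norm_real, Real.norm_eq_abs]
      exact (pow_eq_one_iff_of_nonneg (abs_nonneg σ) two_ne_zero).1 (by rw [sq_abs, hσ])
    have hY : ‖(besselY (r * x) : ℂ)‖ ≤ C := by rwa [Complex.norm_real, Real.norm_eq_abs]
    have hY' : ‖(besselY' (r * x) : ℂ)‖ ≤ C := by rwa [Complex.norm_real, Real.norm_eq_abs]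
    have hsn : ‖((r * x : ℝ) : ℂ)‖ = r * x := by
      rw [Complex.norm_real, Real.norm_eq_abs, abs_of_pos hs0]
    have hrn : ‖(r : ℂ)‖ = r := by
      rw [Complex.norm_real, Real.norm_eq_abs, abs_of_pos (by linarith)]
    have p1 : 0 ≤ C / α := by positivity
    have p2 : 0 ≤ C / α ^ 2 := by positivity
    have p3 : 0 ≤ C / α ^ 3 := by positivity
    have p2' : 2 * C / α ^ 2 = 2 * (C / α ^ 2) := by ring
    have hq : r * (C / (r * x) ^ 2) ≤ C / α ^ 2 := by
      have : r * (C / (r * x) ^ 2) = C / (r * x ^ 2) := by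
        field_simp
      rw [this]
      refine div_le_div_of_nonneg_left hC (by positivity) ?_
      exact (pow_le_pow_left₀ hα.le hx.1 2).trans (le_mul_of_one_le_left (by positivity) hr)
    have hq2 : r * (r * (C / (r * x) ^ 2)) ≤ C / α ^ 2 := by
      have : r * (r * (C / (r * x) ^ 2)) = C / x ^ 2 := by
        field_simp
      rw [this]
      exact div_le_div_of_nonneg_left hC (by positivity) (pow_le_pow_left₀ hα.le hx.1 2)
    have hq3 : r * (r * (C / (r * x) ^ 3)) ≤ C / α ^ 3 := by
      have : r * (r * (C / (r * x) ^ 3)) = C / (r * x ^ 3) := by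
        field_simp
      rw [this]
      refine div_le_div_of_nonneg_left hC (by positivity) ?_
      exact (pow_le_pow_left₀ hα.le hx.1 3).trans (le_mul_of_one_le_left (by positivity) hr)
    refine ⟨?_, ?_, ?_⟩
    · beta_reduce
      rw [besselAmp, norm_div, norm_mul, norm_cexp_I_mul, one_mul]
      have : ‖(besselY (r * x) : ℂ) - Complex.I * σ * besselY' (r * x)‖ ≤ C + C := by
        refine norm_sub_le_of_le hY ?_
        rw [norm_mul, norm_mul, Complex.norm_I, hσ1]; simpa using hY'
      rw [show ‖(2 : ℂ)‖ = 2 by simp]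
      linarith
    · beta_reduce
      rw [besselAmp', norm_mul, hrn, norm_div, norm_mul, norm_mul, norm_mul, norm_cexp_I_mul,
        Complex.norm_I, hσ1, norm_mul, norm_pow, hsn]
      have : 1 * 1 * 1 * ‖(besselY (r * x) : ℂ)‖ / (‖(8 : ℂ)‖ * (r * x) ^ 2) ≤
          C / (r * x) ^ 2 := by
        rw [show ‖(8 : ℂ)‖ = 8 by simp]
        refine div_le_div₀ hC (by linarith) (by positivity) ?_
        nlinarith [sq_nonneg (r * x)]
      have := mul_le_mul_of_nonneg_left this (by linarith : 0 ≤ r)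
      linarith
    · beta_reduce
      rw [besselAmp'', norm_mul, norm_mul, hrn, norm_mul, norm_mul, norm_mul, norm_cexp_I_mul,
        Complex.norm_I, hσ1, one_mul, one_mul, one_mul]
      have e1 : ‖-(Complex.I * σ) * besselY (r * x) / (8 * ((r * x : ℝ) : ℂ) ^ 2)‖ ≤
          C / (r * x) ^ 2 / 8 := by
        rw [norm_div, norm_mul, norm_neg, norm_mul, Complex.norm_I, hσ1, norm_mul, norm_pow, hsn,
          show ‖(8 : ℂ)‖ = 8 by simp, div_div, mul_comm (8 : ℝ)]
        exact div_le_div_of_nonneg_right (by linarith) (by positivity)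
      have e2 : ‖(besselY' (r * x) : ℂ) / (8 * ((r * x : ℝ) : ℂ) ^ 2)‖ ≤
          C / (r * x) ^ 2 / 8 := by
        rw [norm_div, norm_mul, norm_pow, hsn,
          show ‖(8 : ℂ)‖ = 8 by simp, div_div, mul_comm (8 : ℝ)]
        exact div_le_div_of_nonneg_right (by linarith) (by positivity)
      have e3 : ‖(besselY (r * x) : ℂ) / (4 * ((r * x : ℝ) : ℂ) ^ 3)‖ ≤
          C / (r * x) ^ 3 / 4 := by
        rw [norm_div, norm_mul, norm_pow, hsn,
          show ‖(4 : ℂ)‖ = 4 by simp, div_div, mul_comm (4 : ℝ)]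
        exact div_le_div_of_nonneg_right (by linarith) (by positivity)
      have e := norm_sub_le_of_le (norm_add_le_of_le e1 e2) e3
      have hp2 : 0 ≤ C / (r * x) ^ 2 := by positivity
      have hp3 : 0 ≤ C / (r * x) ^ 3 := by positivity
      have e' := e.trans (by linarith : _ ≤ C / (r * x) ^ 2 + C / (r * x) ^ 3)
      have hr0 : 0 ≤ r := by linarith
      have := mul_le_mul_of_nonneg_left (mul_le_mul_of_nonneg_left e' hr0) hr0
      rw [mul_add, mul_add] at this
      linarith

end RadialWave

end

/-! ### Phase and amplitude form of the dilated Bessel functions -/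

noncomputable section

namespace RadialWave

variable {α β : ℝ}

/-- `T(ω) = e^{iσrω} A₁(ω) + e^{-iσrω} A₂(ω)` on `[α, β]` with amplitudes of size `c₁`, `c₂`. -/
def HasAmp (α β : ℝ) (T : ℝ → ℂ) (σ r c₁ c₂ : ℝ) : Prop :=
  ∃ A₁ A₂ : ℝ → ℂ, C2On α β A₁ c₁ ∧ C2On α β A₂ c₂ ∧ ∀ x ∈ Icc α β,
    T x = Complex.exp (Complex.I * (σ * r * x)) * A₁ x +
      Complex.exp (Complex.I * (-(σ * r) * x)) * A₂ x

theorem besselJ_eq_amp (σ : ℝ) {s : ℝ} (hs : 0 < s) :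
    (besselJ s : ℂ) = (s ^ (-1 / 2 : ℝ) : ℝ) * (Complex.exp (Complex.I * (σ * s)) * besselAmp σ s +
      Complex.exp (Complex.I * (-σ * s)) * besselAmp (-σ) s) := by
  have e1 : Complex.exp (Complex.I * (σ * s)) * Complex.exp (-(Complex.I * σ * s)) = 1 := by
    rw [← Complex.exp_add, show Complex.I * (σ * s) + -(Complex.I * σ * s) = (0 : ℂ) by ring,
      Complex.exp_zero]
  have e2 : Complex.exp (Complex.I * (-σ * s)) *
      Complex.exp (-(Complex.I * ((-σ : ℝ) : ℂ) * s)) = 1 := by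
    rw [← Complex.exp_add, show Complex.I * (-σ * s) + -(Complex.I * ((-σ : ℝ) : ℂ) * s) = (0 : ℂ)
      by push_cast; ring, Complex.exp_zero]
  have hss : ((s ^ (-1 / 2 : ℝ) : ℝ) : ℂ) * ((s ^ (1 / 2 : ℝ) : ℝ) : ℂ) = 1 := by
    rw [← Complex.ofReal_mul, ← Real.rpow_add hs]; norm_num
  have hY : (besselY s : ℂ) = ((s ^ (1 / 2 : ℝ) : ℝ) : ℂ) * besselJ s := by
    rw [besselY]; push_cast; ring
  rw [besselAmp, besselAmp]
  have : (besselJ s : ℂ) = ((s ^ (-1 / 2 : ℝ) : ℝ) : ℂ) * besselY s := by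
    rw [hY, ← mul_assoc, hss, one_mul]
  rw [this]
  generalize ((s ^ (-1 / 2 : ℝ) : ℝ) : ℂ) = q at *
  push_cast at e2 ⊢
  linear_combination (-(q * ((besselY s : ℂ) - Complex.I * σ * besselY' s) / 2)) * e1 -
    (q * ((besselY s : ℂ) + Complex.I * σ * besselY' s) / 2) * e2

/-- Besides Y itself, the two amplitudes encode Y' = iσ(e^{iσs}a_σ - e^{-iσs}a_{-σ}).
Differentiating J₀ = s^{-1/2}Y adds the lower-order term -J₀/(2s). -/
theorem besselJ'_eq_amp {σ s : ℝ} (hσ : σ ^ 2 = 1) (hs : 0 < s) :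
    (besselJ' s : ℂ) = (s ^ (-1 / 2 : ℝ) : ℝ) * (Complex.I * σ *
      (Complex.exp (Complex.I * (σ * s)) * besselAmp σ s -
      Complex.exp (Complex.I * (-σ * s)) * besselAmp (-σ) s)) - besselJ s / (2 * s) := by
  have e1 : Complex.exp (Complex.I * (σ * s)) * Complex.exp (-(Complex.I * σ * s)) = 1 := by
    rw [← Complex.exp_add, show Complex.I * (σ * s) + -(Complex.I * σ * s) = (0 : ℂ) by ring,
      Complex.exp_zero]
  have e2 : Complex.exp (Complex.I * (-σ * s)) *
      Complex.exp (-(Complex.I * ((-σ : ℝ) : ℂ) * s)) = 1 := by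
    rw [← Complex.exp_add, show Complex.I * (-σ * s) + -(Complex.I * ((-σ : ℝ) : ℂ) * s) = (0 : ℂ)
      by push_cast; ring, Complex.exp_zero]
  have hss : ((s ^ (-1 / 2 : ℝ) : ℝ) : ℂ) * ((s ^ (1 / 2 : ℝ) : ℝ) : ℂ) = 1 := by
    rw [← Complex.ofReal_mul, ← Real.rpow_add hs]; norm_num
  have hs0 : (s : ℂ) ≠ 0 := by exact_mod_cast hs.ne'
  have hq2 : ((s ^ (-1 / 2 : ℝ) : ℝ) : ℂ) ^ 2 = 1 / s := by
    rw [← Complex.ofReal_pow, ← Real.rpow_natCast, ← Real.rpow_mul hs.le]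
    norm_num
    rw [Real.rpow_neg_one]; push_cast; rfl
  have hσ' : (σ : ℂ) ^ 2 = 1 := by exact_mod_cast hσ
  have hJ : (besselJ' s : ℂ) = ((s ^ (-1 / 2 : ℝ) : ℝ) : ℂ) * besselY' s - besselJ s / (2 * s) := by
    rw [besselY']; push_cast
    generalize ((s ^ (-1 / 2 : ℝ) : ℝ) : ℂ) = q at *
    generalize ((s ^ (1 / 2 : ℝ) : ℝ) : ℂ) = p at *
    linear_combination (-(besselJ' s : ℂ)) * hss - (besselJ s / 2 : ℂ) * hq2
  rw [hJ, besselAmp, besselAmp]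
  generalize ((s ^ (-1 / 2 : ℝ) : ℝ) : ℂ) = q at *
  push_cast at e2 ⊢
  linear_combination
    (-(q * Complex.I * σ * ((besselY s : ℂ) - Complex.I * σ * besselY' s) / 2)) * e1 +
    (q * Complex.I * σ * ((besselY s : ℂ) + Complex.I * σ * besselY' s) / 2) * e2
    - q * besselY' s * hσ' + (q * besselY' s * σ ^ 2) * (Complex.I_sq)

theorem contDiffOn_rpow_ofReal (p : ℝ) :
    ContDiffOn ℝ ∞ (fun x : ℝ => ((x ^ p : ℝ) : ℂ)) (Ioi 0) :=
  Complex.ofRealCLM.contDiff.comp_contDiffOn fun x hx => by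
    have h : ContDiffAt ℝ ∞ (fun y : ℝ => y ^ p) x :=
      Real.contDiffAt_rpow_const_of_ne (ne_of_gt hx)
    exact h.contDiffWithinAt

/-- A smooth function of `rω` is a bounded amplitude for `r ≤ 1`. -/
theorem exists_hasAmp_small (hα : 0 < α) {f : ℝ → ℂ} (hf : ContDiff ℝ ∞ f) (σ : ℝ) :
    ∃ C, 0 ≤ C ∧ ∀ r ∈ Icc (0 : ℝ) 1, ∀ c₁ c₂, C ≤ c₁ → 0 ≤ c₂ →
      HasAmp α β (fun x => f (r * x)) σ r c₁ c₂ := by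
  -- For r ≤ 1 the phase rω stays bounded, so e^{-iσrω} is itself a harmless amplitude: everything
  -- is put into the first component and the second one is zero.
  obtain ⟨C, hC, h⟩ := exists_c2On_comp_mul (β := β) hα
    (f := fun s : ℝ => Complex.exp (-(Complex.I * (σ * s))) * f s)
    ((Complex.contDiff_exp.comp (by
      exact (contDiff_const.mul (contDiff_const.mul Complex.ofRealCLM.contDiff)).neg)).mul hf)
  refine ⟨C, hC, fun r hr c₁ c₂ h1 h2 => ⟨_, _, (h r hr).mono h1, C2On.zero.mono h2,
    fun x _ => ?_⟩⟩
  have : Complex.exp (Complex.I * (σ * r * x)) *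
      Complex.exp (-(Complex.I * (σ * ((r * x : ℝ) : ℂ)))) = 1 := by
    rw [← Complex.exp_add, show Complex.I * (σ * r * x) + -(Complex.I * (σ * ((r * x : ℝ) : ℂ))) =
      (0 : ℂ) by push_cast; ring, Complex.exp_zero]
  rw [mul_zero, add_zero, ← mul_assoc, this, one_mul]

theorem rpow_neg_le_two_mul {r : ℝ} (hr : 1 ≤ r) {p q : ℝ} (hp : 0 ≤ p) (hq : p ≤ q) (hq' : q ≤ 2) :
    r ^ (-q) ≤ 4 * (1 + r) ^ (-p) := by
  have h0 : 0 < r := by linarith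
  have h1 : r ^ (-q) ≤ r ^ (-p) := Real.rpow_le_rpow_of_exponent_le hr (by linarith)
  have h2 : r ^ (-p) ≤ ((1 + r) / 2) ^ (-p) :=
    Real.rpow_le_rpow_of_nonpos (by linarith) (by linarith) (by linarith)
  rw [Real.div_rpow (by linarith) (by norm_num)] at h2
  have h3 : ((1 : ℝ) / 4) ≤ 2 ^ (-p) := by
    have := Real.rpow_le_rpow_of_exponent_le (x := 2) (by norm_num) (by linarith : (-2 : ℝ) ≤ -p)
    rw [Real.rpow_neg (by norm_num)] at this
    norm_num at this ⊢
    exact this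
  have h4 : 0 < (1 + r) ^ (-p) := by positivity
  have h5 : (1 + r) ^ (-p) / 2 ^ (-p) ≤ 4 * (1 + r) ^ (-p) := by
    rw [div_le_iff₀ (by positivity)]
    nlinarith
  linarith

theorem one_le_four_mul {r : ℝ} (hr : r ∈ Icc (0 : ℝ) 1) {p : ℝ} (hp : 0 ≤ p) (hp' : p ≤ 2) :
    1 ≤ 4 * (1 + r) ^ (-p) := by
  have h2 : (2 : ℝ) ^ (-p) ≤ (1 + r) ^ (-p) :=
    Real.rpow_le_rpow_of_nonpos (by linarith [hr.1]) (by linarith [hr.2]) (by linarith)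
  have h3 : ((1 : ℝ) / 4) ≤ 2 ^ (-p) := by
    have := Real.rpow_le_rpow_of_exponent_le (x := 2) (by norm_num) (by linarith : (-2 : ℝ) ≤ -p)
    rw [Real.rpow_neg (by norm_num)] at this
    norm_num at this ⊢
    exact this
  linarith

/-- General form: `T(s) = s^{-1/2} (u₁ e^{iσs} a_σ + u₂ e^{-iσs} a_{-σ}) + v s^{-1} J₀(s)`. -/
theorem exists_hasAmp (hα : 0 < α) {T : ℝ → ℂ} (hT : ContDiff ℝ ∞ T) {σ : ℝ} (hσ : σ ^ 2 = 1)
    (u₁ u₂ v : ℂ) {p : ℝ} (hp : 1 / 2 ≤ p) (hp' : p ≤ 3 / 2) (hu : u₂ = 0 ∨ p = 1 / 2)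
    (h : ∀ s, 0 < s → T s = (s ^ (-1 / 2 : ℝ) : ℝ) *
      (u₁ * (Complex.exp (Complex.I * (σ * s)) * besselAmp σ s) +
      u₂ * (Complex.exp (Complex.I * (-σ * s)) * besselAmp (-σ) s)) + v * (besselJ s / s)) :
    ∃ C, 0 ≤ C ∧ ∀ r, 0 ≤ r →
      HasAmp α β (fun x => T (r * x)) σ r (C * (1 + r) ^ (-(1 / 2) : ℝ)) (C * (1 + r) ^ (-p)) := by
  obtain ⟨C0, hC0, h0⟩ := exists_hasAmp_small (β := β) hα hT σ
  obtain ⟨C1, hC1, h1⟩ := exists_c2On_besselAmp (β := β) hα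
  obtain ⟨C2, hC2, h2⟩ := exists_c2On_of_contDiffOn (β := β) hα (contDiffOn_rpow_ofReal (-1 / 2))
  obtain ⟨C3, hC3, h3⟩ := exists_c2On_of_contDiffOn (β := β) hα (contDiffOn_rpow_ofReal (-3 / 2))
  set K : ℝ := 4 * ((‖u₁‖ + ‖u₂‖) * C2 + ‖v‖ * C3) * C1 with hK
  have hK0 : 0 ≤ K := by positivity
  refine ⟨4 * C0 + 4 * K, by positivity, fun r hr => ?_⟩
  rcases le_total r 1 with hr1 | hr1
  · refine h0 r ⟨hr, hr1⟩ _ _ ?_ (by positivity)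
    have := one_le_four_mul ⟨hr, hr1⟩ (p := 1 / 2) (by norm_num) (by norm_num)
    nlinarith [mul_nonneg hK0 (by positivity : 0 ≤ (1 + r) ^ (-(1 / 2) : ℝ))]
  · have hr0 : 0 < r := by linarith
    have hσ2 : (-σ) ^ 2 = 1 := by simpa using hσ
    have hb1 := (((h2.const_mul (u₁ * (r ^ (-1 / 2 : ℝ) : ℝ))).add
      (h3.const_mul (v * (r ^ (-3 / 2 : ℝ) : ℝ)))).mul (h1 σ hσ r hr1))
    have hb2 := (((h2.const_mul (u₂ * (r ^ (-1 / 2 : ℝ) : ℝ))).add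
      (h3.const_mul (v * (r ^ (-3 / 2 : ℝ) : ℝ)))).mul (h1 (-σ) hσ2 r hr1))
    have hn : ∀ q : ℝ, ‖((r ^ q : ℝ) : ℂ)‖ = r ^ q := fun q => by
      rw [Complex.norm_real, Real.norm_eq_abs, abs_of_pos (by positivity)]
    have q1 := rpow_neg_le_two_mul hr1 (p := 1 / 2) (q := 1 / 2) (by norm_num) le_rfl (by norm_num)
    have q2 := rpow_neg_le_two_mul hr1 (p := 1 / 2) (q := 3 / 2) (by norm_num) (by norm_num)
      (by norm_num)
    have q3 := rpow_neg_le_two_mul hr1 (p := p) (q := 3 / 2) (by linarith) hp' (by norm_num)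
    -- The opposite phase has a term of size r^{-1/2} only if u₂ ≠ 0, in which case p = 1/2 is all
    -- that is claimed. The term v J₀(s)/s contributes r^{-3/2} to both phases, whence the
    -- restriction p ≤ 3/2.
    have q4 : ‖u₂‖ * r ^ (-1 / 2 : ℝ) ≤ ‖u₂‖ * (4 * (1 + r) ^ (-p)) := by
      rcases hu with hu | hu
      · simp [hu]
      · refine mul_le_mul_of_nonneg_left ?_ (norm_nonneg _)
        rw [hu, show (-1 / 2 : ℝ) = -(1 / 2) by norm_num]; exact q1
    have hfin : ∀ (u : ℂ) (P : ℝ), 0 ≤ P → ‖u‖ ≤ ‖u₁‖ + ‖u₂‖ →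
        ‖u‖ * r ^ (-1 / 2 : ℝ) ≤ ‖u‖ * (4 * P) → r ^ (-(3 / 2) : ℝ) ≤ 4 * P →
        4 * ((‖u * (r ^ (-1 / 2 : ℝ) : ℝ)‖ * C2 + ‖v * (r ^ (-3 / 2 : ℝ) : ℝ)‖ * C3) * C1) ≤
          (4 * C0 + 4 * K) * P := by
      intro u P hP hu h1 h2
      rw [norm_mul, norm_mul, hn, hn, show (-3 / 2 : ℝ) = -(3 / 2) by norm_num]
      have e1 : ‖u‖ * r ^ (-1 / 2 : ℝ) ≤ (‖u₁‖ + ‖u₂‖) * (4 * P) :=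
        h1.trans (mul_le_mul_of_nonneg_right hu (by positivity))
      have e2 : ‖v‖ * r ^ (-(3 / 2) : ℝ) ≤ ‖v‖ * (4 * P) :=
        mul_le_mul_of_nonneg_left h2 (norm_nonneg _)
      calc _ ≤ 4 * (((‖u₁‖ + ‖u₂‖) * (4 * P) * C2 + ‖v‖ * (4 * P) * C3) * C1) := by gcongr
        _ = 4 * K * P := by rw [hK]; ring
        _ ≤ _ := by nlinarith [mul_nonneg hC0 hP]
    refine ⟨_, _, hb1.mono (hfin u₁ _ (by positivity) (by linarith [norm_nonneg u₂])
      (mul_le_mul_of_nonneg_left ?_ (norm_nonneg _)) q2),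
      hb2.mono (hfin u₂ _ (by positivity) (by linarith [norm_nonneg u₁]) q4 q3), fun x hx => ?_⟩
    · rw [show (-1 / 2 : ℝ) = -(1 / 2) by norm_num]; exact q1
    · have hx0 : 0 < x := hα.trans_le hx.1
      beta_reduce
      rw [h _ (by positivity)]
      have hx3 : (((r * x) ^ (-1 / 2 : ℝ) : ℝ) : ℂ) / ((r * x : ℝ) : ℂ) =
          ((r ^ (-3 / 2 : ℝ) : ℝ) : ℂ) * ((x ^ (-3 / 2 : ℝ) : ℝ) : ℂ) := by
        rw [← Complex.ofReal_div, ← Complex.ofReal_mul, ← Real.mul_rpow hr0.le hx0.le,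
          ← Real.rpow_sub_one (by positivity)]
        norm_num
      rw [besselJ_eq_amp σ (by positivity), mul_div_right_comm, hx3,
        Real.mul_rpow hr0.le hx0.le]
      push_cast
      rw [show (σ : ℂ) * (r * x) = σ * r * x by ring,
        show -(σ : ℂ) * (r * x) = -(σ * r) * x by ring]
      ring

theorem contDiff_besselJ_ofReal : ContDiff ℝ ∞ (fun s => (besselJ s : ℂ)) :=
  Complex.ofRealCLM.contDiff.comp contDiff_besselJ

theorem contDiff_besselJ'_ofReal : ContDiff ℝ ∞ (fun s => (besselJ' s : ℂ)) :=
  Complex.ofRealCLM.contDiff.comp contDiff_besselJ'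

theorem exists_hasAmp_besselJ (hα : 0 < α) {σ : ℝ} (hσ : σ ^ 2 = 1) :
    ∃ C, 0 ≤ C ∧ ∀ r, 0 ≤ r → HasAmp α β (fun x => besselJ (r * x)) σ r
      (C * (1 + r) ^ (-(1 / 2) : ℝ)) (C * (1 + r) ^ (-(1 / 2) : ℝ)) := by
  refine exists_hasAmp hα contDiff_besselJ_ofReal hσ 1 1 0 le_rfl (by norm_num) (Or.inr rfl) ?_
  intro s hs
  rw [besselJ_eq_amp σ hs]; ring

theorem exists_hasAmp_besselJ' (hα : 0 < α) {σ : ℝ} (hσ : σ ^ 2 = 1) :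
    ∃ C, 0 ≤ C ∧ ∀ r, 0 ≤ r → HasAmp α β (fun x => besselJ' (r * x)) σ r
      (C * (1 + r) ^ (-(1 / 2) : ℝ)) (C * (1 + r) ^ (-(1 / 2) : ℝ)) := by
  refine exists_hasAmp hα contDiff_besselJ'_ofReal hσ (Complex.I * σ) (-(Complex.I * σ)) (-1 / 2)
    le_rfl (by norm_num) (Or.inr rfl) ?_
  intro s hs
  rw [besselJ'_eq_amp hσ hs]; ring

/-- The structural cancellation behind the null norms. In J₀ - iσJ₀' the leading e^{-iσs} parts of
J₀ and J₀' cancel and the e^{iσs} parts add up to twice the amplitude; the opposite phase enters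
only through iσJ₀/(2s), of size s^{-3/2}. -/
theorem exists_hasAmp_null (hα : 0 < α) {σ : ℝ} (hσ : σ ^ 2 = 1) :
    ∃ C, 0 ≤ C ∧ ∀ r, 0 ≤ r →
      HasAmp α β (fun x => besselJ (r * x) - Complex.I * σ * besselJ' (r * x)) σ r
        (C * (1 + r) ^ (-(1 / 2) : ℝ)) (C * (1 + r) ^ (-(3 / 2) : ℝ)) := by
  refine exists_hasAmp hα (T := fun s => besselJ s - Complex.I * σ * besselJ' s)
    (contDiff_besselJ_ofReal.sub (contDiff_const.mul contDiff_besselJ'_ofReal)) hσ 2 0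
    (Complex.I * σ / 2) (by norm_num) le_rfl (Or.inl rfl) ?_
  intro s hs
  have hσ' : (σ : ℂ) ^ 2 = 1 := by exact_mod_cast hσ
  rw [besselJ'_eq_amp hσ hs, mul_sub]
  nth_rewrite 1 [besselJ_eq_amp σ hs]
  generalize ((s ^ (-1 / 2 : ℝ) : ℝ) : ℂ) = q
  linear_combination (-(σ : ℂ) ^ 2 * q * (Complex.exp (Complex.I * (σ * s)) * besselAmp σ s -
      Complex.exp (Complex.I * (-σ * s)) * besselAmp (-σ) s)) * Complex.I_sq +
    (q * (Complex.exp (Complex.I * (σ * s)) * besselAmp σ s -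
      Complex.exp (Complex.I * (-σ * s)) * besselAmp (-σ) s)) * hσ'

/-! ### Oscillatory integrals -/

/-- The weight `w(s) = (1 + s²)⁻¹`. -/
def decay (s : ℝ) : ℝ := (1 + s ^ 2)⁻¹

theorem decay_pos (s : ℝ) : 0 < decay s := by unfold decay; positivity

theorem decay_neg (s : ℝ) : decay (-s) = decay s := by simp [decay]

/-- Two integrations by parts without boundary terms, since Ψ and Ψ' vanish at the end points, bound
z² times the integral. The trivial bound accounts for the 1 in 1 + z², hence the factor 2. -/
theorem norm_integral_cexp_le (hαβ : α ≤ β) {Ψ : ℝ → ℂ} {c : ℝ} (hΨ : C2Zero α β Ψ c) (z : ℝ) :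
    ‖∫ x in α..β, Ψ x * Complex.exp (Complex.I * (z * x))‖ ≤ 2 * (β - α) * c * decay z := by
  have hcont := hΨ.1.continuousOn
  obtain ⟨⟨f₁, f₂, h1, h2, h3, h4⟩, z1, z2, z3, z4⟩ := hΨ
  rw [(h1 α (left_mem_Icc.2 hαβ)).deriv] at z3
  rw [(h1 β (right_mem_Icc.2 hαβ)).deriv] at z4
  set e : ℝ → ℂ := fun x => Complex.exp (Complex.I * (z * x)) with he
  have hne : ∀ x, ‖e x‖ = 1 := fun x => by
    rw [he]; beta_reduce
    rw [show Complex.I * (z * x) = ((z * x : ℝ) : ℂ) * Complex.I by push_cast; ring]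
    exact Complex.norm_exp_ofReal_mul_I _
  have hec : Continuous e := by fun_prop
  have hed : ∀ x, HasDerivAt e (Complex.I * z * e x) x := fun x => by
    refine ((((Complex.ofRealCLM.hasDerivAt (x := x)).const_mul (z : ℂ)).const_mul
      Complex.I).cexp).congr_deriv ?_
    simp [he]; ring
  have hb : ∀ (f : ℝ → ℂ), (∀ x ∈ Icc α β, ‖f x‖ ≤ c) → ‖∫ x in α..β, f x * e x‖ ≤ c * (β - α) := by
    intro f hf
    refine (intervalIntegral.norm_integral_le_of_norm_le_const (C := c) ?_).trans
      (by rw [abs_of_nonneg (by linarith)])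
    intro x hx
    rw [uIoc_of_le hαβ] at hx
    rw [norm_mul, hne, mul_one]
    exact hf x (Ioc_subset_Icc_self hx)
  have i1 : IntervalIntegrable (fun x => Ψ x * e x) volume α β := by
    refine ContinuousOn.intervalIntegrable ?_
    rw [uIcc_of_le hαβ]; exact hcont.mul hec.continuousOn
  have i2 : IntervalIntegrable (fun x => f₂ x * e x) volume α β := by
    refine ContinuousOn.intervalIntegrable ?_
    rw [uIcc_of_le hαβ]; exact h3.mul hec.continuousOn
  have key : ∫ x in α..β, (f₂ x * e x + (z : ℂ) ^ 2 * (Ψ x * e x)) = 0 := by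
    -- Both integrations by parts at once: (Ψ' - izΨ)e^{izx} has derivative (Ψ'' + z²Ψ)e^{izx}.
    rw [intervalIntegral.integral_eq_sub_of_hasDerivAt
      (f := fun x => (f₁ x - Complex.I * z * Ψ x) * e x)]
    · simp [z1, z2, z3, z4]
    · intro x hx
      rw [uIcc_of_le hαβ] at hx
      refine (((h2 x hx).sub ((h1 x hx).const_mul (Complex.I * z))).mul (hed x)).congr_deriv ?_
      simp only [Pi.sub_apply]
      linear_combination (-(z : ℂ) ^ 2 * Ψ x * e x) * Complex.I_sq
    · exact i2.add (i1.const_mul _)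
  rw [intervalIntegral.integral_add i2 (i1.const_mul _), intervalIntegral.integral_const_mul] at key
  have k1 := hb Ψ fun x hx => (h4 x hx).1
  have k2 := hb f₂ fun x hx => (h4 x hx).2.2
  have k3 : z ^ 2 * ‖∫ x in α..β, Ψ x * e x‖ ≤ c * (β - α) := by
    have : (z : ℂ) ^ 2 * ∫ x in α..β, Ψ x * e x = -∫ x in α..β, f₂ x * e x := by
      linear_combination key
    have := congrArg norm this
    rw [norm_neg, norm_mul, norm_pow, Complex.norm_real, Real.norm_eq_abs, sq_abs] at this
    rw [this]; exact k2
  rw [decay, ← div_eq_mul_inv, le_div_iff₀ (by positivity)]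
  linarith

/-- Multiplying out the two factors leaves four oscillatory integrals with phases τ ± σr ± r'. The
constant 32 is 2·4·4: the factor 2 of the single integral and one factor 4 for each of the two
products of amplitudes. -/
theorem norm_integral_hasAmp_le (hαβ : α ≤ β) {Ψ T B : ℝ → ℂ} {c c₁ c₂ d σ r r' : ℝ}
    (hΨ : C2Zero α β Ψ c) (hT : HasAmp α β T σ r c₁ c₂) (hB : HasAmp α β B 1 r' d d) (τ : ℝ) :
    ‖∫ x in α..β, Ψ x * T x * Complex.exp (Complex.I * (τ * x)) * B x‖ ≤
      32 * (β - α) * c * d * (c₁ * (decay (τ + σ * r + r') + decay (τ + σ * r - r')) +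
        c₂ * (decay (τ - σ * r + r') + decay (τ - σ * r - r'))) := by
  obtain ⟨A₁, A₂, hA₁, hA₂, hTe⟩ := hT
  obtain ⟨B₁, B₂, hB₁, hB₂, hBe⟩ := hB
  have hint : ∀ {A D : ℝ → ℂ} {a : ℝ}, C2On α β A a → C2On α β D d → ∀ z : ℝ,
      IntervalIntegrable (fun x => Ψ x * A x * D x * Complex.exp (Complex.I * (z * x)))
        volume α β := by
    intro A D a hA hD z
    refine ContinuousOn.intervalIntegrable ?_
    rw [uIcc_of_le hαβ]
    exact ((hΨ.1.continuousOn.mul hA.continuousOn).mul hD.continuousOn).mul (by fun_prop)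
  have hbd : ∀ {A D : ℝ → ℂ} {a : ℝ}, C2On α β A a → C2On α β D d → ∀ z : ℝ,
      ‖∫ x in α..β, Ψ x * A x * D x * Complex.exp (Complex.I * (z * x))‖ ≤
        32 * (β - α) * c * d * (a * decay z) := by
    intro A D a hA hD z
    refine (norm_integral_cexp_le hαβ ((hΨ.mul hαβ hA).mul hαβ hD) z).trans (le_of_eq ?_)
    ring
  have heq : ∫ x in α..β, Ψ x * T x * Complex.exp (Complex.I * (τ * x)) * B x =
      ((∫ x in α..β, Ψ x * A₁ x * B₁ x *
        Complex.exp (Complex.I * (((τ + σ * r + r' : ℝ) : ℂ) * x))) +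
      ∫ x in α..β, Ψ x * A₁ x * B₂ x *
        Complex.exp (Complex.I * (((τ + σ * r - r' : ℝ) : ℂ) * x))) +
      ((∫ x in α..β, Ψ x * A₂ x * B₁ x *
        Complex.exp (Complex.I * (((τ - σ * r + r' : ℝ) : ℂ) * x))) +
      ∫ x in α..β, Ψ x * A₂ x * B₂ x *
        Complex.exp (Complex.I * (((τ - σ * r - r' : ℝ) : ℂ) * x))) := by
    rw [← intervalIntegral.integral_add (hint hA₁ hB₁ _) (hint hA₁ hB₂ _),
      ← intervalIntegral.integral_add (hint hA₂ hB₁ _) (hint hA₂ hB₂ _),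
      ← intervalIntegral.integral_add ((hint hA₁ hB₁ _).add (hint hA₁ hB₂ _))
        ((hint hA₂ hB₁ _).add (hint hA₂ hB₂ _))]
    refine intervalIntegral.integral_congr fun x hx => ?_
    rw [uIcc_of_le hαβ] at hx
    have e : ∀ u v w : ℂ, Complex.exp (Complex.I * u) * Complex.exp (Complex.I * v) *
        Complex.exp (Complex.I * w) = Complex.exp (Complex.I * (u + v + w)) := fun u v w => by
      rw [← Complex.exp_add, ← Complex.exp_add]; congr 1; ring
    rw [hTe x hx, hBe x hx]
    have e1 := e (τ * x) (σ * r * x) ((1 : ℝ) * r' * x)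
    have e2 := e (τ * x) (σ * r * x) (-((1 : ℝ) * r') * x)
    have e3 := e (τ * x) (-(σ * r) * x) ((1 : ℝ) * r' * x)
    have e4 := e (τ * x) (-(σ * r) * x) (-((1 : ℝ) * r') * x)
    rw [show (τ * x + σ * r * x + (1 : ℝ) * r' * x : ℂ) = ((τ + σ * r + r' : ℝ) : ℂ) * x by
      push_cast; ring] at e1
    rw [show (τ * x + σ * r * x + -((1 : ℝ) * r') * x : ℂ) = ((τ + σ * r - r' : ℝ) : ℂ) * x by
      push_cast; ring] at e2
    rw [show (τ * x + -(σ * r) * x + (1 : ℝ) * r' * x : ℂ) = ((τ - σ * r + r' : ℝ) : ℂ) * x by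
      push_cast; ring] at e3
    rw [show (τ * x + -(σ * r) * x + -((1 : ℝ) * r') * x : ℂ) = ((τ - σ * r - r' : ℝ) : ℂ) * x by
      push_cast; ring] at e4
    rw [← e1, ← e2, ← e3, ← e4]
    ring
  rw [heq]
  refine (norm_add_le_of_le (norm_add_le_of_le (hbd hA₁ hB₁ _) (hbd hA₁ hB₂ _))
    (norm_add_le_of_le (hbd hA₂ hB₁ _) (hbd hA₂ hB₂ _))).trans (le_of_eq ?_)
  ring

end RadialWave

end

/-! ### Radial wave packets solving the wave equation -/

noncomputable section

namespace RadialWave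

variable {α β : ℝ}

/-! ### Superpositions of plane waves -/

/-- Shifting θ by the argument of y turns y₀cos θ + y₁sin θ into |y| cos θ; by periodicity the shift
does not change the integral over a full period. -/
theorem integral_cos_inner (y : Plane) (w : ℝ) :
    ∫ θ in (-Real.pi)..Real.pi, Real.cos (w * (y 0 * Real.cos θ + y 1 * Real.sin θ)) =
      2 * Real.pi * besselJ (‖y‖ * w) := by
  set z : ℂ := ⟨y 0, y 1⟩ with hz
  have hn : ‖y‖ = ‖z‖ := by
    rw [EuclideanSpace.norm_eq, Complex.norm_def, Complex.normSq_mk]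
    simp [Fin.sum_univ_two, sq]
  have h0 : y 0 = ‖y‖ * Real.cos z.arg := by rw [hn, Complex.norm_mul_cos_arg]
  have h1 : y 1 = ‖y‖ * Real.sin z.arg := by rw [hn, Complex.norm_mul_sin_arg]
  have e : ∀ θ, Real.cos (w * (y 0 * Real.cos θ + y 1 * Real.sin θ)) =
      (fun θ => Real.cos (‖y‖ * w * Real.cos θ)) (θ - z.arg) := fun θ => by
    beta_reduce
    rw [Real.cos_sub, h0, h1]
    congr 1
    rw [← h0, ← h1]
    ring_nf
    nth_rewrite 1 [h0]
    nth_rewrite 1 [h1]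
    ring
  have hper : Function.Periodic (fun θ => Real.cos (‖y‖ * w * Real.cos θ)) (2 * Real.pi) :=
    fun θ => by simp [Real.cos_periodic θ]
  simp_rw [e]
  rw [intervalIntegral.integral_comp_sub_right (fun θ => Real.cos (‖y‖ * w * Real.cos θ))]
  have h := hper.intervalIntegral_add_eq (-Real.pi - z.arg) (-Real.pi)
  rw [show -Real.pi - z.arg + 2 * Real.pi = Real.pi - z.arg by ring,
    show -Real.pi + 2 * Real.pi = Real.pi by ring] at h
  rw [h, besselJ, ← mul_assoc, mul_inv_cancel₀ (by positivity), one_mul]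

theorem besselJ_norm_mul_eq (y : Plane) (w : ℝ) :
    besselJ (‖y‖ * w) = (2 * Real.pi)⁻¹ *
      ∫ θ in (-Real.pi)..Real.pi, Real.cos (w * (y 0 * Real.cos θ + y 1 * Real.sin θ)) := by
  rw [integral_cos_inner, ← mul_assoc, inv_mul_cancel₀ (by positivity), one_mul]

theorem contDiff_plane_coord (i : Fin 2) : ContDiff ℝ ∞ (fun y : Plane => y i) :=
  (EuclideanSpace.proj (𝕜 := ℝ) i).contDiff

/-- The norm is not smooth at the origin, but the average of plane waves involves y only through its
coordinates. This gives smoothness across y = 0. -/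
theorem contDiff_besselJ_norm_mul :
    ContDiff ℝ ∞ (fun p : Plane × ℝ => besselJ (‖p.1‖ * p.2)) := by
  simp_rw [besselJ_norm_mul_eq]
  refine contDiff_const.mul (contDiff_intervalIntegral
    (f := fun q : (Plane × ℝ) × ℝ =>
      Real.cos (q.1.2 * (q.1.1 0 * Real.cos q.2 + q.1.1 1 * Real.sin q.2))) ?_ _ _)
  have h0 : ContDiff ℝ ∞ (fun q : (Plane × ℝ) × ℝ => q.1.1 0) :=
    (contDiff_plane_coord 0).comp (contDiff_fst.comp contDiff_fst)
  have h1 : ContDiff ℝ ∞ (fun q : (Plane × ℝ) × ℝ => q.1.1 1) :=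
    (contDiff_plane_coord 1).comp (contDiff_fst.comp contDiff_fst)
  exact ((contDiff_snd.comp contDiff_fst).mul ((h0.mul (Real.contDiff_cos.comp contDiff_snd)).add
    (h1.mul (Real.contDiff_sin.comp contDiff_snd)))).cos

/-! ### The Laplacian on the plane -/

theorem two_le_infty : (2 : WithTop ℕ∞) ≤ ((⊤ : ℕ∞) : WithTop ℕ∞) :=
  WithTop.coe_le_coe.2 (le_top : (2 : ℕ∞) ≤ ⊤)

theorem laplacian_eq_fderiv (f : Plane → ℝ) (y : Plane) :
    Laplacian.laplacian f y = ∑ i : Fin 2,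
      fderiv ℝ (fderiv ℝ f) y (EuclideanSpace.single i 1) (EuclideanSpace.single i 1) := by
  rw [InnerProductSpace.laplacian_eq_iteratedFDeriv_orthonormalBasis f
    (EuclideanSpace.basisFun (Fin 2) ℝ)]
  simp [iteratedFDeriv_two_apply]

theorem laplacian_mul {f g : Plane → ℝ} (hf : ContDiff ℝ 2 f) (hg : ContDiff ℝ 2 g) (y : Plane) :
    Laplacian.laplacian (fun y => f y * g y) y = f y * Laplacian.laplacian g y +
      g y * Laplacian.laplacian f y + 2 * ∑ i : Fin 2,
        fderiv ℝ f y (EuclideanSpace.single i 1) * fderiv ℝ g y (EuclideanSpace.single i 1) := by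
  have hfd : ∀ y, HasFDerivAt f (fderiv ℝ f y) y := fun y =>
    (hf.differentiable two_ne_zero y).hasFDerivAt
  have hgd : ∀ y, HasFDerivAt g (fderiv ℝ g y) y := fun y =>
    (hg.differentiable two_ne_zero y).hasFDerivAt
  have hf2 : ∀ y, HasFDerivAt (fderiv ℝ f) (fderiv ℝ (fderiv ℝ f) y) y := fun y =>
    ((hf.fderiv_right (m := 1) (by norm_num)).differentiable one_ne_zero y).hasFDerivAt
  have hg2 : ∀ y, HasFDerivAt (fderiv ℝ g) (fderiv ℝ (fderiv ℝ g) y) y := fun y =>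
    ((hg.fderiv_right (m := 1) (by norm_num)).differentiable one_ne_zero y).hasFDerivAt
  have h1 : fderiv ℝ (fun y => f y * g y) = fun y => f y • fderiv ℝ g y + g y • fderiv ℝ f y :=
    funext fun y => ((hfd y).fun_mul (hgd y)).fderiv
  have h2 : fderiv ℝ (fun y => f y • fderiv ℝ g y + g y • fderiv ℝ f y) y = _ :=
    (((hfd y).fun_smul (hg2 y)).fun_add ((hgd y).fun_smul (hf2 y))).fderiv
  simp only [laplacian_eq_fderiv, h1, h2, Fin.sum_univ_two]
  simp
  ring

theorem laplacian_intervalIntegral {f : Plane × ℝ → ℝ} (hf : ContDiff ℝ ∞ f) (a b : ℝ)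
    (y : Plane) :
    Laplacian.laplacian (fun y => ∫ w in a..b, f (y, w)) y =
      ∫ w in a..b, Laplacian.laplacian (fun y => f (y, w)) y := by
  set f' : Plane × ℝ → Plane →L[ℝ] ℝ := fun p =>
    (fderiv ℝ f p).comp (ContinuousLinearMap.inl ℝ Plane ℝ) with hf'
  have hfc : ContDiff ℝ ∞ f' := (hf.fderiv_right (m := ∞) (by simp)).clm_comp contDiff_const
  have h1 : fderiv ℝ (fun y => ∫ w in a..b, f (y, w)) = fun y => ∫ w in a..b, f' (y, w) :=
    funext fun y => (hasFDerivAt_intervalIntegral_of_contDiff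
      (hf.of_le (by exact_mod_cast le_top)) a b y).fderiv
  have h2 := (hasFDerivAt_intervalIntegral_of_contDiff
      (hfc.of_le (by exact_mod_cast le_top)) a b y).fderiv
  have h3 : ∀ w, fderiv ℝ (fun y => f (y, w)) = fun y => f' (y, w) := fun w => funext fun y =>
    (((hf.differentiable (by simp)) (y, w)).hasFDerivAt.comp y (hasFDerivAt_prodMk_left y w)).fderiv
  have h4 : ∀ w, fderiv ℝ (fun y => f' (y, w)) y =
      (fderiv ℝ f' (y, w)).comp (ContinuousLinearMap.inl ℝ Plane ℝ) := fun w => by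
    have h : HasFDerivAt f' (fderiv ℝ f' (y, w)) (y, w) :=
      (hfc.differentiable (by simp) _).hasFDerivAt
    exact (HasFDerivAt.comp (f := fun e : Plane => (e, w)) y h (hasFDerivAt_prodMk_left y w)).fderiv
  have hc : Continuous fun w : ℝ =>
      (fderiv ℝ f' (y, w)).comp (ContinuousLinearMap.inl ℝ Plane ℝ) :=
    ((hfc.continuous_fderiv (by simp)).comp
      (by fun_prop : Continuous fun w : ℝ => (y, w))).clm_comp continuous_const
  simp only [laplacian_eq_fderiv, h1, h2, h3, h4, Fin.sum_univ_two]
  have hv : ∀ v : Plane, Continuous fun w : ℝ =>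
      ((fderiv ℝ f' (y, w)).comp (ContinuousLinearMap.inl ℝ Plane ℝ)) v := fun v =>
    hc.clm_apply continuous_const
  have hi : ∀ v : Plane, (∫ w in a..b,
      (fderiv ℝ f' (y, w)).comp (ContinuousLinearMap.inl ℝ Plane ℝ)) v v =
      ∫ w in a..b, ((fderiv ℝ f' (y, w)).comp (ContinuousLinearMap.inl ℝ Plane ℝ)) v v := by
    intro v
    rw [ContinuousLinearMap.intervalIntegral_apply (hc.intervalIntegrable _ _) v,
      ContinuousLinearMap.intervalIntegral_apply ((hv v).intervalIntegrable _ _) v]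
  rw [intervalIntegral.integral_add, hi, hi]
  · exact ((hv _).clm_apply continuous_const).intervalIntegrable _ _
  · exact ((hv _).clm_apply continuous_const).intervalIntegrable _ _

theorem laplacian_planeWave (w θ : ℝ) (y : Plane) :
    Laplacian.laplacian
      (fun y : Plane => Real.cos (w * (y 0 * Real.cos θ + y 1 * Real.sin θ))) y =
      -w ^ 2 * Real.cos (w * (y 0 * Real.cos θ + y 1 * Real.sin θ)) := by
  set L : Plane →L[ℝ] ℝ := w • (Real.cos θ • EuclideanSpace.proj 0 +
    Real.sin θ • EuclideanSpace.proj 1) with hL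
  have hLy : ∀ y : Plane, w * (y 0 * Real.cos θ + y 1 * Real.sin θ) = L y := fun y => by
    simp [hL]; ring
  simp_rw [hLy]
  have h1 : fderiv ℝ (fun y : Plane => Real.cos (L y)) = fun y => -Real.sin (L y) • L :=
    funext fun y => (L.hasFDerivAt.cos).fderiv
  have h2 : fderiv ℝ (fun y : Plane => -Real.sin (L y) • L) y =
      (-(Real.cos (L y) • L)).smulRight L :=
    ((L.hasFDerivAt (x := y)).sin.neg.smul_const L).fderiv
  simp only [laplacian_eq_fderiv, h1, h2, Fin.sum_univ_two]
  generalize Real.cos (L y) = C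
  simp [hL]
  linear_combination (-(w ^ 2 * C)) * Real.sin_sq_add_cos_sq θ

/-- Each plane wave of frequency w is an eigenfunction of the Laplacian with eigenvalue -w², and so
is their average; the origin needs no separate treatment. -/
theorem laplacian_besselJ_norm_mul (w : ℝ) (y : Plane) :
    Laplacian.laplacian (fun y : Plane => besselJ (‖y‖ * w)) y = -w ^ 2 * besselJ (‖y‖ * w) := by
  have h1 : ContDiff ℝ ∞ (fun q : Plane × ℝ =>
      Real.cos (w * (q.1 0 * Real.cos q.2 + q.1 1 * Real.sin q.2))) := by
    have h0 : ContDiff ℝ ∞ (fun q : Plane × ℝ => q.1 0) :=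
      (contDiff_plane_coord 0).comp contDiff_fst
    have h1 : ContDiff ℝ ∞ (fun q : Plane × ℝ => q.1 1) :=
      (contDiff_plane_coord 1).comp contDiff_fst
    exact (contDiff_const.mul ((h0.mul (Real.contDiff_cos.comp contDiff_snd)).add
      (h1.mul (Real.contDiff_sin.comp contDiff_snd)))).cos
  simp_rw [besselJ_norm_mul_eq]
  have h2 : (fun y : Plane => (2 * Real.pi)⁻¹ * ∫ θ in (-Real.pi)..Real.pi,
      Real.cos (w * (y 0 * Real.cos θ + y 1 * Real.sin θ))) = (2 * Real.pi)⁻¹ •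
      fun y : Plane => ∫ θ in (-Real.pi)..Real.pi,
      Real.cos (w * (y 0 * Real.cos θ + y 1 * Real.sin θ)) := rfl
  rw [h2, InnerProductSpace.laplacian_smul _
    ((contDiff_intervalIntegral h1 _ _).contDiffAt.of_le two_le_infty),
    laplacian_intervalIntegral h1]
  simp_rw [laplacian_planeWave]
  rw [intervalIntegral.integral_const_mul, smul_eq_mul]
  ring

/-! ### Radial wave packets -/

/-- A smooth amplitude, compactly supported in `(α, β)`. -/
def IsAmplitude (α β : ℝ) (c : ℝ → ℂ) : Prop := ContDiff ℝ ∞ c ∧ tsupport c ⊆ Ioo α β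

/-- The radial wave packet `∫ Re (c(ω) e^{iτω}) J₀(|y|ω) dω`. -/
def packet (α β : ℝ) (c : ℝ → ℂ) (τ : ℝ) (y : Plane) : ℝ :=
  ∫ w in α..β, (c w * Complex.exp (Complex.I * (τ * w))).re * besselJ (‖y‖ * w)

/-- The companion `∫ Re (c(ω) e^{iτω}) J₀'(ρω) dω`. -/
def packet' (α β : ℝ) (c : ℝ → ℂ) (τ ρ : ℝ) : ℝ :=
  ∫ w in α..β, (c w * Complex.exp (Complex.I * (τ * w))).re * besselJ' (ρ * w)

theorem IsAmplitude.mul {c f : ℝ → ℂ} (hc : IsAmplitude α β c) (hf : ContDiff ℝ ∞ f) :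
    IsAmplitude α β (fun w => f w * c w) :=
  ⟨hf.mul hc.1, (tsupport_mul_subset_right).trans hc.2⟩

theorem contDiff_phase {c : ℝ → ℂ} (hc : ContDiff ℝ ∞ c) :
    ContDiff ℝ ∞ (fun p : ℝ × ℝ => (c p.2 * Complex.exp (Complex.I * (p.1 * p.2))).re) := by
  refine Complex.reCLM.contDiff.comp ((hc.comp contDiff_snd).mul (Complex.contDiff_exp.comp
    (contDiff_const.mul ((Complex.ofRealCLM.contDiff.comp contDiff_fst).mul
      (Complex.ofRealCLM.contDiff.comp contDiff_snd)))))

theorem hasDerivAt_phase (c : ℝ → ℂ) (τ w : ℝ) :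
    HasDerivAt (fun τ : ℝ => (c w * Complex.exp (Complex.I * (τ * w))).re)
      (Complex.I * w * c w * Complex.exp (Complex.I * (τ * w))).re τ := by
  have h : HasDerivAt (fun τ : ℝ => c w * Complex.exp (Complex.I * (τ * w)))
      (Complex.I * w * c w * Complex.exp (Complex.I * (τ * w))) τ := by
    refine ((((Complex.ofRealCLM.hasDerivAt (x := τ)).mul_const (w : ℂ)).const_mul
      Complex.I).cexp.const_mul (c w)).congr_deriv ?_
    simp; ring
  exact Complex.reCLM.hasFDerivAt.comp_hasDerivAt τ h

theorem contDiff_packet {c : ℝ → ℂ} (hc : ContDiff ℝ ∞ c) :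
    ContDiff ℝ ∞ (fun p : ℝ × Plane => packet α β c p.1 p.2) := by
  refine contDiff_intervalIntegral (f := fun q : (ℝ × Plane) × ℝ =>
    (c q.2 * Complex.exp (Complex.I * (q.1.1 * q.2))).re * besselJ (‖q.1.2‖ * q.2)) ?_ _ _
  have h1 : ContDiff ℝ ∞ (fun q : (ℝ × Plane) × ℝ => (q.1.1, q.2)) := by fun_prop
  have h2 : ContDiff ℝ ∞ (fun q : (ℝ × Plane) × ℝ => (q.1.2, q.2)) := by fun_prop
  have h3 := (contDiff_phase hc).comp h1
  have h4 := contDiff_besselJ_norm_mul.comp h2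
  exact h3.mul h4

theorem hasDerivAt_packet {c : ℝ → ℂ} (hc : ContDiff ℝ ∞ c) (τ : ℝ) (y : Plane) :
    HasDerivAt (fun τ => packet α β c τ y) (packet α β (fun w => Complex.I * w * c w) τ y) τ := by
  refine hasDerivAt_intervalIntegral_of_contDiff (f := fun p : ℝ × ℝ =>
    (c p.2 * Complex.exp (Complex.I * (p.1 * p.2))).re * besselJ (‖y‖ * p.2)) ?_
    (f' := fun τ w => (Complex.I * w * c w * Complex.exp (Complex.I * (τ * w))).re *
      besselJ (‖y‖ * w)) ?_ _ _ _
  · exact ((contDiff_phase hc).mul (contDiff_besselJ.comp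
      (contDiff_const.mul contDiff_snd))).of_le (by exact_mod_cast le_top)
  · exact fun τ w => (hasDerivAt_phase c τ w).mul_const (besselJ (‖y‖ * w))

theorem contDiff_I_mul {c : ℝ → ℂ} (hc : ContDiff ℝ ∞ c) :
    ContDiff ℝ ∞ (fun w : ℝ => Complex.I * w * c w) :=
  (contDiff_const.mul Complex.ofRealCLM.contDiff).mul hc

/-- Multiplying the amplitude by (iω)² represents the Laplacian here and, by `hasDerivAt_packet`
applied twice, also the second time derivative. So packets solve the wave equation. -/
theorem laplacian_packet {c : ℝ → ℂ} (hc : ContDiff ℝ ∞ c) (τ : ℝ) (y : Plane) :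
    Laplacian.laplacian (packet α β c τ) y =
      packet α β (fun w => Complex.I * w * (Complex.I * w * c w)) τ y := by
  have h : ContDiff ℝ ∞ (fun p : Plane × ℝ =>
      (c p.2 * Complex.exp (Complex.I * (τ * p.2))).re * besselJ (‖p.1‖ * p.2)) :=
    ((contDiff_phase hc).comp (contDiff_const.prodMk contDiff_snd)).mul contDiff_besselJ_norm_mul
  have e : packet α β c τ = fun y => ∫ w in α..β, (fun p : Plane × ℝ =>
      (c p.2 * Complex.exp (Complex.I * (τ * p.2))).re * besselJ (‖p.1‖ * p.2)) (y, w) := rfl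
  rw [e, laplacian_intervalIntegral h, packet]
  refine intervalIntegral.integral_congr fun w _ => ?_
  have e2 : (fun y : Plane => (c w * Complex.exp (Complex.I * (τ * w))).re * besselJ (‖y‖ * w)) =
    (c w * Complex.exp (Complex.I * (τ * w))).re • fun y : Plane => besselJ (‖y‖ * w) := rfl
  simp only [e2]
  rw [InnerProductSpace.laplacian_smul, laplacian_besselJ_norm_mul, smul_eq_mul]
  · have : Complex.I * w * (Complex.I * w * c w) * Complex.exp (Complex.I * (τ * w)) =
        ((-w ^ 2 : ℝ) : ℂ) * (c w * Complex.exp (Complex.I * (τ * w))) := by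
      push_cast
      linear_combination (w ^ 2 * c w * Complex.exp (Complex.I * (τ * w))) * Complex.I_sq
    rw [this, Complex.re_ofReal_mul]
    ring
  · exact (contDiff_besselJ_norm_mul.comp
      (contDiff_id.prodMk contDiff_const)).contDiffAt.of_le two_le_infty

theorem IsAmplitude.exists_c2Zero {c : ℝ → ℂ} (hc : IsAmplitude α β c) :
    ∃ C, 0 ≤ C ∧ C2Zero α β c C := by
  have h1 := (contDiff_infty_iff_deriv.1 hc.1).2
  have h2 := (contDiff_infty_iff_deriv.1 h1).2
  obtain ⟨C0, hC0⟩ := (isCompact_Icc (a := α) (b := β)).exists_bound_of_continuousOn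
    hc.1.continuous.continuousOn
  obtain ⟨C1, hC1⟩ := (isCompact_Icc (a := α) (b := β)).exists_bound_of_continuousOn
    h1.continuous.continuousOn
  obtain ⟨C2, hC2⟩ := (isCompact_Icc (a := α) (b := β)).exists_bound_of_continuousOn
    h2.continuous.continuousOn
  have hα : α ∉ tsupport c := fun h => lt_irrefl _ (hc.2 h).1
  have hβ : β ∉ tsupport c := fun h => lt_irrefl _ (hc.2 h).2
  have hd : ∀ x, x ∉ tsupport c → deriv c x = 0 := fun x hx =>
    image_eq_zero_of_notMem_tsupport fun h => hx (tsupport_deriv_subset (𝕜 := ℝ) (f := c) h)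
  refine ⟨max 0 (max C0 (max C1 C2)), le_max_left _ _, ⟨deriv c, deriv (deriv c),
    fun x _ => (hc.1.differentiable (by simp) x).hasDerivAt,
    fun x _ => (h1.differentiable (by simp) x).hasDerivAt, h2.continuous.continuousOn,
    fun x hx => ⟨(hC0 x hx).trans ?_, (hC1 x hx).trans ?_, (hC2 x hx).trans ?_⟩⟩,
    image_eq_zero_of_notMem_tsupport hα, image_eq_zero_of_notMem_tsupport hβ, hd _ hα, hd _ hβ⟩
    <;> simp

/-- A trivial first factor at r = 0, which lets the four-phase estimate be applied to a single
Bessel factor. -/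
theorem hasAmp_one (σ : ℝ) : HasAmp α β (fun _ => 1) σ 0 1 1 :=
  ⟨fun _ => 1, fun _ => 0, ⟨fun _ => 0, fun _ => 0, fun x _ => hasDerivAt_const x 1,
    fun x _ => hasDerivAt_const x 0, continuousOn_const, fun x _ => by simp⟩,
    C2On.zero.mono zero_le_one, fun x _ => by simp⟩

/-- Peetre's inequality. -/
theorem decay_add_le (τ ρ : ℝ) : decay (τ + ρ) ≤ 2 * (1 + τ ^ 2) * decay ρ := by
  rw [decay, decay, ← div_eq_mul_inv, inv_eq_one_div, div_le_div_iff₀ (by positivity)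
    (by positivity)]
  nlinarith [sq_nonneg (2 * τ + ρ), sq_nonneg (τ * (τ + ρ)), sq_nonneg (τ + ρ), sq_nonneg τ]

theorem abs_integral_re_le (hαβ : α ≤ β) {f : ℝ → ℂ} (hf : IntervalIntegrable f volume α β) :
    |∫ w in α..β, (f w).re| ≤ ‖∫ w in α..β, f w‖ := by
  have : ∫ w in α..β, (f w).re = (∫ w in α..β, f w).re := by
    rw [intervalIntegral.integral_of_le hαβ, intervalIntegral.integral_of_le hαβ]
    exact integral_re hf.1
  rw [this]
  exact Complex.abs_re_le_norm _

/-- A qualitative bound: the growth in τ is harmless, because the estimate only serves to justify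
integrability and limits on compact time sets. The quantitative bound is
`AmpFamily.exists_kern_bound`. -/
theorem exists_packet_decay (hα : 0 < α) (hαβ : α ≤ β) {c : ℝ → ℂ} (hc : IsAmplitude α β c) :
    ∃ C, 0 ≤ C ∧ ∀ τ, (∀ y, |packet α β c τ y| ≤ C * (1 + τ ^ 2) * decay ‖y‖) ∧
      ∀ ρ, 0 ≤ ρ → |packet' α β c τ ρ| ≤ C * (1 + τ ^ 2) * decay ρ := by
  obtain ⟨c0, hc0, hz⟩ := hc.exists_c2Zero
  obtain ⟨d, hd, h1⟩ := exists_hasAmp_besselJ (β := β) hα (σ := 1) (by norm_num)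
  obtain ⟨d', hd', h2⟩ := exists_hasAmp_besselJ' (β := β) hα (σ := 1) (by norm_num)
  have key : ∀ (B : ℝ → ℝ) (e : ℝ), Continuous B → 0 ≤ e → (∀ r, 0 ≤ r → HasAmp α β
      (fun x => B (r * x)) 1 r (e * (1 + r) ^ (-(1 / 2) : ℝ)) (e * (1 + r) ^ (-(1 / 2) : ℝ))) →
      ∀ τ ρ : ℝ, 0 ≤ ρ → |∫ w in α..β, (c w * Complex.exp (Complex.I * (τ * w))).re * B (ρ * w)| ≤
        (32 * (β - α) * c0 * e * 8) * (1 + τ ^ 2) * decay ρ := by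
    intro B e hB he h τ ρ hρ
    have h3 := norm_integral_hasAmp_le hαβ hz (hasAmp_one 1) (h ρ hρ) τ
    have h4 : ∀ w, (c w * Complex.exp (Complex.I * (τ * w))).re * B (ρ * w) =
        (c w * 1 * Complex.exp (Complex.I * (τ * w)) * B (ρ * w)).re := fun w => by
      rw [mul_one, mul_comm _ ((B (ρ * w) : ℝ) : ℂ), Complex.re_ofReal_mul, mul_comm]
    simp_rw [h4]
    have hcont := hc.1.continuous
    refine (abs_integral_re_le hαβ ((by fun_prop : Continuous _).intervalIntegrable _ _)).trans
      (h3.trans ?_)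
    have hp : (1 + ρ) ^ (-(1 / 2) : ℝ) ≤ 1 :=
      Real.rpow_le_one_of_one_le_of_nonpos (by linarith) (by norm_num)
    have e1 := decay_add_le τ ρ
    have e2 := decay_add_le τ (-ρ)
    rw [decay_neg, ← sub_eq_add_neg] at e2
    simp only [mul_zero, add_zero, sub_zero, one_mul]
    have hβα : 0 ≤ β - α := by linarith
    -- The factor 8 arises from four decay factors, each at most 2(1+τ²) times the decay at ρ by
    -- Peetre's inequality.
    calc 32 * (β - α) * c0 * (e * (1 + ρ) ^ (-(1 / 2) : ℝ)) *
          (decay (τ + ρ) + decay (τ - ρ) + (decay (τ + ρ) + decay (τ - ρ)))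
        ≤ 32 * (β - α) * c0 * (e * 1) * (8 * (1 + τ ^ 2) * decay ρ) := by
          refine mul_le_mul (by gcongr) (by linarith) ?_ (by positivity)
          have := decay_pos (τ + ρ)
          have := decay_pos (τ - ρ)
          positivity
      _ = _ := by ring
  have hβα : 0 ≤ β - α := sub_nonneg.2 hαβ
  refine ⟨32 * (β - α) * c0 * d * 8 + 32 * (β - α) * c0 * d' * 8, by positivity,
    fun τ => ⟨fun y => (key besselJ d contDiff_besselJ.continuous hd h1 τ ‖y‖
      (norm_nonneg y)).trans ?_, fun ρ hρ => (key besselJ' d' contDiff_besselJ'.continuous hd' h2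
      τ ρ hρ).trans ?_⟩⟩
  · have := decay_pos ‖y‖
    gcongr
    exact le_add_of_nonneg_right (by positivity)
  · have := decay_pos ρ
    gcongr
    exact le_add_of_nonneg_left (by positivity)

/-- The radial profile of a packet. -/
theorem hasDerivAt_packet_radial {c : ℝ → ℂ} (hc : ContDiff ℝ ∞ c) (τ ρ : ℝ) :
    HasDerivAt (fun ρ => ∫ w in α..β, (c w * Complex.exp (Complex.I * (τ * w))).re *
      besselJ (ρ * w)) (packet' α β (fun w => w * c w) τ ρ) ρ := by
  refine (hasDerivAt_intervalIntegral_of_contDiff (f := fun p : ℝ × ℝ =>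
    (c p.2 * Complex.exp (Complex.I * (τ * p.2))).re * besselJ (p.1 * p.2)) ?_
    (f' := fun ρ w => (c w * Complex.exp (Complex.I * (τ * w))).re *
      (besselJ' (ρ * w) * w)) ?_ _ _ _).congr_deriv ?_
  · exact (((contDiff_phase hc).comp (contDiff_const.prodMk contDiff_snd)).mul
      (contDiff_besselJ.comp (contDiff_fst.mul contDiff_snd))).of_le (by exact_mod_cast le_top)
  · intro ρ w
    have := (hasDerivAt_besselJ (ρ * w)).comp ρ ((hasDerivAt_id ρ).mul_const w)
    have h := (this.congr_deriv (by simp : _ = besselJ' (ρ * w) * w)).const_mul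
      (c w * Complex.exp (Complex.I * (τ * w))).re
    exact h
  · refine intervalIntegral.integral_congr fun w _ => ?_
    beta_reduce
    rw [mul_assoc (w : ℂ), Complex.re_ofReal_mul]
    ring

/-- Away from the origin the gradient is the radial derivative times the gradient of |y|, and the
norm is 1-Lipschitz. -/
theorem norm_fderiv_packet_le {c : ℝ → ℂ} (hc : ContDiff ℝ ∞ c) (τ : ℝ) {y : Plane} (hy : y ≠ 0) :
    ‖fderiv ℝ (packet α β c τ) y‖ ≤ |packet' α β (fun w => w * c w) τ ‖y‖| := by
  have h := (hasDerivAt_packet_radial (α := α) (β := β) hc τ ‖y‖).comp_hasFDerivAt y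
    ((contDiffAt_norm ℝ hy (n := 1)).differentiableAt one_ne_zero).hasFDerivAt
  have h' : HasFDerivAt (packet α β c τ) _ y := h
  rw [h'.fderiv, norm_smul, Real.norm_eq_abs]
  refine mul_le_of_le_one_right (abs_nonneg _) ?_
  exact norm_fderiv_le_of_lipschitz ℝ (lipschitzWith_one_norm (E := Plane))

end RadialWave

end

/-! ### Pairing localized functions with packets: Duhamel's formula in weak form -/

noncomputable section

namespace RadialWave

variable {α β : ℝ}

/-! ### Pairings in `L²` of the plane -/

theorem lintegral_mul_le_eLpNorm {X E F : Type*} [MeasurableSpace X] {μ : Measure X}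
    [NormedAddCommGroup E] [NormedAddCommGroup F] {f : X → E} {g : X → F}
    (hf : AEStronglyMeasurable f μ) (hg : AEStronglyMeasurable g μ) :
    ∫⁻ x, ‖f x‖ₑ * ‖g x‖ₑ ∂μ ≤ eLpNorm f 2 μ * eLpNorm g 2 μ := by
  have h := ENNReal.lintegral_mul_le_Lp_mul_Lq μ Real.HolderConjugate.two_two hf.enorm hg.enorm
  rw [eLpNorm_eq_lintegral_rpow_enorm_toReal two_ne_zero ENNReal.ofNat_ne_top,
    eLpNorm_eq_lintegral_rpow_enorm_toReal two_ne_zero ENNReal.ofNat_ne_top]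
  simpa using h

theorem continuous_decay : Continuous decay := by
  unfold decay
  exact (by fun_prop : Continuous fun s : ℝ => 1 + s ^ 2).inv₀ fun s => by positivity

theorem memLp_decay_norm : MemLp (fun y : Plane => decay ‖y‖) 2 volume := by
  have hm : AEStronglyMeasurable (fun y : Plane => decay ‖y‖) volume :=
    (continuous_decay.comp continuous_norm).aestronglyMeasurable
  refine (memLp_two_iff_integrable_sq hm).2 ?_
  have h := integrable_rpow_neg_one_add_norm_sq (E := Plane) (μ := volume) (r := 4)
    (by simp; norm_num)
  refine h.congr (Eventually.of_forall fun y => ?_)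
  beta_reduce
  rw [decay, show (-4 / 2 : ℝ) = -(2 : ℕ) by norm_num, Real.rpow_neg (by positivity),
    Real.rpow_natCast, inv_pow]

/-- A function decaying like `decay ‖y‖` times an `L²` function is integrable. -/
theorem MemLp.integrable_smul_of_decay {h : Plane → ℝ} {f : Plane → ℂ}
    (hf : MemLp f 2 volume) (hh : AEStronglyMeasurable h volume) {C : ℝ}
    (hb : ∀ y, |h y| ≤ C * decay ‖y‖) : Integrable (fun y => h y • f y) := by
  have h2 : MemLp h 2 volume := (memLp_decay_norm.const_mul C).mono' hh
    (Eventually.of_forall hb)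
  exact memLp_one_iff_integrable.1 (hf.smul h2)

/-- By Tonelli one integrates in y first and applies Cauchy–Schwarz there; the spatial decay of h is
square integrable on the plane, so f is only asked to lie in L¹_tL²_x over S. -/
theorem integrable_prod_of_decay {S : Set ℝ} (hS : MeasurableSet S) {h : ℝ × Plane → ℝ}
    {f : ℝ → Plane → ℂ} (hh : AEStronglyMeasurable h volume)
    (hf : AEStronglyMeasurable (fun z : ℝ × Plane => f z.1 z.2) (volume.restrict (S ×ˢ univ)))
    {C : ℝ} (hb : ∀ᵐ z : ℝ × Plane, |h z| ≤ C * decay ‖z.2‖) (h0 : ∀ z, z.1 ∉ S → h z = 0)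
    (hfin : ∫⁻ s in S, eLpNorm (f s) 2 volume < ⊤) :
    Integrable (fun z : ℝ × Plane => h z • f z.1 z.2) := by
  have hSu : MeasurableSet (S ×ˢ (univ : Set Plane)) := hS.prod MeasurableSet.univ
  have hsupp : (fun z : ℝ × Plane => h z • f z.1 z.2) =
      (S ×ˢ (univ : Set Plane)).indicator fun z => h z • f z.1 z.2 := by
    ext z
    by_cases hz : z.1 ∈ S
    · rw [indicator_of_mem (by simp [hz])]
    · rw [indicator_of_notMem (by simp [hz]), h0 z hz, zero_smul]
  rw [hsupp, integrable_indicator_iff hSu]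
  have hm : AEStronglyMeasurable (fun z : ℝ × Plane => h z • f z.1 z.2)
      (volume.restrict (S ×ˢ univ)) := hh.restrict.smul hf
  refine ⟨hm, ?_⟩
  have hr : (volume.restrict (S ×ˢ (univ : Set Plane)) : Measure (ℝ × Plane)) =
      (volume.restrict S).prod volume := by
    rw [Measure.volume_eq_prod, ← Measure.prod_restrict, Measure.restrict_univ]
  have hb' : ∀ᵐ z ∂(volume.restrict S).prod (volume : Measure Plane),
      |h z| ≤ C * decay ‖z.2‖ := by rw [← hr]; exact ae_restrict_of_ae hb
  have hf' : ∀ᵐ s ∂volume.restrict S, AEStronglyMeasurable (f s) volume := by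
    rw [hr] at hf; exact hf.prodMk_left
  rw [hasFiniteIntegral_iff_enorm, hr]
  have hm' := hm
  rw [hr] at hm'
  rw [lintegral_prod _ hm'.enorm]
  have hd : AEStronglyMeasurable (fun y : Plane => C * decay ‖y‖) volume :=
    ((continuous_decay.comp continuous_norm).const_mul C).aestronglyMeasurable
  calc ∫⁻ s in S, ∫⁻ y, ‖h (s, y) • f s y‖ₑ
      ≤ ∫⁻ s in S, eLpNorm (fun y : Plane => C * decay ‖y‖) 2 volume *
          eLpNorm (f s) 2 volume := by
        refine lintegral_mono_ae ?_
        filter_upwards [Measure.ae_ae_of_ae_prod hb', hf'] with s hs hs'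
        refine (lintegral_mono_ae ?_).trans (lintegral_mul_le_eLpNorm hd hs')
        filter_upwards [hs] with y hy
        rw [enorm_smul]
        gcongr
        rw [enorm_le_iff_norm_le, Real.norm_eq_abs, Real.norm_eq_abs]
        exact hy.trans (le_abs_self _)
    _ < ⊤ := by
        rw [lintegral_const_mul' _ _ (memLp_decay_norm.const_mul C).eLpNorm_ne_top]
        exact ENNReal.mul_lt_top (memLp_decay_norm.const_mul C).eLpNorm_lt_top hfin

/-- A continuous function on `I × ℝ²` which is continuous from `I` to `L²`. -/
structure L2ContinuousOn (I : Set ℝ) (f : ℝ → Plane → ℂ) : Prop where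
  continuousOn : ContinuousOn (fun z : ℝ × Plane => f z.1 z.2) (I ×ˢ univ)
  memLp : ∀ t ∈ I, MemLp (f t) 2 volume
  tendsto : ∀ t ∈ I, Tendsto (fun s => eLpNorm (f s - f t) 2 volume) (𝓝[I] t) (𝓝 0)

theorem L2ContinuousOn.exists_bound {I S : Set ℝ} {f : ℝ → Plane → ℂ} (hf : L2ContinuousOn I f)
    (hS : IsCompact S) (hSI : S ⊆ I) : ∃ B : ℝ≥0∞, B < ⊤ ∧ ∀ s ∈ S, eLpNorm (f s) 2 volume ≤ B := by
  have h := hS.induction_on (p := fun U => ∃ B : ℝ≥0∞, B < ⊤ ∧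
    ∀ s ∈ U ∩ S, eLpNorm (f s) 2 volume ≤ B) ⟨0, by simp, by simp⟩
    (fun U V hUV ⟨B, hB, h⟩ => ⟨B, hB, fun s hs => h s ⟨hUV hs.1, hs.2⟩⟩)
    (fun U V ⟨B, hB, h⟩ ⟨B', hB', h'⟩ => ⟨max B B', max_lt hB hB', fun s hs => hs.1.elim
      (fun k => (h s ⟨k, hs.2⟩).trans (le_max_left _ _))
      (fun k => (h' s ⟨k, hs.2⟩).trans (le_max_right _ _))⟩) ?_
  · obtain ⟨B, hB, h⟩ := h
    exact ⟨B, hB, fun s hs => h s ⟨hs, hs⟩⟩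
  · intro t ht
    have h1 := (hf.tendsto t (hSI ht)).eventually (eventually_le_nhds one_pos)
    refine ⟨_, nhdsWithin_mono t hSI h1, 1 + eLpNorm (f t) 2 volume,
      ENNReal.add_lt_top.2 ⟨by simp, (hf.memLp t (hSI ht)).eLpNorm_lt_top⟩, fun s hs => ?_⟩
    have h2 : f s = (f s - f t) + f t := by simp
    rw [h2]
    refine (eLpNorm_add_le ((hf.memLp s (hSI hs.2)).sub (hf.memLp t (hSI ht))).1
      (hf.memLp t (hSI ht)).1 (by norm_num)).trans ?_
    have := hs.1
    change _ ≤ (1 : ℝ≥0∞) at this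
    gcongr

theorem L2ContinuousOn.lintegral_lt_top {I S : Set ℝ} {f : ℝ → Plane → ℂ}
    (hf : L2ContinuousOn I f) (hS : IsCompact S) (hSI : S ⊆ I) :
    ∫⁻ s in S, eLpNorm (f s) 2 volume < ⊤ := by
  obtain ⟨B, hB, h⟩ := hf.exists_bound hS hSI
  calc ∫⁻ s in S, eLpNorm (f s) 2 volume ≤ ∫⁻ s in S, B :=
        setLIntegral_mono' hS.measurableSet h
    _ < ⊤ := by
        rw [lintegral_const, Measure.restrict_apply_univ]
        exact ENNReal.mul_lt_top hB hS.measure_lt_top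

theorem L2ContinuousOn.integrable_prod {I S : Set ℝ} {f : ℝ → Plane → ℂ}
    (hf : L2ContinuousOn I f) (hS : IsCompact S) (hSI : S ⊆ I) {h : ℝ × Plane → ℝ}
    (hh : AEStronglyMeasurable h volume) {C : ℝ}
    (hb : ∀ᵐ z : ℝ × Plane, |h z| ≤ C * decay ‖z.2‖) (h0 : ∀ z, z.1 ∉ S → h z = 0) :
    Integrable (fun z : ℝ × Plane => h z • f z.1 z.2) :=
  integrable_prod_of_decay hS.measurableSet hh ((hf.continuousOn.mono
    (prod_mono_left hSI)).aestronglyMeasurable (hS.measurableSet.prod MeasurableSet.univ))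
    hb h0 (hf.lintegral_lt_top hS hSI)

/-- Continuity of `s ↦ ∫ h(s, y) f(s, y) dy`. -/
theorem L2ContinuousOn.continuousOn_integral {I : Set ℝ} {f : ℝ → Plane → ℂ}
    (hf : L2ContinuousOn I f) {h : ℝ × Plane → ℝ} (hh : Continuous h)
    (hb : ∀ t, ∃ C, ∀ᶠ s in 𝓝 t, ∀ y, |h (s, y)| ≤ C * decay ‖y‖) :
    ContinuousOn (fun s => ∫ y, h (s, y) • f s y) I := by
  intro t ht
  obtain ⟨C, hC⟩ := hb t
  have hCI : ∀ᶠ s in 𝓝[I] t, ∀ y, |h (s, y)| ≤ C * decay ‖y‖ := hC.filter_mono nhdsWithin_le_nhds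
  have hms : ∀ s, AEStronglyMeasurable (fun y => h (s, y)) volume := fun s =>
    (hh.comp (by fun_prop)).aestronglyMeasurable
  -- The increment splits in two. In h(s)(f(s) - f(t)) the L² continuity of f is used with
  -- Cauchy–Schwarz; in (h(s) - h(t))f(t) the function f(t) is frozen and dominated convergence
  -- applies.
  have h1 : Tendsto (fun s => ∫ y, h (s, y) • (f s y - f t y)) (𝓝[I] t) (𝓝 0) := by
    rw [tendsto_zero_iff_norm_tendsto_zero]
    have hT : Tendsto (fun s => (eLpNorm (fun y : Plane => C * decay ‖y‖) 2 volume *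
        eLpNorm (f s - f t) 2 volume).toReal) (𝓝[I] t) (𝓝 0) := by
      have := ENNReal.Tendsto.const_mul (hf.tendsto t ht)
        (Or.inr (memLp_decay_norm.const_mul C).eLpNorm_ne_top)
      rw [mul_zero] at this
      exact (ENNReal.tendsto_toReal ENNReal.zero_ne_top).comp this
    refine squeeze_zero' (Eventually.of_forall fun s => norm_nonneg _) ?_ hT
    filter_upwards [hCI, self_mem_nhdsWithin] with s hs hsI
    have hm := (hf.memLp s hsI).sub (hf.memLp t ht)
    rw [← toReal_enorm]
    refine ENNReal.toReal_mono (ENNReal.mul_ne_top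
      (memLp_decay_norm.const_mul C).eLpNorm_ne_top hm.eLpNorm_ne_top)
      ((enorm_integral_le_lintegral_enorm _).trans ((lintegral_mono fun y => ?_).trans
      (lintegral_mul_le_eLpNorm (memLp_decay_norm.const_mul C).1 hm.1)))
    rw [enorm_smul]
    refine mul_le_mul' ?_ le_rfl
    rw [enorm_le_iff_norm_le, Real.norm_eq_abs, Real.norm_eq_abs]
    exact (hs y).trans (le_abs_self _)
  have h2 : Tendsto (fun s => ∫ y, h (s, y) • f t y) (𝓝[I] t) (𝓝 (∫ y, h (t, y) • f t y)) := by
    refine tendsto_integral_filter_of_dominated_convergence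
      (fun y => ‖(C * decay ‖y‖) • f t y‖)
      (Eventually.of_forall fun s => (hms s).smul (hf.memLp t ht).1) ?_ ?_ ?_
    · filter_upwards [hCI] with s hs
      refine Eventually.of_forall fun y => ?_
      rw [norm_smul, norm_smul]
      gcongr
      rw [Real.norm_eq_abs, Real.norm_eq_abs]
      exact (hs y).trans (le_abs_self _)
    · exact (memLp_one_iff_integrable.1 ((hf.memLp t ht).smul (memLp_decay_norm.const_mul C))).norm
    · refine Eventually.of_forall fun y => ?_
      exact (((hh.comp (by fun_prop : Continuous fun s : ℝ => (s, y))).tendsto t).mono_left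
        nhdsWithin_le_nhds).smul_const _
  have h3 := h1.add h2
  rw [zero_add] at h3
  refine h3.congr' ?_
  filter_upwards [hCI, self_mem_nhdsWithin] with s hs hsI
  have i1 := MemLp.integrable_smul_of_decay ((hf.memLp s hsI).sub (hf.memLp t ht)) (hms s) hs
  have i2 := MemLp.integrable_smul_of_decay (hf.memLp t ht) (hms s) hs
  rw [← integral_add (by simpa using i1) i2]
  refine integral_congr_ae (Eventually.of_forall fun y => ?_)
  beta_reduce
  rw [← smul_add, sub_add_cancel]

/-! ### Regularity of localized functions -/

section Regularity

variable {I : Set ℝ} {φ : ℝ → Plane → ℂ} {a b : ℝ} {k : ℤ}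

theorem uniqueDiffOn_interval (hI : I.OrdConnected) (hne : (interior I).Nonempty) :
    UniqueDiffOn ℝ I := uniqueDiffOn_convex hI.convex hne

theorem hasDerivWithinAt_timeDeriv
    (hφ : ContDiffOn ℝ 1 (fun z : ℝ × Plane => φ z.1 z.2) (I ×ˢ univ)) {t : ℝ} (ht : t ∈ I)
    (x : Plane) : HasDerivWithinAt (fun s => φ s x)
      (fderivWithin ℝ (fun z : ℝ × Plane => φ z.1 z.2) (I ×ˢ univ) (t, x) (1, 0)) I t := by
  have h := (hφ.differentiableOn one_ne_zero (t, x) ⟨ht, mem_univ x⟩).hasFDerivWithinAt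
  have h2 : HasFDerivWithinAt (fun s : ℝ => (s, x)) (ContinuousLinearMap.inl ℝ ℝ Plane) I t :=
    (hasFDerivAt_prodMk_left t x).hasFDerivWithinAt
  have hm : MapsTo (fun s : ℝ => (s, x)) I (I ×ˢ univ) := fun s hs => ⟨hs, mem_univ x⟩
  have h3 := (HasFDerivWithinAt.comp (f := fun s : ℝ => (s, x)) t h h2 hm).hasDerivWithinAt
  exact h3.congr_deriv (by simp)

theorem timeDeriv_eq (hI : I.OrdConnected) (hne : (interior I).Nonempty)
    (hφ : ContDiffOn ℝ 1 (fun z : ℝ × Plane => φ z.1 z.2) (I ×ˢ univ)) {t : ℝ} (ht : t ∈ I)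
    (x : Plane) : timeDeriv I φ t x =
      fderivWithin ℝ (fun z : ℝ × Plane => φ z.1 z.2) (I ×ˢ univ) (t, x) (1, 0) :=
  (hasDerivWithinAt_timeDeriv hφ ht x).derivWithin (uniqueDiffOn_interval hI hne t ht)

theorem continuousOn_fderivWithin_apply (hI : I.OrdConnected) (hne : (interior I).Nonempty)
    (hφ : ContDiffOn ℝ 1 (fun z : ℝ × Plane => φ z.1 z.2) (I ×ˢ univ)) :
    ContinuousOn (fderivWithin ℝ (fun z : ℝ × Plane => φ z.1 z.2) (I ×ˢ univ)) (I ×ˢ univ) :=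
  hφ.continuousOn_fderivWithin ((uniqueDiffOn_interval hI hne).prod uniqueDiffOn_univ) le_rfl

theorem continuousOn_timeDeriv (hI : I.OrdConnected) (hne : (interior I).Nonempty)
    (hφ : ContDiffOn ℝ 1 (fun z : ℝ × Plane => φ z.1 z.2) (I ×ˢ univ)) :
    ContinuousOn (fun z : ℝ × Plane => timeDeriv I φ z.1 z.2) (I ×ˢ univ) :=
  ((continuousOn_fderivWithin_apply hI hne hφ).clm_apply continuousOn_const).congr
    fun z hz => timeDeriv_eq hI hne hφ hz.1 z.2

theorem hasFDerivAt_slice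
    (hφ : ContDiffOn ℝ 1 (fun z : ℝ × Plane => φ z.1 z.2) (I ×ˢ univ)) {t : ℝ} (ht : t ∈ I)
    (x : Plane) : HasFDerivAt (φ t)
      ((fderivWithin ℝ (fun z : ℝ × Plane => φ z.1 z.2) (I ×ˢ univ) (t, x)).comp
        (ContinuousLinearMap.inr ℝ ℝ Plane)) x := by
  have h := (hφ.differentiableOn one_ne_zero (t, x) ⟨ht, mem_univ x⟩).hasFDerivWithinAt
  have h2 : HasFDerivWithinAt (fun y : Plane => (t, y)) (ContinuousLinearMap.inr ℝ ℝ Plane)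
      univ x := (hasFDerivAt_prodMk_right t x).hasFDerivWithinAt
  have hm : MapsTo (fun y : Plane => (t, y)) univ (I ×ˢ univ) := fun y _ => ⟨ht, mem_univ y⟩
  exact (HasFDerivWithinAt.comp (f := fun y : Plane => (t, y)) x h h2 hm).hasFDerivAt univ_mem

theorem continuousOn_fderiv_slice (hI : I.OrdConnected) (hne : (interior I).Nonempty)
    (hφ : ContDiffOn ℝ 1 (fun z : ℝ × Plane => φ z.1 z.2) (I ×ˢ univ)) :
    ContinuousOn (fun z : ℝ × Plane => fderiv ℝ (φ z.1) z.2) (I ×ˢ univ) :=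
  ((continuousOn_fderivWithin_apply hI hne hφ).clm_comp continuousOn_const).congr
    fun z hz => (hasFDerivAt_slice hφ hz.1 z.2).fderiv

theorem IsLocalized.l2ContinuousOn (h : IsLocalized a b k I φ) : L2ContinuousOn I φ :=
  ⟨h.contDiffOn.continuousOn, fun t ht => (h.fourier t ht).1, h.continuous⟩

theorem IsLocalized.l2ContinuousOn_timeDeriv (hI : I.OrdConnected) (hne : (interior I).Nonempty)
    (h : IsLocalized a b k I φ) : L2ContinuousOn I (timeDeriv I φ) :=
  ⟨continuousOn_timeDeriv hI hne h.contDiffOn, h.memLp_timeDeriv, h.continuous_timeDeriv⟩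

theorem IsLocalized.hasDerivAt (hI : I.OrdConnected) (h : IsLocalized a b k I φ) {t : ℝ}
    (ht : t ∈ interior I) (x : Plane) : HasDerivAt (fun s => φ s x) (timeDeriv I φ t x) t := by
  rw [timeDeriv_eq hI ⟨t, ht⟩ h.contDiffOn (interior_subset ht) x]
  exact (hasDerivWithinAt_timeDeriv h.contDiffOn (interior_subset ht) x).hasDerivAt
    (mem_interior_iff_mem_nhds.1 ht)

end Regularity

end RadialWave

end

noncomputable section

namespace RadialWave

variable {α β : ℝ}

/-! ### The fundamental lemma in one variable -/

theorem deriv_smoothTransition_of_notMem {u : ℝ} (hu : u ∉ Icc (0 : ℝ) 1) :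
    deriv Real.smoothTransition u = 0 := by
  rcases lt_or_ge u 0 with h | h
  · have : Real.smoothTransition =ᶠ[𝓝 u] fun _ => 0 := by
      filter_upwards [eventually_lt_nhds h] with v hv
      exact Real.smoothTransition.zero_of_nonpos hv.le
    rw [this.deriv_eq, deriv_const]
  · have h1 : 1 < u := by
      by_contra h'
      exact hu ⟨h, not_lt.1 h'⟩
    have : Real.smoothTransition =ᶠ[𝓝 u] fun _ => 1 := by
      filter_upwards [eventually_gt_nhds h1] with v hv
      exact Real.smoothTransition.one_of_one_le hv.le
    rw [this.deriv_eq, deriv_const]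

theorem contDiff_smoothTransition : ContDiff ℝ ∞ Real.smoothTransition :=
  contDiff_infty.2 fun n => Real.smoothTransition.contDiff (n := (n : ℕ∞))

theorem continuous_deriv_smoothTransition : Continuous (deriv Real.smoothTransition) :=
  (contDiff_infty_iff_deriv.1 contDiff_smoothTransition).2.continuous

theorem hasCompactSupport_deriv_smoothTransition :
    HasCompactSupport (deriv Real.smoothTransition) :=
  HasCompactSupport.intro isCompact_Icc fun _ hu => deriv_smoothTransition_of_notMem hu

theorem integral_deriv_smoothTransition : ∫ u, deriv Real.smoothTransition u = 1 := by
  have h0 : Tendsto Real.smoothTransition atBot (𝓝 0) := by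
    refine tendsto_const_nhds.congr' ?_
    filter_upwards [eventually_le_atBot 0] with u hu
    exact (Real.smoothTransition.zero_of_nonpos hu).symm
  have h1 : Tendsto Real.smoothTransition atTop (𝓝 1) := by
    refine tendsto_const_nhds.congr' ?_
    filter_upwards [eventually_ge_atTop 1] with u hu
    exact (Real.smoothTransition.one_of_one_le hu).symm
  rw [integral_of_hasDerivAt_of_tendsto
    (fun u => ((contDiff_smoothTransition.differentiable (by simp)) u).hasDerivAt)
    (continuous_deriv_smoothTransition.integrable_of_hasCompactSupport
      hasCompactSupport_deriv_smoothTransition) h0 h1, sub_zero]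

/-- The transition `S(n (s - a) + b)` tests a continuous function at `a`. -/
theorem tendsto_integral_deriv_smoothTransition {E : ℝ → ℂ} (hE : Continuous E) {M : ℝ}
    (hM : ∀ s, ‖E s‖ ≤ M) (a b : ℝ) :
    Tendsto (fun n : ℕ => ∫ s, (((n : ℝ) + 1) *
      deriv Real.smoothTransition (((n : ℝ) + 1) * (s - a) + b)) • E s) atTop (𝓝 (E a)) := by
  have h1 : ∀ n : ℕ, ∫ s, (((n : ℝ) + 1) *
      deriv Real.smoothTransition (((n : ℝ) + 1) * (s - a) + b)) • E s =
      ∫ u, deriv Real.smoothTransition u • E (a + (u - b) * (1 / ((n : ℝ) + 1))) := by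
    intro n
    have hn : (0 : ℝ) < (n : ℝ) + 1 := by positivity
    set f : ℝ → ℂ := fun u => deriv Real.smoothTransition u • E (a + (u - b) * (1 / ((n : ℝ) + 1)))
    have e : ∀ s, (((n : ℝ) + 1) *
        deriv Real.smoothTransition (((n : ℝ) + 1) * (s - a) + b)) • E s =
        ((n : ℝ) + 1) • (fun s => f (((n : ℝ) + 1) * s + (b - ((n : ℝ) + 1) * a))) s := fun s => by
      simp only [f]
      rw [smul_smul]
      congr 3
      · ring
      · field_simp; ring
    simp_rw [e]
    rw [integral_smul, Measure.integral_comp_mul_left (fun s => f (s + (b - ((n : ℝ) + 1) * a))),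
      integral_add_right_eq_self f, smul_smul, abs_of_pos (by positivity),
      mul_inv_cancel₀ hn.ne', one_smul]
  simp_rw [h1]
  have h2 : E a = ∫ u, deriv Real.smoothTransition u • E a := by
    rw [integral_smul_const, integral_deriv_smoothTransition, one_smul]
  rw [h2]
  refine tendsto_integral_of_dominated_convergence (fun u => ‖deriv Real.smoothTransition u‖ * M)
    (fun n => ?_) ?_ (fun n => Eventually.of_forall fun u => ?_)
    (Eventually.of_forall fun u => ?_)
  · exact (continuous_deriv_smoothTransition.smul (hE.comp (by fun_prop))).aestronglyMeasurable
  · exact ((continuous_deriv_smoothTransition.integrable_of_hasCompactSupport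
      hasCompactSupport_deriv_smoothTransition).norm).mul_const M
  · rw [norm_smul]
    exact mul_le_mul_of_nonneg_left (hM _) (norm_nonneg _)
  · refine Tendsto.const_smul ?_ _
    have h3 : Tendsto (fun n : ℕ => a + (u - b) * (1 / ((n : ℝ) + 1))) atTop
        (𝓝 (a + (u - b) * 0)) :=
      (tendsto_one_div_add_atTop_nhds_zero_nat.const_mul (u - b)).const_add a
    rw [mul_zero, add_zero] at h3
    exact (hE.tendsto a).comp h3

/-- A continuous function with weak derivative `-L` has `-L` as its derivative in the
integral sense. -/
theorem sub_eq_neg_integral_of_weak_deriv {E L : ℝ → ℂ} {t₁ t₂ : ℝ} (h12 : t₁ < t₂)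
    (hE : ContinuousOn E (Icc t₁ t₂)) (hL : IntegrableOn L (Ioo t₁ t₂))
    (h : ∀ θ : ℝ → ℝ, ContDiff ℝ ∞ θ → HasCompactSupport θ → tsupport θ ⊆ Ioo t₁ t₂ →
      ∫ s, deriv θ s • E s = ∫ s, θ s • L s) :
    E t₁ - E t₂ = ∫ s in Ioo t₁ t₂, L s := by
  -- E is extended by its end point values, so that it becomes bounded and continuous on the whole
  -- line and can be tested at t₁ and t₂.
  set E' : ℝ → ℂ := IccExtend h12.le ((Icc t₁ t₂).domRestrict E) with hE'
  have hE'c : Continuous E' := (continuousOn_iff_continuous_domRestrict.1 hE).Icc_extend'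
  have hE'eq : ∀ s ∈ Icc t₁ t₂, E' s = E s := fun s hs => by
    rw [hE', IccExtend_of_mem _ _ hs]; rfl
  obtain ⟨M, hM⟩ := isCompact_Icc.exists_bound_of_continuousOn hE
  have hE'M : ∀ s, ‖E' s‖ ≤ M := fun s => hM _ (projIcc t₁ t₂ h12.le s).2
  set S := Real.smoothTransition with hS
  -- A smoothed indicator of (t₁, t₂). The shifts -1 and 2 place the ascent in [t₁ + 1/(n+1), t₁ +
  -- 2/(n+1)] and the descent in [t₂ - 2/(n+1), t₂ - 1/(n+1)], so the support stays inside the open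
  -- interval.
  set θ : ℕ → ℝ → ℝ := fun n s => S (((n : ℝ) + 1) * (s - t₁) + (-1)) -
    S (((n : ℝ) + 1) * (s - t₂) + 2) with hθ
  have hSd : ∀ u, HasDerivAt S (deriv S u) u := fun u =>
    (contDiff_smoothTransition.differentiable (by simp) u).hasDerivAt
  have hcd : ∀ n, ContDiff ℝ ∞ (θ n) := fun n =>
    (contDiff_smoothTransition.comp (by fun_prop)).sub
      (contDiff_smoothTransition.comp (by fun_prop))
  have hd : ∀ n s, deriv (θ n) s = ((n : ℝ) + 1) * deriv S (((n : ℝ) + 1) * (s - t₁) + (-1)) -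
      ((n : ℝ) + 1) * deriv S (((n : ℝ) + 1) * (s - t₂) + 2) := by
    intro n s
    have h1 : ∀ a b : ℝ, HasDerivAt (fun s => S (((n : ℝ) + 1) * (s - a) + b))
        (((n : ℝ) + 1) * deriv S (((n : ℝ) + 1) * (s - a) + b)) s := fun a b => by
      have := (hSd (((n : ℝ) + 1) * (s - a) + b)).comp s
        ((((hasDerivAt_id s).sub_const a).const_mul ((n : ℝ) + 1)).add_const b)
      exact this.congr_deriv (by ring)
    exact ((h1 t₁ (-1)).sub (h1 t₂ 2)).deriv
  -- The value 3 is what makes θ n vanish outside [t₁ + 1/(n+1), t₂ - 1/(n+1)]: to the left of this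
  -- interval the descent has not started, and to its right the ascent is complete.
  have hlarge : ∀ᶠ n : ℕ in atTop, 3 ≤ ((n : ℝ) + 1) * (t₂ - t₁) := by
    have : Tendsto (fun n : ℕ => ((n : ℝ) + 1) * (t₂ - t₁)) atTop atTop :=
      (tendsto_atTop_add_const_right _ 1 tendsto_natCast_atTop_atTop).atTop_mul_const
        (sub_pos.2 h12)
    exact this.eventually_ge_atTop 3
  have hzero : ∀ n : ℕ, 3 ≤ ((n : ℝ) + 1) * (t₂ - t₁) → ∀ s,
      s ∉ Icc (t₁ + 1 / ((n : ℝ) + 1)) (t₂ - 1 / ((n : ℝ) + 1)) → θ n s = 0 := by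
    intro n hn s hs
    have hp : (0 : ℝ) < (n : ℝ) + 1 := by positivity
    simp only [hθ]
    by_cases h1 : s < t₁ + 1 / ((n : ℝ) + 1)
    · have e1 : ((n : ℝ) + 1) * (s - t₁) ≤ 1 := by
        rw [← le_div_iff₀' hp]; linarith
      rw [hS, Real.smoothTransition.zero_of_nonpos (by linarith),
        Real.smoothTransition.zero_of_nonpos (by nlinarith), sub_zero]
    · have h2 : t₂ - 1 / ((n : ℝ) + 1) < s := by
        by_contra h2
        exact hs ⟨not_lt.1 h1, not_lt.1 h2⟩
      have e1 : ((n : ℝ) + 1) * (t₂ - s) ≤ 1 := by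
        rw [← le_div_iff₀' hp]; linarith
      rw [hS, Real.smoothTransition.one_of_one_le (by nlinarith),
        Real.smoothTransition.one_of_one_le (by nlinarith), sub_self]
  have hts : ∀ n : ℕ, 3 ≤ ((n : ℝ) + 1) * (t₂ - t₁) →
      tsupport (θ n) ⊆ Icc (t₁ + 1 / ((n : ℝ) + 1)) (t₂ - 1 / ((n : ℝ) + 1)) := fun n hn =>
    closure_minimal (fun s hs => by
      by_contra h'
      exact hs (hzero n hn s h')) isClosed_Icc
  have hsub : ∀ n : ℕ, Icc (t₁ + 1 / ((n : ℝ) + 1)) (t₂ - 1 / ((n : ℝ) + 1)) ⊆ Ioo t₁ t₂ :=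
    fun n s hs => by
      have hp : (0 : ℝ) < 1 / ((n : ℝ) + 1) := by positivity
      exact ⟨by linarith [hs.1], by linarith [hs.2]⟩
  have hleft : Tendsto (fun n : ℕ => ∫ s, deriv (θ n) s • E s) atTop (𝓝 (E t₁ - E t₂)) := by
    have h1 := (tendsto_integral_deriv_smoothTransition hE'c hE'M t₁ (-1)).sub
      (tendsto_integral_deriv_smoothTransition hE'c hE'M t₂ 2)
    rw [hE'eq t₁ (left_mem_Icc.2 h12.le), hE'eq t₂ (right_mem_Icc.2 h12.le)] at h1
    refine h1.congr' ?_
    filter_upwards [hlarge] with n hn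
    have hint : ∀ a b : ℝ, Integrable fun s => (((n : ℝ) + 1) *
        deriv S (((n : ℝ) + 1) * (s - a) + b)) • E' s := by
      intro a b
      have hp : (0 : ℝ) < (n : ℝ) + 1 := by positivity
      refine Continuous.integrable_of_hasCompactSupport ?_ ?_
      · exact (continuous_const.mul
            (continuous_deriv_smoothTransition.comp (by fun_prop))).smul hE'c
      · refine HasCompactSupport.intro (isCompact_Icc (a := a + (0 - b) / ((n : ℝ) + 1))
          (b := a + (1 - b) / ((n : ℝ) + 1))) fun s hs => ?_
        rw [deriv_smoothTransition_of_notMem, mul_zero, zero_smul]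
        rintro ⟨h1, h2⟩
        refine hs ⟨?_, ?_⟩
        · rw [← le_sub_iff_add_le', div_le_iff₀' hp]; linarith
        · rw [← sub_le_iff_le_add', le_div_iff₀' hp]; linarith
    rw [← integral_sub (hint _ _) (hint _ _)]
    refine integral_congr_ae (Eventually.of_forall fun s => ?_)
    beta_reduce
    rw [← sub_smul, ← hd]
    by_cases hs : s ∈ Icc t₁ t₂
    · rw [hE'eq s hs]
    · have : deriv (θ n) s = 0 := image_eq_zero_of_notMem_tsupport fun h' =>
        hs (Ioo_subset_Icc_self (hsub n (hts n hn (tsupport_deriv_subset (𝕜 := ℝ) h'))))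
      rw [this, zero_smul, zero_smul]
  have hright : Tendsto (fun n : ℕ => ∫ s, θ n s • L s) atTop (𝓝 (∫ s in Ioo t₁ t₂, L s)) := by
    rw [← integral_indicator measurableSet_Ioo]
    have hbd : ∀ n s, ‖θ n s‖ ≤ 1 := fun n s => by
      rw [Real.norm_eq_abs, abs_le]
      have := Real.smoothTransition.nonneg (((n : ℝ) + 1) * (s - t₁) + (-1))
      have := Real.smoothTransition.nonneg (((n : ℝ) + 1) * (s - t₂) + 2)
      have := Real.smoothTransition.le_one (((n : ℝ) + 1) * (s - t₁) + (-1))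
      have := Real.smoothTransition.le_one (((n : ℝ) + 1) * (s - t₂) + 2)
      constructor <;> simp only [hθ, hS] <;> linarith
    have hint := (integrable_indicator_iff measurableSet_Ioo).2 hL
    have h1 : Tendsto (fun n : ℕ => ∫ s, θ n s • (Ioo t₁ t₂).indicator L s) atTop
        (𝓝 (∫ s, (Ioo t₁ t₂).indicator L s)) := by
      refine tendsto_integral_of_dominated_convergence (fun s => ‖(Ioo t₁ t₂).indicator L s‖)
        (fun n => (hcd n).continuous.aestronglyMeasurable.smul hint.1) hint.norm
        (fun n => Eventually.of_forall fun s => ?_) (Eventually.of_forall fun s => ?_)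
      · rw [norm_smul]
        exact mul_le_of_le_one_left (norm_nonneg _) (hbd n s)
      · by_cases hs : s ∈ Ioo t₁ t₂
        · refine tendsto_const_nhds.congr' ?_
          have hT : ∀ d : ℝ, 0 < d → ∀ᶠ n : ℕ in atTop, 2 ≤ ((n : ℝ) + 1) * d := fun d hd0 =>
            ((tendsto_atTop_add_const_right _ 1 tendsto_natCast_atTop_atTop).atTop_mul_const
              hd0).eventually_ge_atTop 2
          filter_upwards [hT _ (sub_pos.2 hs.1), hT _ (sub_pos.2 hs.2)] with n h1 h2
          have : θ n s = 1 := by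
            simp only [hθ, hS]
            rw [Real.smoothTransition.one_of_one_le (by linarith),
              Real.smoothTransition.zero_of_nonpos (by nlinarith), sub_zero]
          rw [this, one_smul]
        · simp [indicator_of_notMem hs]
    refine h1.congr' ?_
    filter_upwards [hlarge] with n hn
    refine integral_congr_ae (Eventually.of_forall fun s => ?_)
    beta_reduce
    by_cases hs : s ∈ Ioo t₁ t₂
    · rw [indicator_of_mem hs]
    · rw [hzero n hn s fun h' => hs (hsub n h'), zero_smul, zero_smul]
  refine tendsto_nhds_unique hleft (hright.congr' ?_)
  filter_upwards [hlarge] with n hn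
  exact (h (θ n) (hcd n) (HasCompactSupport.intro isCompact_Icc (hzero n hn))
    ((hts n hn).trans (hsub n))).symm

end RadialWave

end

noncomputable section

namespace RadialWave

variable {α β : ℝ}

/-! ### The d'Alembertian of a truncated packet -/

theorem box_eq_fderiv {g : ℝ × Plane → ℝ} (hg : ContDiff ℝ ∞ g) (z : ℝ × Plane) :
    box g z = -(fderiv ℝ (fderiv ℝ g) z (1, 0) (1, 0)) + ∑ i : Fin 2,
      fderiv ℝ (fderiv ℝ g) z (0, EuclideanSpace.single i 1) (0, EuclideanSpace.single i 1) := by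
  have h1 : ∀ z, HasFDerivAt g (fderiv ℝ g z) z := fun z =>
    (hg.differentiable (by simp) z).hasFDerivAt
  have h2 : ∀ z, HasFDerivAt (fderiv ℝ g) (fderiv ℝ (fderiv ℝ g) z) z := fun z =>
    ((hg.fderiv_right (m := ∞) (by simp)).differentiable (by simp) z).hasFDerivAt
  obtain ⟨s, y⟩ := z
  have ht : ∀ s, deriv (fun s => g (s, y)) s = fderiv ℝ g (s, y) (1, 0) := fun s => by
    have h : HasDerivAt (fun s => g (s, y)) (fderiv ℝ g (s, y) (1, 0)) s :=
      (HasFDerivAt.comp (f := fun s : ℝ => (s, y)) s (h1 (s, y))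
        (hasFDerivAt_prodMk_left s y)).hasDerivAt.congr_deriv (by simp)
    exact h.deriv
  have ht2 : deriv (fun s => fderiv ℝ g (s, y) (1, 0)) s =
      fderiv ℝ (fderiv ℝ g) (s, y) (1, 0) (1, 0) := by
    have h : HasDerivAt (fun s => fderiv ℝ g (s, y) (1, 0))
        (fderiv ℝ (fderiv ℝ g) (s, y) (1, 0) (1, 0)) s :=
      ((HasFDerivAt.comp (f := fun s : ℝ => (s, y)) s (h2 (s, y))
        (hasFDerivAt_prodMk_left s y)).hasDerivAt.clm_apply
          (hasDerivAt_const s ((1 : ℝ), (0 : Plane)))).congr_deriv (by simp)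
    exact h.deriv
  have hx : (fderiv ℝ fun y => g (s, y)) = fun y => (fderiv ℝ g (s, y)).comp
      (ContinuousLinearMap.inr ℝ ℝ Plane) := funext fun y =>
    (HasFDerivAt.comp (f := fun y : Plane => (s, y)) y (h1 (s, y))
      (hasFDerivAt_prodMk_right s y)).fderiv
  have hx2 : fderiv ℝ (fun y => (fderiv ℝ g (s, y)).comp (ContinuousLinearMap.inr ℝ ℝ Plane)) y =
      _ := ((HasFDerivAt.comp (f := fun y : Plane => (s, y)) y (h2 (s, y))
      (hasFDerivAt_prodMk_right s y)).clm_comp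
        (hasFDerivAt_const (ContinuousLinearMap.inr ℝ ℝ Plane) y)).fderiv
  rw [box, laplacian_eq_fderiv, iteratedDeriv_succ, iteratedDeriv_one]
  simp only [hx, hx2]
  rw [funext ht, ht2]
  simp

theorem continuous_box {g : ℝ × Plane → ℝ} (hg : ContDiff ℝ ∞ g) : Continuous (box g) := by
  have h : Continuous (fderiv ℝ (fderiv ℝ g)) :=
    (hg.fderiv_right (m := ∞) (by simp)).continuous_fderiv (by simp)
  rw [funext (box_eq_fderiv hg)]
  exact ((h.clm_apply continuous_const).clm_apply continuous_const).neg.add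
    (continuous_finsetSum _ fun i _ => (h.clm_apply continuous_const).clm_apply continuous_const)

theorem hasFDerivAt_dilate {G : Type*} [NormedAddCommGroup G] [NormedSpace ℝ G] {b : Plane → G}
    (hb : Differentiable ℝ b) (δ : ℝ) (y : Plane) :
    HasFDerivAt (fun y : Plane => b (δ • y)) (δ • fderiv ℝ b (δ • y)) y := by
  have hs : HasFDerivAt (fun y : Plane => δ • y) (δ • ContinuousLinearMap.id ℝ Plane) y :=
    (hasFDerivAt_id y).const_smul δ
  refine (HasFDerivAt.comp (f := fun y : Plane => δ • y) y (hb (δ • y)).hasFDerivAt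
    hs).congr_fderiv ?_
  rw [ContinuousLinearMap.comp_smul, ContinuousLinearMap.comp_id]

theorem abs_laplacian_le (g : Plane → ℝ) (y : Plane) :
    |Laplacian.laplacian g y| ≤ 2 * ‖fderiv ℝ (fderiv ℝ g) y‖ := by
  rw [laplacian_eq_fderiv]
  have key : ∀ i : Fin 2, |fderiv ℝ (fderiv ℝ g) y
      (EuclideanSpace.single i 1) (EuclideanSpace.single i 1)| ≤ ‖fderiv ℝ (fderiv ℝ g) y‖ := by
    intro i
    have h3 := (fderiv ℝ (fderiv ℝ g) y).le_opNorm₂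
      (EuclideanSpace.single i 1) (EuclideanSpace.single i 1)
    have hn : ‖(EuclideanSpace.single i (1 : ℝ) : Plane)‖ = 1 := by simp
    rwa [hn, mul_one, mul_one, Real.norm_eq_abs] at h3
  refine (Finset.abs_sum_le_sum_abs _ _).trans ((Finset.sum_le_sum fun i _ => key i).trans ?_)
  rw [Finset.sum_const, Finset.card_univ, Fintype.card_fin, nsmul_eq_mul, Nat.cast_ofNat]

theorem norm_fderiv_smul_dilate_le {G : Type*} [NormedAddCommGroup G] [NormedSpace ℝ G]
    {b : Plane → G} (hb : Differentiable ℝ b) {C : ℝ} (hC : ∀ y, ‖fderiv ℝ b y‖ ≤ C) {δ c : ℝ}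
    (hδ : 0 ≤ δ) (hc : 0 ≤ c) (y : Plane) :
    ‖fderiv ℝ (fun y => c • b (δ • y)) y‖ ≤ c * (δ * C) := by
  have h : HasFDerivAt (fun y => c • b (δ • y)) (c • δ • fderiv ℝ b (δ • y)) y :=
    (hasFDerivAt_dilate hb δ y).const_smul c
  rw [h.fderiv, norm_smul, norm_smul, Real.norm_eq_abs,
    Real.norm_eq_abs, abs_of_nonneg hδ, abs_of_nonneg hc]
  exact mul_le_mul_of_nonneg_left (mul_le_mul_of_nonneg_left (hC _) hδ) hc

theorem exists_bound_fderiv {G : Type*} [NormedAddCommGroup G] [NormedSpace ℝ G] {b : Plane → G}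
    (hb : ContDiff ℝ ∞ b) (hcs : HasCompactSupport b) : HasCompactSupport (fderiv ℝ b) ∧
      ContDiff ℝ ∞ (fderiv ℝ b) ∧ ∃ C, 0 ≤ C ∧ ∀ y : Plane, ‖fderiv ℝ b y‖ ≤ C := by
  have h1 : ContDiff ℝ ∞ (fderiv ℝ b) := hb.fderiv_right (m := ∞) (by simp)
  have c1 : HasCompactSupport (fderiv ℝ b) := hcs.fderiv (𝕜 := ℝ)
  obtain ⟨A, hA⟩ := c1.exists_bound_of_continuous h1.continuous
  exact ⟨c1, h1, A, (norm_nonneg _).trans (hA 0), hA⟩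

/-- Each derivative of b(δ·) carries a factor δ; for the Laplacian one of the two factors is
discarded using δ ≤ 1. -/
theorem exists_bound_dilate {b : Plane → ℝ} (hb : ContDiff ℝ ∞ b) (hcs : HasCompactSupport b) :
    ∃ C, 0 ≤ C ∧ ∀ δ ∈ Icc (0 : ℝ) 1, ∀ y : Plane,
    ‖fderiv ℝ (fun y => b (δ • y)) y‖ ≤ C * δ ∧
    |Laplacian.laplacian (fun y => b (δ • y)) y| ≤ C * δ := by
  obtain ⟨c1, h1, A, hA0, hA⟩ := exists_bound_fderiv hb hcs
  obtain ⟨-, -, B, hB0, hB⟩ := exists_bound_fderiv h1 c1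
  refine ⟨A + 2 * B, by positivity, fun δ hδ y => ⟨?_, (abs_laplacian_le _ _).trans ?_⟩⟩
  · have := norm_fderiv_smul_dilate_le (hb.differentiable (by simp)) hA hδ.1 zero_le_one y
    simp only [one_smul, one_mul] at this
    nlinarith [mul_nonneg hB0 hδ.1]
  · have e1 : fderiv ℝ (fun y => b (δ • y)) = fun y => δ • fderiv ℝ b (δ • y) :=
      funext fun y => (hasFDerivAt_dilate (hb.differentiable (by simp)) δ y).fderiv
    rw [e1]
    have h2 := norm_fderiv_smul_dilate_le (h1.differentiable (by simp)) hB hδ.1 hδ.1 y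
    have h3 := mul_le_mul_of_nonneg_left hδ.2 (mul_nonneg hB0 hδ.1)
    have h4 := mul_nonneg hA0 hδ.1
    linarith

/-- The test function `θ(s) b(δ y) k(s, y)`, with `k` the packet focusing at time `t`. -/
def testFun (b : Plane → ℝ) (α β : ℝ) (c : ℝ → ℂ) (t δ : ℝ) (θ : ℝ → ℝ) (z : ℝ × Plane) : ℝ :=
  θ z.1 * (b (δ • z.2) * packet α β c (t - z.1) z.2)

/-- The error term in `□ (θ b k)` caused by the spatial cut-off. -/
def cutoffError (b : Plane → ℝ) (α β : ℝ) (c : ℝ → ℂ) (t δ : ℝ) (z : ℝ × Plane) : ℝ :=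
  packet α β c (t - z.1) z.2 * Laplacian.laplacian (fun y => b (δ • y)) z.2 +
  2 * ∑ i : Fin 2, fderiv ℝ (fun y => b (δ • y)) z.2 (EuclideanSpace.single i 1) *
    fderiv ℝ (packet α β c (t - z.1)) z.2 (EuclideanSpace.single i 1)

theorem contDiff_packet_slice {c : ℝ → ℂ} (hc : ContDiff ℝ ∞ c) (τ : ℝ) :
    ContDiff ℝ ∞ (packet α β c τ) := by
  have h := contDiff_packet (α := α) (β := β) hc
  have g : ContDiff ℝ ∞ (fun y : Plane => (τ, y)) := by fun_prop
  exact ContDiff.comp (f := fun y : Plane => (τ, y)) h g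

theorem contDiff_packet_sub {c : ℝ → ℂ} (hc : ContDiff ℝ ∞ c) (t : ℝ) :
    ContDiff ℝ ∞ (fun z : ℝ × Plane => packet α β c (t - z.1) z.2) := by
  have h := contDiff_packet (α := α) (β := β) hc
  have g : ContDiff ℝ ∞ (fun z : ℝ × Plane => (t - z.1, z.2)) := by fun_prop
  exact ContDiff.comp (f := fun z : ℝ × Plane => (t - z.1, z.2)) h g

theorem contDiff_dilate {b : Plane → ℝ} (hb : ContDiff ℝ ∞ b) (δ : ℝ) :
    ContDiff ℝ ∞ (fun y : Plane => b (δ • y)) := by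
  have g : ContDiff ℝ ∞ (fun y : Plane => δ • y) := by fun_prop
  exact ContDiff.comp (f := fun y : Plane => δ • y) hb g

theorem contDiff_testFun {b : Plane → ℝ} (hb : ContDiff ℝ ∞ b) {c : ℝ → ℂ}
    (hc : ContDiff ℝ ∞ c) (t δ : ℝ) {θ : ℝ → ℝ}
    (hθ : ContDiff ℝ ∞ θ) : ContDiff ℝ ∞ (testFun b α β c t δ θ) := by
  have h1 : ContDiff ℝ ∞ (fun z : ℝ × Plane => θ z.1) := hθ.comp contDiff_fst
  have h2 : ContDiff ℝ ∞ (fun z : ℝ × Plane => b (δ • z.2)) :=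
    ContDiff.comp (f := fun z : ℝ × Plane => z.2) (contDiff_dilate hb δ) contDiff_snd
  exact h1.mul (h2.mul (contDiff_packet_sub hc t))

theorem hasDerivAt_packet_sub {c : ℝ → ℂ} (hc : ContDiff ℝ ∞ c) (t s : ℝ) (y : Plane) :
    HasDerivAt (fun s => packet α β c (t - s) y)
      (-packet α β (fun w => Complex.I * w * c w) (t - s) y) s := by
  have := (hasDerivAt_packet (α := α) (β := β) hc (t - s) y).comp s
    ((hasDerivAt_id s).const_sub t)
  exact this.congr_deriv (by simp)

/-- Since the packet solves the wave equation, the terms containing its second derivatives cancel.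
What remains has a derivative on θ or on the spatial cut-off. The cross term has sign +2 because the
packet is evaluated at t - s. -/
theorem box_testFun {b : Plane → ℝ} (hb : ContDiff ℝ ∞ b) {c : ℝ → ℂ}
    (hc : ContDiff ℝ ∞ c) (t δ : ℝ) {θ : ℝ → ℝ}
    (hθ : ContDiff ℝ ∞ θ) (z : ℝ × Plane) :
    box (testFun b α β c t δ θ) z = b (δ • z.2) *
      (-(deriv (deriv θ) z.1 * packet α β c (t - z.1) z.2) +
        2 * deriv θ z.1 * packet α β (fun w => Complex.I * w * c w) (t - z.1) z.2) +
      θ z.1 * cutoffError b α β c t δ z := by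
  obtain ⟨s, y⟩ := z
  have hθ1 : ∀ s, HasDerivAt θ (deriv θ s) s := fun s =>
    (hθ.differentiable (by simp) s).hasDerivAt
  have hθ2 : ∀ s, HasDerivAt (deriv θ) (deriv (deriv θ) s) s := fun s =>
    ((contDiff_infty_iff_deriv.1 hθ).2.differentiable (by simp) s).hasDerivAt
  have d1 : deriv (fun s => testFun b α β c t δ θ (s, y)) = fun s =>
      deriv θ s * (b (δ • y) * packet α β c (t - s) y) +
      θ s * (b (δ • y) * -packet α β (fun w => Complex.I * w * c w) (t - s) y) :=
    funext fun s => ((hθ1 s).mul ((hasDerivAt_packet_sub hc t s y).const_mul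
      (b (δ • y)))).deriv
  have d2 : deriv (fun s => deriv θ s * (b (δ • y) * packet α β c (t - s) y) +
      θ s * (b (δ • y) * -packet α β (fun w => Complex.I * w * c w) (t - s) y)) s = _ :=
    (((hθ2 s).mul ((hasDerivAt_packet_sub hc t s y).const_mul (b (δ • y)))).add
      ((hθ1 s).mul ((hasDerivAt_packet_sub (contDiff_I_mul hc) t s y).neg.const_mul
        (b (δ • y))))).deriv
  have e : (fun y => testFun b α β c t δ θ (s, y)) =
      θ s • fun y => b (δ • y) * packet α β c (t - s) y := rfl
  have hb2 := (contDiff_dilate hb δ).of_le two_le_infty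
  have hk2 := (contDiff_packet_slice (α := α) (β := β) hc (t - s)).of_le two_le_infty
  rw [box, iteratedDeriv_succ, iteratedDeriv_one]
  simp only
  rw [d1, d2, e, InnerProductSpace.laplacian_smul _ (hb2.mul hk2).contDiffAt,
    laplacian_mul hb2 hk2, laplacian_packet hc, cutoffError, smul_eq_mul]
  simp only [Pi.neg_apply]
  ring

theorem exists_bound_packet (hα : 0 < α) (hαβ : α ≤ β) {c : ℝ → ℂ} (hc : IsAmplitude α β c)
    (t : ℝ) {S : Set ℝ} (hS : IsCompact S) :
    ∃ C, 0 ≤ C ∧ ∀ s ∈ S, ∀ y, |packet α β c (t - s) y| ≤ C * decay ‖y‖ := by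
  obtain ⟨C, hC, h⟩ := exists_packet_decay hα hαβ hc
  obtain ⟨B, hB⟩ := hS.exists_bound_of_continuousOn (f := fun s => 1 + (t - s) ^ 2) (by fun_prop)
  refine ⟨C * |B|, by positivity, fun s hs y => ((h (t - s)).1 y).trans ?_⟩
  have := (le_abs_self _).trans ((hB s hs).trans (le_abs_self _))
  have := decay_pos ‖y‖
  gcongr

/-- Every term carries a derivative of the dilated cut-off, hence a factor δ; the packet and its
gradient decay. The origin is excluded because the gradient is bounded through the radial profile.
-/
theorem exists_bound_cutoffError {b : Plane → ℝ} (hb : ContDiff ℝ ∞ b)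
    (hcs : HasCompactSupport b) (hα : 0 < α) (hαβ : α ≤ β) {c : ℝ → ℂ} (hc : IsAmplitude α β c)
    (t : ℝ) {S : Set ℝ} (hS : IsCompact S) :
    ∃ C, 0 ≤ C ∧ ∀ δ ∈ Icc (0 : ℝ) 1, ∀ s ∈ S, ∀ y, y ≠ 0 →
      |cutoffError b α β c t δ (s, y)| ≤ C * δ * decay ‖y‖ := by
  obtain ⟨C, hC, h⟩ := exists_packet_decay hα hαβ hc
  obtain ⟨C', hC', h'⟩ := exists_packet_decay hα hαβ (hc.mul Complex.ofRealCLM.contDiff)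
  obtain ⟨B, hB⟩ := hS.exists_bound_of_continuousOn (f := fun s => 1 + (t - s) ^ 2) (by fun_prop)
  obtain ⟨D, hD, hbd⟩ := exists_bound_dilate hb hcs
  refine ⟨(C * |B|) * D + 4 * (D * (C' * |B|)), by positivity, fun δ hδ s hs y hy => ?_⟩
  have hBs := (le_abs_self _).trans ((hB s hs).trans (le_abs_self _))
  have hd := decay_pos ‖y‖
  have k0 : |packet α β c (t - s) y| ≤ C * |B| * decay ‖y‖ :=
    ((h (t - s)).1 y).trans (by gcongr)
  have k1 : ‖fderiv ℝ (packet α β c (t - s)) y‖ ≤ C' * |B| * decay ‖y‖ :=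
    (norm_fderiv_packet_le hc.1 (t - s) hy).trans
      (((h' (t - s)).2 ‖y‖ (norm_nonneg y)).trans (by gcongr))
  obtain ⟨b1, b2⟩ := hbd δ hδ y
  have hδ0 := hδ.1
  have hn : ∀ i : Fin 2, ‖(EuclideanSpace.single i (1 : ℝ) : Plane)‖ = 1 := fun i => by simp
  have hi : ∀ i : Fin 2, |fderiv ℝ (fun y => b (δ • y)) y (EuclideanSpace.single i 1) *
      fderiv ℝ (packet α β c (t - s)) y (EuclideanSpace.single i 1)| ≤
      (D * δ) * (C' * |B| * decay ‖y‖) := fun i => by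
    rw [abs_mul]
    refine mul_le_mul ?_ ?_ (abs_nonneg _) (by positivity)
    · have := (fderiv ℝ (fun y => b (δ • y)) y).le_opNorm (EuclideanSpace.single i 1)
      rw [hn, mul_one] at this
      exact this.trans b1
    · have := (fderiv ℝ (packet α β c (t - s)) y).le_opNorm (EuclideanSpace.single i 1)
      rw [hn, mul_one] at this
      exact this.trans k1
  rw [cutoffError]
  refine (abs_add_le _ _).trans ?_
  rw [abs_mul, abs_mul, abs_two]
  have e1 : |packet α β c (t - s) y| * |Laplacian.laplacian (fun y => b (δ • y)) y| ≤
      (C * |B| * decay ‖y‖) * (D * δ) := mul_le_mul k0 b2 (abs_nonneg _) (by positivity)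
  have e2 := (Finset.abs_sum_le_sum_abs (fun i : Fin 2 =>
    fderiv ℝ (fun y => b (δ • y)) y (EuclideanSpace.single i 1) *
      fderiv ℝ (packet α β c (t - s)) y (EuclideanSpace.single i 1)) Finset.univ).trans
    (Finset.sum_le_sum fun i _ => hi i)
  simp only [Finset.sum_const, Finset.card_univ, Fintype.card_fin, nsmul_eq_mul,
    Nat.cast_ofNat] at e2
  calc _ ≤ (C * |B| * decay ‖y‖) * (D * δ) + 2 * (2 * ((D * δ) * (C' * |B| * decay ‖y‖))) := by
        gcongr
    _ = _ := by ring

end RadialWave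

end

noncomputable section

namespace RadialWave

variable {α β : ℝ}

/-! ### The weak form of the energy identity -/

theorem support_testFun_subset (b : Plane → ℝ) (c : ℝ → ℂ) (t δ : ℝ) (θ : ℝ → ℝ) :
    Function.support (testFun b α β c t δ θ) ⊆
      tsupport θ ×ˢ tsupport (fun y : Plane => b (δ • y)) := by
  intro z hz
  rw [Function.mem_support, testFun] at hz
  exact ⟨subset_tsupport θ (left_ne_zero_of_mul hz),
    subset_tsupport (fun y : Plane => b (δ • y))
      (left_ne_zero_of_mul (right_ne_zero_of_mul hz))⟩

theorem tsupport_testFun_subset (b : Plane → ℝ) (c : ℝ → ℂ) (t δ : ℝ) (θ : ℝ → ℝ) :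
    tsupport (testFun b α β c t δ θ) ⊆
      tsupport θ ×ˢ tsupport (fun y : Plane => b (δ • y)) :=
  closure_minimal (support_testFun_subset b c t δ θ)
    ((isClosed_tsupport _).prod (isClosed_tsupport _))

theorem hasCompactSupport_testFun {b : Plane → ℝ} (hcs : HasCompactSupport b) (c : ℝ → ℂ)
    (t : ℝ) {δ : ℝ} (hδ : δ ≠ 0) {θ : ℝ → ℝ} (hθ : HasCompactSupport θ) :
    HasCompactSupport (testFun b α β c t δ θ) :=
  (IsCompact.prod hθ (hcs.comp_smul hδ)).of_isClosed_subset (isClosed_tsupport _)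
    (tsupport_testFun_subset b c t δ θ)

/-- A function bounded by `decay ‖y‖` for times in `S` and vanishing for other times. -/
structure DecaysOn (S : Set ℝ) (h : ℝ × Plane → ℝ) (C : ℝ) : Prop where
  bound : ∀ᵐ z : ℝ × Plane, |h z| ≤ C * decay ‖z.2‖
  eq_zero : ∀ z, z.1 ∉ S → h z = 0

theorem exists_bound_packet_mul (hα : 0 < α) (hαβ : α ≤ β) {c : ℝ → ℂ} (hc : IsAmplitude α β c)
    (t : ℝ) {θ : ℝ → ℝ} (hθ : Continuous θ) {S : Set ℝ} (hS : IsCompact S)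
    (h0 : ∀ s ∉ S, θ s = 0) :
    Continuous (fun z : ℝ × Plane => θ z.1 * packet α β c (t - z.1) z.2) ∧
    ∃ C, 0 ≤ C ∧ (∀ z : ℝ × Plane, |θ z.1 * packet α β c (t - z.1) z.2| ≤ C * decay ‖z.2‖) ∧
      DecaysOn S (fun z : ℝ × Plane => θ z.1 * packet α β c (t - z.1) z.2) C := by
  refine ⟨(hθ.comp continuous_fst).mul (contDiff_packet_sub hc.1 t).continuous, ?_⟩
  obtain ⟨C, hC, h⟩ := exists_bound_packet hα hαβ hc t hS
  obtain ⟨M, hM⟩ := hS.exists_bound_of_continuousOn hθ.continuousOn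
  have key : ∀ z : ℝ × Plane, |θ z.1 * packet α β c (t - z.1) z.2| ≤ |M| * C * decay ‖z.2‖ := by
    intro z
    have hd := decay_pos ‖z.2‖
    by_cases hz : z.1 ∈ S
    · rw [abs_mul, mul_assoc]
      exact mul_le_mul ((hM _ hz).trans (le_abs_self M)) (h _ hz _) (abs_nonneg _) (abs_nonneg _)
    · rw [h0 _ hz, zero_mul, abs_zero]
      positivity
  exact ⟨|M| * C, by positivity, key, Eventually.of_forall key, fun z hz => by
    rw [h0 _ hz, zero_mul]⟩

theorem deriv_eq_zero_of_notMem_tsupport {θ : ℝ → ℝ} {s : ℝ} (hs : s ∉ tsupport θ) :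
    deriv θ s = 0 := by
  by_contra h
  exact hs (support_deriv_subset h)

theorem tsupport_deriv_subset' (θ : ℝ → ℝ) : tsupport (deriv θ) ⊆ tsupport θ :=
  closure_minimal support_deriv_subset (isClosed_tsupport θ)

variable {I : Set ℝ} {φ F : ℝ → Plane → ℂ} {a b : ℝ} {k : ℤ}

/-- The weak equation tested against `θ(s) k(s, y)`. -/
theorem HasWeakBox.integral_packet (hbox : HasWeakBox I φ F) (hφ : L2ContinuousOn I φ)
    (hF : ∫⁻ s in I, eLpNorm (F s) 2 volume < ⊤)
    (hα : 0 < α) (hαβ : α ≤ β) {c : ℝ → ℂ} (hc : IsAmplitude α β c) (t : ℝ) {θ : ℝ → ℝ}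
    (hθ : ContDiff ℝ ∞ θ) (hθc : HasCompactSupport θ) (hθI : tsupport θ ⊆ interior I) :
    ∫ z : ℝ × Plane, (-(deriv (deriv θ) z.1 * packet α β c (t - z.1) z.2) +
      2 * (deriv θ z.1 * packet α β (fun w => Complex.I * w * c w) (t - z.1) z.2)) • φ z.1 z.2 =
    ∫ z : ℝ × Plane, (θ z.1 * packet α β c (t - z.1) z.2) • F z.1 z.2 := by
  set S := tsupport θ with hSdef
  have hS : IsCompact S := hθc
  have hSI : S ⊆ I := hθI.trans interior_subset
  have hθ1 : ContDiff ℝ ∞ (deriv θ) := (contDiff_infty_iff_deriv.1 hθ).2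
  have hθ2 : ContDiff ℝ ∞ (deriv (deriv θ)) := (contDiff_infty_iff_deriv.1 hθ1).2
  have z0 : ∀ s ∉ S, θ s = 0 := fun s hs => image_eq_zero_of_notMem_tsupport hs
  have z1 : ∀ s ∉ S, deriv θ s = 0 := fun s hs => deriv_eq_zero_of_notMem_tsupport hs
  have z2 : ∀ s ∉ S, deriv (deriv θ) s = 0 := fun s hs =>
    deriv_eq_zero_of_notMem_tsupport fun h => hs (tsupport_deriv_subset' θ h)
  obtain ⟨m0, C0, hC0, p0, -⟩ := exists_bound_packet_mul hα hαβ hc t hθ.continuous hS z0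
  obtain ⟨m1, C1, hC1, p1, -⟩ := exists_bound_packet_mul hα hαβ
    (hc.mul (f := fun w => Complex.I * w) (contDiff_const.mul Complex.ofRealCLM.contDiff)) t
      hθ1.continuous hS z1
  obtain ⟨m2, C2, hC2, p2, -⟩ := exists_bound_packet_mul hα hαβ hc t hθ2.continuous hS z2
  -- Packets are not compactly supported in space, so the weak equation is tested with b(δₙy)
  -- inserted. As b(0) = 1, the cut-off tends to 1 pointwise when δₙ → 0.
  let bump : ContDiffBump (0 : Plane) := ⟨1, 2, one_pos, one_lt_two⟩
  obtain ⟨b, hb, hbc, hb01, hb0⟩ : ∃ b : Plane → ℝ, ContDiff ℝ ∞ b ∧ HasCompactSupport b ∧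
      (∀ y, b y ∈ Icc (0 : ℝ) 1) ∧ b 0 = 1 :=
    ⟨bump, bump.contDiff, bump.hasCompactSupport, fun y => ⟨bump.nonneg, bump.le_one⟩,
      bump.one_of_mem_closedBall (by simp [bump])⟩
  obtain ⟨C3, hC3, p3⟩ := exists_bound_cutoffError hb hbc hα hαβ hc t hS
  obtain ⟨M, hM⟩ := hθc.exists_bound_of_continuous hθ.continuous
  have hM0 : 0 ≤ M := (norm_nonneg _).trans (hM 0)
  set δ : ℕ → ℝ := fun n => 1 / ((n : ℝ) + 1) with hδdef
  have hδ : ∀ n, δ n ∈ Icc (0 : ℝ) 1 := fun n =>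
    ⟨by positivity, (div_le_one (by positivity)).2 (by simp)⟩
  have hδ0 : ∀ n, δ n ≠ 0 := fun n => by positivity
  have hδlim : Tendsto δ atTop (𝓝 0) := tendsto_one_div_add_atTop_nhds_zero_nat
  have hne : ∀ᵐ z : ℝ × Plane, z.2 ≠ 0 := by
    have h : ∀ᵐ y : Plane, y ≠ 0 := Measure.ae_ne volume 0
    exact Measure.quasiMeasurePreserving_snd.ae h
  have heq : ∀ n, ∫ z : ℝ × Plane, box (testFun b α β c t (δ n) θ) z • φ z.1 z.2 =
      ∫ z : ℝ × Plane, testFun b α β c t (δ n) θ z • F z.1 z.2 := fun n =>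
    hbox.2 _ (contDiff_testFun hb hc.1 t (δ n) hθ) (hasCompactSupport_testFun hbc c t (hδ0 n) hθc)
      ((tsupport_testFun_subset b c t (δ n) θ).trans (prod_mono hθI (subset_univ _)))
  have hblim : ∀ y : Plane, Tendsto (fun n => b (δ n • y)) atTop (𝓝 1) := fun y => by
    have h1 : Tendsto (fun n => δ n • y) atTop (𝓝 ((0 : ℝ) • y)) := hδlim.smul_const y
    rw [zero_smul] at h1
    rw [← hb0]
    exact (hb.continuous.tendsto 0).comp h1
  have hbabs : ∀ y, |b y| ≤ 1 := fun y => abs_le.2 ⟨by linarith [(hb01 y).1], (hb01 y).2⟩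
  -- the majorants
  have hSm := hS.measurableSet
  -- The summands bound the three parts of the d'Alembertian: θ'' times the packet, 2θ' times its
  -- time derivative, and θ times the cut-off error with δ ≤ 1.
  set D : ℝ := C2 + 2 * C1 + M * C3 with hD
  set g : ℝ × Plane → ℝ := fun z => S.indicator (fun _ => 1) z.1 * (1 * decay ‖z.2‖) with hg
  have hgm : AEStronglyMeasurable g volume :=
    (((measurable_const.indicator hSm).comp measurable_fst).mul
      ((continuous_decay.comp continuous_norm).measurable.comp
        measurable_snd |>.const_mul 1)).aestronglyMeasurable
  have hgb : ∀ᵐ z : ℝ × Plane, |g z| ≤ 1 * decay ‖z.2‖ := Eventually.of_forall fun z => by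
    have hd := decay_pos ‖z.2‖
    rw [hg]
    by_cases hz : z.1 ∈ S
    · simp [hz, abs_of_pos hd]
    · simp [hz, hd.le]
  have hg0 : ∀ z, z.1 ∉ S → g z = 0 := fun z hz => by simp [hg, hz]
  have ig := hφ.integrable_prod hS hSI hgm hgb hg0
  have hFm : AEStronglyMeasurable (fun z : ℝ × Plane => F z.1 z.2)
      (volume.restrict (S ×ˢ univ)) :=
    hbox.1.aestronglyMeasurable.mono_measure (Measure.restrict_mono (prod_mono_left hθI) le_rfl)
  have iF := integrable_prod_of_decay hSm hgm hFm hgb hg0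
    ((lintegral_mono_set hSI).trans_lt hF)
  have lim1 : Tendsto (fun n => ∫ z : ℝ × Plane, box (testFun b α β c t (δ n) θ) z • φ z.1 z.2)
      atTop (𝓝 (∫ z : ℝ × Plane, (-(deriv (deriv θ) z.1 * packet α β c (t - z.1) z.2) +
      2 * (deriv θ z.1 * packet α β (fun w => Complex.I * w * c w) (t - z.1) z.2)) •
        φ z.1 z.2)) := by
    have hsupp : ∀ n z, z.1 ∉ S → box (testFun b α β c t (δ n) θ) z = 0 := fun n z hz => by
      rw [box_testFun hb hc.1 t (δ n) hθ, z0 _ hz, z1 _ hz, z2 _ hz]; ring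
    have hbd : ∀ n, ∀ z : ℝ × Plane, z.2 ≠ 0 →
        |box (testFun b α β c t (δ n) θ) z| ≤ D * |g z| := fun n z hz => by
      by_cases hzS : z.1 ∈ S
      · have hd := decay_pos ‖z.2‖
        have hgz : |g z| = decay ‖z.2‖ := by simp [hg, hzS, abs_of_pos hd]
        rw [hgz, box_testFun hb hc.1 t (δ n) hθ]
        refine (abs_add_le _ _).trans ?_
        have e1 : |b (δ n • z.2) * (-(deriv (deriv θ) z.1 * packet α β c (t - z.1) z.2) +
            2 * deriv θ z.1 * packet α β (fun w => Complex.I * w * c w) (t - z.1) z.2)| ≤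
            1 * (C2 * decay ‖z.2‖ + 2 * (C1 * decay ‖z.2‖)) := by
          rw [abs_mul]
          refine mul_le_mul (hbabs _) ((abs_add_le _ _).trans ?_) (abs_nonneg _) zero_le_one
          rw [abs_neg, mul_assoc, abs_mul 2, abs_two]
          exact add_le_add (p2 z) (mul_le_mul_of_nonneg_left (p1 z) zero_le_two)
        have e2 : |θ z.1 * cutoffError b α β c t (δ n) z| ≤ M * (C3 * 1 * decay ‖z.2‖) := by
          rw [abs_mul]
          refine mul_le_mul (hM _) ((p3 (δ n) (hδ n) z.1 hzS z.2 hz).trans ?_)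
            (abs_nonneg _) hM0
          have := (hδ n).2
          gcongr
        refine (add_le_add e1 e2).trans (le_of_eq ?_)
        rw [hD]; ring
      · rw [hsupp n z hzS, abs_zero]; positivity
    have hφm : AEStronglyMeasurable (fun z : ℝ × Plane => φ z.1 z.2)
        (volume.restrict (S ×ˢ univ)) :=
      (hφ.continuousOn.mono (prod_mono_left hSI)).aestronglyMeasurable
        (hSm.prod MeasurableSet.univ)
    refine tendsto_integral_of_dominated_convergence (fun z => D * ‖g z • φ z.1 z.2‖) ?_
      (ig.norm.const_mul D) ?_ ?_
    · intro n
      have : (fun z : ℝ × Plane => box (testFun b α β c t (δ n) θ) z • φ z.1 z.2) =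
          (S ×ˢ (univ : Set Plane)).indicator
            fun z => box (testFun b α β c t (δ n) θ) z • φ z.1 z.2 := by
        ext z
        by_cases hz : z.1 ∈ S
        · rw [indicator_of_mem (by simp [hz])]
        · rw [indicator_of_notMem (by simp [hz]), hsupp n z hz, zero_smul]
      rw [this, aestronglyMeasurable_indicator_iff (hSm.prod MeasurableSet.univ)]
      exact (continuous_box (contDiff_testFun hb hc.1 t (δ n) hθ)).aestronglyMeasurable.smul hφm
    · intro n
      filter_upwards [hne] with z hz
      rw [norm_smul, norm_smul, ← mul_assoc]
      exact mul_le_mul_of_nonneg_right (hbd n z hz) (norm_nonneg _)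
    · filter_upwards [hne] with z hz
      refine Tendsto.smul_const ?_ _
      have hce : Tendsto (fun n => θ z.1 * cutoffError b α β c t (δ n) z) atTop (𝓝 0) := by
        by_cases hzS : z.1 ∈ S
        · rw [← mul_zero (θ z.1)]
          refine Tendsto.const_mul _ (squeeze_zero_norm (a := fun n =>
            (C3 * decay ‖z.2‖) * δ n) (fun n => ?_) ?_)
          · refine (p3 (δ n) (hδ n) z.1 hzS z.2 hz).trans (le_of_eq ?_)
            ring
          · have := hδlim.const_mul (C3 * decay ‖z.2‖)
            rwa [mul_zero] at this
        · simp [z0 _ hzS]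
      have := ((hblim z.2).mul_const
        (-(deriv (deriv θ) z.1 * packet α β c (t - z.1) z.2) +
          2 * deriv θ z.1 * packet α β (fun w => Complex.I * w * c w) (t - z.1) z.2)).add hce
      rw [one_mul, add_zero, mul_assoc] at this
      refine this.congr fun n => ?_
      rw [box_testFun hb hc.1 t (δ n) hθ, mul_assoc 2]
  have lim2 : Tendsto (fun n => ∫ z : ℝ × Plane, testFun b α β c t (δ n) θ z • F z.1 z.2)
      atTop (𝓝 (∫ z : ℝ × Plane, (θ z.1 * packet α β c (t - z.1) z.2) • F z.1 z.2)) := by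
    refine tendsto_integral_of_dominated_convergence (fun z => C0 * ‖g z • F z.1 z.2‖) ?_
      (iF.norm.const_mul C0) ?_ ?_
    · intro n
      have : (fun z : ℝ × Plane => testFun b α β c t (δ n) θ z • F z.1 z.2) =
          (S ×ˢ (univ : Set Plane)).indicator
            fun z => testFun b α β c t (δ n) θ z • F z.1 z.2 := by
        ext z
        by_cases hz : z.1 ∈ S
        · rw [indicator_of_mem (by simp [hz])]
        · rw [indicator_of_notMem (by simp [hz]), testFun, z0 _ hz, zero_mul, zero_smul]
      rw [this, aestronglyMeasurable_indicator_iff (hSm.prod MeasurableSet.univ)]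
      exact (contDiff_testFun hb hc.1 t (δ n) hθ).continuous.aestronglyMeasurable.smul hFm
    · intro n
      refine Eventually.of_forall fun z => ?_
      rw [norm_smul, norm_smul, ← mul_assoc]
      refine mul_le_mul_of_nonneg_right ?_ (norm_nonneg _)
      by_cases hzS : z.1 ∈ S
      · have hd := decay_pos ‖z.2‖
        have hgz : ‖g z‖ = decay ‖z.2‖ := by simp [hg, hzS, abs_of_pos hd]
        rw [hgz, testFun, mul_left_comm, norm_mul, Real.norm_eq_abs, Real.norm_eq_abs]
        exact (mul_le_of_le_one_left (abs_nonneg _) (hbabs _)).trans (p0 z)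
      · rw [testFun, z0 _ hzS, zero_mul, norm_zero]; positivity
    · refine Eventually.of_forall fun z => Tendsto.smul_const ?_ _
      have := ((hblim z.2).mul_const (packet α β c (t - z.1) z.2)).const_mul (θ z.1)
      rwa [one_mul] at this
  exact tendsto_nhds_unique (lim1.congr heq) lim2

end RadialWave

end

noncomputable section

namespace RadialWave

variable {α β : ℝ} {I : Set ℝ} {φ F : ℝ → Plane → ℂ} {a b : ℝ} {k : ℤ}

/-! ### The energy identity -/

/-- The pairing `∫ (k ∂_t φ - φ ∂_t k) dy` at time `s`, with `k` the packet focusing at time `t`. -/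
def pairing (α β : ℝ) (c : ℝ → ℂ) (t : ℝ) (φ φt : ℝ → Plane → ℂ) (s : ℝ) : ℂ :=
  (∫ y, packet α β c (t - s) y • φt s y) +
    ∫ y, packet α β (fun w => Complex.I * w * c w) (t - s) y • φ s y

theorem IsAmplitude.I_mul {c : ℝ → ℂ} (hc : IsAmplitude α β c) :
    IsAmplitude α β (fun w => Complex.I * w * c w) :=
  hc.mul (f := fun w => Complex.I * w) (contDiff_const.mul Complex.ofRealCLM.contDiff)

theorem L2ContinuousOn.continuousOn_integral_packet {f : ℝ → Plane → ℂ} (hf : L2ContinuousOn I f)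
    (hα : 0 < α) (hαβ : α ≤ β) {c : ℝ → ℂ} (hc : IsAmplitude α β c) (t : ℝ) :
    ContinuousOn (fun s => ∫ y, packet α β c (t - s) y • f s y) I := by
  refine hf.continuousOn_integral (h := fun z => packet α β c (t - z.1) z.2)
    (contDiff_packet_sub hc.1 t).continuous fun s => ?_
  obtain ⟨C, -, h⟩ := exists_bound_packet hα hαβ hc t (isCompact_Icc (a := s - 1) (b := s + 1))
  exact ⟨C, mem_of_superset (Icc_mem_nhds (by linarith) (by linarith)) fun s' hs' => h s' hs'⟩

/-- The pairing has weak derivative minus the pairing of the packet with F. The weak equation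
carries θ''kφ and no ∂_tφ; adding the integral of ∂_s(θ'kφ), which is zero, trades the former for
θ'k∂_tφ and reduces the coefficient 2 of the cross term to 1. -/
theorem HasWeakBox.integral_deriv_smul_pairing (hI : I.OrdConnected)
    (hbox : HasWeakBox I φ F) (hφ : IsLocalized a b k I φ)
    (hF : ∫⁻ s in I, eLpNorm (F s) 2 volume < ⊤)
    (hα : 0 < α) (hαβ : α ≤ β) {c : ℝ → ℂ} (hc : IsAmplitude α β c) (t : ℝ) {θ : ℝ → ℝ}
    (hθ : ContDiff ℝ ∞ θ) (hθc : HasCompactSupport θ) (hθI : tsupport θ ⊆ interior I) :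
    ∫ s, deriv θ s • pairing α β c t φ (timeDeriv I φ) s =
      ∫ s, θ s • ∫ y, packet α β c (t - s) y • F s y := by
  by_cases hne : (interior I).Nonempty
  swap
  · rw [not_nonempty_iff_eq_empty] at hne
    rw [hne, subset_empty_iff, tsupport_eq_empty_iff] at hθI
    simp [hθI]
  have h1 := hφ.l2ContinuousOn
  have h2 := hφ.l2ContinuousOn_timeDeriv hI hne
  set S := tsupport θ with hSdef
  have hS : IsCompact S := hθc
  have hSI : S ⊆ I := hθI.trans interior_subset
  have hθ1 : ContDiff ℝ ∞ (deriv θ) := (contDiff_infty_iff_deriv.1 hθ).2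
  have hθ2 : ContDiff ℝ ∞ (deriv (deriv θ)) := (contDiff_infty_iff_deriv.1 hθ1).2
  have z0 : ∀ s ∉ S, θ s = 0 := fun s hs => image_eq_zero_of_notMem_tsupport hs
  have z1 : ∀ s ∉ S, deriv θ s = 0 := fun s hs => deriv_eq_zero_of_notMem_tsupport hs
  have z2 : ∀ s ∉ S, deriv (deriv θ) s = 0 := fun s hs =>
    deriv_eq_zero_of_notMem_tsupport fun h => hs (tsupport_deriv_subset' θ h)
  obtain ⟨m0, C0, hC0, -, p0⟩ := exists_bound_packet_mul hα hαβ hc t hθ.continuous hS z0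
  obtain ⟨m0', C0', hC0', -, p0'⟩ := exists_bound_packet_mul hα hαβ hc t hθ1.continuous hS z1
  obtain ⟨m1, C1, hC1, -, p1⟩ := exists_bound_packet_mul hα hαβ hc.I_mul t hθ1.continuous hS z1
  obtain ⟨m2, C2, hC2, -, p2⟩ := exists_bound_packet_mul hα hαβ hc t hθ2.continuous hS z2
  have iF := integrable_prod_of_decay hS.measurableSet m0.aestronglyMeasurable
    (hbox.1.aestronglyMeasurable.mono_measure (Measure.restrict_mono (prod_mono_left hθI) le_rfl))
    p0.bound p0.eq_zero ((lintegral_mono_set hSI).trans_lt hF)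
  have i2 := h1.integrable_prod hS hSI m2.aestronglyMeasurable p2.bound p2.eq_zero
  have i1 := h1.integrable_prod hS hSI m1.aestronglyMeasurable p1.bound p1.eq_zero
  have i0 := h1.integrable_prod hS hSI m0'.aestronglyMeasurable p0'.bound p0'.eq_zero
  have it := h2.integrable_prod hS hSI m0'.aestronglyMeasurable p0'.bound p0'.eq_zero
  -- integration of `∂_s (θ' k φ)`
  have hzero : ∫ z : ℝ × Plane, ((deriv (deriv θ) z.1 * packet α β c (t - z.1) z.2) • φ z.1 z.2 -
      (deriv θ z.1 * packet α β (fun w => Complex.I * w * c w) (t - z.1) z.2) • φ z.1 z.2 +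
      (deriv θ z.1 * packet α β c (t - z.1) z.2) • timeDeriv I φ z.1 z.2) = 0 := by
    have hint := (i2.sub i1).add it
    rw [Measure.volume_eq_prod] at hint i0 ⊢
    have e := integral_prod_symm _ hint
    simp only [Pi.add_apply, Pi.sub_apply] at e
    rw [e]
    refine integral_eq_zero_of_ae ?_
    filter_upwards [hint.prod_left_ae, i0.prod_left_ae] with y hy1 hy0
    refine integral_eq_zero_of_hasDerivAt_of_integrable (f := fun s =>
      (deriv θ s * packet α β c (t - s) y) • φ s y) (fun s => ?_) hy1 hy0
    by_cases hs : s ∈ S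
    · have d1 := (((hθ1.differentiable (by simp) s).hasDerivAt).fun_mul
        (hasDerivAt_packet_sub (α := α) (β := β) hc.1 t s y))
      refine (d1.fun_smul (hφ.hasDerivAt hI (hθI hs) y)).congr_deriv ?_
      simp only [add_smul, Complex.real_smul]
      push_cast
      ring
    · have hev : (fun s => (deriv θ s * packet α β c (t - s) y) • φ s y) =ᶠ[𝓝 s] fun _ => 0 := by
        filter_upwards [(isClosed_tsupport θ).isOpen_compl.mem_nhds hs] with s' hs'
        rw [z1 s' hs', zero_mul, zero_smul]
      refine ((hasDerivAt_const s (0 : ℂ)).congr_of_eventuallyEq hev).congr_deriv ?_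
      rw [z1 s hs, z2 s hs]
      simp
  have hw := hbox.integral_packet h1 hF hα hαβ hc t hθ hθc hθI
  have e1 : ∫ z : ℝ × Plane, ((deriv θ z.1 * packet α β c (t - z.1) z.2) •
      timeDeriv I φ z.1 z.2 + (deriv θ z.1 *
        packet α β (fun w => Complex.I * w * c w) (t - z.1) z.2) • φ z.1 z.2) =
      ∫ z : ℝ × Plane, (θ z.1 * packet α β c (t - z.1) z.2) • F z.1 z.2 := by
    have i3 : Integrable (fun z : ℝ × Plane =>
        (-(deriv (deriv θ) z.1 * packet α β c (t - z.1) z.2) + 2 * (deriv θ z.1 *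
          packet α β (fun w => Complex.I * w * c w) (t - z.1) z.2)) • φ z.1 z.2) := by
      refine (i2.neg.add (i1.const_mul 2)).congr (Eventually.of_forall fun z => ?_)
      simp only [Complex.real_smul, Pi.add_apply, Pi.neg_apply]
      push_cast
      ring
    have e := integral_sub (it.add i1) i3
    simp only [Pi.add_apply] at e
    rw [← hw, ← sub_eq_zero, ← e, ← hzero]
    refine integral_congr_ae (Eventually.of_forall fun z => ?_)
    simp only [Complex.real_smul]
    push_cast
    ring
  have key : ∀ {h : ℝ → ℝ} {c : ℝ → ℂ} {f : ℝ → Plane → ℂ},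
      Integrable (fun z : ℝ × Plane => (h z.1 * packet α β c (t - z.1) z.2) • f z.1 z.2) →
      Integrable (fun s => h s • ∫ y, packet α β c (t - s) y • f s y) ∧
      ∫ z : ℝ × Plane, (h z.1 * packet α β c (t - z.1) z.2) • f z.1 z.2 =
      ∫ s, h s • ∫ y, packet α β c (t - s) y • f s y := by
    intro h c f hi
    have hs : ∀ s, ∫ y, (h s * packet α β c (t - s) y) • f s y =
        h s • ∫ y, packet α β c (t - s) y • f s y := fun s => by
      rw [← integral_smul]
      simp only [smul_smul]
    rw [Measure.volume_eq_prod] at hi ⊢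
    refine ⟨hi.integral_prod_left.congr (Eventually.of_forall hs), ?_⟩
    rw [integral_prod _ hi]
    exact integral_congr_ae (Eventually.of_forall hs)
  rw [integral_add it i1, (key it).2, (key i1).2, (key iF).2, ← integral_add (key it).1 (key i1).1]
    at e1
  rw [← e1]
  refine integral_congr_ae (Eventually.of_forall fun s => ?_)
  simp only [pairing, smul_add]

/-- Duhamel's formula in the weak form: the pairing with a packet changes by the pairing of the
packet with the forcing term. -/
theorem HasWeakBox.pairing_sub_pairing (hI : I.OrdConnected)
    (hbox : HasWeakBox I φ F) (hφ : IsLocalized a b k I φ)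
    (hF : ∫⁻ s in I, eLpNorm (F s) 2 volume < ⊤)
    (hα : 0 < α) (hαβ : α ≤ β) {c : ℝ → ℂ} (hc : IsAmplitude α β c) (t : ℝ) {t₁ t₂ : ℝ}
    (h12 : t₁ < t₂) (h1 : t₁ ∈ I) (h2 : t₂ ∈ I) :
    pairing α β c t φ (timeDeriv I φ) t₁ - pairing α β c t φ (timeDeriv I φ) t₂ =
      ∫ s in Ioo t₁ t₂, ∫ y, packet α β c (t - s) y • F s y := by
  have hIcc : Icc t₁ t₂ ⊆ I := hI.out h1 h2
  have hIoo : Ioo t₁ t₂ ⊆ interior I :=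
    interior_maximal (Ioo_subset_Icc_self.trans hIcc) isOpen_Ioo
  have hne : (interior I).Nonempty := (nonempty_Ioo.2 h12).mono hIoo
  refine sub_eq_neg_integral_of_weak_deriv h12 ?_ ?_ fun θ hθ hθc hθI =>
    hbox.integral_deriv_smul_pairing hI hφ hF hα hαβ hc t hθ hθc (hθI.trans hIoo)
  · exact (((hφ.l2ContinuousOn_timeDeriv hI hne).continuousOn_integral_packet hα hαβ hc t).add
      (hφ.l2ContinuousOn.continuousOn_integral_packet hα hαβ hc.I_mul t)).mono hIcc
  · obtain ⟨C, hC, h⟩ := exists_bound_packet hα hαβ hc t (isCompact_Icc (a := t₁) (b := t₂))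
    have hm : MeasurableSet (Ioo t₁ t₂) := measurableSet_Ioo
    have i := integrable_prod_of_decay (f := F) hm
      (h := fun z => (Ioo t₁ t₂).indicator (fun _ => 1) z.1 * packet α β c (t - z.1) z.2)
      (((measurable_const.indicator hm).comp measurable_fst).mul
        (contDiff_packet_sub hc.1 t).continuous.measurable).aestronglyMeasurable
      (hbox.1.aestronglyMeasurable.mono_measure
        (Measure.restrict_mono (prod_mono_left hIoo) le_rfl)) (C := C)
      (Eventually.of_forall fun z => ?_) (fun z hz => by simp [hz])
      ((lintegral_mono_set (hIoo.trans interior_subset)).trans_lt hF)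
    · rw [Measure.volume_eq_prod] at i
      rw [← integrable_indicator_iff hm]
      refine i.integral_prod_left.congr (Eventually.of_forall fun s => ?_)
      by_cases hs : s ∈ Ioo t₁ t₂ <;> simp [hs]
    · have hd := decay_pos ‖z.2‖
      by_cases hs : z.1 ∈ Ioo t₁ t₂
      · simpa [hs] using h z.1 (Ioo_subset_Icc_self hs) z.2
      · simp only [hs, not_false_eq_true, indicator_of_notMem, zero_mul, abs_zero]
        positivity

end RadialWave

end

/-! ### Reproducing formula for radial, frequency localized functions -/

noncomputable section

namespace RadialWave

variable {α β : ℝ}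

/-! ### Polar coordinates in the plane -/

/-- The point with polar coordinates `(ρ, θ)`. -/
def polarPoint (ρ θ : ℝ) : Plane := !₂[ρ * Real.cos θ, ρ * Real.sin θ]

theorem norm_polarPoint (ρ θ : ℝ) : ‖polarPoint ρ θ‖ = |ρ| := by
  rw [EuclideanSpace.norm_eq, polarPoint, ← Real.sqrt_sq_eq_abs]
  congr 1
  simp only [Real.norm_eq_abs, sq_abs, Fin.sum_univ_two]
  simp only [Matrix.cons_val_zero, Matrix.cons_val_one]
  linear_combination ρ ^ 2 * Real.sin_sq_add_cos_sq θ

theorem repr_polarCoord_symm (p : ℝ × ℝ) :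
    Complex.orthonormalBasisOneI.repr (Complex.polarCoord.symm p) = polarPoint p.1 p.2 := by
  ext i
  rw [Complex.polarCoord_symm_apply, polarPoint]
  fin_cases i <;> simp [Complex.orthonormalBasisOneI, Complex.cos_ofReal_re, Complex.sin_ofReal_re]

theorem integral_plane_polar {E : Type*} [NormedAddCommGroup E] [NormedSpace ℝ E] (f : Plane → E) :
    ∫ y, f y = ∫ p in Ioi (0 : ℝ) ×ˢ Ioo (-Real.pi) Real.pi, p.1 • f (polarPoint p.1 p.2) := by
  have h := (Complex.orthonormalBasisOneI.repr.measurePreserving).integral_comp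
    Complex.orthonormalBasisOneI.repr.toMeasurableEquiv.measurableEmbedding f
  rw [← h, ← Complex.integral_comp_polarCoord_symm]
  simp only [repr_polarCoord_symm]
  rfl

theorem lintegral_plane_polar (f : Plane → ℝ≥0∞) :
    ∫⁻ y, f y = ∫⁻ p in Ioi (0 : ℝ) ×ˢ Ioo (-Real.pi) Real.pi,
      ENNReal.ofReal p.1 * f (polarPoint p.1 p.2) := by
  have h := (Complex.orthonormalBasisOneI.repr.measurePreserving).lintegral_comp_emb
    Complex.orthonormalBasisOneI.repr.toMeasurableEquiv.measurableEmbedding f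
  rw [← h, ← Complex.lintegral_comp_polarCoord_symm]
  simp only [repr_polarCoord_symm]
  rfl

theorem lintegral_plane_radial {g : ℝ → ℝ≥0∞} (hg : Measurable g) :
    ∫⁻ y : Plane, g ‖y‖ = ENNReal.ofReal (2 * Real.pi) *
      ∫⁻ ρ in Ioi (0 : ℝ), ENNReal.ofReal ρ * g ρ := by
  rw [lintegral_plane_polar, Measure.volume_eq_prod, ← Measure.prod_restrict]
  have h : ∫⁻ p, ENNReal.ofReal p.1 * g ‖polarPoint p.1 p.2‖
      ∂(volume.restrict (Ioi (0 : ℝ))).prod (volume.restrict (Ioo (-Real.pi) Real.pi)) =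
      ∫⁻ p, ENNReal.ofReal p.1 * g |p.1|
      ∂(volume.restrict (Ioi (0 : ℝ))).prod (volume.restrict (Ioo (-Real.pi) Real.pi)) := by
    simp only [norm_polarPoint]
  rw [h, lintegral_prod _ (by fun_prop)]
  simp only [lintegral_const, Measure.restrict_apply_univ, Real.volume_Ioo]
  rw [lintegral_mul_const _ (by fun_prop), mul_comm, show Real.pi - -Real.pi = 2 * Real.pi by ring]
  congr 1
  refine setLIntegral_congr_fun measurableSet_Ioi fun ρ hρ => ?_
  rw [abs_of_pos hρ]

/-! ### The Fourier transform of a radial bump -/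

/-- In polar coordinates the angular integral of the cosine is 2πJ₀, and the radial integral is
confined to the support of h. -/
theorem integral_radial_mul_cos {h : ℝ → ℝ} (hh : Continuous h) (hα : 0 < α) (hαβ : α ≤ β)
    (h0 : ∀ ρ ∉ Ioo α β, h ρ = 0) (y : Plane) :
    ∫ ξ : Plane, h ‖ξ‖ * Real.cos (2 * Real.pi * inner ℝ ξ y) =
      ∫ ρ in α..β, 2 * Real.pi * ρ * h ρ * besselJ (‖y‖ * (2 * Real.pi * ρ)) := by
  rw [integral_plane_polar]
  have hin : ∀ p : ℝ × ℝ, inner ℝ (polarPoint p.1 p.2) y =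
      p.1 * (y 0 * Real.cos p.2 + y 1 * Real.sin p.2) := fun p => by
    rw [PiLp.inner_apply, Fin.sum_univ_two]
    simp [polarPoint]
    ring
  simp only [norm_polarPoint, hin, smul_eq_mul]
  have hsub : Ioc α β ×ˢ Ioc (-Real.pi) Real.pi ⊆ Ioi (0 : ℝ) ×ˢ Ioc (-Real.pi) Real.pi :=
    prod_mono (fun ρ hρ => hα.trans hρ.1) le_rfl
  set G : ℝ × ℝ → ℝ := fun p => p.1 * (h |p.1| *
    Real.cos (2 * Real.pi * (p.1 * (y 0 * Real.cos p.2 + y 1 * Real.sin p.2)))) with hG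
  have hGc : Continuous G := by rw [hG]; fun_prop
  have hae : (Ioi (0 : ℝ) ×ˢ Ioo (-Real.pi) Real.pi : Set (ℝ × ℝ)) =ᵐ[volume]
      Ioi (0 : ℝ) ×ˢ Ioc (-Real.pi) Real.pi := by
    rw [Measure.volume_eq_prod]
    exact Measure.set_prod_ae_eq ae_eq_rfl Ioo_ae_eq_Ioc
  rw [setIntegral_congr_set hae, setIntegral_eq_of_subset_of_forall_sdiff_eq_zero
    (measurableSet_Ioi.prod measurableSet_Ioc) hsub]
  · have hint : IntegrableOn G (Ioc α β ×ˢ Ioc (-Real.pi) Real.pi) (volume.prod volume) := by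
      refine IntegrableOn.mono_set (t := Icc α β ×ˢ Icc (-Real.pi) Real.pi) ?_
        (prod_mono Ioc_subset_Icc_self Ioc_subset_Icc_self)
      exact hGc.continuousOn.integrableOn_compact (isCompact_Icc.prod isCompact_Icc)
    rw [Measure.volume_eq_prod, setIntegral_prod _ hint, intervalIntegral.integral_of_le hαβ]
    refine setIntegral_congr_fun measurableSet_Ioc fun ρ hρ => ?_
    have hρ0 : 0 < ρ := hα.trans hρ.1
    rw [← intervalIntegral.integral_of_le (by linarith [Real.pi_pos]), hG]
    simp only [abs_of_pos hρ0]
    rw [intervalIntegral.integral_const_mul, intervalIntegral.integral_const_mul]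
    have := integral_cos_inner y (2 * Real.pi * ρ)
    simp only [mul_assoc] at this ⊢
    rw [this]
    ring
  · intro p hp
    have hp1 : (0 : ℝ) < p.1 := hp.1.1
    have : p.1 ∉ Ioo α β := fun h => hp.2 ⟨⟨h.1, h.2.le⟩, hp.1.2⟩
    simp only [abs_of_pos hp1, h0 _ this, zero_mul, mul_zero]

theorem fourier_radial {h : ℝ → ℝ} (hh : Continuous h) (hα : 0 < α) (hαβ : α ≤ β)
    (h0 : ∀ ρ ∉ Ioo α β, h ρ = 0) (y : Plane) :
    𝓕 (fun ξ : Plane => (h ‖ξ‖ : ℂ)) y =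
      ((∫ ρ in α..β, 2 * Real.pi * ρ * h ρ * besselJ (‖y‖ * (2 * Real.pi * ρ)) : ℝ) : ℂ) := by
  rw [← integral_radial_mul_cos hh hα hαβ h0, Real.fourier_eq']
  have hc : Continuous fun ξ : Plane => h ‖ξ‖ := hh.comp continuous_norm
  have hcs : HasCompactSupport fun ξ : Plane => h ‖ξ‖ := by
    refine HasCompactSupport.of_support_subset_isCompact (isCompact_closedBall (0 : Plane) β)
      fun ξ hξ => ?_
    rw [mem_closedBall_zero_iff]
    by_contra hlt
    exact hξ (h0 _ fun h => hlt h.2.le)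
  have hi : Integrable fun ξ : Plane => h ‖ξ‖ := hc.integrable_of_hasCompactSupport hcs
  set f : Plane → ℂ := fun ξ =>
    Complex.exp (↑(-2 * Real.pi * inner ℝ ξ y) * Complex.I) • (h ‖ξ‖ : ℂ) with hf
  have hfi : Integrable f := by
    refine (hi.ofReal (𝕜 := ℂ)).bdd_mul (c := 1) (f := fun ξ : Plane =>
      Complex.exp (↑(-2 * Real.pi * inner ℝ ξ y) * Complex.I)) ?_ ?_
    · exact (by fun_prop : Continuous fun ξ : Plane =>
        Complex.exp (↑(-2 * Real.pi * inner ℝ ξ y) * Complex.I)).aestronglyMeasurable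
    · exact Eventually.of_forall fun ξ => (Complex.norm_exp_ofReal_mul_I _).le
  have h2 : ∫ ξ, f ξ = ∫ ξ, f (-ξ) := (integral_neg_eq_self f volume).symm
  -- Averaging over ξ and -ξ replaces the exponential by a cosine, because the function being
  -- transformed is even.
  have h3 : ∫ ξ, f ξ = ∫ ξ, (2 : ℂ)⁻¹ * (f ξ + f (-ξ)) := by
    rw [integral_const_mul, integral_add hfi hfi.comp_neg, ← h2]
    ring
  rw [h3, ← integral_complex_ofReal]
  refine integral_congr_ae (Eventually.of_forall fun ξ => ?_)
  simp only [hf, norm_neg, inner_neg_left, smul_eq_mul]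
  push_cast
  rw [Complex.cos]
  ring_nf

/-- The singularity of the norm at the origin is invisible, since h vanishes near 0. -/
theorem contDiff_radial {h : ℝ → ℝ} (hh : ContDiff ℝ ∞ h) (hα : 0 < α)
    (h0 : ∀ ρ ∉ Ioo α β, h ρ = 0) : ContDiff ℝ ∞ (fun ξ : Plane => (h ‖ξ‖ : ℂ)) := by
  rw [contDiff_iff_contDiffAt]
  intro ξ
  by_cases hξ : ξ = 0
  · have : (fun ξ : Plane => (h ‖ξ‖ : ℂ)) =ᶠ[𝓝 ξ] fun _ => 0 := by
      rw [hξ]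
      filter_upwards [Metric.ball_mem_nhds (0 : Plane) hα] with η hη
      rw [mem_ball_zero_iff] at hη
      rw [h0 _ fun h => absurd h.1 hη.le.not_gt, Complex.ofReal_zero]
    exact contDiffAt_const.congr_of_eventuallyEq this
  · exact Complex.ofRealCLM.contDiff.contDiffAt.comp ξ (hh.contDiffAt.comp ξ (contDiffAt_norm ℝ hξ))

end RadialWave

end

noncomputable section

namespace RadialWave

variable {α β : ℝ}

/-! ### The reproducing formula for frequency localized radial functions -/

/-- The Fourier transform of a square integrable function, as a function. -/
def fourierL2 {f : Plane → ℂ} (hf : MemLp f 2 volume) : Plane → ℂ :=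
  (𝓕 (hf.toLp f) : Lp ℂ 2 (volume : Measure Plane))

theorem memLp_fourierL2 {f : Plane → ℂ} (hf : MemLp f 2 volume) :
    MemLp (fourierL2 hf) 2 volume := Lp.memLp _

/-- The transform of an L² function agrees with its transform as a tempered distribution, so 𝓕 may
be moved onto a Schwartz function. -/
theorem integral_fourier_smul_eq_of_memLp {f : Plane → ℂ} (hf : MemLp f 2 volume)
    (ψ : SchwartzMap Plane ℂ) : ∫ x, (𝓕 ψ) x • f x =
      ∫ ξ, ψ ξ • fourierL2 hf ξ := by
  have h := congrArg (fun T => T ψ) (Lp.fourier_toTemperedDistribution_eq (hf.toLp f))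
  simp only [TemperedDistribution.fourier_apply, Lp.toTemperedDistribution_apply] at h
  refine Eq.trans ?_ h
  refine integral_congr_ae ?_
  filter_upwards [hf.coeFn_toLp] with x hx
  rw [hx]

/-- An L² function vanishing outside a bounded set is integrable; this is what makes pointwise
Fourier inversion available. -/
theorem HasFourierSupport.integrable {f : Plane → ℂ} {A : Set Plane} (hA : Bornology.IsBounded A)
    (hf : HasFourierSupport f A) :
    Integrable (fourierL2 hf.1) := by
  set g : Plane → ℂ := fourierL2 hf.1
  obtain ⟨R, hR⟩ := hA.subset_closedBall 0
  have hfin : IsFiniteMeasure (volume.restrict (Metric.closedBall (0 : Plane) R)) :=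
    ⟨by simpa using! (measure_closedBall_lt_top : volume (Metric.closedBall (0 : Plane) R) < ⊤)⟩
  have h1 : IntegrableOn g (Metric.closedBall 0 R) :=
    memLp_one_iff_integrable.1 (((memLp_fourierL2 hf.1).restrict _).mono_exponent one_le_two)
  refine h1.integrable_of_ae_notMem_eq_zero ?_
  have hf2 : ∀ᵐ ξ, ξ ∉ A → fourierL2 hf.1 ξ = 0 := hf.2
  filter_upwards [hf2] with ξ hξ hξ'
  exact hξ fun h => hξ' (hR h)

/-- Testing with smooth compactly supported η and moving the transform across gives equality almost
everywhere. Both sides are continuous, so it holds at every point. -/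
theorem HasFourierSupport.eq_fourierInv {f : Plane → ℂ} {A : Set Plane}
    (hA : Bornology.IsBounded A) (hf : HasFourierSupport f A) (hfc : Continuous f) (x : Plane) :
    f x = 𝓕⁻ (fourierL2 hf.1) x := by
  have hg := hf.integrable hA
  set g : Plane → ℂ := fourierL2 hf.1 with hgdef
  have hneg : Continuous fun p : Plane × Plane => (-innerₗ Plane) p.1 p.2 :=
    (continuous_inner (𝕜 := ℝ) (E := Plane)).neg
  have hflip : (-innerₗ Plane).flip = -innerₗ Plane := by
    ext x y
    simp [real_inner_comm]
  have hgc : Continuous (𝓕⁻ g) :=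
    VectorFourier.fourierIntegral_continuous Real.continuous_fourierChar
      hneg hg
  have hae : ∀ᵐ x, f x = 𝓕⁻ g x := by
    refine ae_eq_of_integral_contDiff_smul_eq hfc.locallyIntegrable hgc.locallyIntegrable
      fun η hη hηc => ?_
    have hηc' : HasCompactSupport fun x => (η x : ℂ) := hηc.comp_left Complex.ofReal_zero
    set ψ : SchwartzMap Plane ℂ :=
      hηc'.toSchwartzMap (Complex.ofRealCLM.contDiff.comp hη) with hψ
    have hψη : ∀ x, ψ x = (η x : ℂ) := fun x => rfl
    have h1 := integral_fourier_smul_eq_of_memLp hf.1 (𝓕⁻ ψ)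
    rw [FourierTransform.fourier_fourierInv_eq] at h1
    have h2 : ∫ ξ, (𝓕⁻ ψ) ξ • g ξ = ∫ x, ψ x • 𝓕⁻ g x := by
      rw [SchwartzMap.fourierInv_coe]
      have := VectorFourier.integral_fourierIntegral_smul_eq_flip (L := -innerₗ Plane)
        (μ := volume) (ν := volume) (f := ψ) (g := g) Real.continuous_fourierChar
        hneg ψ.integrable hg
      rw [hflip] at this
      exact this
    rw [h2] at h1
    simpa only [hψη, Complex.coe_smul, smul_eq_mul, Complex.real_smul] using h1
  exact congrFun (Continuous.ae_eq_iff_eq volume hfc hgc |>.1 hae) x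

/-- As f is constant on the circle of radius |x|, the inversion formula may be averaged over that
circle. Averaging the plane waves produces J₀, and Fubini applies because the transform is
integrable. -/
theorem HasFourierSupport.eq_integral_besselJ {f : Plane → ℂ} {A : Set Plane}
    (hA : Bornology.IsBounded A) (hf : HasFourierSupport f A) (hfc : Continuous f)
    (hfr : IsRadial f) (x : Plane) :
    f x = ∫ ξ, (besselJ (‖ξ‖ * (2 * Real.pi * ‖x‖)) : ℂ) *
      fourierL2 hf.1 ξ := by
  have hg := hf.integrable hA
  have hinv := hf.eq_fourierInv hA hfc
  set g : Plane → ℂ := fourierL2 hf.1 with hgdef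
  have he : ∀ p : Plane, Integrable fun ξ =>
      Complex.exp (↑(2 * Real.pi * inner ℝ ξ p) * Complex.I) * g ξ := fun p =>
    hg.bdd_mul (c := 1) (by fun_prop : Continuous fun ξ : Plane =>
        Complex.exp (↑(2 * Real.pi * inner ℝ ξ p) * Complex.I)).aestronglyMeasurable
      (Eventually.of_forall fun ξ => (Complex.norm_exp_ofReal_mul_I _).le)
  -- Inversion at p and at -p, two points of the same circle, is averaged so that only a cosine
  -- remains.
  have hcos : ∀ θ : ℝ, f x = ∫ ξ : Plane,
      (Real.cos (2 * Real.pi * ‖x‖ * (ξ 0 * Real.cos θ + ξ 1 * Real.sin θ)) : ℂ) * g ξ := by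
    intro θ
    set p := polarPoint ‖x‖ θ with hp
    have hpn : ‖p‖ = ‖x‖ := by rw [hp, norm_polarPoint, abs_of_nonneg (norm_nonneg x)]
    have h1 := hinv p
    have h2 := hinv (-p)
    rw [hfr p x hpn, Real.fourierInv_eq'] at h1
    rw [hfr (-p) x (by rw [norm_neg, hpn]), Real.fourierInv_eq'] at h2
    have h3 : f x = (2 : ℂ)⁻¹ * (f x + f x) := by ring
    rw [h3]
    nth_rewrite 1 [h1]
    rw [h2]
    simp only [smul_eq_mul]
    rw [← integral_add (he p) (he (-p)), ← integral_const_mul]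
    refine integral_congr_ae (Eventually.of_forall fun ξ => ?_)
    have hin : inner ℝ ξ p = ‖x‖ * (ξ 0 * Real.cos θ + ξ 1 * Real.sin θ) := by
      rw [PiLp.inner_apply, Fin.sum_univ_two]
      simp [hp, polarPoint]
      ring
    simp only [inner_neg_right, hin]
    rw [Complex.ofReal_cos, Complex.cos]
    push_cast
    ring_nf
  have hswap : ∫ θ in Ioc (-Real.pi) Real.pi, ∫ ξ : Plane,
      (Real.cos (2 * Real.pi * ‖x‖ * (ξ 0 * Real.cos θ + ξ 1 * Real.sin θ)) : ℂ) * g ξ =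
      ∫ ξ : Plane, ∫ θ in Ioc (-Real.pi) Real.pi,
      (Real.cos (2 * Real.pi * ‖x‖ * (ξ 0 * Real.cos θ + ξ 1 * Real.sin θ)) : ℂ) * g ξ := by
    refine integral_integral_swap ?_
    refine (hg.comp_snd (volume.restrict (Ioc (-Real.pi) Real.pi))).bdd_mul (c := 1)
      (f := fun q : ℝ × Plane => (Real.cos (2 * Real.pi * ‖x‖ *
        (q.2 0 * Real.cos q.1 + q.2 1 * Real.sin q.1)) : ℂ)) ?_ ?_
    · exact (by fun_prop : Continuous fun q : ℝ × Plane => (Real.cos (2 * Real.pi * ‖x‖ *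
        (q.2 0 * Real.cos q.1 + q.2 1 * Real.sin q.1)) : ℂ)).aestronglyMeasurable
    · refine Eventually.of_forall fun q => ?_
      rw [Complex.norm_real, Real.norm_eq_abs]
      exact Real.abs_cos_le_one _
  have hpi : (0 : ℝ) < 2 * Real.pi := by positivity
  have hL : ∫ θ in Ioc (-Real.pi) Real.pi, f x = (2 * Real.pi : ℝ) * f x := by
    rw [setIntegral_const, Real.volume_real_Ioc, max_eq_left (by linarith [Real.pi_pos]),
      Complex.real_smul]
    congr 2
    ring
  have hR : ∀ ξ : Plane, ∫ θ in Ioc (-Real.pi) Real.pi,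
      (Real.cos (2 * Real.pi * ‖x‖ * (ξ 0 * Real.cos θ + ξ 1 * Real.sin θ)) : ℂ) * g ξ =
      (2 * Real.pi : ℝ) * ((besselJ (‖ξ‖ * (2 * Real.pi * ‖x‖)) : ℂ) * g ξ) := fun ξ => by
    rw [integral_mul_const, integral_complex_ofReal,
      ← intervalIntegral.integral_of_le (by linarith [Real.pi_pos]), integral_cos_inner]
    push_cast
    ring
  have hfin : (2 * Real.pi : ℝ) * f x = (2 * Real.pi : ℝ) *
      ∫ ξ, (besselJ (‖ξ‖ * (2 * Real.pi * ‖x‖)) : ℂ) * g ξ := by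
    rw [← hL, ← integral_const_mul, ← integral_congr_ae (Eventually.of_forall hR), ← hswap]
    exact setIntegral_congr_fun measurableSet_Ioc fun θ _ => hcos θ
  exact mul_left_cancel₀ (by exact_mod_cast hpi.ne') hfin

/-- The amplitude of the reproducing kernel, for the frequency cut-off `m`. -/
def kernelAmp (m : ℝ → ℝ) (r w : ℝ) : ℂ :=
  ((m w * (w * (2 * Real.pi)⁻¹) * besselJ (r * w) : ℝ) : ℂ)

/-- On the frequency support the factor J₀ in the inversion formula may be multiplied by the cut-off
m(2π|ξ|). The product is a radial test function, so by duality its Fourier transform is paired with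
f itself, and that transform is a packet at time 0. -/
theorem HasFourierSupport.eq_integral_packet {f : Plane → ℂ} {A : Set Plane}
    (hA : Bornology.IsBounded A) (hf : HasFourierSupport f A) (hfc : Continuous f)
    (hfr : IsRadial f) (hα : 0 < α) (hαβ : α ≤ β) {m : ℝ → ℝ} (hm : ContDiff ℝ ∞ m)
    (hm0 : ∀ w ∉ Ioo α β, m w = 0) (hm1 : ∀ ξ ∈ A, m (2 * Real.pi * ‖ξ‖) = 1) (x : Plane) :
    f x = ∫ y, packet α β (kernelAmp m ‖x‖) 0 y • f y := by
  have hpi : (0 : ℝ) < 2 * Real.pi := by positivity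
  set h : ℝ → ℝ := fun ρ => m (2 * Real.pi * ρ) * besselJ (‖x‖ * (2 * Real.pi * ρ)) with hh
  have hJ : ContDiff ℝ ∞ besselJ := contDiff_besselJ
  have hhc : ContDiff ℝ ∞ h := (hm.comp (contDiff_const.mul contDiff_id)).mul
    (hJ.comp (contDiff_const.mul (contDiff_const.mul contDiff_id)))
  have hα' : 0 < α / (2 * Real.pi) := by positivity
  have hαβ' : α / (2 * Real.pi) ≤ β / (2 * Real.pi) := by gcongr
  have h0 : ∀ ρ ∉ Ioo (α / (2 * Real.pi)) (β / (2 * Real.pi)), h ρ = 0 := fun ρ hρ => by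
    rw [hh]
    beta_reduce
    rw [hm0, zero_mul]
    rintro ⟨h1, h2⟩
    exact hρ ⟨by rwa [div_lt_iff₀' hpi], by rwa [lt_div_iff₀' hpi]⟩
  have hcs : HasCompactSupport fun ξ : Plane => (h ‖ξ‖ : ℂ) := by
    refine HasCompactSupport.of_support_subset_isCompact
      (isCompact_closedBall (0 : Plane) (β / (2 * Real.pi))) fun ξ hξ => ?_
    rw [mem_closedBall_zero_iff]
    by_contra hlt
    exact hξ (by beta_reduce; rw [h0 _ fun h => hlt h.2.le, Complex.ofReal_zero])
  set ψ : SchwartzMap Plane ℂ := hcs.toSchwartzMap (contDiff_radial hhc hα' h0) with hψdef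
  have hψ : ∀ ξ, ψ ξ = (h ‖ξ‖ : ℂ) := fun ξ => rfl
  have hF : ∀ y, (𝓕 ψ) y = (packet α β (kernelAmp m ‖x‖) 0 y : ℂ) := fun y => by
    rw [SchwartzMap.fourier_coe]
    have e := fourier_radial hhc.continuous hα' hαβ' h0 y
    refine Eq.trans e (congrArg _ ?_)
    rw [packet]
    -- The substitution ω = 2πρ passes from the variable of the Fourier transform to angular
    -- frequency and leaves the factor (2π)⁻¹ of the kernel amplitude.
    have hsub := intervalIntegral.integral_comp_mul_left (a := α / (2 * Real.pi))
      (b := β / (2 * Real.pi)) (fun w => w * (m w * besselJ (‖x‖ * w)) * besselJ (‖y‖ * w))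
      hpi.ne'
    rw [mul_div_cancel₀ _ hpi.ne', mul_div_cancel₀ _ hpi.ne'] at hsub
    simp only [hh]
    rw [hsub, smul_eq_mul, ← intervalIntegral.integral_const_mul]
    refine intervalIntegral.integral_congr fun w _ => ?_
    simp only [kernelAmp, Complex.ofReal_zero, zero_mul, mul_zero, Complex.exp_zero, mul_one,
      Complex.ofReal_re]
    ring
  have h1 := integral_fourier_smul_eq_of_memLp hf.1 ψ
  simp only [hF, smul_eq_mul, Complex.real_smul] at h1 ⊢
  rw [h1, hf.eq_integral_besselJ hA hfc hfr x]
  refine integral_congr_ae ?_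
  have hf2 : ∀ᵐ ξ, ξ ∉ A → fourierL2 hf.1 ξ = 0 := hf.2
  filter_upwards [hf2] with ξ hξ
  by_cases hξA : ξ ∈ A
  · rw [hψ, hh]
    beta_reduce
    rw [hm1 ξ hξA, one_mul]
    congr 3
    ring
  · rw [hξ hξA, mul_zero, mul_zero]

end RadialWave

end

/-! ### Kernel bounds and representation of the wave by packets -/

noncomputable section

namespace RadialWave

variable {α β : ℝ}

/-! ### Kernel bounds at frequency scale `N` -/

/-- The profile of incoming and outgoing waves at frequency `N`. -/
def wave (N v ρ : ℝ) : ℝ := decay (N * (v + ρ)) + decay (N * (v - ρ))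

theorem wave_pos (N v ρ : ℝ) : 0 < wave N v ρ := add_pos (decay_pos _) (decay_pos _)

/-- The majorant of the kernels at frequency `N`. -/
def kern (N σ e r τ ρ : ℝ) : ℝ :=
  (1 + N * ρ) ^ (-(1 / 2) : ℝ) * ((1 + N * r) ^ (-(1 / 2) : ℝ) * wave N (τ + σ * r) ρ +
    (1 + N * r) ^ (-e) * wave N (τ - σ * r) ρ)

theorem kern_nonneg {N r ρ : ℝ} (hN : 0 ≤ N) (hr : 0 ≤ r) (hρ : 0 ≤ ρ) (σ e τ : ℝ) :
    0 ≤ kern N σ e r τ ρ := by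
  have := (wave_pos N (τ + σ * r) ρ).le
  have := (wave_pos N (τ - σ * r) ρ).le
  unfold kern
  positivity

/-- The substitution ω = Nu reduces all estimates to unit frequency, which is why their constants do
not depend on k. -/
theorem integral_profile_scale (B : ℝ → ℝ) (c : ℝ → ℂ) {N : ℝ} (hN : 0 < N) (τ ρ : ℝ) :
    ∫ w in (N * α)..(N * β), (c (w / N) * Complex.exp (Complex.I * (τ * w))).re * B (ρ * w) =
      N * ∫ u in α..β,
        (c u * Complex.exp (Complex.I * ((N * τ : ℝ) * u))).re * B (N * ρ * u) := by
  have h := intervalIntegral.integral_comp_mul_left (a := α) (b := β) (fun w : ℝ =>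
    (c (w / N) * Complex.exp (Complex.I * (τ * w))).re * B (ρ * w)) hN.ne'
  rw [smul_eq_mul, eq_comm, inv_mul_eq_iff_eq_mul₀ hN.ne'] at h
  rw [h]
  congr 1
  refine intervalIntegral.integral_congr fun u _ => ?_
  rw [mul_div_cancel_left₀ _ hN.ne', show ρ * (N * u) = N * ρ * u by ring,
    show (τ : ℂ) * ((N * u : ℝ) : ℂ) = ((N * τ : ℝ) : ℂ) * u by push_cast; ring]

theorem abs_integral_profile_le (hαβ : α ≤ β) {ψ T : ℝ → ℂ} {c₀ d σ r c₁ c₂ : ℝ}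
    (hψ : C2Zero α β ψ c₀) (hψc : Continuous ψ) (hTc : Continuous T)
    (hT : HasAmp α β T σ r c₁ c₂) {B : ℝ → ℝ} (hBc : Continuous B)
    (hB : ∀ ρ, 0 ≤ ρ → HasAmp α β (fun x => B (ρ * x)) 1 ρ (d * (1 + ρ) ^ (-(1 / 2) : ℝ))
      (d * (1 + ρ) ^ (-(1 / 2) : ℝ))) (τ : ℝ) {ρ : ℝ} (hρ : 0 ≤ ρ) :
    |∫ w in α..β, (ψ w * T w * Complex.exp (Complex.I * (τ * w))).re * B (ρ * w)| ≤
      32 * (β - α) * c₀ * d * ((1 + ρ) ^ (-(1 / 2) : ℝ) * (c₁ * wave 1 (τ + σ * r) ρ +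
        c₂ * wave 1 (τ - σ * r) ρ)) := by
  have h := norm_integral_hasAmp_le hαβ hψ hT (hB ρ hρ) τ
  have e : ∀ w : ℝ, (ψ w * T w * Complex.exp (Complex.I * (τ * w))).re * B (ρ * w) =
      (ψ w * T w * Complex.exp (Complex.I * (τ * w)) * B (ρ * w)).re := fun w => by
    rw [Complex.re_mul_ofReal]
  simp only [e]
  refine (abs_integral_re_le hαβ ?_).trans (h.trans (le_of_eq ?_))
  · refine Continuous.intervalIntegrable ?_ _ _
    exact ((hψc.mul hTc).mul (by fun_prop)).mul
      (Complex.continuous_ofReal.comp (hBc.comp (continuous_const.mul continuous_id)))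
  · simp only [wave, one_mul]
    ring

/-- A family of smooth amplitudes with phase `σ r ω` and size `(1 + r)^{-1/2}`, up to an error
with the opposite phase and size `(1 + r)^{-e}`. -/
structure AmpFamily (α β : ℝ) (T : ℝ → ℝ → ℂ) (σ e : ℝ) : Prop where
  contDiff : ∀ r, ContDiff ℝ ∞ (T r)
  hasAmp : ∃ C, 0 ≤ C ∧ ∀ r, 0 ≤ r →
    HasAmp α β (T r) σ r (C * (1 + r) ^ (-(1 / 2) : ℝ)) (C * (1 + r) ^ (-e))

theorem HasAmp.const_mul {T : ℝ → ℂ} {σ r c₁ c₂ : ℝ} (hT : HasAmp α β T σ r c₁ c₂) {z : ℂ}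
    (hz : ‖z‖ = 1) : HasAmp α β (fun x => z * T x) σ r c₁ c₂ := by
  obtain ⟨A₁, A₂, h1, h2, h⟩ := hT
  have e1 := h1.const_mul z
  have e2 := h2.const_mul z
  rw [hz, one_mul] at e1 e2
  exact ⟨_, _, e1, e2, fun x hx => by beta_reduce; rw [h x hx]; ring⟩

theorem ampFamily_besselJ (hα : 0 < α) (β : ℝ) :
    AmpFamily α β (fun r w => besselJ (r * w)) 1 (1 / 2) :=
  ⟨fun _ => contDiff_besselJ_ofReal.comp (contDiff_const.mul contDiff_id),
    exists_hasAmp_besselJ hα (by norm_num)⟩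

theorem ampFamily_null (hα : 0 < α) (β : ℝ) {σ : ℝ} (hσ : σ ^ 2 = 1) :
    AmpFamily α β (fun r w => besselJ (r * w) - Complex.I * σ * besselJ' (r * w)) σ (3 / 2) :=
  ⟨fun r => (contDiff_besselJ_ofReal.sub (contDiff_const.mul contDiff_besselJ'_ofReal)).comp
    (contDiff_const.mul contDiff_id : ContDiff ℝ ∞ fun w : ℝ => r * w),
    exists_hasAmp_null hα hσ⟩

/-- After rescaling to unit frequency this is the four-phase estimate, with T carrying the
dependence on r = |x| and J₀ or J₀' the dependence on ρ. The second bound, with the extra factor -i,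
is the one needed once the data term has been integrated by parts. -/
theorem AmpFamily.exists_kern_bound (hα : 0 < α) (hαβ : α ≤ β) {T : ℝ → ℝ → ℂ} {σ e : ℝ}
    (hT : AmpFamily α β T σ e) {ψ : ℝ → ℂ} (hψ : IsAmplitude α β ψ) :
    ∃ C, 0 ≤ C ∧ ∀ N r, 0 < N → 0 ≤ r → ∀ τ,
      (∀ y, |packet (N * α) (N * β) (fun w => ψ (w / N) * T (N * r) (w / N)) τ y| ≤
        C * N * kern N σ e r τ ‖y‖) ∧
      ∀ ρ, 0 ≤ ρ → |packet' (N * α) (N * β)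
        (fun w => -Complex.I * (ψ (w / N) * T (N * r) (w / N))) τ ρ| ≤
        C * N * kern N σ e r τ ρ := by
  obtain ⟨c0, hc0, hz⟩ := hψ.exists_c2Zero
  obtain ⟨d, hd, h1⟩ := exists_hasAmp_besselJ (β := β) hα (σ := 1) (by norm_num)
  obtain ⟨d', hd', h2⟩ := exists_hasAmp_besselJ' (β := β) hα (σ := 1) (by norm_num)
  obtain ⟨C, hC, h3⟩ := hT.hasAmp
  have hβα : 0 ≤ β - α := by linarith
  have hw : ∀ N v ρ : ℝ, wave 1 (N * v) (N * ρ) = wave N v ρ := fun N v ρ => by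
    simp only [wave, one_mul, mul_add, mul_sub]
  have key : ∀ (B : ℝ → ℝ) (b : ℝ) (T' : ℝ → ℝ → ℂ), Continuous B → 0 ≤ b →
      (∀ r, 0 ≤ r → HasAmp α β (fun x => B (r * x)) 1 r (b * (1 + r) ^ (-(1 / 2) : ℝ))
        (b * (1 + r) ^ (-(1 / 2) : ℝ))) → (∀ r, Continuous (T' r)) → (∀ r, 0 ≤ r →
        HasAmp α β (T' r) σ r (C * (1 + r) ^ (-(1 / 2) : ℝ)) (C * (1 + r) ^ (-e))) →
      ∀ N r, 0 < N → 0 ≤ r → ∀ τ ρ : ℝ, 0 ≤ ρ → |∫ w in (N * α)..(N * β),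
        (ψ (w / N) * T' (N * r) (w / N) * Complex.exp (Complex.I * (τ * w))).re * B (ρ * w)| ≤
        (32 * (β - α) * c0 * b * C) * N * kern N σ e r τ ρ := by
    intro B b T' hB hb hB2 hTc hT2 N r hN hr τ ρ hρ
    rw [integral_profile_scale B (fun u => ψ u * T' (N * r) u) hN, abs_mul, abs_of_pos hN]
    have := abs_integral_profile_le hαβ hz hψ.1.continuous (hTc (N * r))
      (hT2 (N * r) (by positivity)) hB hB2 (N * τ) (ρ := N * ρ) (by positivity)
    rw [show N * τ + σ * (N * r) = N * (τ + σ * r) by ring,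
      show N * τ - σ * (N * r) = N * (τ - σ * r) by ring, hw, hw] at this
    refine (mul_le_mul_of_nonneg_left this hN.le).trans (le_of_eq ?_)
    rw [kern]
    ring
  refine ⟨32 * (β - α) * c0 * d * C + 32 * (β - α) * c0 * d' * C, by positivity,
    fun N r hN hr τ => ⟨fun y => ?_, fun ρ hρ => ?_⟩⟩
  · refine (key besselJ d T contDiff_besselJ.continuous hd h1 (fun r => (hT.contDiff r).continuous)
      h3 N r hN hr τ ‖y‖ (norm_nonneg y)).trans ?_
    have := kern_nonneg hN.le hr (norm_nonneg y) σ e τ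
    gcongr
    exact le_add_of_nonneg_right (by positivity)
  · have := key besselJ' d' (fun r w => -Complex.I * T r w) contDiff_besselJ'.continuous hd' h2
      (fun r => continuous_const.mul (hT.contDiff r).continuous)
      (fun r hr => (h3 r hr).const_mul (by simp)) N r hN hr τ ρ hρ
    have e1 : packet' (N * α) (N * β)
        (fun w => -Complex.I * (ψ (w / N) * T (N * r) (w / N))) τ ρ =
        ∫ w in (N * α)..(N * β), (ψ (w / N) * (-Complex.I * T (N * r) (w / N)) *
          Complex.exp (Complex.I * (τ * w))).re * besselJ' (ρ * w) := by
      rw [packet']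
      refine intervalIntegral.integral_congr fun w _ => ?_
      congr 3
      ring
    rw [e1]
    refine this.trans ?_
    have := kern_nonneg hN.le hr hρ σ e τ
    gcongr
    exact le_add_of_nonneg_left (by positivity)

/-! ### The contribution of the data -/

theorem integral_mul_laplacian_smul {g p : Plane → ℝ} {f : Plane → ℂ} (hg : ContDiff ℝ ∞ g)
    (hgc : HasCompactSupport g) (hp : ContDiff ℝ ∞ p) (hf : ContDiff ℝ 1 f) :
    ∫ y, (g y * Laplacian.laplacian p y) • f y =
      -(∫ y, (∑ i : Fin 2, fderiv ℝ g y (EuclideanSpace.single i 1) *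
        fderiv ℝ p y (EuclideanSpace.single i 1)) • f y) -
      ∫ y, ∑ i : Fin 2, (g y * fderiv ℝ p y (EuclideanSpace.single i 1)) •
        fderiv ℝ f y (EuclideanSpace.single i 1) := by
  set e : Fin 2 → Plane := fun i => EuclideanSpace.single i 1 with he
  have hfc := hf.continuous
  have hf' : ∀ v, Continuous fun y => fderiv ℝ f y v := fun v =>
    (hf.continuous_fderiv one_ne_zero).clm_apply continuous_const
  have hg' : ∀ v, Continuous fun y => fderiv ℝ g y v := fun v =>
    (hg.continuous_fderiv (by simp)).clm_apply continuous_const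
  have hp1 : ContDiff ℝ ∞ (fderiv ℝ p) := hp.fderiv_right (m := ∞) (by simp)
  have hp' : ∀ v, ContDiff ℝ ∞ fun y => fderiv ℝ p y v := fun v => hp1.clm_apply contDiff_const
  have hp2 : ∀ v, Continuous fun y => fderiv ℝ (fderiv ℝ p) y v v := fun v =>
    ((hp1.continuous_fderiv (by simp)).clm_apply continuous_const).clm_apply continuous_const
  have hgd : ∀ y, HasFDerivAt g (fderiv ℝ g y) y := fun y =>
    (hg.differentiable (by simp) y).hasFDerivAt
  have hgc' : ∀ v, HasCompactSupport fun y => fderiv ℝ g y v := fun v =>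
    hgc.fderiv_apply (𝕜 := ℝ) v
  have i1 : ∀ i, Integrable fun y => (fderiv ℝ g y (e i) * fderiv ℝ p y (e i)) • f y := fun i =>
    (((hg' _).mul (hp' _).continuous).smul hfc).integrable_of_hasCompactSupport
      ((hgc' _).mul_right.smul_right)
  have i2 : ∀ i, Integrable fun y => (g y * fderiv ℝ (fderiv ℝ p) y (e i) (e i)) • f y := fun i =>
    ((hg.continuous.mul (hp2 _)).smul hfc).integrable_of_hasCompactSupport hgc.mul_right.smul_right
  have i3 : ∀ i, Integrable fun y => (g y * fderiv ℝ p y (e i)) • fderiv ℝ f y (e i) := fun i =>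
    ((hg.continuous.mul (hp' _).continuous).smul (hf' _)).integrable_of_hasCompactSupport
      hgc.mul_right.smul_right
  have hu : ∀ i y, fderiv ℝ (fun y => g y * fderiv ℝ p y (e i)) y (e i) =
      fderiv ℝ g y (e i) * fderiv ℝ p y (e i) + g y * fderiv ℝ (fderiv ℝ p) y (e i) (e i) := by
    intro i y
    have h1 : HasFDerivAt (fun y => fderiv ℝ p y (e i)) _ y :=
      ((hp1.differentiable (by simp) y).hasFDerivAt).clm_apply (hasFDerivAt_const (e i) y)
    rw [((hgd y).fun_mul h1).fderiv]
    simp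
    ring
  have key : ∀ i, ∫ y, (g y * fderiv ℝ p y (e i)) • fderiv ℝ f y (e i) =
      -((∫ y, (fderiv ℝ g y (e i) * fderiv ℝ p y (e i)) • f y) +
        ∫ y, (g y * fderiv ℝ (fderiv ℝ p) y (e i) (e i)) • f y) := by
    intro i
    have h := integral_bilinear_fderiv_right_eq_neg_left_of_integrable (μ := volume)
      (f := fun y => g y * fderiv ℝ p y (e i)) (g := f) (v := e i)
      (B := ContinuousLinearMap.lsmul ℝ ℝ) ?_ (i3 i) ?_ ?_ ?_
    · simp only [ContinuousLinearMap.lsmul_apply, hu, add_smul] at h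
      rw [h, integral_add (i1 i) (i2 i)]
    · simp only [ContinuousLinearMap.lsmul_apply, hu, add_smul]
      exact (i1 i).add (i2 i)
    · exact ((hg.continuous.mul (hp' _).continuous).smul hfc).integrable_of_hasCompactSupport
        hgc.mul_right.smul_right
    · exact fun y _ => (hg.differentiable (by simp) y).mul
        ((hp' (e i)).differentiable (by simp) y)
    · exact fun y _ => hf.differentiable one_ne_zero y
  simp only [laplacian_eq_fderiv, Finset.mul_sum, Finset.sum_smul]
  rw [integral_finsetSum _ fun i _ => i2 i, integral_finsetSum _ fun i _ => i1 i,
    integral_finsetSum _ fun i _ => i3 i, Finset.sum_congr rfl fun i _ => key i,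
    Finset.sum_neg_distrib, Finset.sum_add_distrib]
  ring

/-- Integration by parts against a function decaying together with its gradient and Laplacian. -/
theorem enorm_integral_laplacian_smul_le {p : Plane → ℝ} {f : Plane → ℂ} {C : ℝ}
    (hp : ContDiff ℝ ∞ p) (hΔ : ∀ y, |Laplacian.laplacian p y| ≤ C * decay ‖y‖)
    (hD : ∀ y, y ≠ 0 → ‖fderiv ℝ p y‖ ≤ C * decay ‖y‖) (hf : ContDiff ℝ 1 f)
    (hf2 : MemLp f 2 volume) :
    ‖∫ y, Laplacian.laplacian p y • f y‖ₑ ≤ 2 * ∫⁻ y, ‖fderiv ℝ p y‖ₑ * ‖fderiv ℝ f y‖ₑ := by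
  let bump : ContDiffBump (0 : Plane) := ⟨1, 2, one_pos, one_lt_two⟩
  obtain ⟨b, hb, hbc, hb01, hb0⟩ : ∃ b : Plane → ℝ, ContDiff ℝ ∞ b ∧ HasCompactSupport b ∧
      (∀ y, b y ∈ Icc (0 : ℝ) 1) ∧ b 0 = 1 :=
    ⟨bump, bump.contDiff, bump.hasCompactSupport, fun y => ⟨bump.nonneg, bump.le_one⟩,
      bump.one_of_mem_closedBall (by simp [bump])⟩
  have hbabs : ∀ y, |b y| ≤ 1 := fun y => abs_le.2 ⟨by linarith [(hb01 y).1], (hb01 y).2⟩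
  obtain ⟨D, hD0, hbd⟩ := exists_bound_dilate hb hbc
  set δ : ℕ → ℝ := fun n => 1 / ((n : ℝ) + 1) with hδdef
  have hδ : ∀ n, δ n ∈ Icc (0 : ℝ) 1 := fun n =>
    ⟨by positivity, (div_le_one (by positivity)).2 (by simp)⟩
  have hδ0 : ∀ n, δ n ≠ 0 := fun n => by positivity
  have hδlim : Tendsto δ atTop (𝓝 0) := tendsto_one_div_add_atTop_nhds_zero_nat
  have hdm : AEStronglyMeasurable (fun y : Plane => decay ‖y‖) volume :=
    (continuous_decay.comp continuous_norm).aestronglyMeasurable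
  have hdi : Integrable fun y => decay ‖y‖ • f y := MemLp.integrable_smul_of_decay hf2 hdm (C := 1)
    fun y => by rw [one_mul, abs_of_pos (decay_pos _)]
  have hn : ∀ i : Fin 2, ‖(EuclideanSpace.single i (1 : ℝ) : Plane)‖ = 1 := fun i => by simp
  have hap : ∀ {G : Type} [NormedAddCommGroup G] [NormedSpace ℝ G] (L : Plane →L[ℝ] G)
      (i : Fin 2), ‖L (EuclideanSpace.single i 1)‖ ≤ ‖L‖ := fun L i => by
    have := L.le_opNorm (EuclideanSpace.single i 1)
    rwa [hn, mul_one] at this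
  set K := ∫ y, ‖decay ‖y‖ • f y‖ with hK
  have hne : ∀ᵐ y : Plane, y ≠ 0 := Measure.ae_ne volume 0
  -- The term with the gradient of the cut-off is O(δₙ) and disappears in the limit. The factor 2 in
  -- front of the other one is the number of coordinate directions.
  have hbound : ∀ n, ‖∫ y, (b (δ n • y) * Laplacian.laplacian p y) • f y‖ₑ ≤
      ENNReal.ofReal (2 * D * C * K * δ n) +
        2 * ∫⁻ y, ‖fderiv ℝ p y‖ₑ * ‖fderiv ℝ f y‖ₑ := by
    intro n
    rw [integral_mul_laplacian_smul (contDiff_dilate hb (δ n)) (hbc.comp_smul (hδ0 n)) hp hf]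
    refine (enorm_sub_le).trans (add_le_add ?_ ?_)
    · rw [enorm_neg, ← ofReal_norm]
      refine ENNReal.ofReal_le_ofReal ?_
      rw [hK, show ∀ K : ℝ, 2 * D * C * K * δ n = (2 * (D * δ n) * C) * K by intro K; ring,
        ← integral_const_mul]
      refine norm_integral_le_of_norm_le (hdi.norm.const_mul _) ?_
      filter_upwards [hne] with y hy
      rw [norm_smul, norm_smul, ← mul_assoc]
      refine mul_le_mul_of_nonneg_right ?_ (norm_nonneg _)
      have hd := decay_pos ‖y‖
      have hδn := (hδ n).1
      refine (norm_sum_le _ _).trans ((Finset.sum_le_sum (g := fun _ => (D * δ n) * (C * decay ‖y‖))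
        fun i _ => ?_).trans (le_of_eq ?_))
      · rw [norm_mul]
        exact mul_le_mul ((hap _ i).trans (hbd _ (hδ n) y).1) ((hap _ i).trans (hD y hy))
          (norm_nonneg _) (by positivity)
      · rw [Finset.sum_const, Finset.card_univ, Fintype.card_fin, nsmul_eq_mul, Nat.cast_ofNat,
          Real.norm_eq_abs, abs_of_pos hd]
        ring
    · refine (enorm_integral_le_lintegral_enorm _).trans ?_
      rw [← lintegral_const_mul' _ _ ENNReal.ofNat_ne_top]
      refine lintegral_mono fun y => ?_
      refine (enorm_sum_le _ _).trans ((Finset.sum_le_sum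
        (g := fun _ => ‖fderiv ℝ p y‖ₑ * ‖fderiv ℝ f y‖ₑ) fun i _ => ?_).trans (le_of_eq ?_))
      · rw [enorm_smul]
        refine mul_le_mul' ?_ (enorm_le_iff_norm_le.2 (hap _ i))
        rw [enorm_mul]
        refine (mul_le_mul' (b := 1) ?_ (enorm_le_iff_norm_le.2 (hap _ i))).trans (one_mul _).le
        rw [← enorm_one (G := ℝ), enorm_le_iff_norm_le]
        simpa using hbabs _
      · rw [Finset.sum_const, Finset.card_univ, Fintype.card_fin, nsmul_eq_mul, Nat.cast_ofNat]
  have hlim : Tendsto (fun n => ∫ y, (b (δ n • y) * Laplacian.laplacian p y) • f y) atTop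
      (𝓝 (∫ y, Laplacian.laplacian p y • f y)) := by
    have hΔc : Continuous (Laplacian.laplacian p) := by
      have h2 : Continuous (fderiv ℝ (fderiv ℝ p)) :=
        (hp.fderiv_right (m := ∞) (by simp)).continuous_fderiv (by simp)
      rw [funext (laplacian_eq_fderiv p)]
      exact continuous_finsetSum _ fun i _ =>
        (h2.clm_apply continuous_const).clm_apply continuous_const
    refine tendsto_integral_of_dominated_convergence (fun y => C * ‖decay ‖y‖ • f y‖) ?_
      (hdi.norm.const_mul C) ?_ ?_
    · exact fun n => (((contDiff_dilate hb (δ n)).continuous.mul hΔc).smul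
        hf.continuous).aestronglyMeasurable
    · refine fun n => Eventually.of_forall fun y => ?_
      rw [norm_smul, norm_smul, norm_mul, ← mul_assoc, Real.norm_eq_abs, Real.norm_eq_abs,
        Real.norm_eq_abs, abs_of_pos (decay_pos _)]
      exact mul_le_mul_of_nonneg_right ((mul_le_of_le_one_left (abs_nonneg _) (hbabs _)).trans
        (hΔ y)) (norm_nonneg _)
    · refine Eventually.of_forall fun y => Tendsto.smul_const ?_ _
      have h1 : Tendsto (fun n => δ n • y) atTop (𝓝 ((0 : ℝ) • y)) := hδlim.smul_const y
      rw [zero_smul] at h1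
      have h2 := (((hb.continuous.tendsto 0).comp h1).mul_const (Laplacian.laplacian p y))
      rwa [hb0, one_mul] at h2
  refine le_of_tendsto_of_tendsto hlim.enorm ?_ (Eventually.of_forall hbound)
  have h0 : Tendsto (fun n => ENNReal.ofReal (2 * D * C * K * δ n)) atTop (𝓝 0) := by
    have := ENNReal.tendsto_ofReal (hδlim.const_mul (2 * D * C * K))
    rwa [mul_zero, ENNReal.ofReal_zero] at this
  have := h0.add_const (2 * ∫⁻ y, ‖fderiv ℝ p y‖ₑ * ‖fderiv ℝ f y‖ₑ)
  rwa [zero_add] at this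

/-- Division by ω preserves smoothness because the amplitude vanishes near ω = 0. -/
theorem IsAmplitude.div (hα : 0 < α) {c : ℝ → ℂ} (hc : IsAmplitude α β c) :
    IsAmplitude α β (fun w => (w : ℂ)⁻¹ * c w) := by
  refine ⟨contDiff_iff_contDiffAt.2 fun w => ?_, (tsupport_mul_subset_right).trans hc.2⟩
  by_cases hw : w = 0
  · have h0 : w ∉ tsupport c := fun h => by
      have := (hc.2 h).1
      linarith
    have : (fun w : ℝ => (w : ℂ)⁻¹ * c w) =ᶠ[𝓝 w] fun _ => 0 := by
      filter_upwards [(isClosed_tsupport c).isOpen_compl.mem_nhds h0] with v hv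
      rw [image_eq_zero_of_notMem_tsupport hv, mul_zero]
    exact contDiffAt_const.congr_of_eventuallyEq this
  · exact (Complex.ofRealCLM.contDiff.contDiffAt.inv (by simpa using hw)).mul hc.1.contDiffAt

theorem IsAmplitude.eq_zero {c : ℝ → ℂ} (hc : IsAmplitude α β c) {w : ℝ} (hw : w ∉ Ioo α β) :
    c w = 0 :=
  image_eq_zero_of_notMem_tsupport fun h => hw (hc.2 h)

/-- Integration by parts against a radial packet. -/
theorem enorm_integral_packet_le (hα : 0 < α) (hαβ : α ≤ β) {c : ℝ → ℂ} (hc : IsAmplitude α β c)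
    (τ : ℝ) {f : Plane → ℂ} (hf : ContDiff ℝ 1 f) (hf2 : MemLp f 2 volume) :
    ‖∫ y, packet α β (fun w => Complex.I * w * c w) τ y • f y‖ₑ ≤
      2 * ∫⁻ y, ‖packet' α β (fun w => -Complex.I * c w) τ ‖y‖‖ₑ * ‖fderiv ℝ f y‖ₑ := by
  -- With d = -ic/ω one has (iω)²d = iωc and ωd = -ic: the given packet is the Laplacian of the
  -- packet of d, whose radial derivative is the companion integral in the bound.
  set d : ℝ → ℂ := fun w => -Complex.I * ((w : ℂ)⁻¹ * c w) with hd
  have hdA : IsAmplitude α β d := (hc.div hα).mul contDiff_const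
  have e1 : (fun w : ℝ => Complex.I * w * (Complex.I * w * d w)) =
      fun w : ℝ => Complex.I * w * c w := by
    funext w
    by_cases hw : w = 0
    · simp [hw]
    · have : (w : ℂ) ≠ 0 := by exact_mod_cast hw
      rw [hd]
      field_simp
      rw [Complex.I_sq]
      ring
  have e2 : (fun w : ℝ => (w : ℂ) * d w) = fun w => -Complex.I * c w := by
    funext w
    by_cases hw : w = 0
    · rw [hw, hc.eq_zero fun h => absurd h.1 (by linarith : ¬ α < 0)]
      simp
    · have : (w : ℂ) ≠ 0 := by exact_mod_cast hw
      rw [hd]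
      field_simp
  have hL : ∀ y, Laplacian.laplacian (packet α β d τ) y =
      packet α β (fun w => Complex.I * w * c w) τ y := fun y => by
    rw [laplacian_packet hdA.1, e1]
  obtain ⟨C1, hC1, h1⟩ := exists_packet_decay hα hαβ hc.I_mul
  obtain ⟨C2, hC2, h2⟩ := exists_packet_decay hα hαβ (hc.mul (f := fun _ => -Complex.I)
    contDiff_const)
  have h3 : ∀ y, y ≠ 0 → ‖fderiv ℝ (packet α β d τ) y‖ ≤
      |packet' α β (fun w => -Complex.I * c w) τ ‖y‖| := fun y hy => by
    have := norm_fderiv_packet_le (α := α) (β := β) hdA.1 τ hy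
    rwa [e2] at this
  have h := enorm_integral_laplacian_smul_le (p := packet α β d τ) (f := f)
    (C := (C1 + C2) * (1 + τ ^ 2)) (contDiff_packet_slice hdA.1 τ)
    (fun y => ?_) (fun y hy => ?_) hf hf2
  · simp only [hL] at h
    refine h.trans (mul_le_mul' le_rfl (lintegral_mono_ae ?_))
    have hne : ∀ᵐ y : Plane, y ≠ 0 := Measure.ae_ne volume 0
    filter_upwards [hne] with y hy
    refine mul_le_mul' ?_ le_rfl
    rw [enorm_le_iff_norm_le, Real.norm_eq_abs]
    exact h3 y hy
  · rw [hL]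
    refine ((h1 τ).1 y).trans ?_
    have := decay_pos ‖y‖
    gcongr
    linarith
  · refine (h3 y hy).trans (((h2 τ).2 _ (norm_nonneg y)).trans ?_)
    have := decay_pos ‖y‖
    gcongr
    linarith

end RadialWave

end

noncomputable section

namespace RadialWave

variable {α β : ℝ} {I : Set ℝ} {φ F : ℝ → Plane → ℂ} {a b : ℝ} {k : ℤ}

/-! ### Differentiation of the reproducing formula -/

/-- No majorant for the time derivative, uniform in time and pointwise in space, is at hand. Instead
the increment is written as a time integral and Fubini is applied; the integrand is then continuous
in time by L² continuity. -/
theorem L2ContinuousOn.hasDerivAt_integral {φt : ℝ → Plane → ℂ} (hφ : L2ContinuousOn I φ)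
    (hφt : L2ContinuousOn I φt)
    (hd : ∀ s ∈ interior I, ∀ y, HasDerivAt (fun s => φ s y) (φt s y) s)
    {K : Plane → ℝ} (hK : Continuous K) {C : ℝ} (hKb : ∀ y, |K y| ≤ C * decay ‖y‖) {t : ℝ}
    (ht : t ∈ interior I) :
    HasDerivAt (fun s => ∫ y, K y • φ s y) (∫ y, K y • φt t y) t := by
  obtain ⟨ε, hε, hball⟩ := Metric.isOpen_iff.1 isOpen_interior t ht
  have hsub : Icc (t - ε / 2) (t + ε / 2) ⊆ interior I := fun s hs => hball (by
    rw [Metric.mem_ball, Real.dist_eq, abs_lt]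
    constructor <;> linarith [hs.1, hs.2])
  set t₁ := t - ε / 2
  set t₂ := t + ε / 2
  have h12 : t₁ < t₂ := by simp only [t₁, t₂]; linarith
  have hsubI : Icc t₁ t₂ ⊆ I := hsub.trans interior_subset
  have hv : ContinuousOn (fun s => ∫ y, K y • φt s y) I :=
    hφt.continuousOn_integral (h := fun z => K z.2) (hK.comp continuous_snd)
      fun _ => ⟨C, Eventually.of_forall fun _ y => hKb y⟩
  have key : ∀ s ∈ Icc t₁ t₂, ∫ y, K y • φ s y =
      (∫ y, K y • φ t₁ y) + ∫ σ in t₁..s, ∫ y, K y • φt σ y := by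
    intro s hs
    have hsI : Icc t₁ s ⊆ I := (Icc_subset_Icc_right hs.2).trans hsubI
    have hpt : ∀ y, φ s y - φ t₁ y = ∫ σ in t₁..s, φt σ y := fun y => by
      refine (intervalIntegral.integral_eq_sub_of_hasDerivAt (f := fun σ => φ σ y)
        (f' := fun σ => φt σ y) (fun σ hσ => ?_) ?_).symm
      · rw [uIcc_of_le hs.1] at hσ
        exact hd σ (hsub ⟨hσ.1, hσ.2.trans hs.2⟩) y
      · refine ContinuousOn.intervalIntegrable ?_
        rw [uIcc_of_le hs.1]
        exact hφt.continuousOn.comp (f := fun σ : ℝ => (σ, y)) (by fun_prop)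
          fun σ hσ => ⟨hsI hσ, mem_univ y⟩
    have hm : MeasurableSet (Ioc t₁ s) := measurableSet_Ioc
    have hi := hφt.integrable_prod (isCompact_Icc (a := t₁) (b := s)) hsI
      (h := fun z => (Ioc t₁ s).indicator (fun _ => 1) z.1 * K z.2) (C := C)
      (((measurable_const.indicator hm).comp measurable_fst).mul
        (hK.measurable.comp measurable_snd)).aestronglyMeasurable
      (Eventually.of_forall fun z => ?_) (fun z hz => ?_)
    · rw [Measure.volume_eq_prod] at hi
      have e := integral_integral_swap (f := fun (σ : ℝ) (y : Plane) =>
        ((Ioc t₁ s).indicator (fun _ => (1 : ℝ)) σ * K y) • φt σ y) hi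
      have i1 := MemLp.integrable_smul_of_decay (hφ.memLp s (hsubI hs)) hK.aestronglyMeasurable hKb
      have i2 := MemLp.integrable_smul_of_decay (hφ.memLp t₁ (hsubI (left_mem_Icc.2 h12.le)))
        hK.aestronglyMeasurable hKb
      rw [← sub_eq_iff_eq_add', ← integral_sub i1 i2, intervalIntegral.integral_of_le hs.1,
        ← integral_indicator hm]
      have e1 : ∀ σ, (Ioc t₁ s).indicator (fun σ => ∫ y, K y • φt σ y) σ =
          ∫ y, ((Ioc t₁ s).indicator (fun _ => (1 : ℝ)) σ * K y) • φt σ y := fun σ => by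
        by_cases hσ : σ ∈ Ioc t₁ s <;> simp [hσ]
      simp only [e1]
      rw [e]
      refine integral_congr_ae (Eventually.of_forall fun y => ?_)
      beta_reduce
      rw [← smul_sub, hpt y, intervalIntegral.integral_of_le hs.1, ← integral_indicator hm,
        ← integral_smul]
      refine integral_congr_ae (Eventually.of_forall fun σ => ?_)
      by_cases hσ : σ ∈ Ioc t₁ s <;> simp [hσ]
    · have hdp := decay_pos ‖z.2‖
      by_cases hz : z.1 ∈ Ioc t₁ s
      · simpa [hz] using hKb z.2
      · simpa [hz] using (abs_nonneg _).trans (hKb z.2)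
    · have : z.1 ∉ Ioc t₁ s := fun h => hz (Ioc_subset_Icc_self h)
      simp [this]
  have ht1 : t ∈ Ioo t₁ t₂ := ⟨by simp only [t₁]; linarith, by simp only [t₂]; linarith⟩
  have hder : HasDerivAt (fun s => (∫ y, K y • φ t₁ y) + ∫ σ in t₁..s, ∫ y, K y • φt σ y)
      (∫ y, K y • φt t y) t := by
    refine HasDerivAt.const_add _ (intervalIntegral.integral_hasDerivAt_right ?_ ?_ ?_)
    · refine ContinuousOn.intervalIntegrable ?_
      rw [uIcc_of_le ht1.1.le]
      exact hv.mono ((Icc_subset_Icc_right ht1.2.le).trans hsubI)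
    · exact (hv.mono interior_subset).stronglyMeasurableAtFilter isOpen_interior t ht
    · exact hv.continuousAt (mem_interior_iff_mem_nhds.1 ht)
  refine hder.congr_of_eventuallyEq ?_
  filter_upwards [Icc_mem_nhds ht1.1 ht1.2] with s hs using key s hs

/-- With e = x/|x| one has f(y) = f(|y|e) for all y, and the chain rule applies. -/
theorem IsRadial.fderiv_eq {f : Plane → ℂ} (hf : IsRadial f) {x : Plane} (hx : x ≠ 0)
    (hd : DifferentiableAt ℝ f x) (v : Plane) :
    fderiv ℝ f x v = fderiv ℝ (fun y : Plane => ‖y‖) x v • fderiv ℝ f x (‖x‖⁻¹ • x) := by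
  have hx0 : ‖x‖ ≠ 0 := norm_ne_zero_iff.2 hx
  have e : f = fun y => f (‖y‖ • (‖x‖⁻¹ • x)) := funext fun y => hf _ _ (by
    rw [norm_smul, norm_smul, norm_norm, norm_inv, norm_norm, inv_mul_cancel₀ hx0, mul_one])
  have h1 : HasFDerivAt (fun y : Plane => ‖y‖) (fderiv ℝ (fun y : Plane => ‖y‖) x) x :=
    ((contDiffAt_norm ℝ hx (n := 1)).differentiableAt one_ne_zero).hasFDerivAt
  have h2 := h1.smul_const (‖x‖⁻¹ • x)
  have hxx : ‖x‖ • (‖x‖⁻¹ • x) = x := by rw [smul_smul, mul_inv_cancel₀ hx0, one_smul]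
  have h3 : HasFDerivAt f (fderiv ℝ f x) (‖x‖ • (‖x‖⁻¹ • x)) := by
    rw [hxx]; exact hd.hasFDerivAt
  have h4 : HasFDerivAt f ((fderiv ℝ f x).comp ((fderiv ℝ (fun y : Plane => ‖y‖) x).smulRight
      (‖x‖⁻¹ • x))) x :=
    (HasFDerivAt.comp (f := fun y : Plane => ‖y‖ • (‖x‖⁻¹ • x)) x h3 h2).congr_of_eventuallyEq
      (Eventually.of_forall fun y => congrFun e y)
  nth_rewrite 1 [h4.fderiv]
  simp

/-- The amplitude of the radial derivative of the reproducing kernel. -/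
def kernelAmp' (m : ℝ → ℝ) (r w : ℝ) : ℂ :=
  ((m w * (w * (2 * Real.pi)⁻¹) * (besselJ' (r * w) * w) : ℝ) : ℂ)

/-- A smooth frequency cut-off supported in `(α, β)`. -/
def IsFreqCutoff (α β : ℝ) (m : ℝ → ℝ) : Prop := ContDiff ℝ ∞ m ∧ tsupport m ⊆ Ioo α β

theorem IsFreqCutoff.isAmplitude {m : ℝ → ℝ} (hm : IsFreqCutoff α β m) {f : ℝ → ℂ}
    (hf : ContDiff ℝ ∞ f) : IsAmplitude α β (fun w => (m w : ℂ) * f w) :=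
  ⟨(Complex.ofRealCLM.contDiff.comp hm.1).mul hf, (tsupport_mul_subset_left).trans
    ((closure_mono fun x hx => by
      simpa using hx : tsupport (fun w => (m w : ℂ)) ⊆ tsupport m).trans hm.2)⟩

theorem ampFamily_besselJ' (hα : 0 < α) (β : ℝ) :
    AmpFamily α β (fun r w => besselJ' (r * w)) 1 (1 / 2) :=
  ⟨fun _ => contDiff_besselJ'_ofReal.comp (contDiff_const.mul contDiff_id),
    exists_hasAmp_besselJ' hα (by norm_num)⟩

theorem IsFreqCutoff.isAmplitude_kernelAmp {m : ℝ → ℝ} (hm : IsFreqCutoff α β m) (r : ℝ) :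
    IsAmplitude α β (kernelAmp m r) := by
  have h := hm.isAmplitude (f := fun w : ℝ => ((w * (2 * Real.pi)⁻¹ * besselJ (r * w) : ℝ) : ℂ))
    (Complex.ofRealCLM.contDiff.comp ((contDiff_id.mul contDiff_const).mul
      (contDiff_besselJ.comp (contDiff_const.mul contDiff_id))))
  convert h using 1
  funext w
  rw [kernelAmp]
  push_cast
  ring

theorem kern_le_decay {N r ρ : ℝ} (hN : 0 ≤ N) (hr : 0 ≤ r) (hρ : 0 ≤ ρ) {σ e : ℝ}
    (hσ : σ ^ 2 = 1) (he : 0 ≤ e) : kern N σ e r 0 ρ ≤ 8 * (1 + (N * r) ^ 2) * decay (N * ρ) := by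
  have h1 : ∀ p : ℝ, 0 ≤ p → ∀ u : ℝ, 0 ≤ u → (1 + u) ^ (-p) ≤ 1 := fun p hp u hu =>
    Real.rpow_le_one_of_one_le_of_nonpos (by linarith) (by linarith)
  have h2 : ∀ τ : ℝ, τ ^ 2 = r ^ 2 → wave N τ ρ ≤ 4 * (1 + (N * r) ^ 2) * decay (N * ρ) := by
    intro τ hτ
    have e1 := decay_add_le (N * τ) (N * ρ)
    have e2 := decay_add_le (N * τ) (-(N * ρ))
    rw [decay_neg] at e2
    rw [wave, mul_add, mul_sub, sub_eq_add_neg]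
    have : (N * τ) ^ 2 = (N * r) ^ 2 := by rw [mul_pow, mul_pow, hτ]
    rw [this] at e1 e2
    linarith
  have e1 := h2 (0 + σ * r) (by rw [zero_add, mul_pow, hσ, one_mul])
  have e2 := h2 (0 - σ * r) (by rw [zero_sub, neg_sq, mul_pow, hσ, one_mul])
  have w1 := (wave_pos N (0 + σ * r) ρ).le
  have w2 := (wave_pos N (0 - σ * r) ρ).le
  rw [kern]
  have k1 := h1 (1 / 2) (by norm_num) (N * ρ) (by positivity)
  have k2 := h1 (1 / 2) (by norm_num) (N * r) (by positivity)
  have k3 := h1 e he (N * r) (by positivity)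
  calc _ ≤ 1 * (1 * wave N (0 + σ * r) ρ + 1 * wave N (0 - σ * r) ρ) := by gcongr
    _ ≤ _ := by linarith

/-- The bound is uniform for r in bounded sets, which is what differentiation of the reproducing
formula under the integral in r requires. -/
theorem exists_bound_packet_kernelAmp' (hα : 0 < α) (hαβ : α ≤ β) {m : ℝ → ℝ}
    (hm : IsFreqCutoff α β m) : ∃ C, 0 ≤ C ∧ ∀ r, 0 ≤ r → ∀ y,
      |packet α β (kernelAmp' m r) 0 y| ≤ C * (1 + r ^ 2) * decay ‖y‖ := by
  have hψ := hm.isAmplitude (f := fun w : ℝ => ((w * (2 * Real.pi)⁻¹ * w : ℝ) : ℂ))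
    (Complex.ofRealCLM.contDiff.comp ((contDiff_id.mul contDiff_const).mul contDiff_id))
  obtain ⟨C, hC, h⟩ := (ampFamily_besselJ' hα β).exists_kern_bound hα hαβ hψ
  refine ⟨8 * C, by positivity, fun r hr y => ?_⟩
  have h1 := (h 1 r one_pos hr 0).1 y
  have h2 := kern_le_decay zero_le_one hr (norm_nonneg y) (σ := 1) (e := 1 / 2) (by norm_num)
    (by norm_num)
  simp only [one_mul, div_one, mul_one] at h1 h2
  have e : kernelAmp' m r = fun w => (m w : ℂ) * ((w * (2 * Real.pi)⁻¹ * w : ℝ) : ℂ) *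
      (besselJ' (r * w) : ℂ) := by
    funext w
    rw [kernelAmp']
    push_cast
    ring
  rw [e]
  refine h1.trans ((mul_le_mul_of_nonneg_left h2 hC).trans (le_of_eq ?_))
  ring

/-- The reproducing kernel is symmetric in |x| and |y|. Exchanging their roles turns the derivative
in r = |x| into the radial derivative of a packet. -/
theorem packet_kernelAmp_eq (m : ℝ → ℝ) (r : ℝ) (y : Plane) : packet α β (kernelAmp m r) 0 y =
    ∫ w in α..β, (kernelAmp m ‖y‖ w * Complex.exp (Complex.I * ((0 : ℝ) * w))).re *
      besselJ (r * w) := by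
  rw [packet]
  refine intervalIntegral.integral_congr fun w _ => ?_
  simp only [kernelAmp, Complex.ofReal_zero, zero_mul, mul_zero, Complex.exp_zero, mul_one,
    Complex.ofReal_re]
  ring

theorem hasDerivAt_packet_kernelAmp {m : ℝ → ℝ} (hm : IsFreqCutoff α β m) (r : ℝ) (y : Plane) :
    HasDerivAt (fun r => packet α β (kernelAmp m r) 0 y) (packet α β (kernelAmp' m r) 0 y) r := by
  simp only [packet_kernelAmp_eq]
  refine (hasDerivAt_packet_radial (hm.isAmplitude_kernelAmp ‖y‖).1 0 r).congr_deriv ?_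
  rw [packet', packet]
  refine intervalIntegral.integral_congr fun w _ => ?_
  simp only [kernelAmp, kernelAmp', Complex.ofReal_zero, zero_mul, mul_zero, Complex.exp_zero,
    mul_one, Complex.ofReal_re, Complex.re_ofReal_mul]
  ring

theorem hasDerivAt_integral_packet_kernelAmp (hα : 0 < α) (hαβ : α ≤ β) {m : ℝ → ℝ}
    (hm : IsFreqCutoff α β m) {f : Plane → ℂ} (hf : MemLp f 2 volume) {r : ℝ} (hr : 0 < r) :
    HasDerivAt (fun r => ∫ y, packet α β (kernelAmp m r) 0 y • f y)
      (∫ y, packet α β (kernelAmp' m r) 0 y • f y) r := by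
  obtain ⟨C, hC, hb⟩ := exists_bound_packet_kernelAmp' hα hαβ hm
  have hc : ∀ r, Continuous (packet α β (kernelAmp m r) 0) := fun r =>
    (contDiff_packet_slice (hm.isAmplitude_kernelAmp r).1 0).continuous
  have hc' : ∀ r, AEStronglyMeasurable (packet α β (kernelAmp' m r) 0) volume := fun r => by
    have hA := hm.isAmplitude
      (f := fun w : ℝ => ((w * (2 * Real.pi)⁻¹ * (besselJ' (r * w) * w) : ℝ) : ℂ))
      (Complex.ofRealCLM.contDiff.comp ((contDiff_id.mul contDiff_const).mul
        ((contDiff_besselJ'.comp (contDiff_const.mul contDiff_id)).mul contDiff_id)))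
    have e : kernelAmp' m r = fun w : ℝ => (m w : ℂ) *
        ((w * (2 * Real.pi)⁻¹ * (besselJ' (r * w) * w) : ℝ) : ℂ) := by
      funext w
      rw [kernelAmp']
      push_cast
      ring
    rw [e]
    exact (contDiff_packet_slice hA.1 0).continuous.aestronglyMeasurable
  have hdm : AEStronglyMeasurable (fun y : Plane => decay ‖y‖) volume :=
    (continuous_decay.comp continuous_norm).aestronglyMeasurable
  have hdi : Integrable fun y => decay ‖y‖ • f y := MemLp.integrable_smul_of_decay hf hdm (C := 1)
    fun y => by rw [one_mul, abs_of_pos (decay_pos _)]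
  obtain ⟨D, hD, hd⟩ := exists_packet_decay hα hαβ (hm.isAmplitude_kernelAmp r)
  refine (hasDerivAt_integral_of_dominated_loc_of_deriv_le
    (F := fun r y => packet α β (kernelAmp m r) 0 y • f y)
    (F' := fun r y => packet α β (kernelAmp' m r) 0 y • f y)
    (bound := fun y => (C * (1 + (2 * r) ^ 2)) * ‖decay ‖y‖ • f y‖) (s := Ioo 0 (2 * r))
    (Ioo_mem_nhds hr (by linarith)) (Eventually.of_forall fun r' =>
      (hc r').aestronglyMeasurable.smul hf.1) ?_ ((hc' r).smul hf.1) ?_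
    (hdi.norm.const_mul _) ?_).2
  · exact MemLp.integrable_smul_of_decay hf (hc r).aestronglyMeasurable fun y => (hd 0).1 y
  · refine Eventually.of_forall fun y r' hr' => ?_
    have hp := decay_pos ‖y‖
    rw [norm_smul, norm_smul, ← mul_assoc, Real.norm_eq_abs, Real.norm_eq_abs, abs_of_pos hp]
    refine mul_le_mul_of_nonneg_right ((hb r' hr'.1.le y).trans ?_) (norm_nonneg _)
    have h1 := hr'.1.le
    have h2 := hr'.2.le
    gcongr
  · refine Eventually.of_forall fun y r' _ => ?_
    exact (hasDerivAt_packet_kernelAmp hm r' y).smul_const (f y)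

theorem radialDeriv_eq_integral (hα : 0 < α) (hαβ : α ≤ β) {m : ℝ → ℝ}
    (hm : IsFreqCutoff α β m) {t : ℝ} (hφ2 : MemLp (φ t) 2 volume)
    (hrep : ∀ x, φ t x = ∫ y, packet α β (kernelAmp m ‖x‖) 0 y • φ t y) {x : Plane} (hx : x ≠ 0)
    (hd : DifferentiableAt ℝ (φ t) x) :
    radialDeriv φ t x = ∫ y, packet α β (kernelAmp' m ‖x‖) 0 y • φ t y := by
  have hx0 : 0 < ‖x‖ := norm_pos_iff.2 hx
  set e : Plane := ‖x‖⁻¹ • x with he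
  have hen : ‖e‖ = 1 := by
    rw [he, norm_smul, norm_inv, norm_norm, inv_mul_cancel₀ hx0.ne']
  have hxx : ‖x‖ • e = x := by rw [he, smul_smul, mul_inv_cancel₀ hx0.ne', one_smul]
  have h1 : HasDerivAt (fun ρ : ℝ => φ t (ρ • e)) (fderiv ℝ (φ t) x e) ‖x‖ := by
    have hd' : HasFDerivAt (φ t) (fderiv ℝ (φ t) x) (‖x‖ • e) := by
      rw [hxx]; exact hd.hasFDerivAt
    have h2 : HasDerivAt (fun ρ : ℝ => ρ • e) e ‖x‖ := by
      simpa using (hasDerivAt_id ‖x‖).smul_const e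
    exact hd'.comp_hasDerivAt ‖x‖ h2
  have h2 := hasDerivAt_integral_packet_kernelAmp hα hαβ hm hφ2 hx0
  refine h1.unique (h2.congr_of_eventuallyEq ?_)
  filter_upwards [lt_mem_nhds hx0] with ρ hρ
  rw [hrep (ρ • e), norm_smul, hen, mul_one, Real.norm_eq_abs, abs_of_pos hρ]

end RadialWave

end

noncomputable section

namespace RadialWave

variable {α β : ℝ} {I : Set ℝ} {φ F : ℝ → Plane → ℂ} {a b : ℝ} {k : ℤ}

/-! ### Representation of localized functions by pairings with packets -/

theorem tsupport_comp_div_subset {E : Type*} [Zero E] {c : ℝ → E} (hc : tsupport c ⊆ Ioo α β)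
    {N : ℝ} (hN : 0 < N) : tsupport (fun w => c (w / N)) ⊆ Ioo (N * α) (N * β) := by
  have h1 : tsupport (fun w => c (w / N)) ⊆ (fun w => w / N) ⁻¹' tsupport c :=
    closure_minimal (fun w hw => subset_tsupport c hw)
      ((isClosed_tsupport c).preimage (continuous_id.div_const N))
  intro w hw
  have h2 := hc (h1 hw)
  exact ⟨by rw [mul_comm]; exact (lt_div_iff₀ hN).1 h2.1,
    by rw [mul_comm]; exact (div_lt_iff₀ hN).1 h2.2⟩

theorem IsAmplitude.comp_div {c : ℝ → ℂ} (hc : IsAmplitude α β c) {N : ℝ} (hN : 0 < N) :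
    IsAmplitude (N * α) (N * β) (fun w => c (w / N)) :=
  ⟨hc.1.comp (contDiff_id.div_const N), tsupport_comp_div_subset hc.2 hN⟩

theorem IsFreqCutoff.comp_div {m : ℝ → ℝ} (hm : IsFreqCutoff α β m) {N : ℝ} (hN : 0 < N) :
    IsFreqCutoff (N * α) (N * β) (fun w => m (w / N)) :=
  ⟨hm.1.comp (contDiff_id.div_const N), tsupport_comp_div_subset hm.2 hN⟩

theorem isBounded_annulus (a b : ℝ) (k : ℤ) : Bornology.IsBounded (annulus a b k) :=
  (Metric.isBounded_closedBall (x := (0 : Plane)) (r := b * 2 ^ k)).subset fun ξ hξ => by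
    rw [mem_closedBall_zero_iff]; exact hξ.2

theorem IsLocalized.eq_integral_kernelAmp (hφ : IsLocalized a b k I φ) (hα : 0 < α) (hαβ : α ≤ β)
    {m : ℝ → ℝ} (hm : IsFreqCutoff α β m)
    (hm1 : ∀ w ∈ Icc (2 * Real.pi * a) (2 * Real.pi * b), m w = 1) {t : ℝ} (ht : t ∈ I)
    (x : Plane) : φ t x = ∫ y, packet ((2 : ℝ) ^ k * α) ((2 : ℝ) ^ k * β)
      (kernelAmp (fun w => m (w / (2 : ℝ) ^ k)) ‖x‖) 0 y • φ t y := by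
  have hN : (0 : ℝ) < (2 : ℝ) ^ k := by positivity
  have hpi := Real.pi_pos
  have hm' := hm.comp_div hN
  refine (hφ.fourier t ht).eq_integral_packet (isBounded_annulus a b k)
    (continuousOn_univ.1 ((hφ.contDiffOn.continuousOn).comp (f := fun x : Plane => (t, x))
      (by fun_prop) fun x _ => ⟨ht, mem_univ x⟩)) (hφ.radial t ht) (by positivity) (by gcongr)
    hm'.1 (fun w hw => image_eq_zero_of_notMem_tsupport (f := fun w => m (w / (2 : ℝ) ^ k))
      fun h => hw (hm'.2 h)) (fun ξ hξ => hm1 _ ⟨?_, ?_⟩) x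
  · rw [le_div_iff₀ hN, mul_assoc]
    exact mul_le_mul_of_nonneg_left hξ.1 (by positivity)
  · rw [div_le_iff₀ hN, mul_assoc (2 * Real.pi)]
    exact mul_le_mul_of_nonneg_left hξ.2 (by positivity)

/-- The amplitude of the packets representing `φ`. -/
def valueAmp (m : ℝ → ℝ) (N r w : ℝ) : ℂ :=
  (m (w / N) : ℂ) * (-(Complex.I * ((2 * Real.pi)⁻¹ : ℝ))) * besselJ (N * r * (w / N))

/-- The amplitude of the packets representing `N⁻¹ (∂_t + σ ∂_r) φ`. -/
def nullAmp (m : ℝ → ℝ) (σ N r w : ℝ) : ℂ :=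
  (m (w / N) : ℂ) * ((w / N * (2 * Real.pi)⁻¹ : ℝ) : ℂ) *
    (besselJ (N * r * (w / N)) - Complex.I * σ * besselJ' (N * r * (w / N)))

theorem packet_re_zero {α β : ℝ} {c : ℝ → ℂ} (h : ∀ w : ℝ, (c w).re = 0) (y : Plane) :
    packet α β c 0 y = 0 := by
  simp [packet, h]

theorem mul_packet_zero {α β z : ℝ} {c c' : ℝ → ℂ} (h : ∀ w : ℝ, z * (c w).re = (c' w).re)
    (y : Plane) : z * packet α β c 0 y = packet α β c' 0 y := by
  simp only [packet, Complex.ofReal_zero, zero_mul, mul_zero, Complex.exp_zero, mul_one]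
  rw [← intervalIntegral.integral_const_mul]
  refine intervalIntegral.integral_congr fun w _ => ?_
  rw [← h w, mul_assoc]

/-- The amplitude is purely imaginary, so its packet vanishes at the focusing time and the term with
∂_tφ drops out. Multiplication by iω makes it real and equal to the amplitude of the reproducing
kernel. -/
theorem IsLocalized.eq_pairing (hφ : IsLocalized a b k I φ) (hα : 0 < α) (hαβ : α ≤ β)
    {m : ℝ → ℝ} (hm : IsFreqCutoff α β m)
    (hm1 : ∀ w ∈ Icc (2 * Real.pi * a) (2 * Real.pi * b), m w = 1) {t : ℝ} (ht : t ∈ I)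
    (x : Plane) : φ t x = pairing ((2 : ℝ) ^ k * α) ((2 : ℝ) ^ k * β)
      (valueAmp m ((2 : ℝ) ^ k) ‖x‖) t φ (timeDeriv I φ) t := by
  have hN : (0 : ℝ) < (2 : ℝ) ^ k := by positivity
  rw [pairing, sub_self, hφ.eq_integral_kernelAmp hα hαβ hm hm1 ht x]
  have h1 : ∀ y : Plane, packet ((2 : ℝ) ^ k * α) ((2 : ℝ) ^ k * β)
      (valueAmp m ((2 : ℝ) ^ k) ‖x‖) 0 y = 0 :=
    packet_re_zero fun w => by simp [valueAmp]
  have h2 : ∀ y : Plane, packet ((2 : ℝ) ^ k * α) ((2 : ℝ) ^ k * β)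
      (fun w => Complex.I * w * valueAmp m ((2 : ℝ) ^ k) ‖x‖ w) 0 y =
      packet ((2 : ℝ) ^ k * α) ((2 : ℝ) ^ k * β)
        (kernelAmp (fun w => m (w / (2 : ℝ) ^ k)) ‖x‖) 0 y := fun y => by
    have := mul_packet_zero (α := (2 : ℝ) ^ k * α) (β := (2 : ℝ) ^ k * β) (z := 1)
      (c := fun w => Complex.I * w * valueAmp m ((2 : ℝ) ^ k) ‖x‖ w)
      (c' := kernelAmp (fun w => m (w / (2 : ℝ) ^ k)) ‖x‖) (fun w => ?_) y
    · rwa [one_mul] at this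
    · have e : (2 : ℝ) ^ k * ‖x‖ * (w / (2 : ℝ) ^ k) = ‖x‖ * w := by field_simp
      have e2 : Complex.I * w * valueAmp m ((2 : ℝ) ^ k) ‖x‖ w =
          -(Complex.I ^ 2) * kernelAmp (fun w => m (w / (2 : ℝ) ^ k)) ‖x‖ w := by
        rw [valueAmp, kernelAmp, e]
        push_cast
        ring
      rw [e2, Complex.I_sq, one_mul, neg_neg, one_mul]
  simp only [h1, h2, zero_smul, integral_zero, zero_add]

/-- At the focusing time only real parts of amplitudes count. The real part of the amplitude is, up
to N⁻¹, the reproducing kernel and yields ∂_tφ; its imaginary part becomes real after multiplication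
by iω and yields σ∂_rφ. -/
theorem IsLocalized.nullDeriv_eq_pairing (hI : I.OrdConnected) (hφ : IsLocalized a b k I φ)
    (hα : 0 < α) (hαβ : α ≤ β) {m : ℝ → ℝ} (hm : IsFreqCutoff α β m)
    (hm1 : ∀ w ∈ Icc (2 * Real.pi * a) (2 * Real.pi * b), m w = 1) {t : ℝ} (ht : t ∈ interior I)
    {x : Plane} (hx : x ≠ 0) (σ : ℝ) : nullDeriv I σ φ t x =
      ((2 : ℝ) ^ k : ℝ) * pairing ((2 : ℝ) ^ k * α) ((2 : ℝ) ^ k * β)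
        (nullAmp m σ ((2 : ℝ) ^ k) ‖x‖) t φ (timeDeriv I φ) t := by
  have hN : (0 : ℝ) < (2 : ℝ) ^ k := by positivity
  have htI := interior_subset ht
  have hm' := hm.comp_div hN
  have hα' : 0 < (2 : ℝ) ^ k * α := by positivity
  have hαβ' : (2 : ℝ) ^ k * α ≤ (2 : ℝ) ^ k * β := by gcongr
  have hrep := fun s (hs : s ∈ I) x => hφ.eq_integral_kernelAmp hα hαβ hm hm1 hs x
  obtain ⟨D, hD, hd⟩ := exists_packet_decay hα' hαβ' (hm'.isAmplitude_kernelAmp ‖x‖)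
  have ht1 : timeDeriv I φ t x = ∫ y, packet ((2 : ℝ) ^ k * α) ((2 : ℝ) ^ k * β)
      (kernelAmp (fun w => m (w / (2 : ℝ) ^ k)) ‖x‖) 0 y • timeDeriv I φ t y := by
    refine (hφ.hasDerivAt hI ht x).unique
      ((hφ.l2ContinuousOn.hasDerivAt_integral (hφ.l2ContinuousOn_timeDeriv hI ⟨t, ht⟩)
        (fun s hs y => hφ.hasDerivAt hI hs y)
        (contDiff_packet_slice (hm'.isAmplitude_kernelAmp ‖x‖).1 0).continuous
        (fun y => (hd 0).1 y) ht).congr_of_eventuallyEq ?_)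
    filter_upwards [mem_interior_iff_mem_nhds.1 ht] with s hs using hrep s hs x
  have ht2 := radialDeriv_eq_integral hα' hαβ' hm' (hφ.fourier t htI).1 (hrep t htI) hx
    (hasFDerivAt_slice hφ.contDiffOn htI x).differentiableAt
  have h1 : ∀ y : Plane, (2 : ℝ) ^ k * packet ((2 : ℝ) ^ k * α) ((2 : ℝ) ^ k * β)
      (nullAmp m σ ((2 : ℝ) ^ k) ‖x‖) 0 y = packet ((2 : ℝ) ^ k * α) ((2 : ℝ) ^ k * β)
        (kernelAmp (fun w => m (w / (2 : ℝ) ^ k)) ‖x‖) 0 y := by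
    refine mul_packet_zero fun w => ?_
    have e : (2 : ℝ) ^ k * ‖x‖ * (w / (2 : ℝ) ^ k) = ‖x‖ * w := by field_simp
    have e2 : nullAmp m σ ((2 : ℝ) ^ k) ‖x‖ w =
        ((m (w / (2 : ℝ) ^ k) * (w / (2 : ℝ) ^ k * (2 * Real.pi)⁻¹) * besselJ (‖x‖ * w) : ℝ) : ℂ) +
        ((-(m (w / (2 : ℝ) ^ k) * (w / (2 : ℝ) ^ k * (2 * Real.pi)⁻¹) * σ *
          besselJ' (‖x‖ * w)) : ℝ) : ℂ) * Complex.I := by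
      rw [nullAmp, e]
      push_cast
      ring
    rw [e2, kernelAmp, Complex.add_re, Complex.re_ofReal_mul, Complex.I_re, mul_zero, add_zero,
      Complex.ofReal_re, Complex.ofReal_re]
    field_simp
  have h2 : ∀ y : Plane, (2 : ℝ) ^ k * packet ((2 : ℝ) ^ k * α) ((2 : ℝ) ^ k * β)
      (fun w => Complex.I * w * nullAmp m σ ((2 : ℝ) ^ k) ‖x‖ w) 0 y =
      σ * packet ((2 : ℝ) ^ k * α) ((2 : ℝ) ^ k * β)
        (kernelAmp' (fun w => m (w / (2 : ℝ) ^ k)) ‖x‖) 0 y := by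
    intro y
    rw [mul_packet_zero (z := σ) (c' := fun w => (σ : ℂ) *
      kernelAmp' (fun w => m (w / (2 : ℝ) ^ k)) ‖x‖ w) (fun w => by simp)]
    refine mul_packet_zero (fun w => ?_) y
    have e : (2 : ℝ) ^ k * ‖x‖ * (w / (2 : ℝ) ^ k) = ‖x‖ * w := by field_simp
    have e2 : Complex.I * w * nullAmp m σ ((2 : ℝ) ^ k) ‖x‖ w =
        ((w * (m (w / (2 : ℝ) ^ k) * (w / (2 : ℝ) ^ k * (2 * Real.pi)⁻¹) * σ *
          besselJ' (‖x‖ * w)) : ℝ) : ℂ) +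
        ((w * (m (w / (2 : ℝ) ^ k) * (w / (2 : ℝ) ^ k * (2 * Real.pi)⁻¹) *
          besselJ (‖x‖ * w)) : ℝ) : ℂ) * Complex.I := by
      rw [nullAmp, e]
      push_cast
      linear_combination -((w : ℂ) * (m (w / (2 : ℝ) ^ k)) *
        (w / (2 : ℂ) ^ k * (2 * Real.pi)⁻¹) * σ *
          besselJ' (‖x‖ * w)) * Complex.I_sq
    rw [e2, kernelAmp', Complex.add_re, Complex.re_ofReal_mul, Complex.re_ofReal_mul, Complex.I_re,
      mul_zero, add_zero, Complex.ofReal_re, Complex.ofReal_re]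
    field_simp
  rw [nullDeriv, pairing, sub_self, ht1, ht2, mul_add, ← integral_const_mul, ← integral_const_mul,
    ← integral_const_mul]
  congr 1
  · refine integral_congr_ae (Eventually.of_forall fun y => ?_)
    beta_reduce
    rw [← h1 y]
    simp only [Complex.real_smul]
    push_cast
    ring
  · refine integral_congr_ae (Eventually.of_forall fun y => ?_)
    beta_reduce
    simp only [Complex.real_smul]
    rw [← mul_assoc, ← mul_assoc, ← Complex.ofReal_mul, ← Complex.ofReal_mul, h2 y]

/-! ### The pointwise estimate -/

theorem enorm_timeDeriv_le_grad (I : Set ℝ) (φ : ℝ → Plane → ℂ) (t : ℝ) (x : Plane) :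
    ‖timeDeriv I φ t x‖ₑ ≤ ‖grad I φ t x‖ₑ := by
  rw [enorm_le_iff_norm_le]
  exact PiLp.norm_apply_le (grad I φ t x) 0

theorem norm_fderiv_le_spaceDeriv (φ : ℝ → Plane → ℂ) (t : ℝ) (x : Plane) :
    ‖fderiv ℝ (φ t) x‖ ≤ ‖spaceDeriv 0 φ t x‖ + ‖spaceDeriv 1 φ t x‖ := by
  refine ContinuousLinearMap.opNorm_le_bound _ (by positivity) fun v => ?_
  have hv : v = v 0 • EuclideanSpace.single 0 (1 : ℝ) + v 1 • EuclideanSpace.single 1 (1 : ℝ) := by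
    ext i; fin_cases i <;> simp
  have h0 : ‖v 0‖ ≤ ‖v‖ := PiLp.norm_apply_le v 0
  have h1 : ‖v 1‖ ≤ ‖v‖ := PiLp.norm_apply_le v 1
  nth_rewrite 1 [hv]
  rw [map_add, map_smul, map_smul, add_mul]
  refine (norm_add_le _ _).trans (add_le_add ?_ ?_)
  · rw [norm_smul, mul_comm]
    exact mul_le_mul_of_nonneg_left h0 (norm_nonneg _)
  · rw [norm_smul, mul_comm]
    exact mul_le_mul_of_nonneg_left h1 (norm_nonneg _)

theorem enorm_fderiv_le_grad (I : Set ℝ) (φ : ℝ → Plane → ℂ) (t : ℝ) (x : Plane) :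
    ‖fderiv ℝ (φ t) x‖ₑ ≤ 2 * ‖grad I φ t x‖ₑ := by
  have h1 : ‖spaceDeriv 0 φ t x‖ ≤ ‖grad I φ t x‖ := PiLp.norm_apply_le (grad I φ t x) 1
  have h2 : ‖spaceDeriv 1 φ t x‖ ≤ ‖grad I φ t x‖ := PiLp.norm_apply_le (grad I φ t x) 2
  have h := norm_fderiv_le_spaceDeriv φ t x
  have e : (2 : ℝ≥0∞) * ENNReal.ofReal ‖grad I φ t x‖ = ENNReal.ofReal (2 * ‖grad I φ t x‖) := by
    rw [ENNReal.ofReal_mul zero_le_two, ENNReal.ofReal_ofNat]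
  rw [← ofReal_norm, ← ofReal_norm, e]
  exact ENNReal.ofReal_le_ofReal (by linarith)

/-- Duhamel's formula between times t and 0, in either order, leaves the pairing with the data.
There the term with φ(0) is integrated by parts, so that only derivatives of φ(0) enter. -/
theorem HasWeakBox.enorm_pairing_le (hI : I.OrdConnected) (h0 : (0 : ℝ) ∈ I)
    (hbox : HasWeakBox I φ F) (hφ : IsLocalized a b k I φ)
    (hF : ∫⁻ s in I, eLpNorm (F s) 2 volume < ⊤)
    (hα : 0 < α) (hαβ : α ≤ β) {c : ℝ → ℂ} (hc : IsAmplitude α β c) {t : ℝ} (ht : t ∈ I)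
    {κ : ℝ → ℝ → ℝ} (h1 : ∀ τ y, |packet α β c τ y| ≤ κ τ ‖y‖)
    (h2 : ∀ τ ρ, 0 ≤ ρ → |packet' α β (fun w => -Complex.I * c w) τ ρ| ≤ κ τ ρ) :
    ‖pairing α β c t φ (timeDeriv I φ) t‖ₑ ≤
      5 * (∫⁻ y, ENNReal.ofReal (κ t ‖y‖) * ‖grad I φ 0 y‖ₑ) +
        ∫⁻ s in I, ∫⁻ y, ENNReal.ofReal (κ (t - s) ‖y‖) * ‖F s y‖ₑ := by
  have hF1 : ∀ J : Set ℝ, J ⊆ I → ‖∫ s in J, ∫ y, packet α β c (t - s) y • F s y‖ₑ ≤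
      ∫⁻ s in I, ∫⁻ y, ENNReal.ofReal (κ (t - s) ‖y‖) * ‖F s y‖ₑ := fun J hJ => by
    refine (enorm_integral_le_lintegral_enorm _).trans ((lintegral_mono_set hJ).trans ?_)
    refine lintegral_mono fun s => (enorm_integral_le_lintegral_enorm _).trans
      (lintegral_mono fun y => ?_)
    rw [enorm_smul, ← ofReal_norm]
    exact mul_le_mul' (ENNReal.ofReal_le_ofReal (h1 _ _)) le_rfl
  have hdata : ‖pairing α β c t φ (timeDeriv I φ) 0‖ₑ ≤
      5 * ∫⁻ y, ENNReal.ofReal (κ t ‖y‖) * ‖grad I φ 0 y‖ₑ := by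
    have hslice : ContDiff ℝ 1 (φ 0) := contDiffOn_univ.1
      (hφ.contDiffOn.comp (f := fun y : Plane => (0, y))
      (by fun_prop) fun y _ => ⟨h0, mem_univ y⟩)
    have e1 := enorm_integral_packet_le hα hαβ hc t hslice (hφ.fourier 0 h0).1
    rw [pairing, sub_zero]
    refine (enorm_add_le _ _).trans ?_
    -- The summand 1 is for ∂_tφ(0). In 4 = 2·2 one factor comes from the integration by parts and
    -- the other from comparing the spatial differential with the space-time gradient.
    rw [show (5 : ℝ≥0∞) = 1 + 4 by norm_num, add_mul, one_mul]
    refine add_le_add ((enorm_integral_le_lintegral_enorm _).trans (lintegral_mono fun y => ?_))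
      (e1.trans ?_)
    · rw [enorm_smul, ← ofReal_norm (packet α β c t y)]
      exact mul_le_mul' (ENNReal.ofReal_le_ofReal (h1 _ _)) (enorm_timeDeriv_le_grad I φ 0 y)
    · rw [show (4 : ℝ≥0∞) = 2 * 2 by norm_num, mul_assoc]
      refine mul_le_mul' le_rfl ?_
      rw [← lintegral_const_mul' 2 _ ENNReal.ofNat_ne_top]
      refine lintegral_mono fun y => ?_
      rw [mul_left_comm, ← ofReal_norm (packet' _ _ _ _ _)]
      exact mul_le_mul' (ENNReal.ofReal_le_ofReal (h2 _ _ (norm_nonneg y)))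
        (enorm_fderiv_le_grad I φ 0 y)
  rcases lt_trichotomy t 0 with h | h | h
  · have e := hbox.pairing_sub_pairing hI hφ hF hα hαβ hc t h ht h0
    rw [sub_eq_iff_eq_add'] at e
    rw [e]
    exact (enorm_add_le _ _).trans (add_le_add hdata
      (hF1 _ (Ioo_subset_Icc_self.trans (hI.out ht h0))))
  · rw [h] at hdata ⊢
    exact hdata.trans le_self_add
  · have e := hbox.pairing_sub_pairing hI hφ hF hα hαβ hc t h h0 ht
    have e' : pairing α β c t φ (timeDeriv I φ) t = pairing α β c t φ (timeDeriv I φ) 0 -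
        ∫ s in Ioo 0 t, ∫ y, packet α β c (t - s) y • F s y := by rw [← e]; ring
    rw [e']
    exact (enorm_sub_le).trans (add_le_add hdata
      (hF1 _ (Ioo_subset_Icc_self.trans (hI.out h0 ht))))

end RadialWave

end

/-! ### From a one-variable profile to mixed norms -/

noncomputable section

namespace RadialWave

/-! ### Slowly varying square integrable functions -/

/-- A function which is roughly constant at scale `N⁻¹`. -/
structure SlowlyVarying (N : ℝ) (H : ℝ → ℝ≥0∞) : Prop where
  measurable : Measurable H
  le : ∀ v w, N * |v - w| ≤ 1 → H v ≤ 3 * H w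

/-- The squared `L²` norm. -/
def energy (H : ℝ → ℝ≥0∞) : ℝ≥0∞ := ∫⁻ v, H v ^ 2

/-- The weight `(1 + N |v|)^{-κ}`. -/
def tailWeight (N κ v : ℝ) : ℝ≥0∞ := ENNReal.ofReal ((1 + N * |v|) ^ (-κ))

/-- A smooth substitute for `sup_v (1 + N |v - t|)^{-κ} H(v)²`. -/
def squareFunction (N κ : ℝ) (H : ℝ → ℝ≥0∞) (t : ℝ) : ℝ≥0∞ :=
  ENNReal.ofReal N * ∫⁻ v, tailWeight N κ (v - t) * H v ^ 2

theorem measurable_tailWeight (N κ : ℝ) : Measurable (tailWeight N κ) := by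
  unfold tailWeight; fun_prop

variable {N κ : ℝ} {H : ℝ → ℝ≥0∞}

theorem measurable_squareFunction (N κ : ℝ) (hH : Measurable H) :
    Measurable (squareFunction N κ H) := by
  have h : Measurable fun p : ℝ × ℝ => tailWeight N κ (p.2 - p.1) * H p.2 ^ 2 :=
    ((measurable_tailWeight N κ).comp (by fun_prop)).mul ((hH.comp measurable_snd).pow_const 2)
  exact (h.lintegral_prod_right').const_mul _

theorem lintegral_tailWeight (hN : 0 < N) (κ : ℝ) :
    ENNReal.ofReal N * ∫⁻ v, tailWeight N κ v = ∫⁻ v, tailWeight 1 κ v := by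
  have h := lintegral_map_equiv (μ := (volume : Measure ℝ)) (tailWeight 1 κ)
    (MeasurableEquiv.mulLeft₀ N hN.ne')
  have h2 : Measure.map (MeasurableEquiv.mulLeft₀ N hN.ne') volume =
      ENNReal.ofReal |N⁻¹| • (volume : Measure ℝ) := Real.map_volume_mul_left hN.ne'
  rw [h2, lintegral_smul_measure] at h
  have h3 : ∀ v, tailWeight 1 κ (MeasurableEquiv.mulLeft₀ N hN.ne' v) = tailWeight N κ v :=
    fun v => by
      rw [MeasurableEquiv.coe_mulLeft₀, tailWeight, tailWeight, one_mul, abs_mul, abs_of_pos hN]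
  simp only [h3] at h
  rw [← h, smul_eq_mul, ← mul_assoc, abs_of_pos (inv_pos.2 hN), ← ENNReal.ofReal_mul hN.le,
    mul_inv_cancel₀ hN.ne', ENNReal.ofReal_one, one_mul]

theorem lintegral_tailWeight_lt_top (hκ : 1 < κ) : ∫⁻ v, tailWeight 1 κ v < ⊤ := by
  have h := integrable_one_add_norm (E := ℝ) (μ := volume) (r := κ) (by simpa using hκ)
  have h2 := h.lintegral_lt_top
  refine lt_of_le_of_lt (lintegral_mono fun v => le_of_eq ?_) h2
  rw [tailWeight, one_mul, Real.norm_eq_abs]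

/-- By Tonelli the t-integral falls on the tail weight alone, and the prefactor N makes that
integral scale invariant. It is finite for κ > 1. -/
theorem lintegral_squareFunction (hN : 0 < N) (κ : ℝ) (hH : Measurable H) :
    ∫⁻ t, squareFunction N κ H t = (∫⁻ v, tailWeight 1 κ v) * energy H := by
  have hm := measurable_tailWeight N κ
  simp only [squareFunction]
  rw [lintegral_const_mul' _ _ ENNReal.ofReal_ne_top, lintegral_lintegral_swap
    (f := fun t v => tailWeight N κ (v - t) * H v ^ 2)]
  · have e : ∀ v, ∫⁻ t, tailWeight N κ (v - t) * H v ^ 2 =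
        (∫⁻ t, tailWeight N κ t) * H v ^ 2 := fun v => by
      have hv : Measurable fun t => tailWeight N κ (v - t) :=
        hm.comp (measurable_const.sub measurable_id)
      rw [lintegral_mul_const _ hv, lintegral_sub_left_eq_self (fun t => tailWeight N κ t)]
    simp only [e]
    rw [lintegral_const_mul _ (hH.pow_const 2), ← mul_assoc, lintegral_tailWeight hN, energy]
  · exact ((hm.comp (by fun_prop : Measurable fun p : ℝ × ℝ => p.2 - p.1)).mul
      ((hH.comp measurable_snd).pow_const 2)).aemeasurable

theorem SlowlyVarying.sq_le (hH : SlowlyVarying N H) {v w : ℝ} (h : N * |v - w| ≤ 1) :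
    H v ^ 2 ≤ 9 * H w ^ 2 := by
  calc H v ^ 2 ≤ (3 * H w) ^ 2 := pow_le_pow_left' (hH.le v w h) 2
    _ = _ := by rw [mul_pow]; norm_num

/-- A weighted square is controlled by its mean over an interval of length `N⁻¹`. -/
theorem SlowlyVarying.weight_mul_sq_le (hN : 0 < N) (hH : SlowlyVarying N H) (v : ℝ)
    {W : ℝ → ℝ≥0∞} {c B : ℝ≥0∞} (hB : B ≠ ⊤) (hW : ∀ w ∈ Icc v (v + N⁻¹), c ≤ B * W w) :
    c * H v ^ 2 ≤ 9 * B * (ENNReal.ofReal N * ∫⁻ w, W w * H w ^ 2) := by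
  have hN1 : ENNReal.ofReal N * ENNReal.ofReal N⁻¹ = 1 := by
    rw [← ENNReal.ofReal_mul hN.le, mul_inv_cancel₀ hN.ne', ENNReal.ofReal_one]
  have h1 : c * H v ^ 2 * ENNReal.ofReal N⁻¹ ≤ 9 * B * ∫⁻ w, W w * H w ^ 2 := by
    calc c * H v ^ 2 * ENNReal.ofReal N⁻¹ = ∫⁻ w in Icc v (v + N⁻¹), c * H v ^ 2 := by
          rw [setLIntegral_const, Real.volume_Icc, add_sub_cancel_left]
      _ ≤ ∫⁻ w in Icc v (v + N⁻¹), 9 * B * (W w * H w ^ 2) := by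
          refine setLIntegral_mono' measurableSet_Icc fun w hw => ?_
          have h2 : N * |v - w| ≤ 1 := by
            rw [abs_sub_comm, abs_of_nonneg (by linarith [hw.1])]
            calc N * (w - v) ≤ N * N⁻¹ := by gcongr; linarith [hw.2]
              _ = 1 := mul_inv_cancel₀ hN.ne'
          calc c * H v ^ 2 ≤ (B * W w) * (9 * H w ^ 2) := mul_le_mul' (hW w hw) (hH.sq_le h2)
            _ = _ := by ring
      _ ≤ ∫⁻ w, 9 * B * (W w * H w ^ 2) := setLIntegral_le_lintegral _ _
      _ = _ := lintegral_const_mul' _ _ (ENNReal.mul_ne_top (by simp) hB)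
  calc c * H v ^ 2 = ENNReal.ofReal N * (c * H v ^ 2 * ENNReal.ofReal N⁻¹) := by
        rw [mul_comm (c * H v ^ 2), ← mul_assoc, hN1, one_mul]
    _ ≤ ENNReal.ofReal N * (9 * B * ∫⁻ w, W w * H w ^ 2) := mul_le_mul' le_rfl h1
    _ = _ := by ring

theorem SlowlyVarying.sq_le_energy (hN : 0 < N) (hH : SlowlyVarying N H) (v : ℝ) :
    H v ^ 2 ≤ 9 * (ENNReal.ofReal N * energy H) := by
  have h := hH.weight_mul_sq_le hN v (W := fun _ => 1) (c := 1) (B := 1) (by simp) (by simp)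
  simpa [energy] using h

/-- Passing from a point to a mean: on [v, v + 1/N] the value of H² is comparable up to 9 = 3² and
the weight up to 2^κ ≤ 4, whence 36. -/
theorem SlowlyVarying.tailWeight_mul_sq_le (hN : 0 < N) (hH : SlowlyVarying N H) (hκ : 0 ≤ κ)
    (hκ2 : κ ≤ 2) (v t : ℝ) :
    tailWeight N κ (v - t) * H v ^ 2 ≤ 36 * squareFunction N κ H t := by
  have h := hH.weight_mul_sq_le hN v (W := fun w => tailWeight N κ (w - t))
    (c := tailWeight N κ (v - t)) (B := 4) (by simp) (fun w hw => ?_)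
  · rw [squareFunction]
    calc _ ≤ _ := h
      _ = _ := by rw [show (9 : ℝ≥0∞) * 4 = 36 by norm_num]
  · have e4 : (4 : ℝ≥0∞) = ENNReal.ofReal 4 := by simp
    simp only [tailWeight]
    rw [e4, ← ENNReal.ofReal_mul (by norm_num)]
    refine ENNReal.ofReal_le_ofReal ?_
    have hp : 0 < 1 + N * |v - t| := by positivity
    have hq : 0 < 1 + N * |w - t| := by positivity
    have h1 : 1 + N * |w - t| ≤ 2 * (1 + N * |v - t|) := by
      have h2 : |w - t| ≤ N⁻¹ + |v - t| := by
        calc |w - t| = |(w - v) + (v - t)| := by ring_nf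
          _ ≤ |w - v| + |v - t| := abs_add_le _ _
          _ ≤ _ := by
            rw [abs_of_nonneg (by linarith [hw.1] : 0 ≤ w - v)]
            linarith [hw.2]
      have h3 := mul_le_mul_of_nonneg_left h2 hN.le
      rw [mul_add, mul_inv_cancel₀ hN.ne'] at h3
      nlinarith [mul_nonneg hN.le (abs_nonneg (v - t))]
    have h2 : (2 * (1 + N * |v - t|)) ^ (-κ) ≤ (1 + N * |w - t|) ^ (-κ) :=
      Real.rpow_le_rpow_of_nonpos hq h1 (by linarith)
    rw [Real.mul_rpow (by norm_num) hp.le] at h2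
    have h3 : (4 : ℝ)⁻¹ ≤ 2 ^ (-κ) := by
      have := Real.rpow_le_rpow_of_exponent_le (x := 2) (by norm_num) (by linarith : (-2 : ℝ) ≤ -κ)
      rw [Real.rpow_neg (by norm_num)] at this
      norm_num at this ⊢
      exact this
    have h4 : 0 < (1 + N * |v - t|) ^ (-κ) := Real.rpow_pos_of_pos hp _
    nlinarith [mul_le_mul_of_nonneg_right h3 h4.le]

/-! ### The majorant of a radial wave -/

/-- The majorant `(1 + Nr)^{-1/2} (H(t + r) + H(t - r))`. -/
def majorant (N : ℝ) (H : ℝ → ℝ≥0∞) (t r : ℝ) : ℝ≥0∞ :=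
  ENNReal.ofReal ((1 + N * r) ^ (-(1 / 2) : ℝ)) * (H (t + r) + H (t - r))

theorem ofReal_rpow_half_sq {x : ℝ} (hx : 0 ≤ x) (p : ℝ) :
    ENNReal.ofReal (x ^ p) ^ 2 = ENNReal.ofReal (x ^ (2 * p)) := by
  rw [← ENNReal.ofReal_pow (Real.rpow_nonneg hx p), ← Real.rpow_natCast, ← Real.rpow_mul hx]
  congr 2
  push_cast
  ring

theorem add_sq_le_two_mul (x y : ℝ≥0∞) : (x + y) ^ 2 ≤ 2 * (x ^ 2 + y ^ 2) := by
  have h := ENNReal.rpow_add_le_mul_rpow_add_rpow x y (p := 2) one_le_two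
  norm_num at h
  simpa only [← ENNReal.rpow_natCast, Nat.cast_ofNat] using h

theorem majorant_sq_le (hN : 0 < N) {r : ℝ} (hr : 0 ≤ r) (t : ℝ) : majorant N H t r ^ 2 ≤
    2 * (ENNReal.ofReal ((1 + N * r)⁻¹) * (H (t + r) ^ 2 + H (t - r) ^ 2)) := by
  rw [majorant, mul_pow, ofReal_rpow_half_sq (by positivity)]
  calc _ ≤ ENNReal.ofReal ((1 + N * r) ^ (2 * -(1 / 2) : ℝ)) *
        (2 * (H (t + r) ^ 2 + H (t - r) ^ 2)) := mul_le_mul' le_rfl (add_sq_le_two_mul _ _)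
    _ = _ := by
      rw [show (2 * -(1 / 2) : ℝ) = -1 by norm_num, Real.rpow_neg_one]
      ring

theorem measurable_majorant (hH : Measurable H) (N : ℝ) :
    Measurable fun p : ℝ × ℝ => majorant N H p.1 p.2 := by
  unfold majorant; fun_prop

theorem ofReal_eight_mul_pi :
    ENNReal.ofReal (8 * Real.pi) = 4 * ENNReal.ofReal (2 * Real.pi) := by
  have h : 8 * Real.pi = 4 * (2 * Real.pi) := by ring
  rw [h, ENNReal.ofReal_mul (by norm_num : (0 : ℝ) ≤ 4), ENNReal.ofReal_ofNat]

/-- The spatial `L²` norm of the majorant. -/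
theorem lintegral_majorant_sq_le (hN : 0 < N) (hH : Measurable H) (t : ℝ) :
    ∫⁻ x : Plane, majorant N H t ‖x‖ ^ 2 ≤
      ENNReal.ofReal (8 * Real.pi) * (ENNReal.ofReal N⁻¹ * energy H) := by
  have hm : Measurable fun r => majorant N H t r ^ 2 :=
    ((measurable_majorant hH N).comp (measurable_const.prodMk measurable_id)).pow_const 2
  rw [lintegral_plane_radial hm]
  have h1 : ∫⁻ ρ in Ioi (0 : ℝ), ENNReal.ofReal ρ * majorant N H t ρ ^ 2 ≤
      ∫⁻ ρ, 2 * ENNReal.ofReal N⁻¹ * (H (t + ρ) ^ 2 + H (t - ρ) ^ 2) := by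
    refine (setLIntegral_mono' measurableSet_Ioi fun ρ hρ => ?_).trans
      (setLIntegral_le_lintegral (Ioi 0) _)
    have hρ0 : 0 < ρ := hρ
    -- The Jacobian ρ of polar coordinates is absorbed by the factor (1+Nρ)⁻¹ of the squared
    -- majorant, at the price 1/N.
    have h2 : ENNReal.ofReal ρ * ENNReal.ofReal ((1 + N * ρ)⁻¹) ≤ ENNReal.ofReal N⁻¹ := by
      rw [← ENNReal.ofReal_mul hρ0.le]
      refine ENNReal.ofReal_le_ofReal ?_
      rw [← div_eq_mul_inv, div_le_iff₀ (by positivity), inv_mul_eq_div, le_div_iff₀ hN]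
      nlinarith
    calc _ ≤ ENNReal.ofReal ρ * (2 * (ENNReal.ofReal ((1 + N * ρ)⁻¹) *
          (H (t + ρ) ^ 2 + H (t - ρ) ^ 2))) := mul_le_mul' le_rfl (majorant_sq_le hN hρ0.le t)
      _ = 2 * (ENNReal.ofReal ρ * ENNReal.ofReal ((1 + N * ρ)⁻¹)) *
          (H (t + ρ) ^ 2 + H (t - ρ) ^ 2) := by ring
      _ ≤ _ := by gcongr
  have h2 : ∫⁻ ρ, 2 * ENNReal.ofReal N⁻¹ * (H (t + ρ) ^ 2 + H (t - ρ) ^ 2) =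
      2 * ENNReal.ofReal N⁻¹ * (energy H + energy H) := by
    rw [lintegral_const_mul _ (by fun_prop), lintegral_add_left (by fun_prop),
      lintegral_add_left_eq_self (fun v => H v ^ 2) t, lintegral_sub_left_eq_self
      (fun v => H v ^ 2) t, energy]
  calc _ ≤ ENNReal.ofReal (2 * Real.pi) * (2 * ENNReal.ofReal N⁻¹ * (energy H + energy H)) := by
        rw [← h2]; exact mul_le_mul' le_rfl h1
    _ = _ := by
      rw [ofReal_eight_mul_pi]
      ring

theorem lintegral_majorant_sq_time_le (hN : 0 < N) (hH : Measurable H) {r : ℝ} (hr : 0 ≤ r) :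
    ∫⁻ t, majorant N H t r ^ 2 ≤ ENNReal.ofReal ((1 + N * r)⁻¹) * (4 * energy H) := by
  have hH2 : Measurable fun v => H v ^ 2 := hH.pow_const 2
  calc ∫⁻ t, majorant N H t r ^ 2
      ≤ ∫⁻ t, (2 * ENNReal.ofReal ((1 + N * r)⁻¹)) * (H (t + r) ^ 2 + H (t - r) ^ 2) :=
        lintegral_mono fun t => (majorant_sq_le hN hr t).trans_eq (mul_assoc _ _ _).symm
    _ = (2 * ENNReal.ofReal ((1 + N * r)⁻¹)) * (energy H + energy H) := by
        rw [lintegral_const_mul _ (by fun_prop), lintegral_add_left (by fun_prop),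
          lintegral_add_right_eq_self (fun v => H v ^ 2) r,
          lintegral_sub_right_eq_self (fun v => H v ^ 2) r, energy]
    _ = _ := by ring

/-- The space-time `L²` norm of the majorant with a radial weight. -/
theorem lintegral_lintegral_majorant_sq_le (hN : 0 < N) (hH : Measurable H) {w : ℝ → ℝ≥0∞}
    (hw : Measurable w) :
    ∫⁻ t, ∫⁻ x : Plane, w ‖x‖ * majorant N H t ‖x‖ ^ 2 ≤ ENNReal.ofReal (8 * Real.pi) *
      (∫⁻ r in Ioi (0 : ℝ), ENNReal.ofReal (r * (1 + N * r)⁻¹) * w r) * energy H := by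
  have hm : Measurable fun p : ℝ × Plane => w ‖p.2‖ * majorant N H p.1 ‖p.2‖ ^ 2 :=
    (hw.comp measurable_snd.norm).mul (((measurable_majorant hH N).comp
      (measurable_fst.prodMk measurable_snd.norm)).pow_const 2)
  have hmt : ∀ r, Measurable fun t => majorant N H t r ^ 2 := fun r =>
    ((measurable_majorant hH N).comp (measurable_id.prodMk measurable_const)).pow_const 2
  rw [lintegral_lintegral_swap (f := fun t (x : Plane) => w ‖x‖ * majorant N H t ‖x‖ ^ 2)
    hm.aemeasurable]
  have h1 : ∀ x : Plane, ∫⁻ t, w ‖x‖ * majorant N H t ‖x‖ ^ 2 ≤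
      4 * energy H * (w ‖x‖ * ENNReal.ofReal ((1 + N * ‖x‖)⁻¹)) := fun x => by
    rw [lintegral_const_mul _ (hmt ‖x‖)]
    calc _ ≤ w ‖x‖ * (ENNReal.ofReal ((1 + N * ‖x‖)⁻¹) * (4 * energy H)) :=
          mul_le_mul' le_rfl (lintegral_majorant_sq_time_le hN hH (norm_nonneg x))
      _ = _ := by ring
  have hg : Measurable fun r : ℝ => w r * ENNReal.ofReal ((1 + N * r)⁻¹) := by fun_prop
  refine (lintegral_mono h1).trans (le_of_eq ?_)
  have hg2 : Measurable fun x : Plane => w ‖x‖ * ENNReal.ofReal ((1 + N * ‖x‖)⁻¹) :=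
    hg.comp measurable_norm
  rw [lintegral_const_mul _ hg2, lintegral_plane_radial hg, ofReal_eight_mul_pi]
  have e : ∫⁻ r in Ioi (0 : ℝ), ENNReal.ofReal r * (w r * ENNReal.ofReal ((1 + N * r)⁻¹)) =
      ∫⁻ r in Ioi (0 : ℝ), ENNReal.ofReal (r * (1 + N * r)⁻¹) * w r :=
    setLIntegral_congr_fun measurableSet_Ioi fun r (hr : 0 < r) => by
      rw [ENNReal.ofReal_mul hr.le]
      ring
  rw [e]
  ring

end RadialWave

end

noncomputable section

namespace RadialWave

/-! ### Mixed norms of functions controlled by the majorant -/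

section Interpolation

variable {α : Type*} [MeasurableSpace α] {μ : Measure α}

theorem eLpNorm_le_of_lintegral_rpow_le {E : Type*} [TopologicalSpace E]
    [ESeminormedAddMonoid E] {f : α → E}
    {p : ℝ≥0∞} (hp : p ≠ 0) (hp2 : p ≠ ⊤) {X : ℝ≥0∞}
    (h : ∫⁻ x, ‖f x‖ₑ ^ p.toReal ∂μ ≤ X ^ p.toReal) : eLpNorm f p μ ≤ X := by
  rw [eLpNorm_eq_lintegral_rpow_enorm_toReal hp hp2]
  have h0 : 0 < p.toReal := ENNReal.toReal_pos hp hp2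
  calc _ ≤ (X ^ p.toReal) ^ (1 / p.toReal) := ENNReal.rpow_le_rpow h (by positivity)
    _ = X := by rw [← ENNReal.rpow_mul, mul_one_div_cancel h0.ne', ENNReal.rpow_one]

/-- Interpolation between `L^r` and `L^∞`. -/
theorem eLpNorm_le_interpolate {E : Type*} [TopologicalSpace E] [ESeminormedAddMonoid E]
    {f : α → E} {p : ℝ≥0∞} {r : ℝ} (hr : 0 < r) (hp : r * p⁻¹.toReal ≤ 1) {A Y : ℝ≥0∞}
    (hY : Y ≠ ⊤) (h1 : ∫⁻ x, ‖f x‖ₑ ^ r ∂μ ≤ A ^ r) (h2 : ∀ᵐ x ∂μ, ‖f x‖ₑ ≤ Y) :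
    eLpNorm f p μ ≤ A ^ (r * p⁻¹.toReal) * Y ^ (1 - r * p⁻¹.toReal) := by
  rcases eq_or_ne p 0 with rfl | hp0
  · simp
  rcases eq_or_ne p ⊤ with rfl | hpt
  · simpa using eLpNormEssSup_le_of_ae_enorm_bound h2
  have hpr : 0 < p.toReal := ENNReal.toReal_pos hp0 hpt
  rw [ENNReal.toReal_inv] at hp ⊢
  have hrp : r ≤ p.toReal := by
    rw [← div_eq_mul_inv, div_le_one hpr] at hp
    exact hp
  rw [eLpNorm_eq_lintegral_rpow_enorm_toReal hp0 hpt]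
  have h3 : ∫⁻ x, ‖f x‖ₑ ^ p.toReal ∂μ ≤ A ^ r * Y ^ (p.toReal - r) := by
    calc _ ≤ ∫⁻ x, ‖f x‖ₑ ^ r * Y ^ (p.toReal - r) ∂μ := by
          refine lintegral_mono_ae ?_
          filter_upwards [h2] with x hx
          calc ‖f x‖ₑ ^ p.toReal = ‖f x‖ₑ ^ r * ‖f x‖ₑ ^ (p.toReal - r) := by
                rw [← ENNReal.rpow_add_of_nonneg _ _ hr.le (by linarith)]
                congr 1; ring
            _ ≤ _ := by gcongr
      _ ≤ _ := by
          rw [lintegral_mul_const' _ _ (ENNReal.rpow_ne_top_of_nonneg (by linarith) hY)]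
          gcongr
  calc _ ≤ (A ^ r * Y ^ (p.toReal - r)) ^ (1 / p.toReal) := ENNReal.rpow_le_rpow h3 (by positivity)
    _ = _ := by
      rw [ENNReal.mul_rpow_of_nonneg _ _ (by positivity), ← ENNReal.rpow_mul, ← ENNReal.rpow_mul]
      congr 2 <;> field_simp

end Interpolation

/-- Strichartz estimates from the energy bound, the Bernstein bound and one weak endpoint. -/
theorem mixedNorm_le_interpolate {V : Type*} [NormedAddCommGroup V] {I : Set ℝ}
    {g : ℝ → Plane → V} {n X : ℝ≥0∞} {M : ℝ → ℝ≥0∞} {κ : ℝ} (hκ : 1 < κ) (hn0 : n ≠ 0)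
    (hn : n ≠ ⊤) (hX : X ≠ ⊤) (h1 : ∀ᵐ t ∂volume.restrict I, ∫⁻ x, ‖g t x‖ₑ ^ (2 : ℝ) ≤ X ^ (2 : ℝ))
    (h2 : ∀ᵐ t ∂volume.restrict I, ∀ᵐ x, ‖g t x‖ₑ ≤ M t) (h3 : ∀ t, M t ≤ n * X)
    (h4 : ∫⁻ t in I, M t ^ (2 * κ) ≤ n ^ (2 * κ - 1) * X ^ (2 * κ)) {q p : ℝ≥0∞}
    (hp : 2 * p⁻¹.toReal < 1) (hq : 2 * κ * q⁻¹.toReal ≤ 1 - 2 * p⁻¹.toReal) :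
    n ^ (q⁻¹.toReal + 2 * p⁻¹.toReal - 1) * mixedNorm I q p g ≤ X := by
  set s := p⁻¹.toReal with hs
  set z := q⁻¹.toReal with hz
  have hs0 : 0 ≤ s := ENNReal.toReal_nonneg
  have hz0 : 0 ≤ z := ENNReal.toReal_nonneg
  have hθ : 0 < 1 - 2 * s := by linarith
  have hM : ∀ t, M t ≠ ⊤ := fun t => ne_top_of_le_ne_top (ENNReal.mul_ne_top hn hX) (h3 t)
  have hb : ∀ᵐ t ∂volume.restrict I, eLpNorm (g t) p volume ≤ X ^ (2 * s) * M t ^ (1 - 2 * s) := by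
    filter_upwards [h1, h2] with t ht1 ht2
    exact eLpNorm_le_interpolate two_pos hp.le (hM t) ht1 ht2
  have hXs : X ^ (2 * s) * X ^ (1 - 2 * s) = X := by
    rw [← ENNReal.rpow_add_of_nonneg _ _ (by positivity) hθ.le]; simp
  have hc1 : ∀ᵐ t ∂volume.restrict I, ‖eLpNorm (g t) p volume‖ₑ ≤ n ^ (1 - 2 * s) * X := by
    filter_upwards [hb] with t ht
    rw [enorm_eq_self]
    calc _ ≤ _ := ht
      _ ≤ X ^ (2 * s) * (n * X) ^ (1 - 2 * s) := by gcongr; exact h3 t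
      _ = n ^ (1 - 2 * s) * (X ^ (2 * s) * X ^ (1 - 2 * s)) := by
        rw [ENNReal.mul_rpow_of_nonneg _ _ hθ.le]; ring
      _ = _ := by rw [hXs]
  -- This is the time exponent at which the bound X^{2s}M(t)^{1-2s} for the spatial norm is
  -- controlled by the integral of M^{2κ}. A second interpolation, between L^r and L^∞ in time, then
  -- reaches q.
  set r := 2 * κ / (1 - 2 * s) with hr
  have hr0 : 0 < r := by positivity
  have hθr : (1 - 2 * s) * r = 2 * κ := by rw [hr]; field_simp
  have hc2 : ∫⁻ t in I, ‖eLpNorm (g t) p volume‖ₑ ^ r ≤ (n ^ (1 - 2 * s - r⁻¹) * X) ^ r := by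
    calc _ ≤ ∫⁻ t in I, (X ^ (2 * s)) ^ r * M t ^ (2 * κ) := by
          refine lintegral_mono_ae ?_
          filter_upwards [hb] with t ht
          rw [enorm_eq_self, ← hθr, ENNReal.rpow_mul (M t), ← ENNReal.mul_rpow_of_nonneg _ _ hr0.le]
          gcongr
      _ = (X ^ (2 * s)) ^ r * ∫⁻ t in I, M t ^ (2 * κ) := by
          rw [lintegral_const_mul' _ _ (ENNReal.rpow_ne_top_of_nonneg hr0.le
            (ENNReal.rpow_ne_top_of_nonneg (by positivity) hX))]
      _ ≤ (X ^ (2 * s)) ^ r * (n ^ (2 * κ - 1) * X ^ (2 * κ)) := by gcongr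
      _ = n ^ (2 * κ - 1) * (X ^ (2 * s) * X ^ (1 - 2 * s)) ^ r := by
          rw [← hθr, ENNReal.mul_rpow_of_nonneg _ _ hr0.le, ← ENNReal.rpow_mul X (1 - 2 * s)]
          ring
      _ = _ := by
          rw [hXs, ENNReal.mul_rpow_of_nonneg _ _ hr0.le, ← ENNReal.rpow_mul, sub_mul, hθr,
            inv_mul_cancel₀ hr0.ne']
  have hrz : r * z ≤ 1 := by
    rw [hr, div_mul_eq_mul_div, div_le_one hθ]; exact hq
  have hfin := eLpNorm_le_interpolate (p := q) hr0 hrz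
    (ENNReal.mul_ne_top (ENNReal.rpow_ne_top_of_nonneg hθ.le hn) hX) hc2 hc1
  rw [← hz] at hfin
  calc _ ≤ n ^ (z + 2 * s - 1) * ((n ^ (1 - 2 * s - r⁻¹) * X) ^ (r * z) *
        (n ^ (1 - 2 * s) * X) ^ (1 - r * z)) := mul_le_mul' le_rfl hfin
    _ = (n ^ (z + 2 * s - 1) * n ^ ((1 - 2 * s - r⁻¹) * (r * z)) *
        n ^ ((1 - 2 * s) * (1 - r * z))) * (X ^ (r * z) * X ^ (1 - r * z)) := by
      rw [ENNReal.mul_rpow_of_nonneg _ _ (by positivity), ENNReal.mul_rpow_of_nonneg _ _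
        (by linarith), ← ENNReal.rpow_mul n, ← ENNReal.rpow_mul n]
      ring
    _ = X := by
      rw [← ENNReal.rpow_add _ _ hn0 hn, ← ENNReal.rpow_add _ _ hn0 hn,
        ← ENNReal.rpow_add_of_nonneg _ _ (by positivity) (by linarith)]
      have e : z + 2 * s - 1 + (1 - 2 * s - r⁻¹) * (r * z) + (1 - 2 * s) * (1 - r * z) = 0 := by
        field_simp
        ring
      rw [e]
      simp

end RadialWave

end

/-! ### Energy, Strichartz and weighted L²_t L^∞_x bounds -/

noncomputable section

namespace RadialWave

variable {N κ : ℝ} {H : ℝ → ℝ≥0∞} {I : Set ℝ} {D : ℝ≥0∞}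
  {V : Type*} [NormedAddCommGroup V] {g : ℝ → Plane → V}

/-- The scale invariant size of the profile `H`. -/
def size (N : ℝ) (H : ℝ → ℝ≥0∞) : ℝ≥0∞ := (ENNReal.ofReal N⁻¹ * energy H) ^ (1 / 2 : ℝ)

theorem size_sq (N : ℝ) (H : ℝ → ℝ≥0∞) : size N H ^ 2 = ENNReal.ofReal N⁻¹ * energy H := by
  rw [size, ← ENNReal.rpow_natCast, ← ENNReal.rpow_mul]
  norm_num

theorem energy_eq (hN : 0 < N) (H : ℝ → ℝ≥0∞) : energy H = ENNReal.ofReal N * size N H ^ 2 := by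
  rw [size_sq, ← mul_assoc, ← ENNReal.ofReal_mul hN.le, mul_inv_cancel₀ hN.ne',
    ENNReal.ofReal_one, one_mul]

/-- `g` is bounded by a multiple of the majorant of `H` in the interior of `I`. -/
def MajorizedBy (I : Set ℝ) (N : ℝ) (D : ℝ≥0∞) (H : ℝ → ℝ≥0∞) (g : ℝ → Plane → V) : Prop :=
  ∀ t ∈ interior I, ∀ x, x ≠ 0 → ‖g t x‖ₑ ≤ D * majorant N H t ‖x‖

/-- The frontier of an interval is a null set, so pointwise bounds are only needed at interior
times. -/
theorem ae_mem_interior (hI : I.OrdConnected) : ∀ᵐ t ∂volume.restrict I, t ∈ interior I := by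
  have h : volume (frontier I) = 0 := hI.convex.addHaar_frontier volume
  have h2 : ∀ᵐ t ∂volume.restrict I, t ∉ frontier I :=
    ae_restrict_of_ae (measure_eq_zero_iff_ae_notMem.1 h)
  have h3 : ∀ᵐ t ∂volume.restrict I, t ∈ closure I :=
    (ae_restrict_mem isClosed_closure.measurableSet).filter_mono
      (ae_mono (Measure.restrict_mono subset_closure le_rfl))
  filter_upwards [h2, h3] with t ht ht2
  by_contra h4
  exact ht ⟨ht2, h4⟩

theorem MajorizedBy.ae_le (hg : MajorizedBy I N D H g) {t : ℝ} (ht : t ∈ interior I) :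
    ∀ᵐ x, ‖g t x‖ₑ ≤ D * majorant N H t ‖x‖ := by
  filter_upwards [Measure.ae_ne volume 0] with x hx
  exact hg t ht x hx

theorem MajorizedBy.lintegral_sq_le (hg : MajorizedBy I N D H g) (hN : 0 < N) (hH : Measurable H)
    {t : ℝ} (ht : t ∈ interior I) :
    ∫⁻ x, ‖g t x‖ₑ ^ (2 : ℝ) ≤ (6 * D * size N H) ^ (2 : ℝ) := by
  have hm : Measurable fun x : Plane => majorant N H t ‖x‖ ^ 2 :=
    ((measurable_majorant hH N).comp (measurable_const.prodMk measurable_norm)).pow_const 2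
  -- 8π is replaced by the larger perfect square 36, so that 6 appears after the root.
  have h8 : ENNReal.ofReal (8 * Real.pi) ≤ 36 := by
    rw [show (36 : ℝ≥0∞) = ENNReal.ofReal 36 by simp]
    exact ENNReal.ofReal_le_ofReal (by linarith [Real.pi_le_four])
  calc ∫⁻ x, ‖g t x‖ₑ ^ (2 : ℝ) ≤ ∫⁻ x : Plane, D ^ 2 * majorant N H t ‖x‖ ^ 2 := by
        refine lintegral_mono_ae ?_
        filter_upwards [hg.ae_le ht] with x hx
        rw [ENNReal.rpow_two, ← mul_pow]
        gcongr
    _ = D ^ 2 * ∫⁻ x : Plane, majorant N H t ‖x‖ ^ 2 := lintegral_const_mul _ hm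
    _ ≤ D ^ 2 * (36 * size N H ^ 2) := by
        rw [size_sq]
        exact mul_le_mul' le_rfl ((lintegral_majorant_sq_le hN hH t).trans (by gcongr))
    _ = _ := by
        rw [ENNReal.rpow_two]
        ring

/-- The energy bound. -/
theorem MajorizedBy.mixedNorm_top_two_le (hI : I.OrdConnected) (hg : MajorizedBy I N D H g)
    (hN : 0 < N) (hH : Measurable H) : mixedNorm I ⊤ 2 g ≤ 6 * D * size N H := by
  rw [mixedNorm, eLpNorm_exponent_top]
  refine eLpNormEssSup_le_of_ae_enorm_bound ?_
  filter_upwards [ae_mem_interior hI] with t ht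
  rw [enorm_eq_self]
  refine eLpNorm_le_of_lintegral_rpow_le two_ne_zero ENNReal.ofNat_ne_top ?_
  rw [ENNReal.toReal_ofNat]
  exact hg.lintegral_sq_le hN hH ht

/-- The constant in the integral of the square function. -/
def tailConst (κ : ℝ) : ℝ≥0∞ := 1 + ∫⁻ v, tailWeight 1 κ v

theorem tailConst_ne_top (hκ : 1 < κ) : tailConst κ ≠ ⊤ :=
  ENNReal.add_ne_top.2 ⟨ENNReal.one_ne_top, (lintegral_tailWeight_lt_top hκ).ne⟩

theorem one_le_tailConst (κ : ℝ) : 1 ≤ tailConst κ := le_self_add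

theorem lintegral_squareFunction_le (hN : 0 < N) (κ : ℝ) (hH : Measurable H) :
    ∫⁻ t, squareFunction N κ H t ≤ tailConst κ * (ENNReal.ofReal N * size N H ^ 2) := by
  rw [lintegral_squareFunction hN κ hH, energy_eq hN]
  gcongr
  exact le_add_self

theorem tailWeight_le_one (hN : 0 < N) (hκ : 0 ≤ κ) (v : ℝ) : tailWeight N κ v ≤ 1 := by
  rw [tailWeight, ← ENNReal.ofReal_one]
  refine ENNReal.ofReal_le_ofReal (Real.rpow_le_one_of_one_le_of_nonpos ?_ (by linarith))
  have : 0 ≤ N * |v| := by positivity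
  linarith

theorem squareFunction_le (hN : 0 < N) (hκ : 0 ≤ κ) (H : ℝ → ℝ≥0∞) (t : ℝ) :
    squareFunction N κ H t ≤ (ENNReal.ofReal N * size N H) ^ 2 := by
  calc squareFunction N κ H t ≤ ENNReal.ofReal N * energy H := by
        refine mul_le_mul' le_rfl (lintegral_mono fun v => ?_)
        calc _ ≤ 1 * H v ^ 2 := mul_le_mul' (tailWeight_le_one hN hκ _) le_rfl
          _ = _ := one_mul _
    _ = _ := by rw [energy_eq hN]; ring

/-- The majorant with an additional decaying weight is bounded by the square function. -/
theorem SlowlyVarying.weight_mul_majorant_sq_le (hN : 0 < N) (hH : SlowlyVarying N H)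
    (hκ : 0 ≤ κ) (hκ2 : κ ≤ 2) {lam : ℝ} (hl : κ ≤ 1 + 2 * lam) (t : ℝ) {r : ℝ} (hr : 0 ≤ r) :
    (ENNReal.ofReal ((1 + N * r) ^ (-lam)) * majorant N H t r) ^ 2 ≤
      144 * squareFunction N κ H t := by
  have h1 : 1 ≤ 1 + N * r := by nlinarith [mul_nonneg hN.le hr]
  have hw : ∀ v, |v - t| = r → ENNReal.ofReal ((1 + N * r) ^ (-lam)) ^ 2 *
      ENNReal.ofReal ((1 + N * r)⁻¹) * H v ^ 2 ≤ 36 * squareFunction N κ H t := fun v hv => by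
    refine le_trans (mul_le_mul' ?_ le_rfl) (hH.tailWeight_mul_sq_le hN hκ hκ2 v t)
    rw [ofReal_rpow_half_sq (by linarith), tailWeight, hv, ← Real.rpow_neg_one,
      ← ENNReal.ofReal_mul (by positivity), ← Real.rpow_add (by linarith)]
    exact ENNReal.ofReal_le_ofReal (Real.rpow_le_rpow_of_exponent_le h1 (by linarith))
  have hp := hw (t + r) (by rw [add_sub_cancel_left, abs_of_nonneg hr])
  have hm := hw (t - r) (by rw [sub_sub_cancel_left, abs_neg, abs_of_nonneg hr])
  rw [mul_pow]
  calc _ ≤ ENNReal.ofReal ((1 + N * r) ^ (-lam)) ^ 2 *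
        (2 * (ENNReal.ofReal ((1 + N * r)⁻¹) * (H (t + r) ^ 2 + H (t - r) ^ 2))) :=
        mul_le_mul' le_rfl (majorant_sq_le hN hr t)
    _ = 2 * (ENNReal.ofReal ((1 + N * r) ^ (-lam)) ^ 2 * ENNReal.ofReal ((1 + N * r)⁻¹) *
          H (t + r) ^ 2 + ENNReal.ofReal ((1 + N * r) ^ (-lam)) ^ 2 *
          ENNReal.ofReal ((1 + N * r)⁻¹) * H (t - r) ^ 2) := by ring
    _ ≤ 2 * (36 * squareFunction N κ H t + 36 * squareFunction N κ H t) := by gcongr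
    _ = _ := by
      rw [← two_mul, ← mul_assoc, ← mul_assoc]
      norm_num

/-- A pointwise bound for the majorant which is uniform in `r`. -/
def majorantSup (N κ : ℝ) (H : ℝ → ℝ≥0∞) (t : ℝ) : ℝ≥0∞ :=
  (36 * squareFunction N κ H t * (9 * (ENNReal.ofReal N * size N H) ^ 2) ^ (κ - 1)) ^ (1 / (2 * κ))

/-- Raised to the power 2κ, the factor (1+Nr)^{-1/2} is exactly the tail weight of exponent κ. Two
of the 2κ powers of H are then controlled by the square function and the remaining ones by the
uniform bound of H² by N times the energy. -/
theorem SlowlyVarying.majorant_le (hN : 0 < N) (hH : SlowlyVarying N H)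
    (hκ : 1 < κ) (hκ2 : κ ≤ 2) (t : ℝ) {r : ℝ} (hr : 0 ≤ r) :
    majorant N H t r ≤ 2 * majorantSup N κ H t := by
  have h1 : 0 < 1 + N * r := by nlinarith [mul_nonneg hN.le hr]
  have hw : ∀ v, |v - t| = r → ENNReal.ofReal ((1 + N * r) ^ (-(1 / 2) : ℝ)) * H v ≤
      majorantSup N κ H t := fun v hv => by
    have e : ENNReal.ofReal ((1 + N * r) ^ (-(1 / 2) : ℝ)) ^ (2 * κ) = tailWeight N κ (v - t) := by
      rw [tailWeight, hv, ENNReal.ofReal_rpow_of_nonneg (by positivity) (by positivity),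
        ← Real.rpow_mul h1.le]
      congr 2
      ring
    have e2 : H v ^ (2 * κ) = H v ^ 2 * (H v ^ 2) ^ (κ - 1) := by
      rw [← ENNReal.rpow_two, ← ENNReal.rpow_mul, ← ENNReal.rpow_add_of_nonneg _ _ (by norm_num)
        (by linarith)]
      congr 1; ring
    have h3 : (ENNReal.ofReal ((1 + N * r) ^ (-(1 / 2) : ℝ)) * H v) ^ (2 * κ) ≤
        36 * squareFunction N κ H t * (9 * (ENNReal.ofReal N * size N H) ^ 2) ^ (κ - 1) := by
      rw [ENNReal.mul_rpow_of_nonneg _ _ (by linarith), e, e2, ← mul_assoc]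
      refine mul_le_mul' (hH.tailWeight_mul_sq_le hN (by linarith) hκ2 v t)
        (ENNReal.rpow_le_rpow ((hH.sq_le_energy hN v).trans_eq ?_) (by linarith))
      rw [energy_eq hN]
      ring
    calc _ = ((ENNReal.ofReal ((1 + N * r) ^ (-(1 / 2) : ℝ)) * H v) ^ (2 * κ)) ^ (1 / (2 * κ)) := by
          rw [← ENNReal.rpow_mul, mul_one_div_cancel (by linarith), ENNReal.rpow_one]
      _ ≤ _ := ENNReal.rpow_le_rpow h3 (by positivity)
  rw [majorant, mul_add, two_mul]
  exact add_le_add (hw _ (by rw [add_sub_cancel_left, abs_of_nonneg hr]))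
    (hw _ (by rw [sub_sub_cancel_left, abs_neg, abs_of_nonneg hr]))

theorem majorantSup_rpow_le (hκ : 1 < κ) (N : ℝ) (H : ℝ → ℝ≥0∞) (t : ℝ) :
    majorantSup N κ H t ^ (2 * κ) ≤
      6 ^ (2 * κ) * ((ENNReal.ofReal N * size N H) ^ (2 * κ - 2) * squareFunction N κ H t) := by
  have h9 : (9 : ℝ≥0∞) ^ (κ - 1) ≤ 36 ^ (κ - 1) :=
    ENNReal.rpow_le_rpow (by norm_num) (by linarith)
  have h36 : (36 : ℝ≥0∞) * 36 ^ (κ - 1) = 6 ^ (2 * κ) := by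
    rw [show (36 : ℝ≥0∞) = 6 ^ (2 : ℝ) by rw [ENNReal.rpow_two]; norm_num, ← ENNReal.rpow_mul,
      ← ENNReal.rpow_add _ _ (by norm_num) (by norm_num)]
    congr 1; ring
  rw [majorantSup, ← ENNReal.rpow_mul, one_div_mul_cancel (by linarith), ENNReal.rpow_one,
    ENNReal.mul_rpow_of_nonneg _ _ (by linarith), ← ENNReal.rpow_two (ENNReal.ofReal N * size N H),
    ← ENNReal.rpow_mul, ← h36]
  calc _ ≤ 36 * squareFunction N κ H t * (36 ^ (κ - 1) *
        (ENNReal.ofReal N * size N H) ^ (2 * (κ - 1))) :=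
        mul_le_mul' le_rfl (mul_le_mul' h9 le_rfl)
    _ = _ := by
      rw [show 2 * (κ - 1) = 2 * κ - 2 by ring]
      ring

theorem majorantSup_le (hN : 0 < N) (hκ : 1 < κ) (H : ℝ → ℝ≥0∞) (t : ℝ) :
    majorantSup N κ H t ≤ 6 * (ENNReal.ofReal N * size N H) := by
  have h : majorantSup N κ H t ^ (2 * κ) ≤ (6 * (ENNReal.ofReal N * size N H)) ^ (2 * κ) := by
    refine (majorantSup_rpow_le hκ N H t).trans ?_
    rw [ENNReal.mul_rpow_of_nonneg 6 _ (by linarith : 0 ≤ 2 * κ)]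
    refine mul_le_mul' le_rfl ?_
    calc _ ≤ (ENNReal.ofReal N * size N H) ^ (2 * κ - 2) *
          (ENNReal.ofReal N * size N H) ^ (2 : ℝ) := by
          rw [ENNReal.rpow_two]
          exact mul_le_mul' le_rfl (squareFunction_le hN (by linarith) H t)
      _ = _ := by
          rw [← ENNReal.rpow_add_of_nonneg _ _ (by linarith) (by norm_num), sub_add_cancel]
  have h0 : 0 < 2 * κ := by linarith
  exact (ENNReal.rpow_le_rpow_iff h0).1 h

/-- Strichartz estimates. -/
theorem MajorizedBy.strichartz (hI : I.OrdConnected) (hg : MajorizedBy I N D H g)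
    (hN : 0 < N) (hH : SlowlyVarying N H) (hκ : 1 < κ) (hκ2 : κ ≤ 2) {q p : ℝ≥0∞}
    (hp : 2 * p⁻¹.toReal < 1) (hq : 2 * κ * q⁻¹.toReal ≤ 1 - 2 * p⁻¹.toReal) :
    ENNReal.ofReal N ^ (q⁻¹.toReal + 2 * p⁻¹.toReal - 1) * mixedNorm I q p g ≤
      12 * tailConst κ * D * size N H := by
  set X := 12 * tailConst κ * D * size N H with hX
  set n := ENNReal.ofReal N with hn
  rcases eq_or_ne X ⊤ with hXt | hXt
  · rw [hXt]; exact le_top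
  have h1c := one_le_tailConst κ
  -- The function M is the uniform pointwise bound. The constant 12 in X is 2·6: the factor 2 for
  -- the outgoing and the incoming wave and 6 from `majorantSup_rpow_le`.
  refine mixedNorm_le_interpolate (M := fun t => 2 * D * majorantSup N κ H t) hκ
    (ENNReal.ofReal_pos.2 hN).ne' ENNReal.ofReal_ne_top hXt ?_ ?_ ?_ ?_ hp hq
  · filter_upwards [ae_mem_interior hI] with t ht
    refine (hg.lintegral_sq_le hN hH.measurable ht).trans (ENNReal.rpow_le_rpow ?_ zero_le_two)
    calc 6 * D * size N H = 6 * 1 * D * size N H := by ring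
      _ ≤ 12 * tailConst κ * D * size N H := by gcongr; norm_num
  · filter_upwards [ae_mem_interior hI] with t ht
    filter_upwards [hg.ae_le ht] with x hx
    calc _ ≤ _ := hx
      _ ≤ D * (2 * majorantSup N κ H t) := by
        gcongr; exact hH.majorant_le hN hκ hκ2 t (norm_nonneg x)
      _ = _ := by ring
  · intro t
    calc 2 * D * majorantSup N κ H t ≤ 2 * D * (6 * (n * size N H)) := by
          gcongr; exact majorantSup_le hN hκ H t
      _ = n * (12 * 1 * D * size N H) := by ring
      _ ≤ n * X := by rw [hX]; gcongr
  · calc ∫⁻ t in I, (2 * D * majorantSup N κ H t) ^ (2 * κ)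
        ≤ ∫⁻ t, ((2 * D) ^ (2 * κ) * (6 ^ (2 * κ) * (n * size N H) ^ (2 * κ - 2))) *
            squareFunction N κ H t := by
          refine (setLIntegral_le_lintegral _ _).trans (lintegral_mono fun t => ?_)
          rw [ENNReal.mul_rpow_of_nonneg _ _ (by linarith), mul_assoc, mul_assoc]
          exact mul_le_mul' le_rfl (majorantSup_rpow_le hκ N H t)
      _ = ((2 * D) ^ (2 * κ) * (6 ^ (2 * κ) * (n * size N H) ^ (2 * κ - 2))) *
            ∫⁻ t, squareFunction N κ H t :=
          lintegral_const_mul _ (measurable_squareFunction N κ hH.measurable)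
      _ ≤ ((2 * D) ^ (2 * κ) * (6 ^ (2 * κ) * (n * size N H) ^ (2 * κ - 2))) *
            (tailConst κ ^ (2 * κ) * (n * size N H ^ 2)) := by
          refine mul_le_mul' le_rfl ((lintegral_squareFunction_le hN κ hH.measurable).trans ?_)
          gcongr
          calc tailConst κ = tailConst κ ^ (1 : ℝ) := (ENNReal.rpow_one _).symm
            _ ≤ _ := ENNReal.rpow_le_rpow_of_exponent_le h1c (by linarith)
      _ = _ := by
          have en : n ^ (2 * κ - 1) = n ^ (2 * κ - 2) * n := by
            rw [show 2 * κ - 1 = (2 * κ - 2) + 1 by ring, ENNReal.rpow_add_of_nonneg _ _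
              (by linarith) one_pos.le, ENNReal.rpow_one]
          have es : size N H ^ (2 * κ) = size N H ^ (2 * κ - 2) * size N H ^ 2 := by
            rw [← ENNReal.rpow_two, ← ENNReal.rpow_add_of_nonneg _ _ (by linarith) zero_le_two,
              sub_add_cancel]
          have e12 : X = 2 * D * 6 * tailConst κ * size N H := by
            rw [hX, show (12 : ℝ≥0∞) = 2 * 6 by norm_num]; ring
          have h0 : 0 ≤ 2 * κ := by linarith
          have h2 : 0 ≤ 2 * κ - 2 := by linarith
          rw [e12, en]
          simp only [ENNReal.mul_rpow_of_nonneg _ _ h0, ENNReal.mul_rpow_of_nonneg _ _ h2]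
          rw [es]
          ring

theorem rpow_half_rpow_two (x : ℝ≥0∞) : (x ^ (1 / 2 : ℝ)) ^ (2 : ℝ) = x := by
  rw [← ENNReal.rpow_mul, one_div_mul_cancel two_ne_zero, ENNReal.rpow_one]

theorem le_rpow_half {x y : ℝ≥0∞} (h : x ^ 2 ≤ y) : x ≤ y ^ (1 / 2 : ℝ) := by
  have h2 := ENNReal.rpow_le_rpow h (by norm_num : (0 : ℝ) ≤ 1 / 2)
  rwa [← ENNReal.rpow_two, ← ENNReal.rpow_mul, mul_one_div_cancel two_ne_zero,
    ENNReal.rpow_one] at h2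

theorem MajorizedBy.eLpNorm_top_le [NormedSpace ℝ V]
    (hg : MajorizedBy I N D H g) (hN : 0 < N) (hH : SlowlyVarying N H) (hκ : 0 ≤ κ) (hκ2 : κ ≤ 2)
    {lam c : ℝ} (hl : κ ≤ 1 + 2 * lam) {w : ℝ → ℝ}
    (hw : ∀ r, 0 < r → |w r| ≤ c * (1 + N * r) ^ (-lam)) {t : ℝ} (ht : t ∈ interior I) :
    eLpNorm (weighted w g t) ⊤ volume ≤
      ENNReal.ofReal c * D * (144 * squareFunction N κ H t) ^ (1 / 2 : ℝ) := by
  rw [eLpNorm_exponent_top]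
  refine eLpNormEssSup_le_of_ae_enorm_bound ?_
  filter_upwards [hg.ae_le ht, Measure.ae_ne volume 0] with x hx hx0
  have hr : 0 < ‖x‖ := norm_pos_iff.2 hx0
  have h2 : ‖w ‖x‖‖ₑ ≤ ENNReal.ofReal c * ENNReal.ofReal ((1 + N * ‖x‖) ^ (-lam)) := by
    rw [← ENNReal.ofReal_mul' (by positivity), ← ofReal_norm]
    exact ENNReal.ofReal_le_ofReal (hw _ hr)
  have h4 := le_rpow_half (hH.weight_mul_majorant_sq_le hN hκ hκ2 hl t hr.le)
  rw [weighted, enorm_smul]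
  calc ‖w ‖x‖‖ₑ * ‖g t x‖ₑ ≤ (ENNReal.ofReal c * ENNReal.ofReal ((1 + N * ‖x‖) ^ (-lam))) *
        (D * majorant N H t ‖x‖) := mul_le_mul' h2 hx
    _ = ENNReal.ofReal c * D *
        (ENNReal.ofReal ((1 + N * ‖x‖) ^ (-lam)) * majorant N H t ‖x‖) := by ring
    _ ≤ _ := mul_le_mul' le_rfl h4

theorem eLpNorm_two_le_of_squareFunction (hN : 0 < N) (κ : ℝ) (hH : Measurable H)
    {f : ℝ → ℝ≥0∞} {A : ℝ≥0∞}
    (hf : ∀ᵐ t ∂volume.restrict I, f t ≤ A * (144 * squareFunction N κ H t) ^ (1 / 2 : ℝ)) :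
    eLpNorm f 2 (volume.restrict I) ≤
      12 * tailConst κ * A * (ENNReal.ofReal N ^ (1 / 2 : ℝ) * size N H) := by
  refine eLpNorm_le_of_lintegral_rpow_le two_ne_zero ENNReal.ofNat_ne_top ?_
  rw [ENNReal.toReal_ofNat]
  calc ∫⁻ t in I, ‖f t‖ₑ ^ (2 : ℝ) ≤ ∫⁻ t in I, (A ^ 2 * 144) * squareFunction N κ H t := by
        refine lintegral_mono_ae ?_
        filter_upwards [hf] with t ht
        rw [enorm_eq_self]
        calc f t ^ (2 : ℝ) ≤ (A * (144 * squareFunction N κ H t) ^ (1 / 2 : ℝ)) ^ (2 : ℝ) :=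
              ENNReal.rpow_le_rpow ht zero_le_two
          _ = _ := by
            rw [ENNReal.mul_rpow_of_nonneg _ _ zero_le_two, rpow_half_rpow_two, ENNReal.rpow_two,
              mul_assoc]
    _ ≤ ∫⁻ t, (A ^ 2 * 144) * squareFunction N κ H t := setLIntegral_le_lintegral _ _
    _ = (A ^ 2 * 144) * ∫⁻ t, squareFunction N κ H t :=
        lintegral_const_mul _ (measurable_squareFunction N κ hH)
    _ ≤ (A ^ 2 * 144) * (tailConst κ ^ 2 * (ENNReal.ofReal N * size N H ^ 2)) := by
        refine mul_le_mul' le_rfl ((lintegral_squareFunction_le hN κ hH).trans ?_)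
        refine mul_le_mul' ?_ le_rfl
        calc tailConst κ = tailConst κ * 1 := (mul_one _).symm
          _ ≤ tailConst κ * tailConst κ := mul_le_mul' le_rfl (one_le_tailConst κ)
          _ = _ := (sq _).symm
    _ = _ := by
        have e : (ENNReal.ofReal N ^ (1 / 2 : ℝ)) ^ 2 = ENNReal.ofReal N := by
          rw [← ENNReal.rpow_two, rpow_half_rpow_two]
        rw [ENNReal.rpow_two, mul_pow, mul_pow, mul_pow, mul_pow _ (size N H), e,
          show (12 : ℝ≥0∞) ^ 2 = 144 by norm_num]
        ring

/-- The weighted `L²_t L^∞_x` estimate. -/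
theorem MajorizedBy.mixedNorm_two_top_le [NormedSpace ℝ V] (hI : I.OrdConnected)
    (hg : MajorizedBy I N D H g) (hN : 0 < N) (hH : SlowlyVarying N H) (hκ : 0 ≤ κ) (hκ2 : κ ≤ 2)
    {lam c : ℝ} (hl : κ ≤ 1 + 2 * lam) {w : ℝ → ℝ}
    (hw : ∀ r, 0 < r → |w r| ≤ c * (1 + N * r) ^ (-lam)) :
    mixedNorm I 2 ⊤ (weighted w g) ≤
      12 * tailConst κ * (ENNReal.ofReal c * D) * (ENNReal.ofReal N ^ (1 / 2 : ℝ) * size N H) := by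
  refine eLpNorm_two_le_of_squareFunction hN κ hH.measurable ?_
  filter_upwards [ae_mem_interior hI] with t ht
  exact hg.eLpNorm_top_le hN hH hκ hκ2 hl hw ht

end RadialWave

end

noncomputable section

namespace RadialWave

variable {N κ : ℝ} {H : ℝ → ℝ≥0∞} {I : Set ℝ} {D : ℝ≥0∞}
  {V : Type*} [NormedAddCommGroup V] [NormedSpace ℝ V] {g : ℝ → Plane → V}

/-! ### Local energy decay -/

theorem IsDyadicPartition.le_one {χ : ℤ → ℝ → ℝ} (hχ : IsDyadicPartition χ) (l : ℤ) {r : ℝ}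
    (hr : 0 < r) : χ l r ≤ 1 :=
  le_hasSum (hχ.hasSum r hr) l fun j _ => hχ.nonneg j r

/-- On the shell c ≤ r ≤ Ac the Jacobian r(1+Nr)⁻¹ is at most 1/N and the squared weight at most
1/c, while the length is (A-1)c. The product does not depend on the shell. -/
theorem lintegral_dyadic_weight_le (hN : 0 < N) {c A B : ℝ} (hc : 0 < c)
    {f : ℝ → ℝ} (h1 : ∀ r, 0 < r → |f r| ≤ 1)
    (hs : ∀ r, f r ≠ 0 → c ≤ r ∧ r ≤ A * c) (hB : A ≤ B) :
    ∫⁻ r in Ioi (0 : ℝ), ENNReal.ofReal (r * (1 + N * r)⁻¹) *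
      ‖f r * r ^ (-(1 / 2) : ℝ)‖ₑ ^ 2 ≤ ENNReal.ofReal (N⁻¹ * B) := by
  have hpt : ∀ r : ℝ, 0 < r → ENNReal.ofReal (r * (1 + N * r)⁻¹) *
      ‖f r * r ^ (-(1 / 2) : ℝ)‖ₑ ^ 2 ≤
      (Icc c (A * c)).indicator (fun _ => ENNReal.ofReal (N⁻¹ * c⁻¹)) r := fun r hr => by
    by_cases hf : f r = 0
    · simp [hf]
    have hmem := hs r hf
    rw [indicator_of_mem (show r ∈ Icc c (A * c) from hmem), ← ofReal_norm,
      ← ENNReal.ofReal_pow (norm_nonneg _), ← ENNReal.ofReal_mul (by positivity), norm_mul,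
      mul_pow, Real.norm_eq_abs, Real.norm_of_nonneg (Real.rpow_nonneg hr.le _),
      ← Real.rpow_natCast (r ^ (-(1 / 2) : ℝ)), ← Real.rpow_mul hr.le]
    refine ENNReal.ofReal_le_ofReal ?_
    have e : (-(1 / 2) : ℝ) * ((2 : ℕ) : ℝ) = -1 := by norm_num
    rw [e, Real.rpow_neg_one]
    have h2 : |f r| ^ 2 ≤ 1 := pow_le_one₀ (abs_nonneg _) (h1 r hr)
    have h3 : r * (1 + N * r)⁻¹ ≤ N⁻¹ := by
      rw [← div_eq_mul_inv, div_le_iff₀ (by positivity), inv_mul_eq_div, le_div_iff₀ hN]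
      nlinarith
    have h4 : r⁻¹ ≤ c⁻¹ := by gcongr; exact hmem.1
    calc r * (1 + N * r)⁻¹ * (|f r| ^ 2 * r⁻¹) ≤ N⁻¹ * (1 * c⁻¹) := by gcongr
      _ = _ := by ring
  calc _ ≤ ∫⁻ r in Ioi (0 : ℝ), (Icc c (A * c)).indicator
        (fun _ => ENNReal.ofReal (N⁻¹ * c⁻¹)) r := setLIntegral_mono' measurableSet_Ioi hpt
    _ ≤ ∫⁻ r, (Icc c (A * c)).indicator (fun _ => ENNReal.ofReal (N⁻¹ * c⁻¹)) r :=
        setLIntegral_le_lintegral _ _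
    _ = ENNReal.ofReal (N⁻¹ * c⁻¹) * ENNReal.ofReal (A * c - c) := by
        rw [lintegral_indicator measurableSet_Icc, setLIntegral_const, Real.volume_Icc]
    _ ≤ _ := by
        rw [← ENNReal.ofReal_mul (by positivity)]
        refine ENNReal.ofReal_le_ofReal ?_
        calc N⁻¹ * c⁻¹ * (A * c - c) = N⁻¹ * (A - 1) := by field_simp
          _ ≤ _ := by gcongr; linarith

theorem eLpNorm_two_rpow_two {α E : Type*} [MeasurableSpace α] [NormedAddCommGroup E]
    (μ : Measure α) (f : α → E) : eLpNorm f 2 μ ^ (2 : ℝ) = ∫⁻ x, ‖f x‖ₑ ^ 2 ∂μ := by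
  rw [eLpNorm_eq_lintegral_rpow_enorm_toReal two_ne_zero ENNReal.ofNat_ne_top,
    ENNReal.toReal_ofNat, rpow_half_rpow_two]
  simp only [ENNReal.rpow_two]

theorem measurable_weight_mul_majorant_sq (hH : Measurable H) (N : ℝ) {w : ℝ → ℝ≥0∞}
    (hw : Measurable w) :
    Measurable fun p : ℝ × Plane => w ‖p.2‖ * majorant N H p.1 ‖p.2‖ ^ 2 :=
  (hw.comp measurable_snd.norm).mul (((measurable_majorant hH N).comp
    (measurable_fst.prodMk measurable_snd.norm)).pow_const 2)

theorem MajorizedBy.eLpNorm_weighted_sq_le (hg : MajorizedBy I N D H g) (hH : Measurable H)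
    {w : ℝ → ℝ} (hw : Measurable w) {t : ℝ} (ht : t ∈ interior I) :
    eLpNorm (weighted w g t) 2 volume ^ (2 : ℝ) ≤
      D ^ 2 * ∫⁻ x : Plane, ‖w ‖x‖‖ₑ ^ 2 * majorant N H t ‖x‖ ^ 2 := by
  have hw2 : Measurable fun r => ‖w r‖ₑ ^ 2 := hw.enorm.pow_const 2
  have hmx : Measurable fun x : Plane => ‖w ‖x‖‖ₑ ^ 2 * majorant N H t ‖x‖ ^ 2 :=
    (hw2.comp measurable_norm).mul (((measurable_majorant hH N).comp
      (measurable_const.prodMk measurable_norm)).pow_const 2)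
  rw [eLpNorm_two_rpow_two, ← lintegral_const_mul _ hmx]
  refine lintegral_mono_ae ?_
  filter_upwards [hg.ae_le ht] with x hx
  rw [weighted, enorm_smul]
  calc (‖w ‖x‖‖ₑ * ‖g t x‖ₑ) ^ 2 ≤ (‖w ‖x‖‖ₑ * (D * majorant N H t ‖x‖)) ^ 2 :=
        pow_le_pow_left' (mul_le_mul' le_rfl hx) 2
    _ = _ := by ring

theorem MajorizedBy.lintegral_eLpNorm_weighted_sq_le (hI : I.OrdConnected)
    (hg : MajorizedBy I N D H g) (hN : 0 < N) (hH : Measurable H) {w : ℝ → ℝ} (hw : Measurable w) :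
    ∫⁻ t in I, eLpNorm (weighted w g t) 2 volume ^ (2 : ℝ) ≤ D ^ 2 *
      (ENNReal.ofReal (8 * Real.pi) * (∫⁻ r in Ioi (0 : ℝ),
        ENNReal.ofReal (r * (1 + N * r)⁻¹) * ‖w r‖ₑ ^ 2) * energy H) := by
  have hw2 : Measurable fun r => ‖w r‖ₑ ^ 2 := hw.enorm.pow_const 2
  have hmt : Measurable fun t => ∫⁻ x : Plane, ‖w ‖x‖‖ₑ ^ 2 * majorant N H t ‖x‖ ^ 2 :=
    (measurable_weight_mul_majorant_sq hH N hw2).lintegral_prod_right'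
  have h1 : ∫⁻ t in I, eLpNorm (weighted w g t) 2 volume ^ (2 : ℝ) ≤
      ∫⁻ t in I, D ^ 2 * ∫⁻ x : Plane, ‖w ‖x‖‖ₑ ^ 2 * majorant N H t ‖x‖ ^ 2 := by
    refine lintegral_mono_ae ?_
    filter_upwards [ae_mem_interior hI] with t ht using hg.eLpNorm_weighted_sq_le hH hw ht
  refine h1.trans ((setLIntegral_le_lintegral _ _).trans ?_)
  rw [lintegral_const_mul _ hmt]
  exact mul_le_mul' le_rfl (lintegral_lintegral_majorant_sq_le hN hH hw2)

theorem MajorizedBy.mixedNorm_two_two_le (hI : I.OrdConnected) (hg : MajorizedBy I N D H g)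
    (hN : 0 < N) (hH : Measurable H) {w : ℝ → ℝ} (hw : Measurable w) {c : ℝ} (hc : 0 ≤ c)
    (hint : ∫⁻ r in Ioi (0 : ℝ), ENNReal.ofReal (r * (1 + N * r)⁻¹) * ‖w r‖ₑ ^ 2 ≤
      ENNReal.ofReal (N⁻¹ * c ^ 2)) :
    mixedNorm I 2 2 (weighted w g) ≤ 6 * ENNReal.ofReal c * D * size N H := by
  have h8 : ENNReal.ofReal (8 * Real.pi) ≤ 36 := by
    rw [show (36 : ℝ≥0∞) = ENNReal.ofReal 36 by simp]
    exact ENNReal.ofReal_le_ofReal (by linarith [Real.pi_le_four])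
  refine eLpNorm_le_of_lintegral_rpow_le two_ne_zero ENNReal.ofNat_ne_top ?_
  simp only [ENNReal.toReal_ofNat, enorm_eq_self]
  refine (hg.lintegral_eLpNorm_weighted_sq_le hI hN hH hw).trans ?_
  calc _ ≤ D ^ 2 * (36 * ENNReal.ofReal (N⁻¹ * c ^ 2) * energy H) :=
        mul_le_mul' le_rfl (mul_le_mul' (mul_le_mul' h8 hint) le_rfl)
    _ = _ := by
        rw [ENNReal.ofReal_mul (inv_nonneg.2 hN.le), ENNReal.ofReal_pow hc, ENNReal.rpow_two,
          mul_pow, size_sq]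
        ring

theorem MajorizedBy.localEnergyNorm_le {χ : ℤ → ℝ → ℝ} (hχ : IsDyadicPartition χ)
    (hI : I.OrdConnected) (hg : MajorizedBy I N D H g) (hN : 0 < N) (hH : Measurable H)
    {c c' : ℝ} (hc : 0 < c)
    (hs : ∀ l r, χ l r ≠ 0 → c * (2 : ℝ) ^ l ≤ r ∧ r ≤ c' * (2 : ℝ) ^ l) :
    localEnergyNorm χ I g ≤ 6 * ENNReal.ofReal (1 + |c' / c|) * D * size N H := by
  refine iSup_le fun l => ?_
  -- The general estimate expects its constant as a square.
  have hA : |c' / c| ≤ (1 + |c' / c|) ^ 2 := by nlinarith [abs_nonneg (c' / c)]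
  refine hg.mixedNorm_two_two_le hI hN hH
    ((hχ.smooth l).continuous.measurable.mul (measurable_id.pow_const _)) (by positivity) ?_
  refine lintegral_dyadic_weight_le hN (c := c * 2 ^ l) (A := c' / c) (by positivity)
    (fun r hr => ?_) (fun r hr => ?_) ((le_abs_self _).trans hA)
  · rw [abs_of_nonneg (hχ.nonneg l r)]
    exact hχ.le_one l hr
  · obtain ⟨h1, h2⟩ := hs l r hr
    refine ⟨h1, h2.trans_eq ?_⟩
    field_simp

/-! ### Null coordinates -/

/-- The bound for a null derivative of a wave. -/
def NullBoundedBy (I : Set ℝ) (N σ : ℝ) (D : ℝ≥0∞) (H : ℝ → ℝ≥0∞) (ψ : ℝ → Plane → ℂ) : Prop :=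
  ∀ t ∈ interior I, ∀ x, x ≠ 0 → ‖ψ t x‖ₑ ≤
    D * (ENNReal.ofReal ((1 + N * ‖x‖) ^ (-(1 / 2) : ℝ)) * H (t + σ * ‖x‖) +
      ENNReal.ofReal ((1 + N * ‖x‖) ^ (-(3 / 2) : ℝ)) * H (t - σ * ‖x‖))

variable {σ : ℝ} {ψ : ℝ → Plane → ℂ}

theorem NullBoundedBy.majorizedBy (hψ : NullBoundedBy I N σ D H ψ) (hN : 0 < N)
    (hσ : σ = 1 ∨ σ = -1) : MajorizedBy I N D H ψ := fun t ht x hx => by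
  have h1 : 1 ≤ 1 + N * ‖x‖ := by
    have : 0 ≤ N * ‖x‖ := by positivity
    linarith
  refine (hψ t ht x hx).trans (mul_le_mul' le_rfl ?_)
  have h2 : ENNReal.ofReal ((1 + N * ‖x‖) ^ (-(3 / 2) : ℝ)) ≤
      ENNReal.ofReal ((1 + N * ‖x‖) ^ (-(1 / 2) : ℝ)) :=
    ENNReal.ofReal_le_ofReal (Real.rpow_le_rpow_of_exponent_le h1 (by norm_num))
  refine (add_le_add le_rfl (mul_le_mul' h2 le_rfl)).trans_eq ?_
  rw [majorant, ← mul_add]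
  rcases hσ with rfl | rfl
  · rw [one_mul]
  · rw [neg_one_mul, sub_neg_eq_add, ← sub_eq_add_neg, add_comm (H _)]

theorem ae_midpoint_notMem_frontier (hI : I.OrdConnected) (v : ℝ) :
    ∀ᵐ u : ℝ, (v + u) / 2 ∉ frontier I := by
  have h : volume (frontier I) = 0 := hI.convex.addHaar_frontier volume
  suffices h0 : volume {u : ℝ | (v + u) / 2 ∈ frontier I} = 0 from
    measure_eq_zero_iff_ae_notMem.1 h0
  have e : {u : ℝ | (v + u) / 2 ∈ frontier I} =
      (fun u => v + u) ⁻¹' ((fun u => (2 : ℝ)⁻¹ • u) ⁻¹' frontier I) := by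
    ext u
    simp [div_eq_inv_mul]
  rw [e, measure_preimage_add, Measure.addHaar_preimage_smul _ (by norm_num), h, mul_zero]

/-- This is where λ ≤ 1/2 in the null norm matters: the growing weight r^λ must be absorbed by
(1+Nr)^{-1/2}. -/
theorem rpow_mul_le_rpow_neg (hN : 0 < N) {r lam : ℝ} (hr : 0 < r) (h0 : 0 < lam)
    (h1 : lam ≤ 1 / 2) : r ^ lam * (1 + N * r) ^ (-(1 / 2) : ℝ) ≤ N ^ (-lam) := by
  have hNr : 0 < N * r := by positivity
  rw [Real.rpow_neg (by positivity), ← div_eq_mul_inv, div_le_iff₀ (by positivity),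
    Real.rpow_neg hN.le, inv_mul_eq_div, le_div_iff₀ (by positivity),
    ← Real.mul_rpow hr.le hN.le, mul_comm r N]
  calc (N * r) ^ lam ≤ (1 + N * r) ^ lam := by gcongr; linarith
    _ ≤ _ := Real.rpow_le_rpow_of_exponent_le (by linarith) h1

/-- In the null coordinates the leading term is H(v), independent of u. The other term contains H(u)
with an additional factor (1+Nr)⁻¹, and 2r = |u-v|; its square carries a tail weight of exponent 2,
so it is bounded by the square function at v for all u at once. -/
theorem NullBoundedBy.enorm_le (hψ : NullBoundedBy I N σ D H ψ) (hN : 0 < N)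
    (hH : SlowlyVarying N H) (hσ : σ ^ 2 = 1) {lam : ℝ} (h0 : 0 < lam) (h1 : lam ≤ 1 / 2)
    {v u : ℝ} (hI : (v + u) / 2 ∈ interior I) (hr : 0 < σ * (v - u) / 2) :
    ‖weighted (fun r => r ^ lam) ψ ((v + u) / 2)
      (EuclideanSpace.single 0 (σ * (v - u) / 2))‖ₑ ≤
      D * ENNReal.ofReal (N ^ (-lam)) *
        (H v + (144 * squareFunction N 2 H v) ^ (1 / 2 : ℝ)) := by
  set r := σ * (v - u) / 2 with hrdef
  have hnorm : ‖(EuclideanSpace.single 0 r : Plane)‖ = r := by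
    rw [PiLp.norm_single, Real.norm_of_nonneg hr.le]
  have hx : (EuclideanSpace.single 0 r : Plane) ≠ 0 := by
    rw [← norm_pos_iff, hnorm]; exact hr
  have hb := hψ _ hI _ hx
  rw [hnorm] at hb
  have ev : (v + u) / 2 + σ * r = v := by rw [hrdef]; linear_combination (v - u) / 2 * hσ
  have eu : (v + u) / 2 - σ * r = u := by rw [hrdef]; linear_combination -((v - u) / 2) * hσ
  rw [ev, eu] at hb
  have hNr : 0 < N * r := by positivity
  have hN2 : ENNReal.ofReal (r ^ lam) * ENNReal.ofReal ((1 + N * r) ^ (-(1 / 2) : ℝ)) ≤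
      ENNReal.ofReal (N ^ (-lam)) := by
    rw [← ENNReal.ofReal_mul (by positivity)]
    exact ENNReal.ofReal_le_ofReal (rpow_mul_le_rpow_neg hN hr h0 h1)
  have hsplit : ENNReal.ofReal ((1 + N * r) ^ (-(3 / 2) : ℝ)) =
      ENNReal.ofReal ((1 + N * r) ^ (-(1 / 2) : ℝ)) * ENNReal.ofReal ((1 + N * r)⁻¹) := by
    rw [← ENNReal.ofReal_mul (by positivity), ← Real.rpow_neg_one, ← Real.rpow_add (by linarith)]
    norm_num
  have huv : |u - v| = 2 * r := by
    have h2 : |σ| = 1 := by rcases sq_eq_one_iff.1 hσ with h | h <;> simp [h]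
    rw [← abs_of_pos hr, hrdef, abs_div, abs_mul, h2, abs_two, abs_sub_comm]
    ring
  have hsq : ENNReal.ofReal ((1 + N * r)⁻¹) * H u ≤
      (144 * squareFunction N 2 H v) ^ (1 / 2 : ℝ) := by
    refine le_rpow_half ?_
    rw [mul_pow]
    have h2 : ENNReal.ofReal ((1 + N * r)⁻¹) ^ 2 ≤ 4 * tailWeight N 2 (u - v) := by
      rw [tailWeight, huv, ← ENNReal.ofReal_pow (by positivity),
        show (4 : ℝ≥0∞) = ENNReal.ofReal 4 by simp, ← ENNReal.ofReal_mul (by norm_num)]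
      refine ENNReal.ofReal_le_ofReal ?_
      rw [Real.rpow_neg (by positivity), Real.rpow_two, ← div_eq_mul_inv, inv_pow,
        le_div_iff₀ (by positivity), inv_mul_le_iff₀ (by positivity)]
      nlinarith
    calc _ ≤ 4 * tailWeight N 2 (u - v) * H u ^ 2 := mul_le_mul' h2 le_rfl
      _ = 4 * (tailWeight N 2 (u - v) * H u ^ 2) := mul_assoc _ _ _
      _ ≤ 4 * (36 * squareFunction N 2 H v) :=
          mul_le_mul' le_rfl (hH.tailWeight_mul_sq_le hN zero_le_two le_rfl u v)
      _ = _ := by rw [← mul_assoc]; norm_num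
  rw [weighted, enorm_smul, hnorm, Real.enorm_of_nonneg (by positivity)]
  calc _ ≤ _ := mul_le_mul' le_rfl hb
    _ = D * (ENNReal.ofReal (r ^ lam) * ENNReal.ofReal ((1 + N * r) ^ (-(1 / 2) : ℝ))) *
        (H v + ENNReal.ofReal ((1 + N * r)⁻¹) * H u) := by rw [hsplit]; ring
    _ ≤ _ := mul_le_mul' (mul_le_mul' le_rfl hN2) (add_le_add le_rfl hsq)

theorem NullBoundedBy.nullNorm_le (hI : I.OrdConnected) (hψ : NullBoundedBy I N σ D H ψ)
    (hN : 0 < N) (hH : SlowlyVarying N H) (hσ : σ ^ 2 = 1) {lam : ℝ} (h0 : 0 < lam)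
    (h1 : lam ≤ 1 / 2) :
    nullNorm I σ (weighted (fun r => r ^ lam) ψ) ≤
      18 * tailConst 2 * (ENNReal.ofReal (N ^ (-lam)) * D) *
        (ENNReal.ofReal N ^ (1 / 2 : ℝ) * size N H) := by
  have hsup : ∀ v : ℝ, eLpNorm
      ({u : ℝ | (v + u) / 2 ∈ I ∧ 0 < σ * (v - u) / 2}.indicator
        fun u : ℝ => weighted (fun r => r ^ lam) ψ ((v + u) / 2)
          (EuclideanSpace.single 0 (σ * (v - u) / 2))) ⊤ volume ≤
      D * ENNReal.ofReal (N ^ (-lam)) *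
        (H v + (144 * squareFunction N 2 H v) ^ (1 / 2 : ℝ)) := fun v => by
    rw [eLpNorm_exponent_top]
    refine eLpNormEssSup_le_of_ae_enorm_bound ?_
    filter_upwards [ae_midpoint_notMem_frontier hI v] with u hu
    by_cases hmem : u ∈ {u : ℝ | (v + u) / 2 ∈ I ∧ 0 < σ * (v - u) / 2}
    · rw [indicator_of_mem hmem]
      refine hψ.enorm_le hN hH hσ h0 h1 ?_ hmem.2
      by_contra h
      exact hu ⟨subset_closure hmem.1, h⟩
    · rw [indicator_of_notMem hmem, enorm_zero]
      exact zero_le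
  have hsq := measurable_squareFunction N 2 hH.measurable
  refine eLpNorm_le_of_lintegral_rpow_le two_ne_zero ENNReal.ofNat_ne_top ?_
  rw [ENNReal.toReal_ofNat]
  set E := D * ENNReal.ofReal (N ^ (-lam)) with hE
  have hHm : Measurable fun v => H v ^ 2 := hH.measurable.pow_const 2
  have h1T := one_le_tailConst 2
  calc _ ≤ ∫⁻ v, 2 * E ^ 2 * (H v ^ 2 + 144 * squareFunction N 2 H v) := by
        refine lintegral_mono fun v => ?_
        rw [enorm_eq_self]
        refine (ENNReal.rpow_le_rpow (hsup v) zero_le_two).trans ?_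
        rw [ENNReal.mul_rpow_of_nonneg _ _ zero_le_two, ENNReal.rpow_two, ENNReal.rpow_two]
        calc _ ≤ E ^ 2 * (2 * (H v ^ 2 + ((144 * squareFunction N 2 H v) ^ (1 / 2 : ℝ)) ^ 2)) :=
              mul_le_mul' le_rfl (add_sq_le_two_mul _ _)
          _ = _ := by
            rw [← ENNReal.rpow_two ((144 * squareFunction N 2 H v) ^ (1 / 2 : ℝ)),
              rpow_half_rpow_two]
            ring
    _ = 2 * E ^ 2 * (energy H + 144 * ∫⁻ v, squareFunction N 2 H v) := by
        have hm3 : Measurable fun v => H v ^ 2 + 144 * squareFunction N 2 H v :=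
          hHm.add (hsq.const_mul _)
        rw [lintegral_const_mul _ hm3, lintegral_add_left hHm,
          lintegral_const_mul _ hsq, energy]
    _ ≤ 2 * E ^ 2 * (tailConst 2 ^ 2 * (ENNReal.ofReal N * size N H ^ 2) +
          144 * (tailConst 2 ^ 2 * (ENNReal.ofReal N * size N H ^ 2))) := by
        have h2 : tailConst 2 ≤ tailConst 2 ^ 2 := by
          rw [sq]; exact le_mul_of_one_le_left' h1T
        refine mul_le_mul' le_rfl (add_le_add ?_ (mul_le_mul' le_rfl
          ((lintegral_squareFunction_le hN 2 hH.measurable).trans (mul_le_mul' h2 le_rfl))))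
        rw [energy_eq hN]
        exact le_mul_of_one_le_left' (h1T.trans h2)
    -- 290 = 2(1 + 144) is rounded up to 324 = 18².
    _ = 290 * (E ^ 2 * (tailConst 2 ^ 2 * (ENNReal.ofReal N * size N H ^ 2))) := by ring
    _ ≤ 324 * (E ^ 2 * (tailConst 2 ^ 2 * (ENNReal.ofReal N * size N H ^ 2))) :=
        mul_le_mul' (by norm_num) le_rfl
    _ = _ := by
        have e : (ENNReal.ofReal N ^ (1 / 2 : ℝ)) ^ 2 = ENNReal.ofReal N := by
          rw [← ENNReal.rpow_two, rpow_half_rpow_two]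
        rw [ENNReal.rpow_two, mul_pow _ (ENNReal.ofReal N ^ (1 / 2 : ℝ) * size N H),
          mul_pow _ (size N H), e, hE]
        ring

end RadialWave

end

/-! ### The S_k norm of a majorized wave -/

noncomputable section

namespace RadialWave

variable {a b : ℝ} {k : ℤ} {I : Set ℝ} {φ : ℝ → Plane → ℂ}

/-! ### Measurability and symmetry of the null derivatives -/

theorem ContinuousOn.measurable_indicator {X E : Type*} [TopologicalSpace X] [MeasurableSpace X]
    [BorelSpace X] [TopologicalSpace E] [MeasurableSpace E] [BorelSpace E] [Zero E] {f : X → E}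
    {S : Set X} (hf : ContinuousOn f S) (hS : MeasurableSet S) : Measurable (S.indicator f) := by
  classical
  rw [← piecewise_eq_indicator]
  exact hf.measurable_piecewise continuousOn_const hS

theorem radialDeriv_zero (φ : ℝ → Plane → ℂ) (t : ℝ) : radialDeriv φ t 0 = 0 := by
  simp [radialDeriv]

theorem measurable_radialDeriv_slice (φ : ℝ → Plane → ℂ) (t : ℝ) :
    Measurable (radialDeriv φ t) := by
  have e : ∀ x : Plane, radialDeriv φ t x =
      ((‖x‖⁻¹ * x 0 : ℝ) : ℂ) * fderiv ℝ (φ t) x (EuclideanSpace.single 0 1) +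
      ((‖x‖⁻¹ * x 1 : ℝ) : ℂ) * fderiv ℝ (φ t) x (EuclideanSpace.single 1 1) := fun x => by
    have hx : ‖x‖⁻¹ • x = (‖x‖⁻¹ * x 0) • (EuclideanSpace.single 0 1 : Plane) +
        (‖x‖⁻¹ * x 1) • (EuclideanSpace.single 1 1 : Plane) := by
      ext i
      fin_cases i <;> simp
    rw [radialDeriv, hx, map_add, map_smul, map_smul, Complex.real_smul, Complex.real_smul]
  have h0 := measurable_fderiv_apply_const ℝ (φ t) (EuclideanSpace.single 0 1 : Plane)
  have h1 := measurable_fderiv_apply_const ℝ (φ t) (EuclideanSpace.single 1 1 : Plane)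
  have hc : ∀ i : Fin 2, Measurable fun x : Plane => ((‖x‖⁻¹ * x i : ℝ) : ℂ) := fun i =>
    Complex.measurable_ofReal.comp
      (measurable_norm.inv.mul (contDiff_plane_coord i).continuous.measurable)
  rw [show radialDeriv φ t = _ from funext e]
  exact ((hc 0).mul h0).add ((hc 1).mul h1)

theorem eq_singleton_of_interior_eq_empty (hI : I.OrdConnected) (h0 : (0 : ℝ) ∈ I)
    (he : ¬(interior I).Nonempty) : I = {0} := by
  refine subset_antisymm (fun t ht => ?_) (singleton_subset_iff.2 h0)
  by_contra hne
  have hne' : t ≠ 0 := hne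
  refine he ?_
  rcases lt_or_gt_of_ne hne' with h | h
  · exact (nonempty_Ioo.2 h).mono (interior_maximal (Ioo_subset_Icc_self.trans (hI.out ht h0))
      isOpen_Ioo)
  · exact (nonempty_Ioo.2 h).mono (interior_maximal (Ioo_subset_Icc_self.trans (hI.out h0 ht))
      isOpen_Ioo)

theorem timeDeriv_singleton (φ : ℝ → Plane → ℂ) (t : ℝ) (x : Plane) :
    timeDeriv {t} φ t x = 0 := by
  refine derivWithin_zero_of_not_uniqueDiffWithinAt fun h => ?_
  obtain ⟨y, hy⟩ := (accPt_iff_frequently.1 (uniqueDiffWithinAt_iff_accPt.1 h)).exists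
  exact hy.1 hy.2

/-- The radial derivative is continuous away from the origin and zero there, because 0⁻¹·0 = 0. If I
= {0} the one-sided time derivative is 0 by convention, and the radial derivative of a single slice
is measurable in any case. -/
theorem IsLocalized.measurable_nullDeriv (hI : I.OrdConnected) (h0 : (0 : ℝ) ∈ I)
    (hφ : IsLocalized a b k I φ) (σ : ℝ) :
    Measurable ((I ×ˢ univ).indicator fun z : ℝ × Plane => nullDeriv I σ φ z.1 z.2) := by
  have hS : MeasurableSet (I ×ˢ (univ : Set Plane)) :=
    hI.measurableSet.prod MeasurableSet.univ
  by_cases hne : (interior I).Nonempty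
  · have hS' : MeasurableSet (I ×ˢ ({0}ᶜ : Set Plane)) :=
      hI.measurableSet.prod (measurableSet_singleton 0).compl
    have h1 := ContinuousOn.measurable_indicator (continuousOn_timeDeriv hI hne hφ.contDiffOn) hS
    have hc : ContinuousOn (fun z : ℝ × Plane => radialDeriv φ z.1 z.2) (I ×ˢ {0}ᶜ) := by
      refine ((continuousOn_fderiv_slice hI hne hφ.contDiffOn).mono
        (prod_mono le_rfl (subset_univ _))).clm_apply ?_
      refine ContinuousOn.smul (ContinuousOn.inv₀ continuous_snd.norm.continuousOn ?_)
        continuous_snd.continuousOn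
      exact fun z hz => norm_ne_zero_iff.2 hz.2
    have h2 := ContinuousOn.measurable_indicator hc hS'
    have e : (I ×ˢ univ).indicator (fun z : ℝ × Plane => nullDeriv I σ φ z.1 z.2) = fun z =>
        (I ×ˢ univ).indicator (fun z : ℝ × Plane => timeDeriv I φ z.1 z.2) z + (σ : ℂ) *
        (I ×ˢ {0}ᶜ).indicator (fun z : ℝ × Plane => radialDeriv φ z.1 z.2) z := by
      ext ⟨t, x⟩
      by_cases ht : t ∈ I
      · by_cases hx : x = 0
        · simp [indicator, ht, hx, nullDeriv, radialDeriv_zero]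
        · simp [indicator, ht, hx, nullDeriv]
      · simp [indicator, ht]
    rw [e]
    exact h1.add (h2.const_mul _)
  · obtain rfl := eq_singleton_of_interior_eq_empty hI h0 hne
    have h1 : Measurable (({0} ×ˢ (univ : Set Plane)).indicator fun z : ℝ × Plane =>
        (σ : ℂ) * radialDeriv φ 0 z.2) :=
      (((measurable_radialDeriv_slice φ 0).comp measurable_snd).const_mul (σ : ℂ)).indicator hS
    have e : (({0} : Set ℝ) ×ˢ (univ : Set Plane)).indicator
        (fun z : ℝ × Plane => nullDeriv {0} σ φ z.1 z.2) =
        (({0} : Set ℝ) ×ˢ univ).indicator fun z : ℝ × Plane => (σ : ℂ) * radialDeriv φ 0 z.2 := by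
      refine indicator_congr fun z hz => ?_
      have hz0 : z.1 = 0 := hz.1
      rw [nullDeriv, hz0, timeDeriv_singleton, zero_add]
    rw [e]
    exact h1

theorem IsRadial.fderiv_radial {f : Plane → ℂ} (hf : IsRadial f)
    (hd : Differentiable ℝ f) {x y : Plane} (h : ‖x‖ = ‖y‖) :
    fderiv ℝ f x (‖x‖⁻¹ • x) = fderiv ℝ f y (‖y‖⁻¹ • y) := by
  rw [← (hd x).lineDeriv_eq_fderiv, ← (hd y).lineDeriv_eq_fderiv, lineDeriv, lineDeriv]
  congr 1
  ext s
  have e : ∀ z : Plane, z + s • ‖z‖⁻¹ • z = (1 + s * ‖z‖⁻¹) • z := fun z => by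
    rw [add_smul, one_smul, mul_smul]
  refine hf _ _ ?_
  rw [e, e, norm_smul, norm_smul, h]

theorem IsLocalized.isRadial_nullDeriv (hφ : IsLocalized a b k I φ) {t : ℝ} (ht : t ∈ I) (σ : ℝ) :
    IsRadial (nullDeriv I σ φ t) := fun x y h => by
  have h1 : timeDeriv I φ t x = timeDeriv I φ t y :=
    derivWithin_congr (fun s hs => hφ.radial s hs x y h) (hφ.radial t ht x y h)
  rw [nullDeriv, nullDeriv, h1, radialDeriv, radialDeriv, (hφ.radial t ht).fderiv_radial
    (fun z => (hasFDerivAt_slice hφ.contDiffOn ht z).differentiableAt) h]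

/-- The null derivative as an element of the atomic space. -/
def nullAtom (I : Set ℝ) (σ : ℝ) (φ : ℝ → Plane → ℂ) (t : ℝ) (x : Plane) : ℂ :=
  (I ×ˢ univ).indicator (fun z : ℝ × Plane => nullDeriv I σ φ z.1 z.2) (t, x)

theorem nullAtom_eq {t : ℝ} (ht : t ∈ I) (σ : ℝ) (x : Plane) :
    nullAtom I σ φ t x = nullDeriv I σ φ t x :=
  indicator_of_mem (show (t, x) ∈ I ×ˢ univ from ⟨ht, mem_univ x⟩) _

/-- The trivial decomposition suffices: the null derivative as a whole satisfies the null and Y_k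
bounds, and nothing has to be put into W_k. Extension by zero outside I secures measurability and
symmetry at all times. -/
theorem IsLocalized.isDecomposition (hI : I.OrdConnected) (h0 : (0 : ℝ) ∈ I)
    (hφ : IsLocalized a b k I φ) (σ : ℝ) :
    IsDecomposition I (nullDeriv I σ φ) (nullAtom I σ φ) (fun _ _ => 0) where
  measurable_left := hφ.measurable_nullDeriv hI h0 σ
  measurable_right := measurable_const
  radial_left t x y h := by
    by_cases ht : t ∈ I
    · rw [nullAtom_eq ht, nullAtom_eq ht, hφ.isRadial_nullDeriv ht σ x y h]
    · simp [nullAtom, indicator, ht]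
  radial_right _ _ _ _ := rfl
  eq_add t ht x := by rw [nullAtom_eq ht, add_zero]

/-! ### The norms of a function controlled by the majorant -/

theorem ofReal_two_zpow (k : ℤ) : ENNReal.ofReal ((2 : ℝ) ^ k) = (2 : ℝ≥0∞) ^ (k : ℝ) := by
  rw [← Real.rpow_intCast, ← ENNReal.ofReal_rpow_of_pos two_pos, ENNReal.ofReal_ofNat]

theorem two_rpow_mul_intCast (x : ℝ) (k : ℤ) :
    (2 : ℝ≥0∞) ^ (x * k) = ENNReal.ofReal ((2 : ℝ) ^ k) ^ x := by
  rw [ofReal_two_zpow, ← ENNReal.rpow_mul, mul_comm]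

/-- Where the cut-off is nonzero, Nr exceeds a fixed constant c, so that Nr and 1+Nr are comparable.
The comparison factor (1+1/c)^λ is at most 1+1/c, which makes the constant uniform in λ ≤ 1. -/
theorem IsOuterCutoff.exists_weight_bound {η : ℤ → ℝ → ℝ} (hη : IsOuterCutoff η) :
    ∃ c : ℝ, 0 ≤ c ∧ ∀ (k : ℤ) (lam r : ℝ), 0 ≤ lam → lam ≤ 1 → 0 < r →
      |η (-k) r * r ^ (-lam)| ≤
        c * ((2 : ℝ) ^ k) ^ lam * (1 + (2 : ℝ) ^ k * r) ^ (-lam) := by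
  obtain ⟨c, -, hc, h0, -⟩ := hη.transition
  refine ⟨1 + c⁻¹, by positivity, fun k lam r hl hl1 hr => ?_⟩
  have hN : (0 : ℝ) < (2 : ℝ) ^ k := by positivity
  by_cases hz : η (-k) r = 0
  · rw [hz, zero_mul, abs_zero]
    positivity
  have hr2 : c < (2 : ℝ) ^ k * r := by
    by_contra h
    refine hz (h0 _ _ ?_)
    rw [zpow_neg, ← div_eq_mul_inv, le_div_iff₀ hN, mul_comm]
    exact not_lt.1 h
  have h1 : |η (-k) r| ≤ 1 := by
    have := hη.mem_Icc (-k) r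
    rw [abs_of_nonneg this.1]; exact this.2
  have h2 : 1 + (2 : ℝ) ^ k * r ≤ (1 + c⁻¹) * ((2 : ℝ) ^ k * r) := by
    have : 1 ≤ c⁻¹ * ((2 : ℝ) ^ k * r) := by
      rw [inv_mul_eq_div, le_div_iff₀ hc]; linarith
    linarith
  have h3 : (1 + (2 : ℝ) ^ k * r) ^ lam ≤ (1 + c⁻¹) * ((2 : ℝ) ^ k) ^ lam * r ^ lam := by
    calc _ ≤ ((1 + c⁻¹) * ((2 : ℝ) ^ k * r)) ^ lam := by gcongr
      _ = (1 + c⁻¹) ^ lam * ((2 : ℝ) ^ k) ^ lam * r ^ lam := by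
        rw [Real.mul_rpow (by positivity) (by positivity), Real.mul_rpow hN.le hr.le, mul_assoc]
      _ ≤ _ := by
        gcongr
        calc (1 + c⁻¹) ^ lam ≤ (1 + c⁻¹) ^ (1 : ℝ) :=
              Real.rpow_le_rpow_of_exponent_le (by linarith [inv_pos.2 hc]) hl1
          _ = _ := Real.rpow_one _
  have hp : 0 < (1 + (2 : ℝ) ^ k * r) ^ lam := by positivity
  have hp2 : 0 < r ^ lam := by positivity
  rw [abs_mul, abs_of_nonneg (by positivity : 0 ≤ r ^ (-lam)), Real.rpow_neg hr.le,
    Real.rpow_neg (by positivity), ← div_eq_mul_inv, ← div_eq_mul_inv,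
    div_le_div_iff₀ hp2 hp]
  calc _ ≤ 1 * (1 + (2 : ℝ) ^ k * r) ^ lam := by gcongr
    _ ≤ _ := by rw [one_mul]; exact h3

variable {V : Type*} [NormedAddCommGroup V] [NormedSpace ℝ V]

theorem MajorizedBy.weighted_norm_le {η : ℤ → ℝ → ℝ} {ε c : ℝ} {D : ℝ≥0∞} {H : ℝ → ℝ≥0∞}
    {g : ℝ → Plane → V} (hε : 0 < ε) (hε' : ε < 1 / 2)
    (hc : ∀ (k : ℤ) (lam r : ℝ), 0 ≤ lam → lam ≤ 1 → 0 < r → |η (-k) r * r ^ (-lam)| ≤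
        c * ((2 : ℝ) ^ k) ^ lam * (1 + (2 : ℝ) ^ k * r) ^ (-lam)) (hc0 : 0 ≤ c)
    (hI : I.OrdConnected) (hH : SlowlyVarying ((2 : ℝ) ^ k) H)
    (hg : MajorizedBy I ((2 : ℝ) ^ k) D H g) {lam : ℝ} (hl : lam ∈ Ico ε 1) :
    (2 : ℝ≥0∞) ^ (-(1 / 2 + lam) * k) *
      mixedNorm I 2 ⊤ (weighted (fun r => η (-k) r * r ^ (-lam)) g) ≤
      12 * tailConst (1 + 2 * ε) * ENNReal.ofReal c * (D * size ((2 : ℝ) ^ k) H) := by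
  have hN : (0 : ℝ) < (2 : ℝ) ^ k := by positivity
  have hn0 : ENNReal.ofReal ((2 : ℝ) ^ k) ≠ 0 := (ENNReal.ofReal_pos.2 hN).ne'
  have hl0 : 0 < lam := hε.trans_le hl.1
  -- The choice κ = 1+2ε satisfies κ > 1 and κ ≤ 1+2λ for every λ ≥ ε, so one tail constant serves
  -- the whole supremum; ε < 1/2 ensures κ ≤ 2.
  have h := hg.mixedNorm_two_top_le hI hN hH (κ := 1 + 2 * ε) (by linarith) (by linarith)
    (lam := lam) (by linarith [hl.1]) (fun r hr => hc k lam r hl0.le hl.2.le hr)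
  rw [two_rpow_mul_intCast]
  refine (mul_le_mul' le_rfl h).trans (le_of_eq ?_)
  rw [ENNReal.ofReal_mul hc0, ← ENNReal.ofReal_rpow_of_pos hN]
  set n := ENNReal.ofReal ((2 : ℝ) ^ k)
  have e : n ^ (-(1 / 2 + lam)) * (n ^ lam * n ^ (1 / 2 : ℝ)) = 1 := by
    rw [← ENNReal.rpow_add _ _ hn0 ENNReal.ofReal_ne_top,
      ← ENNReal.rpow_add _ _ hn0 ENNReal.ofReal_ne_top, show -(1 / 2 + lam) + (lam + 1 / 2) = 0 by
      ring, ENNReal.rpow_zero]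
  calc _ = 12 * tailConst (1 + 2 * ε) * ENNReal.ofReal c * (D * size ((2 : ℝ) ^ k) H) *
        (n ^ (-(1 / 2 + lam)) * (n ^ lam * n ^ (1 / 2 : ℝ))) := by ring
    _ = _ := by rw [e, mul_one]

end RadialWave

end

noncomputable section

namespace RadialWave

variable {a b : ℝ} {k : ℤ} {I : Set ℝ} {φ : ℝ → Plane → ℂ} {D : ℝ≥0∞} {H : ℝ → ℝ≥0∞}

/-- With κ = 1+2ε, the condition 2κ/q ≤ 1-2/p follows from 1/q+1/p ≤ 1/2-ε and 1/q ≤ 1/2, because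
then 4ε/q ≤ 2ε. -/
theorem MajorizedBy.strichartz_admissibleGap {V : Type*} [NormedAddCommGroup V]
    {g : ℝ → Plane → V} {ε : ℝ} (hε : 0 < ε) (hε' : ε < 1 / 2) (hI : I.OrdConnected)
    (hH : SlowlyVarying ((2 : ℝ) ^ k) H) (hg : MajorizedBy I ((2 : ℝ) ^ k) D H g)
    {e : ℝ≥0∞ × ℝ≥0∞} (he : e ∈ admissibleGap ε) :
    strichartzFactor k e * mixedNorm I e.1 e.2 g ≤
      12 * tailConst (1 + 2 * ε) * (D * size ((2 : ℝ) ^ k) H) := by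
  obtain ⟨h1, -, h3⟩ := he
  have hs0 : 0 ≤ e.2⁻¹.toReal := ENNReal.toReal_nonneg
  have hz0 : 0 ≤ e.1⁻¹.toReal := ENNReal.toReal_nonneg
  have hz : e.1⁻¹.toReal ≤ 1 / 2 := by linarith
  rw [strichartzFactor, two_rpow_mul_intCast, ← mul_assoc]
  refine hg.strichartz hI (by positivity) hH (by linarith) (by linarith) (by linarith) ?_
  nlinarith

theorem MajorizedBy.yNorm_le {χ η : ℤ → ℝ → ℝ} (hχ : IsDyadicPartition χ) {ε c c₁ c₂ : ℝ}
    {ψ : ℝ → Plane → ℂ} (hε : 0 < ε) (hε' : ε < 1 / 2)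
    (hc : ∀ (k : ℤ) (lam r : ℝ), 0 ≤ lam → lam ≤ 1 → 0 < r → |η (-k) r * r ^ (-lam)| ≤
        c * ((2 : ℝ) ^ k) ^ lam * (1 + (2 : ℝ) ^ k * r) ^ (-lam)) (hc0 : 0 ≤ c)
    (hc1 : 0 < c₁) (hs : ∀ l r, χ l r ≠ 0 → c₁ * (2 : ℝ) ^ l ≤ r ∧ r ≤ c₂ * (2 : ℝ) ^ l)
    (hI : I.OrdConnected) (hH : SlowlyVarying ((2 : ℝ) ^ k) H)
    (hψ : MajorizedBy I ((2 : ℝ) ^ k) D H ψ) :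
    yNorm ε χ η k I ψ ≤ (12 * tailConst (1 + 2 * ε) * ENNReal.ofReal c +
      6 * ENNReal.ofReal (1 + |c₂ / c₁|)) * (D * size ((2 : ℝ) ^ k) H) := by
  rw [yNorm, add_mul]
  refine add_le_add (iSup₂_le fun lam hl => hψ.weighted_norm_le hε hε' hc hc0 hI hH hl) ?_
  exact (hψ.localEnergyNorm_le hχ hI (by positivity) hH.measurable hc1 hs).trans_eq
    (mul_assoc _ _ _)

theorem NullBoundedBy.nullWeightedNorm_le {σ : ℝ} {ψ : ℝ → Plane → ℂ} (hσ : σ ^ 2 = 1)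
    (hI : I.OrdConnected) (hH : SlowlyVarying ((2 : ℝ) ^ k) H)
    (hψ : NullBoundedBy I ((2 : ℝ) ^ k) σ D H ψ) :
    nullWeightedNorm k I σ ψ ≤ 18 * tailConst 2 * (D * size ((2 : ℝ) ^ k) H) := by
  refine iSup₂_le fun lam hl => ?_
  have hN : (0 : ℝ) < (2 : ℝ) ^ k := by positivity
  have hn0 : ENNReal.ofReal ((2 : ℝ) ^ k) ≠ 0 := (ENNReal.ofReal_pos.2 hN).ne'
  rw [two_rpow_mul_intCast]
  refine (mul_le_mul' le_rfl (hψ.nullNorm_le hI hN hH hσ hl.1 hl.2)).trans (le_of_eq ?_)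
  rw [← ENNReal.ofReal_rpow_of_pos hN]
  set n := ENNReal.ofReal ((2 : ℝ) ^ k)
  have e : n ^ (-(1 / 2 - lam)) * (n ^ (-lam) * n ^ (1 / 2 : ℝ)) = 1 := by
    rw [← ENNReal.rpow_add _ _ hn0 ENNReal.ofReal_ne_top,
      ← ENNReal.rpow_add _ _ hn0 ENNReal.ofReal_ne_top, show -(1 / 2 - lam) + (-lam + 1 / 2) = 0 by
      ring, ENNReal.rpow_zero]
  calc _ = 18 * tailConst 2 * (D * size ((2 : ℝ) ^ k) H) *
        (n ^ (-(1 / 2 - lam)) * (n ^ (-lam) * n ^ (1 / 2 : ℝ))) := by ring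
    _ = _ := by rw [e, mul_one]

theorem weighted_zero (w : ℝ → ℝ) : weighted w (fun (_ : ℝ) (_ : Plane) => (0 : ℂ)) = 0 := by
  ext t x
  simp [weighted]

theorem mixedNorm_zero (I : Set ℝ) (q p : ℝ≥0∞) :
    mixedNorm I q p (0 : ℝ → Plane → ℂ) = 0 := by
  simp only [mixedNorm, Pi.zero_apply, eLpNorm_zero]
  exact eLpNorm_zero

theorem yNorm_zero (ε : ℝ) (χ η : ℤ → ℝ → ℝ) (k : ℤ) (I : Set ℝ) :
    yNorm ε χ η k I (fun _ _ => 0) = 0 := by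
  simp [yNorm, localEnergyNorm, weighted_zero, mixedNorm_zero]

theorem strichartzWeightedNorm_zero (χ : ℤ → ℝ → ℝ) (k : ℤ) (I : Set ℝ) :
    strichartzWeightedNorm χ k I (fun _ _ => 0) = 0 := by
  simp [strichartzWeightedNorm, weighted_zero, mixedNorm_zero]

theorem IsLocalized.zNorm_le {ε : ℝ} {χ η : ℤ → ℝ → ℝ} (hI : I.OrdConnected) (h0 : (0 : ℝ) ∈ I)
    (hφ : IsLocalized a b k I φ) (σ : ℝ) : zNorm ε χ η k I σ (nullDeriv I σ φ) ≤
      nullWeightedNorm k I σ (nullAtom I σ φ) + yNorm ε χ η k I (nullAtom I σ φ) := by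
  refine iInf_le_of_le (nullAtom I σ φ) (iInf_le_of_le (fun _ _ => 0)
    (iInf_le_of_le (hφ.isDecomposition hI h0 σ) ?_))
  rw [yNorm_zero, strichartzWeightedNorm_zero, add_zero, add_zero]

/-- All components of the norm of `S_k[I]` are controlled by the size of a profile which
majorizes the wave and its derivatives. -/
theorem exists_sNorm_le {χ η : ℤ → ℝ → ℝ} (hχ : IsDyadicPartition χ) (hη : IsOuterCutoff η)
    {ε : ℝ} (hε : 0 < ε) (hε' : ε < 1 / 2) : ∃ C : ℝ≥0∞, C ≠ ⊤ ∧ ∀ (a b : ℝ) (k : ℤ)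
      (I : Set ℝ) (φ : ℝ → Plane → ℂ) (D : ℝ≥0∞) (H : ℝ → ℝ≥0∞), I.OrdConnected → (0 : ℝ) ∈ I →
      IsLocalized a b k I φ → SlowlyVarying ((2 : ℝ) ^ k) H →
      MajorizedBy I ((2 : ℝ) ^ k) D H (grad I φ) →
      MajorizedBy I ((2 : ℝ) ^ k) (ENNReal.ofReal ((2 : ℝ) ^ k)⁻¹ * D) H φ →
      (∀ σ : ℝ, σ = 1 ∨ σ = -1 → NullBoundedBy I ((2 : ℝ) ^ k) σ D H (nullDeriv I σ φ)) →
      sNorm ε χ η k I φ ≤ C * (D * size ((2 : ℝ) ^ k) H) := by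
  obtain ⟨c, hc0, hc⟩ := hη.exists_weight_bound
  obtain ⟨c₁, c₂, hc1, hs⟩ := hχ.support
  have hT : tailConst (1 + 2 * ε) ≠ ⊤ := tailConst_ne_top (by linarith)
  have hT2 : tailConst 2 ≠ ⊤ := tailConst_ne_top one_lt_two
  set T := tailConst (1 + 2 * ε)
  set A := 12 * T * ENNReal.ofReal c with hA
  set L := 6 * ENNReal.ofReal (1 + |c₂ / c₁|) with hL
  have hAt : A ≠ ⊤ := ENNReal.mul_ne_top (ENNReal.mul_ne_top (by simp) hT) ENNReal.ofReal_ne_top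
  have hLt : L ≠ ⊤ := ENNReal.mul_ne_top (by simp) ENNReal.ofReal_ne_top
  have hZt : 18 * tailConst 2 + (A + L) ≠ ⊤ := ENNReal.add_ne_top.2
    ⟨ENNReal.mul_ne_top (by simp) hT2, ENNReal.add_ne_top.2 ⟨hAt, hLt⟩⟩
  -- One summand for each of the six components of the S_k norm, in order.
  refine ⟨6 + 12 * T + A + L + (18 * tailConst 2 + (A + L)) + (18 * tailConst 2 + (A + L)), ?_, ?_⟩
  · simp only [ENNReal.add_ne_top]
    exact ⟨⟨⟨⟨⟨by simp, ENNReal.mul_ne_top (by simp) hT⟩, hAt⟩, hLt⟩,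
      ENNReal.add_ne_top.1 hZt |>.imp id ENNReal.add_ne_top.1⟩,
      ENNReal.add_ne_top.1 hZt |>.imp id ENNReal.add_ne_top.1⟩
  intro a b k I φ D H hI h0 hφ hH hgrad hval hnull
  have hN : (0 : ℝ) < (2 : ℝ) ^ k := by positivity
  have hZ : ∀ σ : ℝ, σ = 1 ∨ σ = -1 → zNorm ε χ η k I σ (nullDeriv I σ φ) ≤
      (18 * tailConst 2 + (A + L)) * (D * size ((2 : ℝ) ^ k) H) := fun σ hσ => by
    have hb : NullBoundedBy I ((2 : ℝ) ^ k) σ D H (nullAtom I σ φ) := fun t ht x hx => by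
      rw [nullAtom_eq (interior_subset ht)]
      exact hnull σ hσ t ht x hx
    refine (hφ.zNorm_le hI h0 σ).trans ?_
    rw [add_mul]
    exact add_le_add (hb.nullWeightedNorm_le (sq_eq_one_iff.2 hσ) hI hH)
      ((hb.majorizedBy hN hσ).yNorm_le hχ hε hε' hc hc0 hc1 hs hI hH)
  have hphi : ∀ lam ∈ Ico ε 1, (2 : ℝ≥0∞) ^ ((1 / 2 - lam) * k) *
      mixedNorm I 2 ⊤ (weighted (fun r => η (-k) r * r ^ (-lam)) φ) ≤
      A * (D * size ((2 : ℝ) ^ k) H) := fun lam hl => by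
    have h := hval.weighted_norm_le hε hε' hc hc0 hI hH hl
    -- The weight for φ exceeds the one in Y_k by a factor N, which is compensated by the N⁻¹ in the
    -- majorization of φ.
    have e : (2 : ℝ≥0∞) ^ ((1 / 2 - lam) * k) =
        ENNReal.ofReal ((2 : ℝ) ^ k) * (2 : ℝ≥0∞) ^ (-(1 / 2 + lam) * k) := by
      rw [two_rpow_mul_intCast, two_rpow_mul_intCast]
      nth_rewrite 2 [← ENNReal.rpow_one (ENNReal.ofReal ((2 : ℝ) ^ k))]
      rw [← ENNReal.rpow_add _ _ (ENNReal.ofReal_pos.2 hN).ne' ENNReal.ofReal_ne_top]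
      congr 1; ring
    have e2 : ENNReal.ofReal ((2 : ℝ) ^ k) * ENNReal.ofReal ((2 : ℝ) ^ k)⁻¹ = 1 := by
      rw [← ENNReal.ofReal_mul hN.le, mul_inv_cancel₀ hN.ne', ENNReal.ofReal_one]
    rw [e, mul_assoc]
    refine (mul_le_mul' le_rfl h).trans (le_of_eq ?_)
    calc _ = A * (D * size ((2 : ℝ) ^ k) H) *
          (ENNReal.ofReal ((2 : ℝ) ^ k) * ENNReal.ofReal ((2 : ℝ) ^ k)⁻¹) := by rw [hA]; ring
      _ = _ := by rw [e2, mul_one]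
  rw [sNorm]
  simp only [add_mul _ _ (D * size ((2 : ℝ) ^ k) H)]
  simp only [add_mul _ _ (D * size ((2 : ℝ) ^ k) H)] at hZ
  refine add_le_add (add_le_add (add_le_add (add_le_add (add_le_add ?_ ?_) ?_) ?_)
    (hZ 1 (Or.inl rfl))) (hZ (-1) (Or.inr rfl))
  · exact (hgrad.mixedNorm_top_two_le hI hN hH.measurable).trans_eq (mul_assoc _ _ _)
  · exact iSup₂_le fun e he => hgrad.strichartz_admissibleGap hε hε' hI hH he
  · exact iSup₂_le hphi
  · exact (hgrad.localEnergyNorm_le hχ hI hN hH.measurable hc1 hs).trans_eq (mul_assoc _ _ _)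

end RadialWave

end

/-! ### The profile of the wave and its L² bound -/

noncomputable section

namespace RadialWave

/-! ### The profile of a wave -/

theorem lintegral_mul_sq_le {X : Type*} [MeasurableSpace X] {μ : Measure X} {p q : X → ℝ≥0∞}
    (hp : AEMeasurable p μ) (hq : AEMeasurable q μ) :
    (∫⁻ x, p x * q x ∂μ) ^ 2 ≤ (∫⁻ x, p x ^ 2 ∂μ) * ∫⁻ x, q x ^ 2 ∂μ := by
  have h := ENNReal.lintegral_mul_le_Lp_mul_Lq μ Real.HolderConjugate.two_two hp hq
  have h2 := pow_le_pow_left' h 2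
  rw [mul_pow, ← ENNReal.rpow_two, ← ENNReal.rpow_two, ← ENNReal.rpow_two, rpow_half_rpow_two,
    rpow_half_rpow_two] at h2
  simpa only [ENNReal.rpow_two, Pi.mul_apply] using h2

/-- Minkowski's integral inequality in `L²`. -/
theorem lintegral_lintegral_sq_le {X Y : Type*} [MeasurableSpace X] [MeasurableSpace Y]
    {μ : Measure X} {ν : Measure Y} [SFinite μ] [SFinite ν] {g : X → Y → ℝ≥0∞}
    (hg : Measurable fun z : X × Y => g z.1 z.2) :
    ∫⁻ v, (∫⁻ s, g s v ∂μ) ^ 2 ∂ν ≤ (∫⁻ s, (∫⁻ v, g s v ^ 2 ∂ν) ^ (1 / 2 : ℝ) ∂μ) ^ 2 := by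
  have hs : ∀ s, Measurable fun v => g s v := fun s => by
    have : Measurable fun v : Y => (s, v) := by fun_prop
    exact hg.comp this
  have hv : ∀ v, Measurable fun s => g s v := fun v => by
    have : Measurable fun s : X => (s, v) := by fun_prop
    exact hg.comp this
  have hm3 : Measurable fun z : (Y × X) × X => g z.1.2 z.1.1 * g z.2 z.1.1 := by
    have h1 : Measurable fun z : (Y × X) × X => (z.1.2, z.1.1) := by fun_prop
    have h2 : Measurable fun z : (Y × X) × X => (z.2, z.1.1) := by fun_prop
    exact (hg.comp h1).mul (hg.comp h2)
  have hm4 : Measurable fun z : X × Y => ∫⁻ s', g z.1 z.2 * g s' z.2 ∂μ := by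
    have h0 : Measurable fun z : (X × Y) × X => g z.1.1 z.1.2 * g z.2 z.1.2 := by
      have h2 : Measurable fun z : (X × Y) × X => (z.2, z.1.2) := by fun_prop
      exact (hg.comp measurable_fst).mul (hg.comp h2)
    exact h0.lintegral_prod_right'
  have hn : Measurable fun s => ∫⁻ v, g s v ^ 2 ∂ν := by
    have h0 : Measurable fun z : X × Y => g z.1 z.2 ^ 2 := hg.pow_const 2
    exact h0.lintegral_prod_right'
  have hcs : ∀ s s', ∫⁻ v, g s v * g s' v ∂ν ≤
      (∫⁻ v, g s v ^ 2 ∂ν) ^ (1 / 2 : ℝ) * (∫⁻ v, g s' v ^ 2 ∂ν) ^ (1 / 2 : ℝ) := fun s s' => by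
    rw [← ENNReal.mul_rpow_of_nonneg _ _ (by norm_num)]
    exact le_rpow_half (lintegral_mul_sq_le (hs s).aemeasurable (hs s').aemeasurable)
  -- The square is opened into a double integral over s and s', so that Tonelli and Cauchy–Schwarz
  -- in v give the claim without duality.
  have e1 : ∀ v, (∫⁻ s, g s v ∂μ) ^ 2 = ∫⁻ s, ∫⁻ s', g s v * g s' v ∂μ ∂μ := fun v => by
    have h1 : ∀ s, ∫⁻ s', g s v * g s' v ∂μ = g s v * ∫⁻ s', g s' v ∂μ := fun s =>
      lintegral_const_mul _ (hv v)
    simp only [h1]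
    rw [lintegral_mul_const _ (hv v), sq]
  have e2 : ∀ s, ∫⁻ v, ∫⁻ s', g s v * g s' v ∂μ ∂ν = ∫⁻ s', ∫⁻ v, g s v * g s' v ∂ν ∂μ :=
    fun s => by
    refine lintegral_lintegral_swap (f := fun v s' => g s v * g s' v) ?_
    have h1 : Measurable fun z : Y × X => g s z.1 := (hs s).comp measurable_fst
    have h2 : Measurable fun z : Y × X => g z.2 z.1 := hg.comp measurable_swap
    exact (h1.mul h2).aemeasurable
  calc ∫⁻ v, (∫⁻ s, g s v ∂μ) ^ 2 ∂ν = ∫⁻ v, ∫⁻ s, ∫⁻ s', g s v * g s' v ∂μ ∂μ ∂ν := by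
        simp only [e1]
    _ = ∫⁻ s, ∫⁻ v, ∫⁻ s', g s v * g s' v ∂μ ∂ν ∂μ := by
        refine lintegral_lintegral_swap (f := fun v s => ∫⁻ s', g s v * g s' v ∂μ) ?_
        exact (hm4.comp measurable_swap).aemeasurable
    _ = ∫⁻ s, ∫⁻ s', ∫⁻ v, g s v * g s' v ∂ν ∂μ ∂μ := by simp only [e2]
    _ ≤ ∫⁻ s, ∫⁻ s', (∫⁻ v, g s v ^ 2 ∂ν) ^ (1 / 2 : ℝ) *
          (∫⁻ v, g s' v ^ 2 ∂ν) ^ (1 / 2 : ℝ) ∂μ ∂μ :=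
        lintegral_mono fun s => lintegral_mono fun s' => hcs s s'
    _ = _ := by
        have hn2 : Measurable fun s => (∫⁻ v, g s v ^ 2 ∂ν) ^ (1 / 2 : ℝ) := hn.pow_const _
        have h1 : ∀ s, ∫⁻ s', (∫⁻ v, g s v ^ 2 ∂ν) ^ (1 / 2 : ℝ) *
            (∫⁻ v, g s' v ^ 2 ∂ν) ^ (1 / 2 : ℝ) ∂μ = (∫⁻ v, g s v ^ 2 ∂ν) ^ (1 / 2 : ℝ) *
            ∫⁻ s', (∫⁻ v, g s' v ^ 2 ∂ν) ^ (1 / 2 : ℝ) ∂μ := fun s => lintegral_const_mul _ hn2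
        simp only [h1]
        rw [lintegral_mul_const _ hn2, sq]

variable {N : ℝ}

theorem decay_le_tailWeight (hN : 0 < N) (v : ℝ) :
    ENNReal.ofReal (decay (N * v)) ≤ 2 * tailWeight N 2 v := by
  rw [tailWeight, show (2 : ℝ≥0∞) = ENNReal.ofReal 2 by simp, ← ENNReal.ofReal_mul zero_le_two]
  refine ENNReal.ofReal_le_ofReal ?_
  have h1 : 0 ≤ N * |v| := by positivity
  have e : (N * v) ^ 2 = (N * |v|) ^ 2 := by rw [mul_pow, mul_pow, sq_abs]
  rw [decay, Real.rpow_neg (by linarith), Real.rpow_two, ← div_eq_mul_inv,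
    le_div_iff₀ (by positivity), inv_mul_le_iff₀ (by positivity), e]
  nlinarith [sq_nonneg (N * |v| - 1)]

theorem continuous_wave (N : ℝ) : Continuous fun p : ℝ × ℝ => wave N p.1 p.2 := by
  unfold wave
  exact (continuous_decay.comp (by fun_prop)).add (continuous_decay.comp (by fun_prop))

theorem measurable_wave (N : ℝ) {X : Type*} [MeasurableSpace X] {f g : X → ℝ} (hf : Measurable f)
    (hg : Measurable g) : Measurable fun x => wave N (f x) (g x) :=
  (continuous_wave N).measurable.comp (hf.prodMk hg)

theorem wave_symm (N v ρ : ℝ) : wave N v ρ = wave N ρ v := by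
  rw [wave, wave, add_comm v ρ, ← decay_neg (N * (v - ρ))]
  congr 2
  ring

theorem lintegral_mul_add_translates {T : ℝ → ℝ≥0∞} (hT : Measurable T) (c : ℝ≥0∞) (v : ℝ) :
    ∫⁻ ρ, c * (T (ρ + v) + T (ρ - v)) = c * ((∫⁻ w, T w) + ∫⁻ w, T w) := by
  have h1 : Measurable fun ρ => T (ρ + v) := hT.comp (measurable_id.add_const v)
  have h2 : Measurable fun ρ => T (ρ - v) := hT.comp (measurable_id.sub_const v)
  have h3 : Measurable fun ρ => T (ρ + v) + T (ρ - v) := h1.add h2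
  rw [lintegral_const_mul _ h3, lintegral_add_left h1, lintegral_add_right_eq_self T,
    lintegral_sub_right_eq_self T]

theorem lintegral_wave_le (hN : 0 < N) (v : ℝ) :
    ∫⁻ ρ, ENNReal.ofReal (wave N ρ v) ≤ 4 * tailConst 2 * ENNReal.ofReal N⁻¹ := by
  have hm := measurable_tailWeight N 2
  have hT : ∫⁻ w, tailWeight N 2 w ≤ tailConst 2 * ENNReal.ofReal N⁻¹ := by
    have h := lintegral_tailWeight hN 2
    calc ∫⁻ w, tailWeight N 2 w = ENNReal.ofReal N⁻¹ * (ENNReal.ofReal N *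
          ∫⁻ w, tailWeight N 2 w) := by
          rw [← mul_assoc, ← ENNReal.ofReal_mul (inv_nonneg.2 hN.le), inv_mul_cancel₀ hN.ne',
            ENNReal.ofReal_one, one_mul]
      _ ≤ ENNReal.ofReal N⁻¹ * tailConst 2 := by
          rw [h]; exact mul_le_mul' le_rfl le_add_self
      _ = _ := mul_comm _ _
  calc ∫⁻ ρ, ENNReal.ofReal (wave N ρ v)
      ≤ ∫⁻ ρ, 2 * (tailWeight N 2 (ρ + v) + tailWeight N 2 (ρ - v)) := by
        refine lintegral_mono fun ρ => ?_
        rw [wave, ENNReal.ofReal_add (decay_pos _).le (decay_pos _).le,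
          mul_add (2 : ℝ≥0∞)]
        exact add_le_add (decay_le_tailWeight hN _) (decay_le_tailWeight hN _)
    _ = 2 * ((∫⁻ w, tailWeight N 2 w) + ∫⁻ w, tailWeight N 2 w) :=
        lintegral_mul_add_translates hm 2 v
    _ ≤ 2 * (tailConst 2 * ENNReal.ofReal N⁻¹ + tailConst 2 * ENNReal.ofReal N⁻¹) := by gcongr
    _ = _ := by ring

/-- The weight in the profile of a wave. -/
def waveWeight (N v ρ : ℝ) : ℝ≥0∞ := ENNReal.ofReal ((1 + N * ρ) ^ (-(1 / 2) : ℝ) * wave N v ρ)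

theorem measurable_waveWeight (N : ℝ) {X : Type*} [MeasurableSpace X] {f g : X → ℝ}
    (hf : Measurable f) (hg : Measurable g) : Measurable fun x => waveWeight N (f x) (g x) := by
  have h1 : Measurable fun x => (1 + N * g x) ^ (-(1 / 2) : ℝ) := by fun_prop
  exact (h1.mul (measurable_wave N hf hg)).ennreal_ofReal

/-- The contribution of `f` to the profile of a wave. -/
def prof (N : ℝ) (f : Plane → ℝ≥0∞) (v : ℝ) : ℝ≥0∞ := ∫⁻ y, waveWeight N v ‖y‖ * f y

/-- The origin of the factor 3 in the notion of slow variation. -/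
theorem decay_le_three_mul {x y : ℝ} (h : |x - y| ≤ 1) : decay x ≤ 3 * decay y := by
  have h2 := (sq_le_one_iff_abs_le_one _).2 h
  rw [decay, decay, ← div_eq_mul_inv, le_div_iff₀ (by positivity), inv_mul_le_iff₀ (by positivity)]
  nlinarith [sq_nonneg (2 * x - y)]

theorem waveWeight_le (hN : 0 < N) {v w ρ : ℝ} (hρ : 0 ≤ ρ) (h : N * |v - w| ≤ 1) :
    waveWeight N v ρ ≤ 3 * waveWeight N w ρ := by
  rw [waveWeight, waveWeight, show (3 : ℝ≥0∞) = ENNReal.ofReal 3 by simp,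
    ← ENNReal.ofReal_mul (by norm_num), mul_left_comm]
  refine ENNReal.ofReal_le_ofReal (mul_le_mul_of_nonneg_left ?_ (by positivity))
  rw [wave, wave, mul_add (3 : ℝ)]
  have e : ∀ z, |N * (v + z) - N * (w + z)| ≤ 1 := fun z => by
    rw [← mul_sub, add_sub_add_right_eq_sub, abs_mul, abs_of_pos hN]; exact h
  exact add_le_add (decay_le_three_mul (e ρ)) (decay_le_three_mul (by
    simpa only [sub_eq_add_neg] using e (-ρ)))

theorem prof_le (hN : 0 < N) (f : Plane → ℝ≥0∞) {v w : ℝ} (h : N * |v - w| ≤ 1) :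
    prof N f v ≤ 3 * prof N f w := by
  rw [prof, prof, ← lintegral_const_mul' _ _ ENNReal.ofNat_ne_top]
  refine lintegral_mono fun y => ?_
  rw [← mul_assoc]
  exact mul_le_mul' (waveWeight_le hN (norm_nonneg y) h) le_rfl

/-- Cauchy–Schwarz with the wave factor split into two square roots. In the pure weight integral
(1+Nρ)⁻¹ cancels the Jacobian ρ at the price 1/N, and the integral of the wave costs another 1/N.
The constant is 28 = 7·4 with 7 ≥ 2π. -/
theorem prof_sq_le (hN : 0 < N) {f : Plane → ℝ≥0∞} (hf : AEMeasurable f) (v : ℝ) :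
    prof N f v ^ 2 ≤ 28 * tailConst 2 * ENNReal.ofReal N⁻¹ ^ 2 *
      ∫⁻ y, ENNReal.ofReal (wave N v ‖y‖) * f y ^ 2 := by
  set p : Plane → ℝ≥0∞ := fun y =>
    ENNReal.ofReal ((1 + N * ‖y‖) ^ (-(1 / 2) : ℝ) * √(wave N v ‖y‖)) with hp
  set q : Plane → ℝ≥0∞ := fun y => ENNReal.ofReal √(wave N v ‖y‖) with hq
  have hw : Measurable fun y : Plane => wave N v ‖y‖ :=
    measurable_wave N measurable_const measurable_norm
  have hpm : Measurable p := by
    have h1 : Measurable fun y : Plane => (1 + N * ‖y‖) ^ (-(1 / 2) : ℝ) := by fun_prop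
    exact (h1.mul hw.sqrt).ennreal_ofReal
  have hqm : Measurable q := hw.sqrt.ennreal_ofReal
  have e : ∀ y, waveWeight N v ‖y‖ * f y = p y * (q y * f y) := fun y => by
    have h0 := (wave_pos N v ‖y‖).le
    rw [← mul_assoc, hp, hq, ← ENNReal.ofReal_mul (by positivity), mul_assoc,
      Real.mul_self_sqrt h0, waveWeight]
  have hq2 : ∀ y, (q y * f y) ^ 2 = ENNReal.ofReal (wave N v ‖y‖) * f y ^ 2 := fun y => by
    rw [mul_pow, hq, ← ENNReal.ofReal_pow (Real.sqrt_nonneg _), Real.sq_sqrt (wave_pos _ _ _).le]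
  have hp2 : ∫⁻ y, p y ^ 2 ≤ 28 * tailConst 2 * ENNReal.ofReal N⁻¹ ^ 2 := by
    have hg : Measurable fun ρ : ℝ => ENNReal.ofReal ((1 + N * ρ)⁻¹ * wave N v ρ) := by
      have h1 : Measurable fun ρ : ℝ => (1 + N * ρ)⁻¹ := by fun_prop
      exact (h1.mul (measurable_wave N measurable_const measurable_id)).ennreal_ofReal
    have e2 : ∀ y, p y ^ 2 = ENNReal.ofReal ((1 + N * ‖y‖)⁻¹ * wave N v ‖y‖) := fun y => by
      have h1 : 0 ≤ 1 + N * ‖y‖ := by positivity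
      rw [hp, ← ENNReal.ofReal_pow (by positivity), mul_pow, Real.sq_sqrt (wave_pos _ _ _).le,
        ← Real.rpow_natCast, ← Real.rpow_mul h1]
      norm_num [Real.rpow_neg_one]
    simp only [e2]
    rw [lintegral_plane_radial hg]
    have h7 : ENNReal.ofReal (2 * Real.pi) ≤ 7 := by
      rw [show (7 : ℝ≥0∞) = ENNReal.ofReal 7 by simp]
      exact ENNReal.ofReal_le_ofReal (by linarith [Real.pi_lt_d2])
    have hin : ∫⁻ ρ in Ioi (0 : ℝ), ENNReal.ofReal ρ *
        ENNReal.ofReal ((1 + N * ρ)⁻¹ * wave N v ρ) ≤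
        ENNReal.ofReal N⁻¹ * (4 * tailConst 2 * ENNReal.ofReal N⁻¹) := by
      calc _ ≤ ∫⁻ ρ in Ioi (0 : ℝ), ENNReal.ofReal N⁻¹ * ENNReal.ofReal (wave N ρ v) := by
            refine setLIntegral_mono' measurableSet_Ioi fun ρ hρ => ?_
            have hρ0 : 0 < ρ := hρ
            rw [← ENNReal.ofReal_mul hρ0.le, ← ENNReal.ofReal_mul (inv_nonneg.2 hN.le),
              wave_symm N ρ v, ← mul_assoc]
            refine ENNReal.ofReal_le_ofReal
              (mul_le_mul_of_nonneg_right ?_ (wave_pos _ _ _).le)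
            rw [← div_eq_mul_inv, div_le_iff₀ (by positivity), inv_mul_eq_div, le_div_iff₀ hN]
            nlinarith
        _ ≤ ∫⁻ ρ, ENNReal.ofReal N⁻¹ * ENNReal.ofReal (wave N ρ v) :=
            setLIntegral_le_lintegral _ _
        _ ≤ _ := by
            rw [lintegral_const_mul' _ _ ENNReal.ofReal_ne_top]
            exact mul_le_mul' le_rfl (lintegral_wave_le hN v)
    calc _ ≤ 7 * (ENNReal.ofReal N⁻¹ * (4 * tailConst 2 * ENNReal.ofReal N⁻¹)) :=
          mul_le_mul' h7 hin
      _ = _ := by ring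
  rw [prof]
  simp only [e]
  refine (lintegral_mul_sq_le (q := fun y => q y * f y) hpm.aemeasurable
    (hqm.aemeasurable.mul hf)).trans ?_
  simp only [hq2]
  exact mul_le_mul' hp2 le_rfl

/-- The second half of Schur's test: integrating the remaining wave factor over v gives the third
power of 1/N. The constant 112 = 28·4 is rounded up to 121 = 11². -/
theorem energy_prof_le (hN : 0 < N) {f : Plane → ℝ≥0∞} (hf : AEMeasurable f) :
    energy (prof N f) ≤ 121 * tailConst 2 ^ 2 * ENNReal.ofReal N⁻¹ ^ 3 * ∫⁻ y, f y ^ 2 := by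
  have hT := one_le_tailConst 2
  have hm : AEMeasurable (Function.uncurry fun (v : ℝ) (y : Plane) =>
      ENNReal.ofReal (wave N v ‖y‖) * f y ^ 2) ((volume : Measure ℝ).prod volume) := by
    have h1 : Measurable fun z : ℝ × Plane => ENNReal.ofReal (wave N z.1 ‖z.2‖) :=
      (measurable_wave N measurable_fst measurable_snd.norm).ennreal_ofReal
    have h2 : AEMeasurable (fun z : ℝ × Plane => f z.2 ^ 2) ((volume : Measure ℝ).prod volume) :=
      (hf.pow_const 2).comp_quasiMeasurePreserving Measure.quasiMeasurePreserving_snd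
    exact h1.aemeasurable.mul h2
  calc energy (prof N f) ≤ ∫⁻ v, 28 * tailConst 2 * ENNReal.ofReal N⁻¹ ^ 2 *
        ∫⁻ y, ENNReal.ofReal (wave N v ‖y‖) * f y ^ 2 := lintegral_mono fun v => prof_sq_le hN hf v
    _ ≤ 28 * tailConst 2 * ENNReal.ofReal N⁻¹ ^ 2 *
        ∫⁻ y, (4 * tailConst 2 * ENNReal.ofReal N⁻¹) * f y ^ 2 := by
        rw [lintegral_const_mul'' _ hm.lintegral_prod_right, lintegral_lintegral_swap hm]
        refine mul_le_mul' le_rfl (lintegral_mono fun y => ?_)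
        have h1 : Measurable fun v => ENNReal.ofReal (wave N v ‖y‖) :=
          (measurable_wave N measurable_id measurable_const).ennreal_ofReal
        rw [lintegral_mul_const _ h1]
        exact mul_le_mul' (lintegral_wave_le hN _) le_rfl
    _ = 112 * (tailConst 2 ^ 2 * ENNReal.ofReal N⁻¹ ^ 3 * ∫⁻ y, f y ^ 2) := by
        rw [lintegral_const_mul'' _ (hf.pow_const 2)]
        ring
    _ ≤ 121 * (tailConst 2 ^ 2 * ENNReal.ofReal N⁻¹ ^ 3 * ∫⁻ y, f y ^ 2) :=
        mul_le_mul' (by norm_num) le_rfl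
    _ = _ := by ring

end RadialWave

end

noncomputable section

namespace RadialWave

variable {N : ℝ} {I : Set ℝ} {f : Plane → ℝ≥0∞} {A : ℝ → Plane → ℝ≥0∞}

/-- The profile of a wave with initial data `f` and forcing term `A`. -/
def waveProfile (N : ℝ) (I : Set ℝ) (f : Plane → ℝ≥0∞) (A : ℝ → Plane → ℝ≥0∞) (v : ℝ) : ℝ≥0∞ :=
  ENNReal.ofReal N ^ 2 * (5 * prof N f v + ∫⁻ s in I, prof N (A s) (v - s))

theorem measurable_prof (hf : Measurable f) : Measurable (prof N f) := by
  have h : Measurable fun z : ℝ × Plane => waveWeight N z.1 ‖z.2‖ * f z.2 :=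
    (measurable_waveWeight N measurable_fst measurable_snd.norm).mul (hf.comp measurable_snd)
  exact h.lintegral_prod_right'

theorem measurable_prof_comp (N : ℝ) (hA : Measurable fun z : ℝ × Plane => A z.1 z.2)
    {X : Type*} [MeasurableSpace X] {σ τ : X → ℝ} (hσ : Measurable σ) (hτ : Measurable τ) :
    Measurable fun x => prof N (A (σ x)) (τ x) := by
  have h2 : Measurable fun w : X × Plane => (σ w.1, w.2) :=
    (hσ.comp measurable_fst).prodMk measurable_snd
  have h : Measurable fun w : X × Plane => waveWeight N (τ w.1) ‖w.2‖ * A (σ w.1) w.2 :=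
    (measurable_waveWeight N (hτ.comp measurable_fst) measurable_snd.norm).mul (hA.comp h2)
  exact h.lintegral_prod_right'

theorem measurable_prof_sub (N : ℝ) (hA : Measurable fun z : ℝ × Plane => A z.1 z.2) :
    Measurable fun z : ℝ × ℝ => prof N (A z.1) (z.2 - z.1) :=
  measurable_prof_comp N hA measurable_fst (measurable_snd.sub measurable_fst)

theorem measurable_lintegral_prof (N : ℝ) (I : Set ℝ)
    (hA : Measurable fun z : ℝ × Plane => A z.1 z.2) :
    Measurable fun v => ∫⁻ s in I, prof N (A s) (v - s) := by
  have h : Measurable fun z : ℝ × ℝ => prof N (A z.2) (z.1 - z.2) :=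
    measurable_prof_comp N hA measurable_snd (measurable_fst.sub measurable_snd)
  exact h.lintegral_prod_right'

theorem slowlyVarying_waveProfile (hN : 0 < N) (I : Set ℝ) (hf : Measurable f)
    (hA : Measurable fun z : ℝ × Plane => A z.1 z.2) : SlowlyVarying N (waveProfile N I f A) where
  measurable := (((measurable_prof hf).const_mul 5).add
    (measurable_lintegral_prof N I hA)).const_mul _
  le v w h := by
    have h2 : ∫⁻ s in I, prof N (A s) (v - s) ≤ 3 * ∫⁻ s in I, prof N (A s) (w - s) := by
      rw [← lintegral_const_mul' _ _ ENNReal.ofNat_ne_top]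
      refine lintegral_mono fun s => prof_le hN _ ?_
      rwa [sub_sub_sub_cancel_right]
    calc waveProfile N I f A v ≤ ENNReal.ofReal N ^ 2 * (5 * (3 * prof N f w) +
          3 * ∫⁻ s in I, prof N (A s) (w - s)) :=
          mul_le_mul' le_rfl (add_le_add (mul_le_mul' le_rfl (prof_le hN f h)) h2)
      _ = _ := by rw [waveProfile]; ring

/-- Minkowski's inequality exchanges the time integral with the L² norm in v, and translation by s
does not change that norm. -/
theorem energy_lintegral_prof_le (hN : 0 < N) (I : Set ℝ)
    (hA : Measurable fun z : ℝ × Plane => A z.1 z.2) :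
    ∫⁻ v, (∫⁻ s in I, prof N (A s) (v - s)) ^ 2 ≤ 121 * tailConst 2 ^ 2 *
      ENNReal.ofReal N⁻¹ ^ 3 * (∫⁻ s in I, (∫⁻ y, A s y ^ 2) ^ (1 / 2 : ℝ)) ^ 2 := by
  have hAs : ∀ s, Measurable (A s) := fun s => by
    have h : Measurable fun y : Plane => (s, y) := by fun_prop
    exact hA.comp h
  set E := 121 * tailConst 2 ^ 2 * ENNReal.ofReal N⁻¹ ^ 3 with hE
  have hEt : E ≠ ⊤ := ENNReal.mul_ne_top (ENNReal.mul_ne_top (by simp)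
    (ENNReal.pow_ne_top (tailConst_ne_top one_lt_two))) (ENNReal.pow_ne_top ENNReal.ofReal_ne_top)
  have h1 : ∀ s, (∫⁻ v, prof N (A s) (v - s) ^ 2) ^ (1 / 2 : ℝ) ≤
      E ^ (1 / 2 : ℝ) * (∫⁻ y, A s y ^ 2) ^ (1 / 2 : ℝ) := fun s => by
    rw [← ENNReal.mul_rpow_of_nonneg _ _ (by norm_num),
      lintegral_sub_right_eq_self (fun v => prof N (A s) v ^ 2) s]
    exact ENNReal.rpow_le_rpow (energy_prof_le hN (hAs s).aemeasurable) (by norm_num)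
  refine (lintegral_lintegral_sq_le (μ := volume.restrict I)
    (g := fun s v => prof N (A s) (v - s)) (measurable_prof_sub N hA)).trans ?_
  calc _ ≤ (∫⁻ s in I, E ^ (1 / 2 : ℝ) * (∫⁻ y, A s y ^ 2) ^ (1 / 2 : ℝ)) ^ 2 :=
        pow_le_pow_left' (lintegral_mono h1) 2
    _ = _ := by
        rw [lintegral_const_mul' _ _ (ENNReal.rpow_ne_top_of_nonneg (by norm_num) hEt), mul_pow,
          ← ENNReal.rpow_two, rpow_half_rpow_two]

/-- The powers of N balance: N⁴ from the squared prefactor, N⁻³ from the energy of a profile and N⁻¹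
from the definition of size. The constant is 88 = 11·8, with 8² = 64 ≥ 50 = 2·5². -/
theorem size_waveProfile_le (hN : 0 < N) (I : Set ℝ) (hf : Measurable f)
    (hA : Measurable fun z : ℝ × Plane => A z.1 z.2) :
    size N (waveProfile N I f A) ≤ 88 * tailConst 2 *
      ((∫⁻ y, f y ^ 2) ^ (1 / 2 : ℝ) + ∫⁻ s in I, (∫⁻ y, A s y ^ 2) ^ (1 / 2 : ℝ)) := by
  set n := ENNReal.ofReal N with hn
  set a₀ := (∫⁻ y, f y ^ 2) ^ (1 / 2 : ℝ) with ha0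
  set a₁ := ∫⁻ s in I, (∫⁻ y, A s y ^ 2) ^ (1 / 2 : ℝ) with ha1
  have hn1 : ENNReal.ofReal N⁻¹ * n = 1 := by
    rw [hn, ← ENNReal.ofReal_mul (inv_nonneg.2 hN.le), inv_mul_cancel₀ hN.ne', ENNReal.ofReal_one]
  have hnt : n ^ 2 ≠ ⊤ := ENNReal.pow_ne_top ENNReal.ofReal_ne_top
  have hP : Measurable fun v => prof N f v ^ 2 := (measurable_prof hf).pow_const 2
  have hQ : Measurable fun v => (∫⁻ s in I, prof N (A s) (v - s)) ^ 2 :=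
    (measurable_lintegral_prof N I hA).pow_const 2
  have ha : ∫⁻ y, f y ^ 2 = a₀ ^ 2 := by rw [← ENNReal.rpow_two, ha0, rpow_half_rpow_two]
  have h1 : energy (waveProfile N I f A) ≤ n ^ 4 * (121 * tailConst 2 ^ 2 *
      ENNReal.ofReal N⁻¹ ^ 3 * (50 * a₀ ^ 2 + 2 * a₁ ^ 2)) := by
    calc energy (waveProfile N I f A)
        ≤ ∫⁻ v, n ^ 4 * (50 * prof N f v ^ 2 + 2 * (∫⁻ s in I, prof N (A s) (v - s)) ^ 2) := by
          refine lintegral_mono fun v => ?_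
          beta_reduce
          rw [waveProfile, mul_pow, ← pow_mul]
          refine mul_le_mul' le_rfl ((add_sq_le_two_mul _ _).trans_eq ?_)
          ring
      _ = n ^ 4 * (50 * energy (prof N f) +
            2 * ∫⁻ v, (∫⁻ s in I, prof N (A s) (v - s)) ^ 2) := by
          rw [lintegral_const_mul' _ _ (ENNReal.pow_ne_top ENNReal.ofReal_ne_top),
            lintegral_add_left (hP.const_mul 50), lintegral_const_mul' _ _ ENNReal.ofNat_ne_top,
            lintegral_const_mul' _ _ ENNReal.ofNat_ne_top, energy]
      _ ≤ n ^ 4 * (50 * (121 * tailConst 2 ^ 2 * ENNReal.ofReal N⁻¹ ^ 3 * a₀ ^ 2) +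
            2 * (121 * tailConst 2 ^ 2 * ENNReal.ofReal N⁻¹ ^ 3 * a₁ ^ 2)) := by
          rw [← ha]
          exact mul_le_mul' le_rfl (add_le_add
            (mul_le_mul' le_rfl (energy_prof_le hN hf.aemeasurable))
            (mul_le_mul' le_rfl (energy_lintegral_prof_le hN I hA)))
      _ = _ := by ring
  have h2 : size N (waveProfile N I f A) ^ (2 : ℝ) ≤
      (88 * tailConst 2 * (a₀ + a₁)) ^ (2 : ℝ) := by
    rw [ENNReal.rpow_two, ENNReal.rpow_two, size_sq]
    calc _ ≤ ENNReal.ofReal N⁻¹ * (n ^ 4 * (121 * tailConst 2 ^ 2 *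
          ENNReal.ofReal N⁻¹ ^ 3 * (50 * a₀ ^ 2 + 2 * a₁ ^ 2))) := mul_le_mul' le_rfl h1
      _ = (ENNReal.ofReal N⁻¹ * n) ^ 4 * (121 * tailConst 2 ^ 2 * (50 * a₀ ^ 2 + 2 * a₁ ^ 2)) := by
          ring
      _ ≤ 121 * tailConst 2 ^ 2 * (64 * (a₀ ^ 2 + 2 * (a₀ * a₁) + a₁ ^ 2)) := by
          have h64 : 50 * a₀ ^ 2 + 2 * a₁ ^ 2 ≤ 64 * (a₀ ^ 2 + 2 * (a₀ * a₁) + a₁ ^ 2) := by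
            rw [mul_add, mul_add]
            exact add_le_add (le_add_right (mul_le_mul' (by norm_num) le_rfl))
              (mul_le_mul' (by norm_num) le_rfl)
          rw [hn1, one_pow, one_mul]
          exact mul_le_mul' le_rfl h64
      _ = _ := by ring
  exact (ENNReal.rpow_le_rpow_iff two_pos).1 h2

theorem ofReal_kern {σ e r : ℝ} (hN : 0 < N) (hr : 0 ≤ r) {C : ℝ} (hC : 0 ≤ C) (τ : ℝ) {ρ : ℝ}
    (hρ : 0 ≤ ρ) : ENNReal.ofReal (C * N * kern N σ e r τ ρ) = ENNReal.ofReal (C * N) *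
      (ENNReal.ofReal ((1 + N * r) ^ (-(1 / 2) : ℝ)) * waveWeight N (τ + σ * r) ρ +
        ENNReal.ofReal ((1 + N * r) ^ (-e)) * waveWeight N (τ - σ * r) ρ) := by
  have h1 := (wave_pos N (τ + σ * r) ρ).le
  have h2 := (wave_pos N (τ - σ * r) ρ).le
  rw [ENNReal.ofReal_mul (by positivity), waveWeight, waveWeight,
    ← ENNReal.ofReal_mul (p := (1 + N * r) ^ (-(1 / 2) : ℝ)) (by positivity),
    ← ENNReal.ofReal_mul (p := (1 + N * r) ^ (-e)) (by positivity),
    ← ENNReal.ofReal_add (by positivity) (by positivity), kern]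
  congr 2
  ring

theorem lintegral_kern_mul {σ e r : ℝ} (hN : 0 < N) (hr : 0 ≤ r) {C : ℝ} (hC : 0 ≤ C) (τ : ℝ)
    (hf : Measurable f) : ∫⁻ y, ENNReal.ofReal (C * N * kern N σ e r τ ‖y‖) * f y =
      ENNReal.ofReal (C * N) *
      (ENNReal.ofReal ((1 + N * r) ^ (-(1 / 2) : ℝ)) * prof N f (τ + σ * r) +
        ENNReal.ofReal ((1 + N * r) ^ (-e)) * prof N f (τ - σ * r)) := by
  have hm : ∀ v, Measurable fun y : Plane => waveWeight N v ‖y‖ * f y := fun v =>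
    (measurable_waveWeight N measurable_const measurable_norm).mul hf
  set w₁ := ENNReal.ofReal ((1 + N * r) ^ (-(1 / 2) : ℝ)) with hw1
  set w₂ := ENNReal.ofReal ((1 + N * r) ^ (-e)) with hw2
  have e : ∀ y, ENNReal.ofReal (C * N * kern N σ e r τ ‖y‖) * f y = ENNReal.ofReal (C * N) *
      (w₁ * (waveWeight N (τ + σ * r) ‖y‖ * f y) + w₂ * (waveWeight N (τ - σ * r) ‖y‖ * f y)) :=
    fun y => by
      rw [ofReal_kern hN hr hC τ (norm_nonneg y)]
      ring
  simp only [e]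
  rw [lintegral_const_mul' _ _ ENNReal.ofReal_ne_top, lintegral_add_left ((hm _).const_mul _),
    lintegral_const_mul' _ _ ENNReal.ofReal_ne_top, lintegral_const_mul' _ _ ENNReal.ofReal_ne_top,
    prof, prof]

/-- The kernel depends on the time difference and on r, apart from its prefactors, only through τ ±
σr. The integral over the forcing therefore becomes the same profile evaluated at t ± σr. The
prefactor N is written as N⁻¹N² to match its normalization. -/
theorem lintegral_kern_waveProfile {σ e r : ℝ} (hN : 0 < N) (hr : 0 ≤ r) {C : ℝ} (hC : 0 ≤ C)
    (t : ℝ) (hf : Measurable f) (hA : Measurable fun z : ℝ × Plane => A z.1 z.2) :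
    5 * (∫⁻ y, ENNReal.ofReal (C * N * kern N σ e r t ‖y‖) * f y) +
      ∫⁻ s in I, ∫⁻ y, ENNReal.ofReal (C * N * kern N σ e r (t - s) ‖y‖) * A s y =
      ENNReal.ofReal C * ENNReal.ofReal N⁻¹ *
      (ENNReal.ofReal ((1 + N * r) ^ (-(1 / 2) : ℝ)) * waveProfile N I f A (t + σ * r) +
        ENNReal.ofReal ((1 + N * r) ^ (-e)) * waveProfile N I f A (t - σ * r)) := by
  have hAs : ∀ s, Measurable (A s) := fun s => by
    have h : Measurable fun y : Plane => (s, y) := by fun_prop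
    exact hA.comp h
  have hm : ∀ v, Measurable fun s => prof N (A s) (v - s) := fun v =>
    measurable_prof_comp N hA measurable_id (measurable_const.sub measurable_id)
  set w₁ := ENNReal.ofReal ((1 + N * r) ^ (-(1 / 2) : ℝ)) with hw1
  set w₂ := ENNReal.ofReal ((1 + N * r) ^ (-e)) with hw2
  have h1 : ∀ s, ∫⁻ y, ENNReal.ofReal (C * N * kern N σ e r (t - s) ‖y‖) * A s y =
      ENNReal.ofReal (C * N) * (w₁ * prof N (A s) (t + σ * r - s) +
        w₂ * prof N (A s) (t - σ * r - s)) := fun s => by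
    rw [lintegral_kern_mul hN hr hC _ (hAs s), add_sub_right_comm, sub_right_comm]
  simp only [h1]
  rw [lintegral_kern_mul hN hr hC _ hf, lintegral_const_mul' _ _ ENNReal.ofReal_ne_top,
    lintegral_add_left ((hm _).const_mul _), lintegral_const_mul' _ _ ENNReal.ofReal_ne_top,
    lintegral_const_mul' _ _ ENNReal.ofReal_ne_top, waveProfile, waveProfile,
    ENNReal.ofReal_mul hC]
  have hn1 : ENNReal.ofReal N⁻¹ * ENNReal.ofReal N ^ 2 = ENNReal.ofReal N := by
    rw [sq, ← mul_assoc, ← ENNReal.ofReal_mul (inv_nonneg.2 hN.le), inv_mul_cancel₀ hN.ne',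
      ENNReal.ofReal_one, one_mul]
  nth_rewrite 1 2 [← hn1]
  ring

end RadialWave

end

/-! ### Conclusion: pointwise bounds and the energy estimate -/

noncomputable section

namespace RadialWave

variable {a b : ℝ} {k : ℤ} {I : Set ℝ} {φ F : ℝ → Plane → ℂ} {f : Plane → ℝ≥0∞}
  {A : ℝ → Plane → ℝ≥0∞}

/-! ### Pointwise bounds for localized waves -/

/-- A localized wave `φ` with forcing term `F`, together with measurable versions `f` and `A` of
the sizes of the initial data and of the forcing term. -/
structure IsWave (a b : ℝ) (k : ℤ) (I : Set ℝ) (φ F : ℝ → Plane → ℂ) (f : Plane → ℝ≥0∞)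
    (A : ℝ → Plane → ℝ≥0∞) : Prop where
  ordConnected : I.OrdConnected
  zero_mem : (0 : ℝ) ∈ I
  localized : IsLocalized a b k I φ
  hasWeakBox : HasWeakBox I φ F
  lintegral_lt_top : ∫⁻ s in I, eLpNorm (F s) 2 volume < ⊤
  measurable_data : Measurable f
  measurable_force : Measurable fun z : ℝ × Plane => A z.1 z.2
  data_eq : ∀ᵐ y, ‖grad I φ 0 y‖ₑ = f y
  force_eq : ∀ᵐ s ∂volume.restrict I, ∀ᵐ y, ‖F s y‖ₑ = A s y

theorem exists_enorm_pairing_le {α β σ e : ℝ} (hα : 0 < α) (hαβ : α ≤ β) {T : ℝ → ℝ → ℂ}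
    (hT : AmpFamily α β T σ e) {ψ : ℝ → ℂ} (hψ : IsAmplitude α β ψ) :
    ∃ C : ℝ, 0 ≤ C ∧ ∀ (a b : ℝ) (k : ℤ) (I : Set ℝ) (φ F : ℝ → Plane → ℂ) (f : Plane → ℝ≥0∞)
      (A : ℝ → Plane → ℝ≥0∞), IsWave a b k I φ F f A → ∀ t ∈ I, ∀ r, 0 ≤ r →
      ‖pairing ((2 : ℝ) ^ k * α) ((2 : ℝ) ^ k * β)
        (fun w => ψ (w / (2 : ℝ) ^ k) * T ((2 : ℝ) ^ k * r) (w / (2 : ℝ) ^ k)) t φ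
        (timeDeriv I φ) t‖ₑ ≤ ENNReal.ofReal C * ENNReal.ofReal ((2 : ℝ) ^ k)⁻¹ *
        (ENNReal.ofReal ((1 + (2 : ℝ) ^ k * r) ^ (-(1 / 2) : ℝ)) *
          waveProfile ((2 : ℝ) ^ k) I f A (t + σ * r) +
        ENNReal.ofReal ((1 + (2 : ℝ) ^ k * r) ^ (-e)) *
          waveProfile ((2 : ℝ) ^ k) I f A (t - σ * r)) := by
  obtain ⟨C, hC, h⟩ := hT.exists_kern_bound hα hαβ hψ
  refine ⟨C, hC, fun a b k I φ F f A hw t ht r hr => ?_⟩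
  have hN : (0 : ℝ) < (2 : ℝ) ^ k := by positivity
  have hc : IsAmplitude ((2 : ℝ) ^ k * α) ((2 : ℝ) ^ k * β)
      (fun w => ψ (w / (2 : ℝ) ^ k) * T ((2 : ℝ) ^ k * r) (w / (2 : ℝ) ^ k)) := by
    simp only [mul_comm (ψ _)]
    exact (hψ.mul (hT.contDiff ((2 : ℝ) ^ k * r))).comp_div hN
  refine (hw.hasWeakBox.enorm_pairing_le hw.ordConnected hw.zero_mem hw.localized
    hw.lintegral_lt_top (by positivity) (by gcongr) hc ht
    (κ := fun τ ρ => C * (2 : ℝ) ^ k * kern ((2 : ℝ) ^ k) σ e r τ ρ)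
    (fun τ y => (h _ r hN hr τ).1 y) (fun τ ρ hρ => (h _ r hN hr τ).2 ρ hρ)).trans ?_
  rw [← lintegral_kern_waveProfile hN hr hC t hw.measurable_data hw.measurable_force]
  refine add_le_add (mul_le_mul' le_rfl (lintegral_mono_ae ?_)) (lintegral_mono_ae ?_)
  · filter_upwards [hw.data_eq] with y hy
    rw [hy]
  · filter_upwards [hw.force_eq] with s hs
    refine lintegral_mono_ae ?_
    filter_upwards [hs] with y hy
    rw [hy]

theorem MajorizedBy.mono {N : ℝ} {D D' : ℝ≥0∞} {H : ℝ → ℝ≥0∞} {V : Type*} [NormedAddCommGroup V]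
    {g : ℝ → Plane → V} (hg : MajorizedBy I N D H g) (h : D ≤ D') : MajorizedBy I N D' H g :=
  fun t ht x hx => (hg t ht x hx).trans (mul_le_mul' h le_rfl)

theorem NullBoundedBy.mono {N σ : ℝ} {D D' : ℝ≥0∞} {H : ℝ → ℝ≥0∞} {ψ : ℝ → Plane → ℂ}
    (hψ : NullBoundedBy I N σ D H ψ) (h : D ≤ D') : NullBoundedBy I N σ D' H ψ :=
  fun t ht x hx => (hψ t ht x hx).trans (mul_le_mul' h le_rfl)

theorem exists_majorizedBy {α β : ℝ} (hα : 0 < α) (hαβ : α ≤ β) {m : ℝ → ℝ}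
    (hm : IsFreqCutoff α β m) (a b : ℝ)
    (hm1 : ∀ w ∈ Icc (2 * Real.pi * a) (2 * Real.pi * b), m w = 1) :
    ∃ C : ℝ, 0 ≤ C ∧ ∀ (k : ℤ) (I : Set ℝ) (φ F : ℝ → Plane → ℂ) (f : Plane → ℝ≥0∞)
      (A : ℝ → Plane → ℝ≥0∞), IsWave a b k I φ F f A →
      MajorizedBy I ((2 : ℝ) ^ k) (ENNReal.ofReal ((2 : ℝ) ^ k)⁻¹ * ENNReal.ofReal C)
        (waveProfile ((2 : ℝ) ^ k) I f A) φ := by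
  obtain ⟨C, hC, h⟩ := exists_enorm_pairing_le hα hαβ (ampFamily_besselJ hα β)
    (hm.isAmplitude (contDiff_const (c := (-(Complex.I * ((2 * Real.pi)⁻¹ : ℝ))))))
  refine ⟨C, hC, fun k I φ F f A hw t ht x hx => ?_⟩
  have htI := interior_subset ht
  have h1 := h a b k I φ F f A hw t htI ‖x‖ (norm_nonneg x)
  rw [hw.localized.eq_pairing hα hαβ hm hm1 htI x]
  refine h1.trans_eq ?_
  rw [one_mul, majorant]
  ring

theorem exists_nullBoundedBy {α β : ℝ} (hα : 0 < α) (hαβ : α ≤ β) {m : ℝ → ℝ}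
    (hm : IsFreqCutoff α β m) (a b : ℝ)
    (hm1 : ∀ w ∈ Icc (2 * Real.pi * a) (2 * Real.pi * b), m w = 1) {σ : ℝ} (hσ : σ ^ 2 = 1) :
    ∃ C : ℝ, 0 ≤ C ∧ ∀ (k : ℤ) (I : Set ℝ) (φ F : ℝ → Plane → ℂ) (f : Plane → ℝ≥0∞)
      (A : ℝ → Plane → ℝ≥0∞), IsWave a b k I φ F f A →
      NullBoundedBy I ((2 : ℝ) ^ k) σ (ENNReal.ofReal C)
        (waveProfile ((2 : ℝ) ^ k) I f A) (nullDeriv I σ φ) := by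
  obtain ⟨C, hC, h⟩ := exists_enorm_pairing_le hα hαβ (ampFamily_null hα β hσ)
    (hm.isAmplitude (f := fun w : ℝ => ((w * (2 * Real.pi)⁻¹ : ℝ) : ℂ))
      (Complex.ofRealCLM.contDiff.comp (contDiff_id.mul contDiff_const)))
  refine ⟨C, hC, fun k I φ F f A hw t ht x hx => ?_⟩
  have hN : (0 : ℝ) < (2 : ℝ) ^ k := by positivity
  have h1 := h a b k I φ F f A hw t (interior_subset ht) ‖x‖ (norm_nonneg x)
  have hn : ‖(((2 : ℝ) ^ k : ℝ) : ℂ)‖ₑ = ENNReal.ofReal ((2 : ℝ) ^ k) := by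
    rw [← ofReal_norm, Complex.norm_real, Real.norm_of_nonneg hN.le]
  have hn1 : ENNReal.ofReal ((2 : ℝ) ^ k) * ENNReal.ofReal ((2 : ℝ) ^ k)⁻¹ = 1 := by
    rw [← ENNReal.ofReal_mul hN.le, mul_inv_cancel₀ hN.ne', ENNReal.ofReal_one]
  rw [hw.localized.nullDeriv_eq_pairing hw.ordConnected hα hαβ hm hm1 ht hx σ, enorm_mul, hn]
  refine (mul_le_mul' le_rfl h1).trans_eq ?_
  rw [← mul_assoc, mul_left_comm, hn1, mul_one]

theorem norm_spaceDeriv_le {f : Plane → ℂ} (hf : IsRadial f) {x : Plane} (hx : x ≠ 0)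
    (hd : DifferentiableAt ℝ f x) (i : Fin 2) :
    ‖fderiv ℝ f x (EuclideanSpace.single i 1)‖ ≤ ‖fderiv ℝ f x (‖x‖⁻¹ • x)‖ := by
  rw [hf.fderiv_eq hx hd, norm_smul]
  have h1 : ‖fderiv ℝ (fun y : Plane => ‖y‖) x (EuclideanSpace.single i 1)‖ ≤ 1 := by
    refine (ContinuousLinearMap.le_opNorm _ _).trans ?_
    rw [PiLp.norm_single, norm_one, mul_one]
    exact norm_fderiv_le_of_lipschitz ℝ (C := 1) lipschitzWith_one_norm
  exact mul_le_of_le_one_left (norm_nonneg _) h1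

/-- The derivatives ∂_t and ∂_r are half the sum and half the difference of the null derivatives,
and for a radial function each ∂_i is bounded by ∂_r. -/
theorem norm_grad_le {t : ℝ} {x : Plane} (hr : IsRadial (φ t)) (hx : x ≠ 0)
    (hd : DifferentiableAt ℝ (φ t) x) :
    ‖grad I φ t x‖ ≤ 2 * (‖nullDeriv I 1 φ t x‖ + ‖nullDeriv I (-1) φ t x‖) := by
  have h0 : ‖spaceDeriv 0 φ t x‖ ≤ ‖radialDeriv φ t x‖ := norm_spaceDeriv_le hr hx hd 0
  have h1 : ‖spaceDeriv 1 φ t x‖ ≤ ‖radialDeriv φ t x‖ := norm_spaceDeriv_le hr hx hd 1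
  have e1 : timeDeriv I φ t x = (1 / 2 : ℂ) * (nullDeriv I 1 φ t x + nullDeriv I (-1) φ t x) := by
    rw [nullDeriv, nullDeriv]; push_cast; ring
  have e2 : radialDeriv φ t x = (1 / 2 : ℂ) * (nullDeriv I 1 φ t x - nullDeriv I (-1) φ t x) := by
    rw [nullDeriv, nullDeriv]; push_cast; ring
  have n1 : ‖timeDeriv I φ t x‖ ≤
      1 / 2 * (‖nullDeriv I 1 φ t x‖ + ‖nullDeriv I (-1) φ t x‖) := by
    rw [e1, norm_mul]
    norm_num
    exact norm_add_le _ _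
  have n2 : ‖radialDeriv φ t x‖ ≤
      1 / 2 * (‖nullDeriv I 1 φ t x‖ + ‖nullDeriv I (-1) φ t x‖) := by
    rw [e2, norm_mul]
    norm_num
    exact norm_sub_le _ _
  have hg : ‖grad I φ t x‖ ≤
      ‖timeDeriv I φ t x‖ + ‖spaceDeriv 0 φ t x‖ + ‖spaceDeriv 1 φ t x‖ := by
    rw [EuclideanSpace.norm_eq, Fin.sum_univ_three]
    refine Real.sqrt_le_iff.2 ⟨by positivity, ?_⟩
    have p0 := norm_nonneg (timeDeriv I φ t x)
    have p1 := norm_nonneg (spaceDeriv 0 φ t x)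
    have p2 := norm_nonneg (spaceDeriv 1 φ t x)
    calc _ = ‖timeDeriv I φ t x‖ ^ 2 + ‖spaceDeriv 0 φ t x‖ ^ 2 + ‖spaceDeriv 1 φ t x‖ ^ 2 := rfl
      _ ≤ _ := by nlinarith [mul_nonneg p0 p1, mul_nonneg p0 p2, mul_nonneg p1 p2]
  have p := norm_nonneg (nullDeriv I 1 φ t x)
  have p' := norm_nonneg (nullDeriv I (-1) φ t x)
  linarith

theorem IsLocalized.majorizedBy_grad {N : ℝ} {D : ℝ≥0∞} {H : ℝ → ℝ≥0∞}
    (hφ : IsLocalized a b k I φ) (hp : MajorizedBy I N D H (nullDeriv I 1 φ))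
    (hm : MajorizedBy I N D H (nullDeriv I (-1) φ)) :
    MajorizedBy I N (4 * D) H (grad I φ) := fun t ht x hx => by
  have htI := interior_subset ht
  have h := norm_grad_le (I := I) (hφ.radial t htI) hx
    (hasFDerivAt_slice hφ.contDiffOn htI x).differentiableAt
  have h2 : ‖grad I φ t x‖ₑ ≤ 2 * (‖nullDeriv I 1 φ t x‖ₑ + ‖nullDeriv I (-1) φ t x‖ₑ) := by
    have e : ∀ s : ℝ, (2 : ℝ≥0∞) * ENNReal.ofReal s = ENNReal.ofReal (2 * s) := fun s => by
      rw [ENNReal.ofReal_mul zero_le_two, ENNReal.ofReal_ofNat]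
    rw [← ofReal_norm, ← ofReal_norm, ← ofReal_norm, ← ENNReal.ofReal_add (norm_nonneg _)
      (norm_nonneg _), e]
    exact ENNReal.ofReal_le_ofReal h
  refine h2.trans ((mul_le_mul' le_rfl (add_le_add (hp t ht x hx) (hm t ht x hx))).trans_eq ?_)
  ring

/-! ### The energy estimate -/

theorem aestronglyMeasurable_grad (h0 : (0 : ℝ) ∈ I)
    (hφ : IsLocalized a b k I φ) : AEStronglyMeasurable (grad I φ 0) volume := by
  have h : ∀ i : Fin 3, AEStronglyMeasurable (fun y => (grad I φ 0 y) i) volume := fun i => by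
    fin_cases i
    · exact (hφ.memLp_timeDeriv 0 h0).1
    · exact (measurable_fderiv_apply_const ℝ (φ 0)
        (EuclideanSpace.single 0 1 : Plane)).aestronglyMeasurable
    · exact (measurable_fderiv_apply_const ℝ (φ 0)
        (EuclideanSpace.single 1 1 : Plane)).aestronglyMeasurable
  exact (PiLp.continuous_toLp 2 (fun _ : Fin 3 => ℂ)).comp_aestronglyMeasurable
    (aemeasurable_pi_iff.2 fun i => (h i).aemeasurable).aestronglyMeasurable

/-- F is measurable only up to a null set of the interior of I × ℝ². A measurable representative is
chosen there, and the end points of I are negligible. -/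
theorem HasWeakBox.exists_measurable_force (hI : I.OrdConnected) (hbox : HasWeakBox I φ F) :
    ∃ A : ℝ → Plane → ℝ≥0∞, (Measurable fun z : ℝ × Plane => A z.1 z.2) ∧
      ∀ᵐ s ∂volume.restrict I, ∀ᵐ y, ‖F s y‖ₑ = A s y := by
  have h1 := hbox.1.aestronglyMeasurable
  have h2 : (volume : Measure (ℝ × Plane)).restrict (interior I ×ˢ univ) =
      (volume.restrict (interior I)).prod volume := by
    rw [Measure.volume_eq_prod, ← Measure.prod_restrict, Measure.restrict_univ]
  obtain ⟨G, hG, h3⟩ := h1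
  rw [h2] at h3
  refine ⟨fun s y => ‖G (s, y)‖ₑ, hG.measurable.enorm, ?_⟩
  have h6 : ∀ᵐ s, s ∈ interior I → ∀ᵐ y, F s y = G (s, y) :=
    (ae_restrict_iff' isOpen_interior.measurableSet).1 (Measure.ae_ae_of_ae_prod h3)
  filter_upwards [ae_mem_interior hI, ae_restrict_of_ae h6] with s hs hs2
  filter_upwards [hs2 hs] with y hy
  rw [hy]

theorem exists_isFreqCutoff {a b : ℝ} (ha : 0 < a) (hab : a < b) : ∃ (α β : ℝ) (m : ℝ → ℝ),
    0 < α ∧ α ≤ β ∧ IsFreqCutoff α β m ∧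
      ∀ w ∈ Icc (2 * Real.pi * a) (2 * Real.pi * b), m w = 1 := by
  have hpi := Real.pi_pos
  have h1 : 0 < Real.pi * (b - a) := by nlinarith
  have h2 : 0 < Real.pi * a := by positivity
  -- Centre π(a+b) and inner radius π(b-a) make the plateau exactly [2πa, 2πb]; the margin πa/2
  -- keeps the support away from frequency 0.
  let m : ContDiffBump (Real.pi * (a + b)) :=
    ⟨Real.pi * (b - a), Real.pi * (b - a) + Real.pi * a / 2, h1, by linarith⟩
  refine ⟨Real.pi * a, 3 * Real.pi * b, m, h2, by nlinarith, ⟨m.contDiff, ?_⟩, fun w hw => ?_⟩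
  · rw [m.tsupport_eq, Real.closedBall_eq_Icc]
    refine Icc_subset_Ioo ?_ ?_
    · change Real.pi * a < Real.pi * (a + b) - (Real.pi * (b - a) + Real.pi * a / 2)
      nlinarith
    · change Real.pi * (a + b) + (Real.pi * (b - a) + Real.pi * a / 2) < 3 * Real.pi * b
      nlinarith
  · refine m.one_of_mem_closedBall ?_
    rw [Real.closedBall_eq_Icc]
    change w ∈ Icc (Real.pi * (a + b) - Real.pi * (b - a)) (Real.pi * (a + b) + Real.pi * (b - a))
    exact ⟨by linarith [hw.1], by linarith [hw.2]⟩

theorem IsWave.size_le (hw : IsWave a b k I φ F f A) :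
    size ((2 : ℝ) ^ k) (waveProfile ((2 : ℝ) ^ k) I f A) ≤ 88 * tailConst 2 *
      (eLpNorm (grad I φ 0) 2 volume + mixedNorm I 1 2 F) := by
  refine (size_waveProfile_le (by positivity) I hw.measurable_data hw.measurable_force).trans ?_
  refine mul_le_mul' le_rfl (add_le_add ?_ ?_)
  · refine ENNReal.rpow_le_rpow_iff (z := 2) two_pos |>.1 ?_
    rw [rpow_half_rpow_two, eLpNorm_two_rpow_two]
    refine lintegral_mono_ae ?_
    filter_upwards [hw.data_eq] with y hy
    rw [hy]
  · rw [mixedNorm, eLpNorm_one_eq_lintegral_enorm]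
    refine lintegral_mono_ae ?_
    filter_upwards [hw.force_eq] with s hs
    rw [enorm_eq_self]
    refine ENNReal.rpow_le_rpow_iff (z := 2) two_pos |>.1 ?_
    rw [rpow_half_rpow_two, eLpNorm_two_rpow_two]
    refine lintegral_mono_ae ?_
    filter_upwards [hs] with y hy
    rw [hy]

end RadialWave

end

theorem mainTheorem9 (a b : ℝ) (ha : 0 < a) (hab : a < b)
    (χ : ℤ → ℝ → ℝ) (hχ : RadialWave.IsDyadicPartition χ)
    (η : ℤ → ℝ → ℝ) (hη : RadialWave.IsOuterCutoff η)
    (ε : ℝ) (hε : 0 < ε) (hε' : ε < 1 / 2) :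
    ∃ C : NNReal, ∀ (k : ℤ) (I : Set ℝ), I.OrdConnected → (0 : ℝ) ∈ I →
      ∀ φ F : ℝ → RadialWave.Plane → ℂ,
        RadialWave.IsLocalized a b k I φ → RadialWave.HasWeakBox I φ F →
        RadialWave.sNorm ε χ η k I φ ≤
          C * (eLpNorm (RadialWave.grad I φ 0) 2 volume + RadialWave.mixedNorm I 1 2 F) := by
  obtain ⟨α, β, m, hα, hαβ, hm, hm1⟩ := RadialWave.exists_isFreqCutoff ha hab
  obtain ⟨C₁, hC1, h1⟩ := RadialWave.exists_majorizedBy hα hαβ hm a b hm1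
  obtain ⟨C₂, hC2, h2⟩ := RadialWave.exists_nullBoundedBy hα hαβ hm a b hm1 (σ := 1) (by norm_num)
  obtain ⟨C₃, hC3, h3⟩ := RadialWave.exists_nullBoundedBy hα hαβ hm a b hm1 (σ := -1) (by norm_num)
  obtain ⟨C₄, hC4, h4⟩ := RadialWave.exists_sNorm_le hχ hη hε hε'
  set D := ENNReal.ofReal C₁ + ENNReal.ofReal C₂ + ENNReal.ofReal C₃ with hD
  have hT : RadialWave.tailConst 2 ≠ ⊤ := RadialWave.tailConst_ne_top one_lt_two
  have hDt : D ≠ ⊤ := by simp [hD]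
  -- The added 1 makes the constant nonzero, so that for infinite forcing the right side is ⊤ and
  -- the claim is trivial.
  have hCt : C₄ * (4 * D * (88 * RadialWave.tailConst 2)) + 1 ≠ ⊤ := ENNReal.add_ne_top.2
    ⟨ENNReal.mul_ne_top hC4 (ENNReal.mul_ne_top (ENNReal.mul_ne_top (by simp) hDt)
      (ENNReal.mul_ne_top (by simp) hT)), ENNReal.one_ne_top⟩
  refine ⟨(C₄ * (4 * D * (88 * RadialWave.tailConst 2)) + 1).toNNReal,
    fun k I hI h0 φ F hφ hbox => ?_⟩
  rw [ENNReal.coe_toNNReal hCt]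
  by_cases hF : RadialWave.mixedNorm I 1 2 F = ⊤
  · rw [hF, add_top, ENNReal.mul_top (by simp)]
    exact le_top
  obtain ⟨A, hA, hFA⟩ := hbox.exists_measurable_force hI
  have hgm := (RadialWave.aestronglyMeasurable_grad h0 hφ).enorm
  have hw : RadialWave.IsWave a b k I φ F (hgm.mk _) A :=
    { ordConnected := hI
      zero_mem := h0
      localized := hφ
      hasWeakBox := hbox
      lintegral_lt_top := by
        rw [RadialWave.mixedNorm, eLpNorm_one_eq_lintegral_enorm] at hF
        simp only [enorm_eq_self] at hF
        exact lt_top_iff_ne_top.2 hF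
      measurable_data := hgm.measurable_mk
      measurable_force := hA
      data_eq := hgm.ae_eq_mk
      force_eq := hFA }
  have hN : (0 : ℝ) < (2 : ℝ) ^ k := by positivity
  have hD4 : D ≤ 4 * D := le_mul_of_one_le_left' (by norm_num)
  have hp := (h2 k I φ F _ A hw).mono (show ENNReal.ofReal C₂ ≤ D from
    le_add_self.trans le_self_add)
  have hn := (h3 k I φ F _ A hw).mono (show ENNReal.ofReal C₃ ≤ D from le_add_self)
  have hgrad := hφ.majorizedBy_grad (hp.majorizedBy hN (Or.inl rfl))
    (hn.majorizedBy hN (Or.inr rfl))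
  have hval := (h1 k I φ F _ A hw).mono (mul_le_mul' le_rfl
    ((le_self_add.trans le_self_add : ENNReal.ofReal C₁ ≤ D).trans hD4))
  refine (h4 a b k I φ (4 * D) _ hI h0 hφ (RadialWave.slowlyVarying_waveProfile hN I
    hw.measurable_data hA) hgrad hval fun σ hσ => ?_).trans ?_
  · rcases hσ with rfl | rfl
    · exact hp.mono hD4
    · exact hn.mono hD4
  · calc _ ≤ C₄ * (4 * D * (88 * RadialWave.tailConst 2 *
          (eLpNorm (RadialWave.grad I φ 0) 2 volume + RadialWave.mixedNorm I 1 2 F))) :=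
        mul_le_mul' le_rfl (mul_le_mul' le_rfl hw.size_le)
      _ = C₄ * (4 * D * (88 * RadialWave.tailConst 2)) *
          (eLpNorm (RadialWave.grad I φ 0) 2 volume + RadialWave.mixedNorm I 1 2 F) := by ring
      _ ≤ _ := mul_le_mul' le_self_add le_rfl
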